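/- **Setting.** Let $\mathcal P$ be the graded $\mathbb C$-linear symmetric monoidal category whose objects are finite direct sums of shifts $q^kE^{\otimes n}$ ($k\in\mathbb Z$, $n\ge 0$), with $\mathrm{Hom}(q^kE^{\otimes n},q^lE^{\otimes n})=(\mathbb C[x_1,\dots,x_n]\rtimes\mathbb C[S_n])_{k-l}$, where $\deg x_i=2$ and $S_n$ has degree $0$, and $\mathrm{Hom}(q^kE^{\otimes m},q^lE^{\otimes n})=0$ for $m\ne n$; let $\hat{\mathcal P}$ be its Karoubi envelope. Work in the homotopy category of bounded complexes over $\hat{\mathcal P}$ (differentials lower the homological degree by one), where $\mathrm{Hom}(A,B)$ denotes homotopy classes of chain maps of all homological and $q$-degrees. For $n\ge 1$ let $\mathrm{Cube}_n$ be the Koszul complex of the operators $x_i-x_{i+1}$ ($1\le i\le n-1$) on $E^{\otimes n}$, normalized so that the summand indexed by $S\subseteq\{1,\dots,n-1\}$ is $q^{2|S|+1-n}E^{\otimes n}$ in homological degree $|S|$. Let $U_n=\{u\in\mathbb C^n:\sum u_i=0\}$ be the reflection representation of $S_n$; $u\in U_n$ acts on $\mathrm{Cube}_n$ by the contraction $\epsilon_u$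 that pairs the $i$-th Koszul generator with $u$ to give $u_i-u_{i+1}$. **Theorem.** The morphisms between tensor products of the complexes $\mathrm{Cube}_n$, $n\ge1$, are described as follows. 1. For every $n\ge 1$ there is an isomorphism of bigraded algebras $$\mathrm{End}(\mathrm{Cube}_n)\cong\bigl(\textstyle\bigwedge^\bullet(U_n)\otimes\mathbb C[x]\bigr)\rtimes\mathbb C[S_n],$$ where $S_n$ acts trivially on $x$, $x$ has homological degree $0$ and $q$-degree $2$, $U_n$ has homological degree $-1$ and $q$-degree $-2$, and $S_n$ has bidegree $(0,0)$. Here $x$ corresponds to each of the homotopic endomorphisms $x_1,\dots,x_n$, $u\in U_n$ to $\epsilon_u$, and $\sigma\in S_n$ to a chain map of bidegree $(0,0)$ that is the permutation $\sigma$ on the last term $q^{1-n}E^{\otimes n}$. 2. For all $n,m\ge 1$ there is an isomorphism, of bidegree $(0,0)$ and equal to the identity of $E^{\otimes(n+m)}$ between the summands $q^{1-n-m}E^{\otimes(n+m)}$ in homological degree $0$, $$\mathrm{Cube}_{n+m}\cong\mathrm{Cone}\bigl(q\,\mathrm{Cube}_n\otimes\mathrm{Cube}_m\xrightarrow{x_n-x_{n+1}}q^{-1}\mathrm{Cube}_n\otimes\mathrm{Cube}_m\bigr)$$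 (the target unshifted homologically), such that, for the canonical maps $\mathrm{merge}\colon\mathrm{Cube}_n\otimes\mathrm{Cube}_m\to\mathrm{Cube}_{n+m}$ and $\mathrm{split}\colon\mathrm{Cube}_{n+m}\to\mathrm{Cube}_n\otimes\mathrm{Cube}_m$ that it induces (inclusion of, respectively projection to, a term of the cone): * every morphism $\mathrm{Cube}_n\otimes\mathrm{Cube}_m\to\mathrm{Cube}_{n+m}$ is $\varphi\circ\mathrm{merge}$, and every morphism $\mathrm{Cube}_{n+m}\to\mathrm{Cube}_n\otimes\mathrm{Cube}_m$ is $\mathrm{split}\circ\varphi$, for some $\varphi\in\mathrm{End}(\mathrm{Cube}_{n+m})$; * on both of these spaces of morphisms the actions of $x\in\mathrm{End}(\mathrm{Cube}_n)$, of $x\in\mathrm{End}(\mathrm{Cube}_m)$ and of $x\in\mathrm{End}(\mathrm{Cube}_{n+m})$ agree (up to homotopy); * the exterior actions are identified under the induction (inclusion) map $\mathrm{ind}\colon U_n\oplus U_m\to U_{n+m}$ and the restriction (orthogonal projection) map $\mathrm{res}\colon U_{n+m}\to U_n\oplus U_m$: with $\epsilon_{(v,w)}=\epsilon_v\otimes1+1\otimes\epsilon_w$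 (Koszul signs) one has $\mathrm{merge}\circ\epsilon_{(v,w)}=\epsilon_{\mathrm{ind}(v,w)}\circ\mathrm{merge}$ and $\mathrm{merge}\circ\epsilon_{\mathrm{res}(u)}=\epsilon_u\circ\mathrm{merge}$, and, up to the Koszul sign of the odd map $\mathrm{split}$, $\epsilon_{(v,w)}\circ\mathrm{split}=-\mathrm{split}\circ\epsilon_{\mathrm{ind}(v,w)}$ and $\epsilon_{\mathrm{res}(u)}\circ\mathrm{split}=-\mathrm{split}\circ\epsilon_u$. 3. All other morphisms are induced by these: every morphism between two tensor products of $\mathrm{Cube}_n$'s is obtained from the endomorphisms of the $\mathrm{Cube}_n$ and the merge and split maps of part 2 by linear combinations, composition, tensor products and the structural isomorphisms (associativity and symmetry) of the symmetric monoidal homotopy category. -/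

import Mathlib

open CategoryTheory
open scoped TensorProduct

noncomputable section

namespace AnnularCube

/-- Morphisms `E^{⊗m} ⟶ E^{⊗n}` in `P`, of all `q`-degrees at once: finite sums of dotted
permutations `p · σ`, where `σ` is a bijection of the strands and `p` is a polynomial in the dots
`x_1, …, x_n`. It is `ℂ[x_1, …, x_n] ⋊ ℂ[S_n]` for `m = n`, and `0` for `m ≠ n`. -/
def DotPerm (m n : ℕ) : Type := (Fin m ≃ Fin n) →₀ MvPolynomial (Fin n) ℂ

namespace DotPerm

instance (m n : ℕ) : AddCommGroup (DotPerm m n) :=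
  inferInstanceAs (AddCommGroup ((Fin m ≃ Fin n) →₀ MvPolynomial (Fin n) ℂ))

instance (m n : ℕ) : Module ℂ (DotPerm m n) :=
  inferInstanceAs (Module ℂ ((Fin m ≃ Fin n) →₀ MvPolynomial (Fin n) ℂ))

/-- The polynomial in front of the bijection `σ`. -/
def coeff {m n : ℕ} (σ : Fin m ≃ Fin n) : DotPerm m n →ₗ[ℂ] MvPolynomial (Fin n) ℂ :=
  Finsupp.lapply σ

/-- The morphism `p · σ`: first permute by `σ`, then multiply by `p`. -/
def single {m n : ℕ} (σ : Fin m ≃ Fin n) : MvPolynomial (Fin n) ℂ →ₗ[ℂ] DotPerm m n :=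
  Finsupp.lsingle σ

/-- Linear maps out of `DotPerm m n`. -/
def lift {m n : ℕ} {L : Type} [AddCommGroup L] [Module ℂ L] :
    ((Fin m ≃ Fin n) → MvPolynomial (Fin n) ℂ →ₗ[ℂ] L) →ₗ[ℂ] DotPerm m n →ₗ[ℂ] L :=
  (Finsupp.lsum (R := ℂ) (M := MvPolynomial (Fin n) ℂ) ℂ).toLinearMap

@[simp] theorem lift_single {m n : ℕ} {L : Type} [AddCommGroup L] [Module ℂ L]
    (B : (Fin m ≃ Fin n) → MvPolynomial (Fin n) ℂ →ₗ[ℂ] L) (σ : Fin m ≃ Fin n)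
    (p : MvPolynomial (Fin n) ℂ) : lift B (single σ p) = B σ p := by
  exact Finsupp.lsum_single ℂ B σ p

/-- Bilinear maps out of `DotPerm a b` and `DotPerm c d`. -/
def lift₂ {a b c d : ℕ} {L : Type} [AddCommGroup L] [Module ℂ L]
    (B : (Fin a ≃ Fin b) → (Fin c ≃ Fin d) →
      MvPolynomial (Fin b) ℂ →ₗ[ℂ] MvPolynomial (Fin d) ℂ →ₗ[ℂ] L) :
    DotPerm a b →ₗ[ℂ] DotPerm c d →ₗ[ℂ] L :=
  lift fun σ => lift ∘ₗ LinearMap.pi fun τ => B σ τ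

theorem lift₂_single {a b c d : ℕ} {L : Type} [AddCommGroup L] [Module ℂ L]
    (B : (Fin a ≃ Fin b) → (Fin c ≃ Fin d) →
      MvPolynomial (Fin b) ℂ →ₗ[ℂ] MvPolynomial (Fin d) ℂ →ₗ[ℂ] L)
    (σ : Fin a ≃ Fin b) (τ : Fin c ≃ Fin d)
    (p : MvPolynomial (Fin b) ℂ) (r : MvPolynomial (Fin d) ℂ) :
    lift₂ B (single σ p) (single τ r) = B σ τ p r := by
  simp [lift₂]

theorem ind {m n : ℕ} {P : DotPerm m n → Prop} (f : DotPerm m n) (h0 : P 0)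
    (hadd : ∀ f g, P f → P g → P (f + g)) (hs : ∀ σ p, P (single σ p)) : P f :=
  Finsupp.induction_linear (motive := P) f h0 hadd hs

/-- Composition, the first argument being applied first: `(r · τ) ∘ (p · σ) = r τ(p) · (τ ∘ σ)`,
where `τ(x_i) = x_{τ(i)}`. -/
def comp {a b c : ℕ} : DotPerm a b →ₗ[ℂ] DotPerm b c →ₗ[ℂ] DotPerm a c :=
  lift₂ fun σ τ =>
    ((LinearMap.mul ℂ (MvPolynomial (Fin c) ℂ)).comp
      (MvPolynomial.rename τ).toLinearMap).compr₂ (single (σ.trans τ))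

theorem comp_single {a b c : ℕ} (σ : Fin a ≃ Fin b) (τ : Fin b ≃ Fin c)
    (p : MvPolynomial (Fin b) ℂ) (r : MvPolynomial (Fin c) ℂ) :
    comp (single σ p) (single τ r) =
      single (σ.trans τ) (MvPolynomial.rename τ p * r) := by
  rw [comp, lift₂_single]; rfl

theorem comp_assoc {a b c d : ℕ} (f : DotPerm a b) (g : DotPerm b c) (h : DotPerm c d) :
    comp (comp f g) h = comp f (comp g h) := by
  induction f using ind with
  | h0 => simp
  | hadd f f' h1 h2 => simp [h1, h2]
  | hs σ p =>
  induction g using ind with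
  | h0 => simp
  | hadd f f' h1 h2 => simp [h1, h2]
  | hs τ r =>
  induction h using ind with
  | h0 => simp
  | hadd f f' h1 h2 => simp [h1, h2]
  | hs ρ s =>
    simp only [comp_single, map_mul, MvPolynomial.rename_rename, mul_assoc]
    rfl

/-- The identity of `E^{⊗n}`. -/
def one (n : ℕ) : DotPerm n n := single (Equiv.refl _) 1

theorem one_comp {a b : ℕ} (f : DotPerm a b) : comp (one a) f = f := by
  induction f using ind with
  | h0 => simp
  | hadd f f' h1 h2 => simp [h1, h2]
  | hs σ p => simp [one, comp_single]

theorem comp_one {a b : ℕ} (f : DotPerm a b) : comp f (one b) = f := by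
  induction f using ind with
  | h0 => simp
  | hadd f f' h1 h2 => simp [h1, h2]
  | hs σ p => simp [one, comp_single]

/-- Two bijections of strands placed side by side. -/
def sumPerm {a b c d : ℕ} (σ : Fin a ≃ Fin b) (τ : Fin c ≃ Fin d) : Fin (a + c) ≃ Fin (b + d) :=
  finSumFinEquiv.symm.trans ((Equiv.sumCongr σ τ).trans finSumFinEquiv)

@[simp] theorem sumPerm_castAdd {a b c d : ℕ} (σ : Fin a ≃ Fin b) (τ : Fin c ≃ Fin d) (i : Fin a) :
    sumPerm σ τ (Fin.castAdd c i) = Fin.castAdd d (σ i) := by simp [sumPerm]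

@[simp] theorem sumPerm_natAdd {a b c d : ℕ} (σ : Fin a ≃ Fin b) (τ : Fin c ≃ Fin d) (i : Fin c) :
    sumPerm σ τ (Fin.natAdd a i) = Fin.natAdd b (τ i) := by simp [sumPerm]

/-- Tensor product of dotted permutations. -/
def tens {a b c d : ℕ} : DotPerm a b →ₗ[ℂ] DotPerm c d →ₗ[ℂ] DotPerm (a + c) (b + d) :=
  lift₂ fun σ τ =>
    ((LinearMap.mul ℂ (MvPolynomial (Fin (b + d)) ℂ)).compl₁₂
      (MvPolynomial.rename (Fin.castAdd d)).toLinearMap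
      (MvPolynomial.rename (Fin.natAdd b)).toLinearMap).compr₂ (single (sumPerm σ τ))

theorem tens_single {a b c d : ℕ} (σ : Fin a ≃ Fin b) (τ : Fin c ≃ Fin d)
    (p : MvPolynomial (Fin b) ℂ) (r : MvPolynomial (Fin d) ℂ) :
    tens (single σ p) (single τ r) = single (sumPerm σ τ)
      (MvPolynomial.rename (Fin.castAdd d) p * MvPolynomial.rename (Fin.natAdd b) r) := by
  rw [tens, lift₂_single]; rfl

theorem tens_comp {a b c a' b' c' : ℕ} (f : DotPerm a b) (g : DotPerm b c)
    (f' : DotPerm a' b') (g' : DotPerm b' c') :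
    tens (comp f g) (comp f' g') = comp (tens f f') (tens g g') := by
  induction f using ind with
  | h0 => simp
  | hadd f f' h1 h2 => simp [h1, h2]
  | hs σ p =>
  induction g using ind with
  | h0 => simp
  | hadd f f' h1 h2 => simp [h1, h2]
  | hs τ r =>
  induction f' using ind with
  | h0 => simp
  | hadd f f' h1 h2 => simp [h1, h2]
  | hs σ' p' =>
  induction g' using ind with
  | h0 => simp
  | hadd f f' h1 h2 => simp [h1, h2]
  | hs τ' r' =>
    simp only [comp_single, tens_single, map_mul, MvPolynomial.rename_rename]
    have e0 : sumPerm (σ.trans τ) (σ'.trans τ') = (sumPerm σ σ').trans (sumPerm τ τ') := by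
      ext i; simp [sumPerm]
    have e1 : sumPerm τ τ' ∘ Fin.castAdd b' = Fin.castAdd c' ∘ τ := by ext i; simp [sumPerm]
    have e2 : sumPerm τ τ' ∘ Fin.natAdd b = Fin.natAdd c ∘ τ' := by ext i; simp [sumPerm]
    rw [e0, e1, e2]
    congr 1; ring

theorem tens_one (a b : ℕ) : tens (one a) (one b) = one (a + b) := by
  rw [one, one, tens_single, one]
  congr 1
  · congr 1; ext i; simp [sumPerm]
  · simp

theorem rename_homog {m n : ℕ} (g : Fin m → Fin n) {p : MvPolynomial (Fin m) ℂ} {k : ℤ}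
    (hp : MvPolynomial.IsWeightedHomogeneous (fun _ => (2 : ℤ)) p k) :
    MvPolynomial.IsWeightedHomogeneous (fun _ => (2 : ℤ)) (MvPolynomial.rename g p) k := by
  rw [p.as_sum, map_sum]
  refine MvPolynomial.IsWeightedHomogeneous.sum _ _ _ fun s hs => ?_
  rw [MvPolynomial.rename_monomial]
  apply MvPolynomial.isWeightedHomogeneous_monomial
  rw [← hp (MvPolynomial.mem_support_iff.mp hs), Finsupp.weight_apply, Finsupp.weight_apply,
    Finsupp.sum_mapDomain_index (by simp) (by intros; simp [add_mul])]

/-- Elements of degree `k`, where each `x_i` has degree `2` and permutations have degree `0`. -/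
def homog (m n : ℕ) (k : ℤ) : Submodule ℂ (DotPerm m n) where
  carrier := {f | ∀ σ, MvPolynomial.IsWeightedHomogeneous (fun _ => (2 : ℤ)) (coeff σ f) k}
  add_mem' {f g} hf hg σ := by
    have := (hf σ).add (hg σ)
    simpa using this
  zero_mem' σ := by
    simpa using MvPolynomial.isWeightedHomogeneous_zero ℂ _ k
  smul_mem' c f hf σ := by
    have := (MvPolynomial.isWeightedHomogeneous_C (fun _ : Fin n => (2 : ℤ)) c).mul (hf σ)
    simpa [MvPolynomial.smul_eq_C_mul] using this

theorem coeff_single_self {m n : ℕ} (σ : Fin m ≃ Fin n) (p : MvPolynomial (Fin n) ℂ) :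
    coeff σ (single σ p) = p := Finsupp.single_eq_same

theorem coeff_single_ne {m n : ℕ} {σ τ : Fin m ≃ Fin n} (h : τ ≠ σ)
    (p : MvPolynomial (Fin n) ℂ) : coeff τ (single σ p) = 0 := Finsupp.single_eq_of_ne h

theorem single_mem_homog {m n : ℕ} (σ : Fin m ≃ Fin n) {p : MvPolynomial (Fin n) ℂ} {k : ℤ}
    (hp : MvPolynomial.IsWeightedHomogeneous (fun _ => (2 : ℤ)) p k) :
    single σ p ∈ homog m n k := by
  intro τ
  by_cases h : τ = σ
  · subst h; rwa [coeff_single_self]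
  · rw [coeff_single_ne h]; exact MvPolynomial.isWeightedHomogeneous_zero ℂ _ k

theorem eq_sum_single {m n : ℕ} (f : DotPerm m n) : f = ∑ σ, single σ (coeff σ f) := by
  induction f using ind with
  | h0 => simp
  | hadd f g h1 h2 => simp only [map_add, Finset.sum_add_distrib, ← h1, ← h2]
  | hs σ p =>
    rw [Finset.sum_eq_single σ]
    · rw [coeff_single_self]
    · intro τ _ hτ; rw [coeff_single_ne hτ, map_zero]
    · simp

theorem one_mem_homog (n : ℕ) : one n ∈ homog n n 0 :=
  single_mem_homog _ (MvPolynomial.isWeightedHomogeneous_one ℂ _)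

theorem tens_mem_homog {a b c d : ℕ} {f : DotPerm a b} {g : DotPerm c d} {k l : ℤ}
    (hf : f ∈ homog a b k) (hg : g ∈ homog c d l) :
    tens f g ∈ homog (a + c) (b + d) (k + l) := by
  rw [eq_sum_single f, eq_sum_single g, LinearMap.map_sum₂]
  refine Submodule.sum_mem _ fun σ _ => ?_
  rw [map_sum]
  refine Submodule.sum_mem _ fun τ _ => ?_
  rw [tens_single]
  exact single_mem_homog _ ((rename_homog _ (hf σ)).mul (rename_homog _ (hg τ)))

theorem tens_assoc {a b c a' b' c' : ℕ} (f : DotPerm a a') (g : DotPerm b b')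
    (h : DotPerm c c') :
    comp (tens (tens f g) h) (single (finCongr (Nat.add_assoc a' b' c')) 1) =
      comp (single (finCongr (Nat.add_assoc a b c)) 1) (tens f (tens g h)) := by
  induction f using ind with
  | h0 => simp
  | hadd f f' h1 h2 => simp [h1, h2]
  | hs σ p =>
  induction g using ind with
  | h0 => simp
  | hadd f f' h1 h2 => simp [h1, h2]
  | hs τ r =>
  induction h using ind with
  | h0 => simp
  | hadd f f' h1 h2 => simp [h1, h2]
  | hs ρ s =>
    simp only [comp_single, tens_single, map_mul, MvPolynomial.rename_rename, map_one, mul_one,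
      one_mul]
    have e0 : (sumPerm (sumPerm σ τ) ρ).trans (finCongr (Nat.add_assoc a' b' c')) =
        (finCongr (Nat.add_assoc a b c)).trans (sumPerm σ (sumPerm τ ρ)) := by
      ext i
      simp only [Equiv.trans_apply]
      induction i using Fin.addCases with
      | right i =>
        have : finCongr (Nat.add_assoc a b c) (Fin.natAdd (a + b) i) =
          Fin.natAdd a (Fin.natAdd b i) := by ext; simp [Nat.add_assoc]
        rw [this]
        simp [Nat.add_assoc]
      | left i =>
        induction i using Fin.addCases with
        | left i =>
          have : finCongr (Nat.add_assoc a b c) (Fin.castAdd c (Fin.castAdd b i)) =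
            Fin.castAdd (b + c) i := rfl
          rw [this]
          simp only [sumPerm_castAdd]
          rfl
        | right i =>
          have : finCongr (Nat.add_assoc a b c) (Fin.castAdd c (Fin.natAdd a i)) =
            Fin.natAdd a (Fin.castAdd c i) := rfl
          rw [this]
          simp only [sumPerm_castAdd, sumPerm_natAdd]
          rfl
    rw [e0]
    congr 1
    rw [mul_assoc]
    congr 1
    have e1 : finCongr (Nat.add_assoc a' b' c') ∘ Fin.natAdd (a' + b') =
        Fin.natAdd a' ∘ Fin.natAdd b' := by ext i; simp [Nat.add_assoc]
    rw [e1]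
    rfl

theorem tens_assoc_inv {a b c a' b' c' : ℕ} (f : DotPerm a a') (g : DotPerm b b')
    (h : DotPerm c c') :
    comp (tens f (tens g h)) (single (finCongr (Nat.add_assoc a' b' c').symm) 1) =
      comp (single (finCongr (Nat.add_assoc a b c).symm) 1) (tens (tens f g) h) := by
  have h1 : ∀ {m n : ℕ} (e : m = n), comp (single (finCongr e) 1) (single (finCongr e.symm) 1) =
      one m := by
    rintro m _ rfl; rw [comp_single, one]; simp
  calc _ = comp (comp (comp (single (finCongr (Nat.add_assoc a b c).symm) 1)
          (single (finCongr (Nat.add_assoc a b c)) 1)) (tens f (tens g h)))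
          (single (finCongr (Nat.add_assoc a' b' c').symm) 1) := by
        rw [h1 (Nat.add_assoc a b c).symm, one_comp]
    _ = _ := by
        rw [comp_assoc, comp_assoc, ← comp_assoc _ _ (single (finCongr _) 1), ← tens_assoc,
          comp_assoc (tens _ _), h1, comp_one]

theorem tens_swap {a b a' b' : ℕ} (f : DotPerm a a') (g : DotPerm b b') :
    comp (tens f g) (single finAddFlip 1) = comp (single finAddFlip 1) (tens g f) := by
  induction f using ind with
  | h0 => simp
  | hadd f f' h1 h2 => simp [h1, h2]
  | hs σ p =>
  induction g using ind with
  | h0 => simp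
  | hadd f f' h1 h2 => simp [h1, h2]
  | hs τ r =>
    simp only [comp_single, tens_single, map_mul, MvPolynomial.rename_rename, map_one, mul_one,
      one_mul]
    have e0 : (sumPerm σ τ).trans finAddFlip = finAddFlip.trans (sumPerm τ σ) := by
      ext i; induction i using Fin.addCases <;> simp [sumPerm]
    have e1 : finAddFlip ∘ Fin.castAdd b' = Fin.natAdd (m := a') b' := by ext i; simp
    have e2 : finAddFlip ∘ Fin.natAdd (m := b') a' = Fin.castAdd a' := by ext i; simp
    rw [e0, e1, e2, mul_comm]

end DotPerm

/-- The object `E^{⊗n}` of `P`. Its `q`-shifts are recorded in `GObj` below. -/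
structure PObj : Type where
  strands : ℕ

instance : Category PObj where
  Hom X Y := DotPerm X.strands Y.strands
  id X := DotPerm.one X.strands
  comp f g := DotPerm.comp f g
  id_comp f := DotPerm.one_comp f
  comp_id f := DotPerm.comp_one f
  assoc f g h := DotPerm.comp_assoc f g h

instance : Preadditive PObj where
  homGroup X Y := inferInstanceAs (AddCommGroup (DotPerm X.strands Y.strands))
  add_comp _ _ _ f f' g := LinearMap.map_add₂ DotPerm.comp f f' g
  comp_add _ _ _ f g g' := (DotPerm.comp f).map_add g g'

instance : Linear ℂ PObj where
  homModule X Y := inferInstanceAs (Module ℂ (DotPerm X.strands Y.strands))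
  smul_comp _ _ _ c f g := LinearMap.map_smul₂ DotPerm.comp c f g
  comp_smul _ _ _ f c g := (DotPerm.comp f).map_smul c g

instance : Linear ℂ (Mat_ PObj) where
  homModule M N := inferInstanceAs (Module ℂ (∀ i j, M.X i ⟶ N.X j))
  smul_comp X Y Z c f g := by
    ext i k
    change ∑ j, (c • f i j) ≫ g j k = c • ∑ j, f i j ≫ g j k
    simp [Finset.smul_sum]
  comp_smul X Y Z f c g := by
    ext i k
    change ∑ j, f i j ≫ (c • g j k) = c • ∑ j, f i j ≫ g j k
    simp [Finset.smul_sum]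

/-- A finite direct sum of `q^k E^{⊗n}`, each summand placed in a homological degree. -/
structure GObj where
  X : Mat_ PObj
  hdeg : X.ι → ℤ
  qdeg : X.ι → ℤ

/-- `f` is homogeneous of homological degree `h` and `q`-degree `k`. A morphism
`q^a E^{⊗m} ⟶ q^b E^{⊗n}` of `q`-degree `k` is a combination of dotted permutations of degree
`k + a - b`; those of `q`-degree `0` are the morphisms of `P`. -/
def IsBihom {A B : GObj} (h k : ℤ) (f : A.X ⟶ B.X) : Prop :=
  ∀ i j, (f i j ≠ 0 → B.hdeg j = A.hdeg i + h) ∧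
    f i j ∈ DotPerm.homog (A.X.X i).strands (B.X.X j).strands (k + A.qdeg i - B.qdeg j)

/-- The sign `(-1)^h` in homological degree `h`. -/
def GObj.sgn (A : GObj) : A.X ⟶ A.X :=
  fun i j => (A.hdeg i).negOnePow • (𝟙 A.X : A.X ⟶ A.X) i j

theorem sgn_comp_apply {A : GObj} {M : Mat_ PObj} (f : A.X ⟶ M) (i j) :
    (A.sgn ≫ f) i j = (A.hdeg i).negOnePow • f i j := by
  classical
  simp only [Mat_.comp_apply, GObj.sgn]
  rw [Finset.sum_eq_single i]
  · simp
  · intro b _ hb; rw [Mat_.id_apply_of_ne _ _ _ hb.symm]; simp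
  · simp

theorem comp_sgn_apply {A : GObj} {M : Mat_ PObj} (f : M ⟶ A.X) (i j) :
    (f ≫ A.sgn) i j = (A.hdeg j).negOnePow • f i j := by
  classical
  simp only [Mat_.comp_apply, GObj.sgn]
  rw [Finset.sum_eq_single j]
  · simp
  · intro b _ hb; rw [Mat_.id_apply_of_ne _ _ _ hb]; simp
  · simp

@[simp] theorem sgn_sgn (A : GObj) : A.sgn ≫ A.sgn = 𝟙 A.X := by
  ext i j
  rw [sgn_comp_apply, GObj.sgn, smul_smul]
  simp

@[simp] theorem sgn_sgn_assoc (A : GObj) {M : Mat_ PObj} (f : A.X ⟶ M) :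
    A.sgn ≫ A.sgn ≫ f = f := by
  rw [← Category.assoc, sgn_sgn, Category.id_comp]

theorem IsBihom.sgn_comm {A B : GObj} {h k : ℤ} {f : A.X ⟶ B.X} (hf : IsBihom h k f) :
    f ≫ B.sgn = h.negOnePow • (A.sgn ≫ f) := by
  ext i j
  rw [comp_sgn_apply]
  change _ = h.negOnePow • ((A.sgn ≫ f) i j)
  rw [sgn_comp_apply, smul_smul]
  by_cases h0 : f i j = 0
  · simp [h0]
  · rw [(hf i j).1 h0, Int.negOnePow_add, mul_comm]

/-- A bounded complex over the Karoubi envelope of (the additive closure of) `P`: a finite direct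
sum of shifted `E^{⊗n}`'s with an idempotent `e` and a differential `d = e d e` which lowers the
homological degree by one; both are homogeneous of `q`-degree `0`. -/
structure Cx extends GObj where
  e : X ⟶ X
  d : X ⟶ X
  e_bihom : IsBihom (A := toGObj) (B := toGObj) 0 0 e
  d_bihom : IsBihom (A := toGObj) (B := toGObj) (-1) 0 d
  e_e : e ≫ e = e
  e_d : e ≫ d = d
  d_e : d ≫ e = d
  d_d : d ≫ d = 0

attribute [simp] Cx.e_e Cx.e_d Cx.d_e Cx.d_d

namespace Cx

@[simp] theorem e_sgn (A : Cx) : A.e ≫ A.sgn = A.sgn ≫ A.e := by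
  rw [A.e_bihom.sgn_comm]; simp

@[simp] theorem d_sgn (A : Cx) : A.d ≫ A.sgn = - (A.sgn ≫ A.d) := by
  rw [A.d_bihom.sgn_comm]; simp

@[simp] theorem e_e_assoc (A : Cx) {M : Mat_ PObj} (f : A.X ⟶ M) : A.e ≫ A.e ≫ f = A.e ≫ f := by
  rw [← Category.assoc, e_e]
@[simp] theorem e_d_assoc (A : Cx) {M : Mat_ PObj} (f : A.X ⟶ M) : A.e ≫ A.d ≫ f = A.d ≫ f := by
  rw [← Category.assoc, e_d]
@[simp] theorem d_e_assoc (A : Cx) {M : Mat_ PObj} (f : A.X ⟶ M) : A.d ≫ A.e ≫ f = A.d ≫ f := by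
  rw [← Category.assoc, d_e]
@[simp] theorem d_d_assoc (A : Cx) {M : Mat_ PObj} (f : A.X ⟶ M) : A.d ≫ A.d ≫ f = 0 := by
  rw [← Category.assoc, d_d, Limits.zero_comp]
@[simp] theorem e_sgn_assoc (A : Cx) {M : Mat_ PObj} (f : A.X ⟶ M) :
    A.e ≫ A.sgn ≫ f = A.sgn ≫ A.e ≫ f := by
  rw [← Category.assoc, e_sgn, Category.assoc]
@[simp] theorem d_sgn_assoc (A : Cx) {M : Mat_ PObj} (f : A.X ⟶ M) :
    A.d ≫ A.sgn ≫ f = -(A.sgn ≫ A.d ≫ f) := by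
  rw [← Category.assoc, d_sgn, Preadditive.neg_comp, Category.assoc]

/-- The differential of the Hom complex: `δ f = d ∘ f - (-1)^h f ∘ d` for `f` of homological
degree `h`. -/
def delta (A B : Cx) : (A.X ⟶ B.X) →ₗ[ℂ] (A.X ⟶ B.X) where
  toFun f := f ≫ B.d - A.d ≫ A.sgn ≫ f ≫ B.sgn
  map_add' f g := by simp only [Preadditive.add_comp, Preadditive.comp_add]; abel
  map_smul' c f := by simp

theorem delta_apply {A B : Cx} (f : A.X ⟶ B.X) :
    delta A B f = f ≫ B.d - A.d ≫ A.sgn ≫ f ≫ B.sgn := rfl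

/-- The Hom complex over the Karoubi envelope: the maps (of all bidegrees) with `f = e f e`. -/
def maps (A B : Cx) : Submodule ℂ (A.X ⟶ B.X) where
  carrier := {f | A.e ≫ f = f ∧ f ≫ B.e = f}
  add_mem' := by rintro f g ⟨h1, h2⟩ ⟨h3, h4⟩; constructor <;> simp [*]
  zero_mem' := by constructor <;> simp
  smul_mem' := by rintro c f ⟨h1, h2⟩; constructor <;> simp [*]

/-- The closed maps of the Hom complex. -/
def cycles (A B : Cx) : Submodule ℂ (A.X ⟶ B.X) := maps A B ⊓ LinearMap.ker (delta A B)

/-- The null-homotopic maps. -/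
def boundaries (A B : Cx) : Submodule ℂ (A.X ⟶ B.X) := (maps A B).map (delta A B)

/-- Homology of the Hom complex: homotopy classes of closed maps of all bidegrees. -/
def HHom (A B : Cx) : Type := cycles A B ⧸ (boundaries A B).submoduleOf (cycles A B)

instance (A B : Cx) : AddCommGroup (HHom A B) :=
  inferInstanceAs (AddCommGroup (cycles A B ⧸ (boundaries A B).submoduleOf (cycles A B)))

instance (A B : Cx) : Module ℂ (HHom A B) :=
  inferInstanceAs (Module ℂ (cycles A B ⧸ (boundaries A B).submoduleOf (cycles A B)))

/-- The homotopy class of a closed map. -/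
def toHHom (A B : Cx) : cycles A B →ₗ[ℂ] HHom A B :=
  ((boundaries A B).submoduleOf (cycles A B)).mkQ

theorem toHHom_eq_zero {A B : Cx} (f : cycles A B) : toHHom A B f = 0 ↔ f.1 ∈ boundaries A B :=
  (Submodule.Quotient.mk_eq_zero _).trans Iff.rfl

theorem toHHom_surjective (A B : Cx) : Function.Surjective (toHHom A B) :=
  Submodule.mkQ_surjective _

theorem comp_mem_maps {A B C : Cx} {f : A.X ⟶ B.X} {g : B.X ⟶ C.X} (hf : f ∈ maps A B)
    (hg : g ∈ maps B C) : f ≫ g ∈ maps A C :=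
  ⟨by rw [← Category.assoc, hf.1], by rw [Category.assoc, hg.2]⟩

theorem cycles_comm {A B : Cx} {f : A.X ⟶ B.X} (hf : f ∈ cycles A B) :
    f ≫ B.d = A.d ≫ A.sgn ≫ f ≫ B.sgn :=
  sub_eq_zero.mp hf.2

theorem comp_mem_cycles {A B C : Cx} {f : A.X ⟶ B.X} {g : B.X ⟶ C.X} (hf : f ∈ cycles A B)
    (hg : g ∈ cycles B C) : f ≫ g ∈ cycles A C := by
  refine ⟨comp_mem_maps hf.1 hg.1, sub_eq_zero.mpr ?_⟩
  rw [Category.assoc, cycles_comm hg, ← Category.assoc f, cycles_comm hf]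
  simp

theorem comp_delta {A B C : Cx} {f : A.X ⟶ B.X} (hf : f ∈ cycles A B) (k : B.X ⟶ C.X) :
    f ≫ delta B C k = delta A C (f ≫ k) := by
  rw [delta_apply, delta_apply, Preadditive.comp_sub, ← Category.assoc f B.d, cycles_comm hf]
  simp

theorem delta_comp {A B C : Cx} (k : A.X ⟶ B.X) {g : B.X ⟶ C.X} (hg : g ∈ cycles B C) :
    delta A B k ≫ g = delta A C (k ≫ B.sgn ≫ g ≫ C.sgn) := by
  have h : B.sgn ≫ g ≫ C.sgn ≫ C.d = B.d ≫ g := by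
    have := cycles_comm hg
    have h2 : C.sgn ≫ C.d = - (C.d ≫ C.sgn) := by simp
    rw [h2, Preadditive.comp_neg, ← Category.assoc g, this]
    simp
  rw [delta_apply, delta_apply, Preadditive.sub_comp]
  simp [h]

theorem sgn_conj_mem_maps {A B : Cx} {f : A.X ⟶ B.X} (hf : f ∈ maps A B) :
    A.sgn ≫ f ≫ B.sgn ∈ maps A B := by
  constructor
  · rw [e_sgn_assoc, ← Category.assoc A.e, hf.1]
  · simp only [Category.assoc, ← e_sgn]
    rw [← Category.assoc f, hf.2]

/-- Composition of closed maps. -/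
def compCycles (A B C : Cx) : cycles A B →ₗ[ℂ] cycles B C →ₗ[ℂ] cycles A C :=
  LinearMap.mk₂ ℂ (fun f g => ⟨f.1 ≫ g.1, comp_mem_cycles f.2 g.2⟩)
    (by intros; ext1; simp) (by intros; ext1; simp) (by intros; ext1; simp)
    (by intros; ext1; simp)

/-- Composition of homotopy classes. -/
def hcomp {A B C : Cx} : HHom A B →ₗ[ℂ] HHom B C →ₗ[ℂ] HHom A C :=
  Submodule.liftQ _
    (LinearMap.flip (Submodule.liftQ _ (LinearMap.flip ((compCycles A B C).compr₂ (toHHom A C)))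
      (by
        rintro g ⟨k, hk, hk'⟩
        rw [LinearMap.mem_ker]
        ext f
        change toHHom A C _ = 0
        rw [toHHom_eq_zero]
        refine ⟨f.1 ≫ k, comp_mem_maps f.2.1 hk, ?_⟩
        rw [← comp_delta f.2, hk']
        rfl)))
    (by
      rintro f ⟨k, hk, hk'⟩
      rw [LinearMap.mem_ker]
      ext g
      obtain ⟨g, rfl⟩ := toHHom_surjective _ _ g
      change toHHom A C _ = 0
      rw [toHHom_eq_zero]
      refine ⟨k ≫ B.sgn ≫ g.1 ≫ C.sgn, comp_mem_maps hk (sgn_conj_mem_maps g.2.1), ?_⟩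
      rw [← delta_comp k g.2, hk']
      rfl)

theorem hcomp_mk {A B C : Cx} (f : cycles A B) (g : cycles B C) :
    hcomp (toHHom A B f) (toHHom B C g) =
      toHHom A C ⟨f.1 ≫ g.1, comp_mem_cycles f.2 g.2⟩ := rfl

theorem e_mem_cycles (A : Cx) : A.e ∈ cycles A A :=
  ⟨⟨by simp, by simp⟩, sub_eq_zero.mpr (by simp)⟩

/-- The bigraded homotopy category of bounded complexes over the Karoubi envelope of `P`. -/
instance : Category Cx where
  Hom := HHom
  id A := toHHom A A ⟨A.e, e_mem_cycles A⟩
  comp f g := hcomp f g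
  id_comp {A B} f := by
    obtain ⟨f, rfl⟩ := toHHom_surjective _ _ f
    rw [hcomp_mk]; congr 1; ext1; exact f.2.1.1
  comp_id {A B} f := by
    obtain ⟨f, rfl⟩ := toHHom_surjective _ _ f
    rw [hcomp_mk]; congr 1; ext1; exact f.2.1.2
  assoc {A B C D} f g h := by
    obtain ⟨f, rfl⟩ := toHHom_surjective _ _ f
    obtain ⟨g, rfl⟩ := toHHom_surjective _ _ g
    obtain ⟨h, rfl⟩ := toHHom_surjective _ _ h
    simp only [hcomp_mk, Category.assoc]

instance : Preadditive Cx where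
  homGroup A B := inferInstanceAs (AddCommGroup (HHom A B))
  add_comp _ _ _ f f' g := LinearMap.map_add₂ hcomp f f' g
  comp_add _ _ _ f g g' := (hcomp f).map_add g g'

instance : Linear ℂ Cx where
  homModule A B := inferInstanceAs (Module ℂ (HHom A B))
  smul_comp _ _ _ c f g := LinearMap.map_smul₂ hcomp c f g
  comp_smul _ _ _ f c g := (hcomp f).map_smul c g

/-- The morphism of the homotopy category given by a closed map. -/
def cls {A B : Cx} (f : A.X ⟶ B.X) (hf : f ∈ cycles A B) : A ⟶ B := toHHom A B ⟨f, hf⟩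

end Cx

/-- Tensor product of formal direct sums of `E^{⊗n}`'s. -/
abbrev matTensObj (M N : Mat_ PObj) : Mat_ PObj :=
  ⟨M.ι × N.ι, fun p => ⟨(M.X p.1).strands + (N.X p.2).strands⟩⟩

/-- Tensor product of matrices of morphisms. -/
def matTens {M M' N N' : Mat_ PObj} (f : M ⟶ M') (g : N ⟶ N') :
    matTensObj M N ⟶ matTensObj M' N' :=
  fun p r => DotPerm.tens (f p.1 r.1) (g p.2 r.2)

section matTens
variable {M M' M'' N N' N'' : Mat_ PObj}

theorem matTens_comp_apply (f : M ⟶ M') (f' : M' ⟶ M'') (g : N ⟶ N') (g' : N' ⟶ N'')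
    (i : M.ι × N.ι) (k : M''.ι × N''.ι) :
    ∑ j : M'.ι × N'.ι, DotPerm.comp (DotPerm.tens (f i.1 j.1) (g i.2 j.2))
      (DotPerm.tens (f' j.1 k.1) (g' j.2 k.2)) =
    DotPerm.tens ((f ≫ f') i.1 k.1) ((g ≫ g') i.2 k.2) := by
  change _ = DotPerm.tens (∑ j : M'.ι, DotPerm.comp (f i.1 j) (f' j k.1))
      (∑ j : N'.ι, DotPerm.comp (g i.2 j) (g' j k.2))
  rw [Fintype.sum_prod_type, LinearMap.map_sum₂]
  refine Finset.sum_congr rfl fun j _ => ?_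
  rw [map_sum]
  refine Finset.sum_congr rfl fun j' _ => ?_
  exact (DotPerm.tens_comp _ _ _ _).symm

theorem matTens_comp (f : M ⟶ M') (f' : M' ⟶ M'') (g : N ⟶ N') (g' : N' ⟶ N'') :
    matTens f g ≫ matTens f' g' = matTens (f ≫ f') (g ≫ g') := by
  ext i k
  exact matTens_comp_apply f f' g g' i k

theorem matTens_add_left (f f' : M ⟶ M') (g : N ⟶ N') :
    matTens (f + f') g = matTens f g + matTens f' g := by
  ext i j; exact LinearMap.map_add₂ DotPerm.tens _ _ _

theorem matTens_add_right (f : M ⟶ M') (g g' : N ⟶ N') :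
    matTens f (g + g') = matTens f g + matTens f g' := by
  ext i j; exact (DotPerm.tens (f i.1 j.1)).map_add _ _

theorem matTens_smul_left (c : ℂ) (f : M ⟶ M') (g : N ⟶ N') :
    matTens (c • f) g = c • matTens f g := by
  ext i j; exact LinearMap.map_smul₂ DotPerm.tens _ _ _

theorem matTens_smul_right (c : ℂ) (f : M ⟶ M') (g : N ⟶ N') :
    matTens f (c • g) = c • matTens f g := by
  ext i j; exact (DotPerm.tens (f i.1 j.1)).map_smul _ _

@[simp] theorem matTens_zero_left (g : N ⟶ N') : matTens (0 : M ⟶ M') g = 0 := by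
  ext i j; exact LinearMap.map_zero₂ DotPerm.tens _

@[simp] theorem matTens_zero_right (f : M ⟶ M') : matTens f (0 : N ⟶ N') = 0 := by
  ext i j; exact (DotPerm.tens (f i.1 j.1)).map_zero

theorem matTens_neg_left (f : M ⟶ M') (g : N ⟶ N') : matTens (-f) g = - matTens f g := by
  ext i j; exact LinearMap.map_neg₂ DotPerm.tens _ _

theorem matTens_neg_right (f : M ⟶ M') (g : N ⟶ N') : matTens f (-g) = - matTens f g := by
  ext i j; exact (DotPerm.tens (f i.1 j.1)).map_neg _

end matTens

/-- Tensor product of graded objects; degrees add. -/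
abbrev gTens (A B : GObj) : GObj where
  X := matTensObj A.X B.X
  hdeg p := A.hdeg p.1 + B.hdeg p.2
  qdeg p := A.qdeg p.1 + B.qdeg p.2

theorem IsBihom.tens {A A' B B' : GObj} {f : A.X ⟶ A'.X} {g : B.X ⟶ B'.X} {h k h' k' : ℤ}
    (hf : IsBihom h k f) (hg : IsBihom h' k' g) :
    IsBihom (A := gTens A B) (B := gTens A' B') (h + h') (k + k') (matTens f g) := by
  rintro ⟨i, i'⟩ ⟨j, j'⟩
  constructor
  · intro hne
    have h1 : f i j ≠ 0 := by
      intro h0; apply hne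
      change DotPerm.tens (f i j) (g i' j') = 0
      rw [h0]; exact LinearMap.map_zero₂ DotPerm.tens _
    have h2 : g i' j' ≠ 0 := by
      intro h0; apply hne
      change DotPerm.tens (f i j) (g i' j') = 0
      rw [h0]; exact (DotPerm.tens (f i j)).map_zero
    change A'.hdeg j + B'.hdeg j' = A.hdeg i + B.hdeg i' + (h + h')
    rw [(hf i j).1 h1, (hg i' j').1 h2]; ring
  · have := DotPerm.tens_mem_homog (hf i j).2 (hg i' j').2
    have e : (k + k') + (gTens A B).qdeg (i, i') - (gTens A' B').qdeg (j, j') =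
      (k + A.qdeg i - A'.qdeg j) + (k' + B.qdeg i' - B'.qdeg j') := by
      ring
    rw [e]; exact this

theorem IsBihom.add {A B : GObj} {f g : A.X ⟶ B.X} {h k : ℤ}
    (hf : IsBihom h k f) (hg : IsBihom h k g) : IsBihom h k (f + g) := by
  intro i j
  refine ⟨fun hne => ?_, Submodule.add_mem _ (hf i j).2 (hg i j).2⟩
  by_cases h1 : f i j = 0
  · apply (hg i j).1
    intro h2; apply hne; rw [Mat_.add_apply, h1, h2, add_zero]
  · exact (hf i j).1 h1

theorem IsBihom.smul {A B : GObj} {f : A.X ⟶ B.X} {h k : ℤ} (c : ℂ)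
    (hf : IsBihom h k f) : IsBihom h k (c • f) := by
  intro i j
  refine ⟨fun hne => (hf i j).1 fun h0 => hne ?_, Submodule.smul_mem _ c (hf i j).2⟩
  change c • f i j = 0
  rw [h0, smul_zero]

theorem id_bihom (A : GObj) : IsBihom 0 0 (𝟙 A.X) := by
  intro i j
  by_cases h : i = j
  · subst h
    refine ⟨by simp, ?_⟩
    rw [Mat_.id_apply_self, zero_add, sub_self]
    exact DotPerm.one_mem_homog _
  · rw [Mat_.id_apply_of_ne _ _ _ h]
    exact ⟨by simp, Submodule.zero_mem _⟩

theorem units_smul_mem {m n : ℕ} {k : ℤ} (u : ℤˣ) {f : DotPerm m n}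
    (hf : f ∈ DotPerm.homog m n k) : u • f ∈ DotPerm.homog m n k := by
  rcases Int.units_eq_one_or u with rfl | rfl
  · simpa using hf
  · simpa using hf

theorem IsBihom.sgn_comp {A B : GObj} {f : A.X ⟶ B.X} {h k : ℤ}
    (hf : IsBihom h k f) : IsBihom h k (A.sgn ≫ f) := by
  intro i j
  rw [sgn_comp_apply]
  exact ⟨fun hne => (hf i j).1 fun h0 => hne (by rw [h0, smul_zero]),
    units_smul_mem _ (hf i j).2⟩

theorem matTens_id (M N : Mat_ PObj) : matTens (𝟙 M) (𝟙 N) = 𝟙 (matTensObj M N) := by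
  ext ⟨i, i'⟩ ⟨j, j'⟩
  change DotPerm.tens ((𝟙 M : M ⟶ M) i j) ((𝟙 N : N ⟶ N) i' j') = _
  by_cases h : i = j
  · by_cases h' : i' = j'
    · subst h; subst h'
      rw [Mat_.id_apply_self, Mat_.id_apply_self, Mat_.id_apply_self]
      exact DotPerm.tens_one _ _
    · rw [Mat_.id_apply_of_ne N _ _ h',
        Mat_.id_apply_of_ne (matTensObj M N) (i, i') (j, j') (by simp [h'])]
      exact (DotPerm.tens _).map_zero
  · rw [Mat_.id_apply_of_ne M _ _ h,
      Mat_.id_apply_of_ne (matTensObj M N) (i, i') (j, j') (by simp [h])]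
    exact LinearMap.map_zero₂ DotPerm.tens _

theorem tens_units_smul {a b c d : ℕ} (u v : ℤˣ) (f : DotPerm a b) (g : DotPerm c d) :
    DotPerm.tens (u • f) (v • g) = (u * v) • DotPerm.tens f g := by
  rcases Int.units_eq_one_or u with rfl | rfl <;> rcases Int.units_eq_one_or v with rfl | rfl <;>
    simp

theorem gTens_sgn (A B : GObj) : (gTens A B).sgn = matTens A.sgn B.sgn := by
  ext ⟨i, i'⟩ ⟨j, j'⟩
  change (A.hdeg i + B.hdeg i').negOnePow • (𝟙 (matTensObj A.X B.X) : _ ⟶ _) (i, i') (j, j') =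
    DotPerm.tens ((A.hdeg i).negOnePow • (𝟙 A.X : A.X ⟶ A.X) i j)
      ((B.hdeg i').negOnePow • (𝟙 B.X : B.X ⟶ B.X) i' j')
  rw [Int.negOnePow_add, ← matTens_id]
  exact (tens_units_smul _ _ _ _).symm

namespace Cx

/-- Tensor product of complexes, with differential `d ⊗ 1 + (-1)^h 1 ⊗ d` on the part where the
first factor has homological degree `h`. -/
abbrev tens (A B : Cx) : Cx where
  toGObj := gTens A.toGObj B.toGObj
  e := matTens A.e B.e
  d := matTens A.d B.e + matTens (A.sgn ≫ A.e) B.d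
  e_bihom := A.e_bihom.tens B.e_bihom
  d_bihom := (A.d_bihom.tens B.e_bihom).add (A.e_bihom.sgn_comp.tens B.d_bihom)
  e_e := by simp [matTens_comp]
  e_d := by simp [matTens_comp]
  d_e := by simp [matTens_comp]
  d_d := by
    simp [matTens_comp, matTens_neg_left]


/-- `f ⊗ id_C`. -/
def rightMap {A B : Cx} (f : A.X ⟶ B.X) (C : Cx) : (tens A C).X ⟶ (tens B C).X :=
  matTens f C.e

theorem rightMap_delta {A B : Cx} (f : A.X ⟶ B.X) (C : Cx) (hf : f ∈ maps A B) :
    delta (tens A C) (tens B C) (rightMap f C) = rightMap (delta A B f) C := by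
  have h1 : f ≫ B.sgn ≫ B.e = f ≫ B.sgn := by
    rw [← e_sgn, ← Category.assoc, hf.2]
  have h2 : A.e ≫ f ≫ B.sgn = f ≫ B.sgn := by rw [← Category.assoc, hf.1]
  have hd : delta (tens A C) (tens B C) (rightMap f C) =
    matTens f C.e ≫ (matTens B.d C.e + matTens (B.sgn ≫ B.e) C.d) -
      (matTens A.d C.e + matTens (A.sgn ≫ A.e) C.d) ≫ matTens A.sgn C.sgn ≫
        matTens f C.e ≫ matTens B.sgn C.sgn := by
    rw [← gTens_sgn, ← gTens_sgn]; rfl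
  rw [hd]
  have hr : rightMap (delta A B f) C =
    matTens (f ≫ B.d - A.d ≫ A.sgn ≫ f ≫ B.sgn) C.e := rfl
  rw [hr, sub_eq_add_neg (f ≫ B.d), matTens_add_left, matTens_neg_left]
  simp only [Preadditive.comp_add, Preadditive.add_comp, matTens_comp, Category.assoc]
  simp only [d_sgn_assoc, e_d, sgn_sgn_assoc, e_sgn_assoc, e_e, h1, h2, matTens_neg_left]
  simp

theorem rightMap_mem_maps {A B : Cx} {f : A.X ⟶ B.X} (C : Cx) (hf : f ∈ maps A B) :
    rightMap f C ∈ maps (tens A C) (tens B C) := by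
  constructor
  · change matTens A.e C.e ≫ matTens f C.e = matTens f C.e
    rw [matTens_comp, hf.1, e_e]
  · change matTens f C.e ≫ matTens B.e C.e = matTens f C.e
    rw [matTens_comp, hf.2, e_e]

/-- The sum of the components of even homological degree. -/
def even {A B : GObj} (g : A.X ⟶ B.X) : A.X ⟶ B.X := (1 / 2 : ℂ) • (g + A.sgn ≫ g ≫ B.sgn)

/-- The sum of the components of odd homological degree. -/
def odd {A B : GObj} (g : A.X ⟶ B.X) : A.X ⟶ B.X := (1 / 2 : ℂ) • (g - A.sgn ≫ g ≫ B.sgn)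

/-- `id_C ⊗ g` with the Koszul sign: `c ⊗ a ↦ (-1)^{|g||c|} c ⊗ g(a)`. -/
def leftMap (C : Cx) {A B : Cx} (g : A.X ⟶ B.X) : (tens C A).X ⟶ (tens C B).X :=
  matTens C.e (even g) + matTens (C.sgn ≫ C.e) (odd g)

theorem even_mem_maps {A B : Cx} {g : A.X ⟶ B.X} (hg : g ∈ maps A B) : even g ∈ maps A B :=
  Submodule.smul_mem _ _ (Submodule.add_mem _ hg (sgn_conj_mem_maps hg))

theorem odd_mem_maps {A B : Cx} {g : A.X ⟶ B.X} (hg : g ∈ maps A B) : odd g ∈ maps A B :=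
  Submodule.smul_mem _ _ (Submodule.sub_mem _ hg (sgn_conj_mem_maps hg))

theorem even_sgn {A B : GObj} (g : A.X ⟶ B.X) : even g ≫ B.sgn = A.sgn ≫ even g := by
  simp [even, add_comm]

theorem odd_sgn {A B : GObj} (g : A.X ⟶ B.X) : odd g ≫ B.sgn = -(A.sgn ≫ odd g) := by
  simp [odd, ← smul_neg]

theorem sgn_delta_sgn {A B : Cx} (g : A.X ⟶ B.X) :
    A.sgn ≫ delta A B g ≫ B.sgn = A.d ≫ g - A.sgn ≫ g ≫ B.sgn ≫ B.d := by
  have h : B.d ≫ B.sgn = -(B.sgn ≫ B.d) := d_sgn B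
  have h' : A.sgn ≫ A.d ≫ A.sgn = - A.d := by rw [d_sgn, Preadditive.comp_neg, sgn_sgn_assoc]
  rw [delta_apply, Preadditive.sub_comp, Preadditive.comp_sub, Category.assoc g, h]
  have h2 : A.sgn ≫ (A.d ≫ A.sgn ≫ g ≫ B.sgn) ≫ B.sgn =
      (A.sgn ≫ A.d ≫ A.sgn) ≫ g ≫ B.sgn ≫ B.sgn := by simp only [Category.assoc]
  rw [h2, h', sgn_sgn, Category.comp_id]
  simp only [Preadditive.comp_neg, Preadditive.neg_comp]
  abel

theorem even_delta {A B : Cx} (g : A.X ⟶ B.X) :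
    even (delta A B g) = odd g ≫ B.d + A.d ≫ odd g := by
  rw [even, sgn_delta_sgn, odd, Linear.smul_comp, Linear.comp_smul, ← smul_add, delta_apply,
    Preadditive.sub_comp, Preadditive.comp_sub]
  refine congrArg (fun t => (1 / 2 : ℂ) • t) ?_
  simp only [Category.assoc]
  abel

theorem odd_delta {A B : Cx} (g : A.X ⟶ B.X) :
    odd (delta A B g) = even g ≫ B.d - A.d ≫ even g := by
  rw [odd, sgn_delta_sgn, even, Linear.smul_comp, Linear.comp_smul, ← smul_sub, delta_apply,
    Preadditive.add_comp, Preadditive.comp_add]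
  refine congrArg (fun t => (1 / 2 : ℂ) • t) ?_
  simp only [Category.assoc]
  abel

theorem leftMap_delta (C : Cx) {A B : Cx} (g : A.X ⟶ B.X) (hg : g ∈ maps A B) :
    delta (tens C A) (tens C B) (leftMap C g) = leftMap C (delta A B g) := by
  have hd : delta (tens C A) (tens C B) (leftMap C g) =
    (matTens C.e (even g) + matTens (C.sgn ≫ C.e) (odd g)) ≫
      (matTens C.d B.e + matTens (C.sgn ≫ C.e) B.d) -
      (matTens C.d A.e + matTens (C.sgn ≫ C.e) A.d) ≫ matTens C.sgn A.sgn ≫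
        (matTens C.e (even g) + matTens (C.sgn ≫ C.e) (odd g)) ≫ matTens C.sgn B.sgn := by
    rw [← gTens_sgn, ← gTens_sgn]; rfl
  rw [hd, leftMap, even_delta, odd_delta, sub_eq_add_neg (even g ≫ B.d), matTens_add_right,
    matTens_add_right, matTens_neg_right]
  have h0 : A.e ≫ even g = even g := (even_mem_maps hg).1
  have h1 : A.e ≫ odd g = odd g := (odd_mem_maps hg).1
  have h0' : even g ≫ B.e = even g := (even_mem_maps hg).2
  have h1' : odd g ≫ B.e = odd g := (odd_mem_maps hg).2
  have h2 : A.e ≫ A.sgn ≫ even g = A.sgn ≫ even g := by rw [e_sgn_assoc, h0]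
  have h3 : A.e ≫ A.sgn ≫ odd g = A.sgn ≫ odd g := by rw [e_sgn_assoc, h1]
  simp only [Preadditive.comp_add, Preadditive.add_comp, matTens_comp, Category.assoc,
    even_sgn, odd_sgn]
  simp [matTens_neg_left, matTens_neg_right, h0, h1, h0', h1']
  abel

theorem leftMap_mem_maps (C : Cx) {A B : Cx} {g : A.X ⟶ B.X} (hg : g ∈ maps A B) :
    leftMap C g ∈ maps (tens C A) (tens C B) := by
  constructor
  · change matTens C.e A.e ≫ (matTens C.e (even g) + matTens (C.sgn ≫ C.e) (odd g)) = _
    rw [Preadditive.comp_add, matTens_comp, matTens_comp, (even_mem_maps hg).1,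
      (odd_mem_maps hg).1]
    simp [leftMap]
  · change (matTens C.e (even g) + matTens (C.sgn ≫ C.e) (odd g)) ≫ matTens C.e B.e = _
    rw [Preadditive.add_comp, matTens_comp, matTens_comp, (even_mem_maps hg).2,
      (odd_mem_maps hg).2]
    simp [leftMap]

end Cx

namespace Cx

/-- The map on homotopy classes induced by a map of Hom complexes. -/
def induced {A B A' B' : Cx} (F : (A.X ⟶ B.X) →ₗ[ℂ] (A'.X ⟶ B'.X))
    (hF : ∀ f ∈ maps A B, F f ∈ maps A' B')
    (hd : ∀ f ∈ maps A B, delta A' B' (F f) = F (delta A B f)) : (A ⟶ B) →ₗ[ℂ] (A' ⟶ B') :=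
  Submodule.mapQ _ _
    (F.restrict (p := cycles A B) (q := cycles A' B') fun f hf =>
      ⟨hF f hf.1, by
        have h0 : delta A B f = 0 := hf.2
        change delta A' B' (F f) = 0
        rw [hd f hf.1, h0, map_zero]⟩)
    (by
      rintro f ⟨k, hk, hk'⟩
      refine ⟨F k, hF k hk, ?_⟩
      rw [hd k hk, hk']
      rfl)

/-- `f ⊗ id_C` in the homotopy category. -/
def whiskerRight {A B : Cx} (f : A ⟶ B) (C : Cx) : tens A C ⟶ tens B C :=
  induced
    { toFun f := rightMap f C
      map_add' _ _ := matTens_add_left _ _ _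
      map_smul' _ _ := matTens_smul_left _ _ _ }
    (fun _ hf => rightMap_mem_maps C hf) (fun f hf => rightMap_delta f C hf) f

theorem leftMap_add (C : Cx) {A B : Cx} (f g : A.X ⟶ B.X) :
    leftMap C (f + g) = leftMap C f + leftMap C g := by
  have h0 : even (f + g) = even f + even g := by
    simp only [even, ← smul_add]
    refine congrArg (fun t => (1 / 2 : ℂ) • t) ?_
    simp only [Preadditive.comp_add, Preadditive.add_comp]; abel
  have h1 : odd (f + g) = odd f + odd g := by
    simp only [odd, ← smul_add]
    refine congrArg (fun t => (1 / 2 : ℂ) • t) ?_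
    simp only [Preadditive.comp_add, Preadditive.add_comp]; abel
  rw [leftMap, leftMap, leftMap, h0, h1, matTens_add_right, matTens_add_right]
  abel

theorem leftMap_smul (C : Cx) {A B : Cx} (c : ℂ) (g : A.X ⟶ B.X) :
    leftMap C (c • g) = c • leftMap C g := by
  have h0 : even (c • g) = c • even g := by
    rw [even, even, smul_comm c, Linear.smul_comp, Linear.comp_smul]
    simp only [smul_add]
  have h1 : odd (c • g) = c • odd g := by
    rw [odd, odd, smul_comm c, Linear.smul_comp, Linear.comp_smul]
    simp only [smul_sub]
  rw [leftMap, leftMap, h0, h1, matTens_smul_right, matTens_smul_right]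
  exact (smul_add _ _ _).symm

/-- `id_C ⊗ g` in the homotopy category, with the Koszul sign. -/
def whiskerLeft (C : Cx) {A B : Cx} (g : A ⟶ B) : tens C A ⟶ tens C B :=
  induced
    { toFun g := leftMap C g
      map_add' _ _ := leftMap_add C _ _
      map_smul' _ _ := leftMap_smul C _ _ }
    (fun _ hf => leftMap_mem_maps C hf) (fun f hf => leftMap_delta C f hf) g

theorem mem_cycles_of_even {A B : Cx} {f : A.X ⟶ B.X} (hf : f ∈ maps A B)
    (hs : f ≫ B.sgn = A.sgn ≫ f) (hd : f ≫ B.d = A.d ≫ f) : f ∈ cycles A B := by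
  refine ⟨hf, ?_⟩
  change delta A B f = 0
  rw [delta_apply, hs, sgn_sgn_assoc, hd, sub_self]

theorem mem_cycles_of_odd {A B : Cx} {f : A.X ⟶ B.X} (hf : f ∈ maps A B)
    (hs : f ≫ B.sgn = -(A.sgn ≫ f)) (hd : f ≫ B.d = -(A.d ≫ f)) : f ∈ cycles A B := by
  refine ⟨hf, ?_⟩
  change delta A B f = 0
  rw [delta_apply, hs, Preadditive.comp_neg, sgn_sgn_assoc, hd,
    Preadditive.comp_neg, sub_self]

section assoc
variable {M N K M' N' K' M'' N'' K'' : Mat_ PObj}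

/-- `(M ⊗ N) ⊗ K ⟶ M' ⊗ (N' ⊗ K')`: `f ⊗ g ⊗ h` followed by the associator. -/
def matAssoc (f : M ⟶ M') (g : N ⟶ N') (h : K ⟶ K') :
    matTensObj (matTensObj M N) K ⟶ matTensObj M' (matTensObj N' K') :=
  fun p r => DotPerm.comp (DotPerm.tens (DotPerm.tens (f p.1.1 r.1) (g p.1.2 r.2.1)) (h p.2 r.2.2))
    (DotPerm.single (finCongr (Nat.add_assoc _ _ _)) 1)

/-- `M ⊗ (N ⊗ K) ⟶ (M' ⊗ N') ⊗ K'`: `f ⊗ g ⊗ h` followed by the inverse associator. -/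
def matAssocInv (f : M ⟶ M') (g : N ⟶ N') (h : K ⟶ K') :
    matTensObj M (matTensObj N K) ⟶ matTensObj (matTensObj M' N') K' :=
  fun p r => DotPerm.comp (DotPerm.tens (f p.1 r.1.1) (DotPerm.tens (g p.2.1 r.1.2) (h p.2.2 r.2)))
    (DotPerm.single (finCongr (Nat.add_assoc _ _ _).symm) 1)

/-- `M ⊗ N ⟶ N' ⊗ M'`: `f ⊗ g` followed by the symmetry of `P`. -/
def matSwap (f : M ⟶ M') (g : N ⟶ N') : matTensObj M N ⟶ matTensObj N' M' :=
  fun p r => DotPerm.comp (DotPerm.tens (f p.1 r.2) (g p.2 r.1)) (DotPerm.single finAddFlip 1)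

theorem matTens_matAssoc (f : M ⟶ M') (g : N ⟶ N') (h : K ⟶ K')
    (f' : M' ⟶ M'') (g' : N' ⟶ N'') (h' : K' ⟶ K'') :
    matTens (matTens f g) h ≫ matAssoc f' g' h' = matAssoc (f ≫ f') (g ≫ g') (h ≫ h') := by
  ext ⟨⟨i, j⟩, k⟩ ⟨i', j', k'⟩
  have key : ∑ p : (M'.ι × N'.ι) × K'.ι, DotPerm.comp (DotPerm.tens (DotPerm.tens
      (f i p.1.1) (g j p.1.2)) (h k p.2)) (DotPerm.tens (DotPerm.tens
      (f' p.1.1 i') (g' p.1.2 j')) (h' p.2 k')) =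
      DotPerm.tens (DotPerm.tens ((f ≫ f') i i') ((g ≫ g') j j')) ((h ≫ h') k k') := by
    refine (matTens_comp_apply (matTens f g) (matTens f' g') h h' ((i, j), k)
      ((i', j'), k')).trans ?_
    rw [matTens_comp]
    rfl
  change ∑ p : (M'.ι × N'.ι) × K'.ι, DotPerm.comp (DotPerm.tens (DotPerm.tens
      (f i p.1.1) (g j p.1.2)) (h k p.2)) (DotPerm.comp (DotPerm.tens (DotPerm.tens
      (f' p.1.1 i') (g' p.1.2 j')) (h' p.2 k')) (DotPerm.single (finCongr _) 1)) =
    DotPerm.comp (DotPerm.tens (DotPerm.tens ((f ≫ f') i i') ((g ≫ g') j j')) ((h ≫ h') k k'))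
      (DotPerm.single (finCongr _) 1)
  rw [← key, LinearMap.map_sum₂]
  exact Finset.sum_congr rfl fun _ _ => (DotPerm.comp_assoc _ _ _).symm

theorem matAssoc_matTens (f : M ⟶ M') (g : N ⟶ N') (h : K ⟶ K')
    (f' : M' ⟶ M'') (g' : N' ⟶ N'') (h' : K' ⟶ K'') :
    matAssoc f g h ≫ matTens f' (matTens g' h') = matAssoc (f ≫ f') (g ≫ g') (h ≫ h') := by
  rw [← matTens_matAssoc]
  ext ⟨⟨i, j⟩, k⟩ ⟨i', j', k'⟩
  change ∑ p : M'.ι × (N'.ι × K'.ι), DotPerm.comp (DotPerm.comp (DotPerm.tens (DotPerm.tens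
      (f i p.1) (g j p.2.1)) (h k p.2.2)) (DotPerm.single (finCongr _) 1))
      (DotPerm.tens (f' p.1 i') (DotPerm.tens (g' p.2.1 j') (h' p.2.2 k'))) =
    ∑ p : (M'.ι × N'.ι) × K'.ι, DotPerm.comp (DotPerm.tens (DotPerm.tens
      (f i p.1.1) (g j p.1.2)) (h k p.2)) (DotPerm.comp (DotPerm.tens (DotPerm.tens
      (f' p.1.1 i') (g' p.1.2 j')) (h' p.2 k')) (DotPerm.single (finCongr _) 1))
  refine (Fintype.sum_equiv (Equiv.prodAssoc _ _ _) _ _ fun p => ?_).symm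
  rw [DotPerm.comp_assoc, DotPerm.tens_assoc]
  rfl

theorem matTens_matAssocInv (f : M ⟶ M') (g : N ⟶ N') (h : K ⟶ K')
    (f' : M' ⟶ M'') (g' : N' ⟶ N'') (h' : K' ⟶ K'') :
    matTens f (matTens g h) ≫ matAssocInv f' g' h' = matAssocInv (f ≫ f') (g ≫ g') (h ≫ h') := by
  ext ⟨i, j, k⟩ ⟨⟨i', j'⟩, k'⟩
  have key : ∑ p : M'.ι × (N'.ι × K'.ι), DotPerm.comp (DotPerm.tens (f i p.1) (DotPerm.tens
      (g j p.2.1) (h k p.2.2))) (DotPerm.tens (f' p.1 i') (DotPerm.tens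
      (g' p.2.1 j') (h' p.2.2 k'))) =
      DotPerm.tens ((f ≫ f') i i') (DotPerm.tens ((g ≫ g') j j') ((h ≫ h') k k')) := by
    refine (matTens_comp_apply f f' (matTens g h) (matTens g' h') (i, (j, k))
      (i', (j', k'))).trans ?_
    rw [matTens_comp]
    rfl
  change ∑ p : M'.ι × (N'.ι × K'.ι), DotPerm.comp (DotPerm.tens (f i p.1) (DotPerm.tens
      (g j p.2.1) (h k p.2.2))) (DotPerm.comp (DotPerm.tens (f' p.1 i') (DotPerm.tens
      (g' p.2.1 j') (h' p.2.2 k'))) (DotPerm.single (finCongr _) 1)) =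
    DotPerm.comp (DotPerm.tens ((f ≫ f') i i') (DotPerm.tens ((g ≫ g') j j') ((h ≫ h') k k')))
      (DotPerm.single (finCongr _) 1)
  rw [← key, LinearMap.map_sum₂]
  exact Finset.sum_congr rfl fun _ _ => (DotPerm.comp_assoc _ _ _).symm

theorem matAssocInv_matTens (f : M ⟶ M') (g : N ⟶ N') (h : K ⟶ K')
    (f' : M' ⟶ M'') (g' : N' ⟶ N'') (h' : K' ⟶ K'') :
    matAssocInv f g h ≫ matTens (matTens f' g') h' = matAssocInv (f ≫ f') (g ≫ g') (h ≫ h') := by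
  rw [← matTens_matAssocInv]
  ext ⟨i, j, k⟩ ⟨⟨i', j'⟩, k'⟩
  change ∑ p : (M'.ι × N'.ι) × K'.ι, DotPerm.comp (DotPerm.comp (DotPerm.tens
      (f i p.1.1) (DotPerm.tens (g j p.1.2) (h k p.2))) (DotPerm.single (finCongr _) 1))
      (DotPerm.tens (DotPerm.tens (f' p.1.1 i') (g' p.1.2 j')) (h' p.2 k')) =
    ∑ p : M'.ι × (N'.ι × K'.ι), DotPerm.comp (DotPerm.tens
      (f i p.1) (DotPerm.tens (g j p.2.1) (h k p.2.2))) (DotPerm.comp (DotPerm.tens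
      (f' p.1 i') (DotPerm.tens (g' p.2.1 j') (h' p.2.2 k'))) (DotPerm.single (finCongr _) 1))
  refine Fintype.sum_equiv (Equiv.prodAssoc _ _ _) _ _ fun p => ?_
  rw [DotPerm.comp_assoc, ← DotPerm.tens_assoc_inv]
  rfl

theorem matTens_matSwap (f : M ⟶ M') (g : N ⟶ N') (f' : M' ⟶ M'') (g' : N' ⟶ N'') :
    matTens f g ≫ matSwap f' g' = matSwap (f ≫ f') (g ≫ g') := by
  ext ⟨i, j⟩ ⟨j', i'⟩
  have := congrFun (congrFun (matTens_comp f f' g g') (i, j)) (i', j')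
  have h2 := congrArg (fun t => DotPerm.comp t (DotPerm.single finAddFlip 1)) this
  refine Eq.trans ?_ h2
  simp only [Mat_.comp_apply]
  rw [LinearMap.map_sum₂]
  exact Finset.sum_congr rfl fun _ _ => (DotPerm.comp_assoc _ _ _).symm

theorem matSwap_matTens (f : M ⟶ M') (g : N ⟶ N') (f' : M' ⟶ M'') (g' : N' ⟶ N'') :
    matSwap f g ≫ matTens g' f' = matSwap (f ≫ f') (g ≫ g') := by
  rw [← matTens_matSwap]
  ext ⟨i, j⟩ ⟨j', i'⟩
  change ∑ p : N'.ι × M'.ι, DotPerm.comp (DotPerm.comp (DotPerm.tens (f i p.2) (g j p.1))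
      (DotPerm.single finAddFlip 1)) (DotPerm.tens (g' p.1 j') (f' p.2 i')) =
    ∑ p : M'.ι × N'.ι, DotPerm.comp (DotPerm.tens (f i p.1) (g j p.2))
      (DotPerm.comp (DotPerm.tens (f' p.1 i') (g' p.2 j')) (DotPerm.single finAddFlip 1))
  refine Fintype.sum_equiv (Equiv.prodComm _ _) _ _ fun p => ?_
  rw [DotPerm.comp_assoc, ← DotPerm.tens_swap]
  rfl

end assoc

theorem tens_sgn (A B : Cx) : (tens A B).sgn = matTens A.sgn B.sgn := gTens_sgn _ _

/-- The associator. -/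
def assocHom (A B C : Cx) : tens (tens A B) C ⟶ tens A (tens B C) :=
  cls (matAssoc A.e B.e C.e) (by
    refine mem_cycles_of_even ⟨?_, ?_⟩ ?_ ?_
    · change matTens (matTens A.e B.e) C.e ≫ _ = _
      rw [matTens_matAssoc, e_e, e_e, e_e]
    · change _ ≫ matTens A.e (matTens B.e C.e) = _
      rw [matAssoc_matTens, e_e, e_e, e_e]
    · rw [tens_sgn, tens_sgn, tens_sgn, tens_sgn, matAssoc_matTens, matTens_matAssoc]
      simp
    · change _ ≫ (matTens A.d (matTens B.e C.e) + matTens (A.sgn ≫ A.e)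
          (matTens B.d C.e + matTens (B.sgn ≫ B.e) C.d)) =
        (matTens (matTens A.d B.e + matTens (A.sgn ≫ A.e) B.d) C.e +
          matTens ((tens A B).sgn ≫ matTens A.e B.e) C.d) ≫ _
      rw [tens_sgn, matTens_comp]
      simp only [matTens_add_left, matTens_add_right, Preadditive.comp_add, Preadditive.add_comp,
        matAssoc_matTens, matTens_matAssoc]
      simp [add_assoc])

/-- The inverse associator. -/
def assocInv (A B C : Cx) : tens A (tens B C) ⟶ tens (tens A B) C :=
  cls (matAssocInv A.e B.e C.e) (by
    refine mem_cycles_of_even ⟨?_, ?_⟩ ?_ ?_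
    · change matTens A.e (matTens B.e C.e) ≫ _ = _
      rw [matTens_matAssocInv, e_e, e_e, e_e]
    · change _ ≫ matTens (matTens A.e B.e) C.e = _
      rw [matAssocInv_matTens, e_e, e_e, e_e]
    · rw [tens_sgn, tens_sgn, tens_sgn, tens_sgn, matAssocInv_matTens, matTens_matAssocInv]
      simp
    · change _ ≫ (matTens (matTens A.d B.e + matTens (A.sgn ≫ A.e) B.d) C.e +
          matTens ((tens A B).sgn ≫ matTens A.e B.e) C.d) =
        (matTens A.d (matTens B.e C.e) + matTens (A.sgn ≫ A.e)
          (matTens B.d C.e + matTens (B.sgn ≫ B.e) C.d)) ≫ _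
      rw [tens_sgn, matTens_comp]
      simp only [matTens_add_left, matTens_add_right, Preadditive.comp_add, Preadditive.add_comp,
        matAssocInv_matTens, matTens_matAssocInv]
      simp [add_assoc])

/-- The symmetry of the tensor product of complexes: `a ⊗ b ↦ (-1)^{|a||b|} b ⊗ a`. -/
def braidMat (A B : Cx) : (tens A B).X ⟶ (tens B A).X :=
  fun p r => (A.hdeg p.1 * B.hdeg p.2).negOnePow • matSwap A.e B.e p r

theorem swap_units_smul {a b c d : ℕ} (u v : ℤˣ) (f : DotPerm a b) (g : DotPerm c d) :
    DotPerm.comp (DotPerm.tens (u • f) (v • g)) (DotPerm.single finAddFlip 1) =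
      (u * v) • DotPerm.comp (DotPerm.tens f g) (DotPerm.single finAddFlip 1) := by
  rcases Int.units_eq_one_or u with rfl | rfl <;> rcases Int.units_eq_one_or v with rfl | rfl <;>
    simp

theorem braidMat_eq (A B : Cx) : braidMat A B = (1 / 2 : ℂ) • (matSwap A.e B.e +
    matSwap (A.sgn ≫ A.e) B.e + matSwap A.e (B.sgn ≫ B.e) -
    matSwap (A.sgn ≫ A.e) (B.sgn ≫ B.e)) := by
  ext ⟨i, j⟩ ⟨j', i'⟩
  have h1 : matSwap (A.sgn ≫ A.e) B.e (i, j) (j', i') =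
      (A.hdeg i).negOnePow • matSwap A.e B.e (i, j) (j', i') := by
    have := swap_units_smul (A.hdeg i).negOnePow 1 (A.e i i') (B.e j j')
    rw [one_smul, mul_one] at this
    refine Eq.trans ?_ this
    rw [← sgn_comp_apply]; rfl
  have h2 : matSwap A.e (B.sgn ≫ B.e) (i, j) (j', i') =
      (B.hdeg j).negOnePow • matSwap A.e B.e (i, j) (j', i') := by
    have := swap_units_smul 1 (B.hdeg j).negOnePow (A.e i i') (B.e j j')
    rw [one_smul, one_mul] at this
    refine Eq.trans ?_ this
    rw [← sgn_comp_apply]; rfl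
  have h3 : matSwap (A.sgn ≫ A.e) (B.sgn ≫ B.e) (i, j) (j', i') =
      ((A.hdeg i).negOnePow * (B.hdeg j).negOnePow) • matSwap A.e B.e (i, j) (j', i') := by
    have := swap_units_smul (A.hdeg i).negOnePow (B.hdeg j).negOnePow (A.e i i') (B.e j j')
    refine Eq.trans ?_ this
    rw [← sgn_comp_apply, ← sgn_comp_apply]; rfl
  change (A.hdeg i * B.hdeg j).negOnePow • matSwap A.e B.e (i, j) (j', i') =
    (1 / 2 : ℂ) • (matSwap A.e B.e (i, j) (j', i') + matSwap (A.sgn ≫ A.e) B.e (i, j) (j', i') +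
      matSwap A.e (B.sgn ≫ B.e) (i, j) (j', i') -
      matSwap (A.sgn ≫ A.e) (B.sgn ≫ B.e) (i, j) (j', i'))
  rw [h1, h2, h3]
  generalize matSwap A.e B.e (i, j) (j', i') = t
  rcases Int.even_or_odd (A.hdeg i) with ha | ha <;> rcases Int.even_or_odd (B.hdeg j) with hb | hb
  · rw [Int.negOnePow_even _ ha, Int.negOnePow_even _ hb, Int.negOnePow_even _ (ha.mul_right _)]
    simp only [one_smul, mul_one]; module
  · rw [Int.negOnePow_even _ ha, Int.negOnePow_odd _ hb, Int.negOnePow_even _ (ha.mul_right _)]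
    simp only [one_smul, one_mul, Units.neg_smul]; module
  · rw [Int.negOnePow_odd _ ha, Int.negOnePow_even _ hb, Int.negOnePow_even _ (hb.mul_left _)]
    simp only [one_smul, mul_one, Units.neg_smul]; module
  · rw [Int.negOnePow_odd _ ha, Int.negOnePow_odd _ hb, Int.negOnePow_odd _ (ha.mul hb)]
    simp only [one_smul, mul_neg, mul_one, neg_neg, Units.neg_smul]; module

theorem matSwap_neg_left {M M' N N' : Mat_ PObj} (f : M ⟶ M') (g : N ⟶ N') :
    matSwap (-f) g = - matSwap f g := by
  ext i j
  change DotPerm.comp (DotPerm.tens (-(f i.1 j.2)) (g i.2 j.1)) _ =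
    - DotPerm.comp (DotPerm.tens (f i.1 j.2) (g i.2 j.1)) _
  simp

theorem matSwap_neg_right {M M' N N' : Mat_ PObj} (f : M ⟶ M') (g : N ⟶ N') :
    matSwap f (-g) = - matSwap f g := by
  ext i j
  change DotPerm.comp (DotPerm.tens (f i.1 j.2) (-(g i.2 j.1))) _ =
    - DotPerm.comp (DotPerm.tens (f i.1 j.2) (g i.2 j.1)) _
  simp

/-- The symmetry in the homotopy category. -/
def braiding (A B : Cx) : tens A B ⟶ tens B A :=
  cls (braidMat A B) (by
    rw [braidMat_eq]
    refine mem_cycles_of_even (Submodule.smul_mem _ _ ⟨?_, ?_⟩) ?_ ?_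
    · change matTens A.e B.e ≫ _ = _
      simp only [Preadditive.comp_add, Preadditive.comp_sub, matTens_matSwap]
      simp
    · change _ ≫ matTens B.e A.e = _
      simp only [Preadditive.add_comp, Preadditive.sub_comp, matSwap_matTens]
      simp
    · rw [tens_sgn, tens_sgn, Linear.smul_comp, Linear.comp_smul]
      simp only [Preadditive.comp_add, Preadditive.comp_sub, matTens_matSwap,
        Preadditive.add_comp, Preadditive.sub_comp, matSwap_matTens]
      simp
    · rw [Linear.smul_comp, Linear.comp_smul]
      refine congrArg (fun t => (1 / 2 : ℂ) • t) ?_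
      change _ ≫ (matTens B.d A.e + matTens (B.sgn ≫ B.e) A.d) =
        (matTens A.d B.e + matTens (A.sgn ≫ A.e) B.d) ≫ _
      simp only [Preadditive.comp_add, Preadditive.comp_sub, matTens_matSwap,
        Preadditive.add_comp, Preadditive.sub_comp, matSwap_matTens]
      simp [matSwap_neg_left, matSwap_neg_right]
      abel)

end Cx

section blocks
variable {M M' M'' N N' N'' : Mat_ PObj}

/-- Direct sum. -/
abbrev matSum (M N : Mat_ PObj) : Mat_ PObj := ⟨M.ι ⊕ N.ι, Sum.elim M.X N.X⟩

/-- The map with components `c`, `d` into a direct sum. -/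
def matRow (c : N ⟶ M') (d : N ⟶ N') : N ⟶ matSum M' N'
  | i, .inl j => c i j
  | i, .inr j => d i j

/-- The map with components `a`, `c` out of a direct sum. -/
def matCol (a : M ⟶ M') (c : N ⟶ M') : matSum M N ⟶ M'
  | .inl i, j => a i j
  | .inr i, j => c i j

/-- A block matrix of maps between direct sums. -/
def matBlock (a : M ⟶ M') (b : M ⟶ N') (c : N ⟶ M') (d : N ⟶ N') : matSum M N ⟶ matSum M' N'
  | .inl i, .inl j => a i j
  | .inl i, .inr j => b i j
  | .inr i, .inl j => c i j
  | .inr i, .inr j => d i j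

theorem matBlock_comp (a : M ⟶ M') (b : M ⟶ N') (c : N ⟶ M') (d : N ⟶ N')
    (a' : M' ⟶ M'') (b' : M' ⟶ N'') (c' : N' ⟶ M'') (d' : N' ⟶ N'') :
    matBlock a b c d ≫ matBlock a' b' c' d' =
      matBlock (a ≫ a' + b ≫ c') (a ≫ b' + b ≫ d') (c ≫ a' + d ≫ c') (c ≫ b' + d ≫ d') := by
  ext i j
  refine (Fintype.sum_sum_type _).trans ?_
  rcases i with i | i <;> rcases j with j | j <;> rfl

theorem matRow_comp_block (c : N ⟶ M') (d : N ⟶ N')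
    (a' : M' ⟶ M'') (b' : M' ⟶ N'') (c' : N' ⟶ M'') (d' : N' ⟶ N'') :
    matRow c d ≫ matBlock a' b' c' d' = matRow (c ≫ a' + d ≫ c') (c ≫ b' + d ≫ d') := by
  ext i j
  refine (Fintype.sum_sum_type _).trans ?_
  rcases j with j | j <;> rfl

theorem comp_matRow (g : M ⟶ N) (c : N ⟶ M') (d : N ⟶ N') :
    g ≫ matRow c d = matRow (g ≫ c) (g ≫ d) := by
  ext i j
  rcases j with j | j <;> rfl

theorem matBlock_comp_col (a : M ⟶ M') (b : M ⟶ N') (c : N ⟶ M') (d : N ⟶ N')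
    (a' : M' ⟶ M'') (c' : N' ⟶ M'') :
    matBlock a b c d ≫ matCol a' c' = matCol (a ≫ a' + b ≫ c') (c ≫ a' + d ≫ c') := by
  ext i j
  refine (Fintype.sum_sum_type _).trans ?_
  rcases i with i | i <;> rfl

theorem matCol_comp (a : M ⟶ M') (c : N ⟶ M') (g : M' ⟶ M'') :
    matCol a c ≫ g = matCol (a ≫ g) (c ≫ g) := by
  ext i j
  rcases i with i | i <;> rfl

theorem matBlock_zero : matBlock (0 : M ⟶ M') (0 : M ⟶ N') (0 : N ⟶ M') (0 : N ⟶ N') = 0 := by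
  ext i j
  rcases i with i | i <;> rcases j with j | j <;> rfl

theorem matCol_neg (a : M ⟶ M') (c : N ⟶ M') : matCol (-a) (-c) = -matCol a c := by
  ext i j
  rcases i with i | i <;> rfl

end blocks

namespace Cx

/-- The `q`-shift `q^k A`. -/
abbrev shift (k : ℤ) (A : Cx) : Cx where
  X := A.X
  hdeg := A.hdeg
  qdeg i := A.qdeg i + k
  e := A.e
  d := A.d
  e_bihom i j := ⟨(A.e_bihom i j).1, by
    have h : 0 + (A.qdeg i + k) - (A.qdeg j + k) = 0 + A.qdeg i - A.qdeg j := by ring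
    rw [h]; exact (A.e_bihom i j).2⟩
  d_bihom i j := ⟨(A.d_bihom i j).1, by
    have h : 0 + (A.qdeg i + k) - (A.qdeg j + k) = 0 + A.qdeg i - A.qdeg j := by ring
    rw [h]; exact (A.d_bihom i j).2⟩
  e_e := A.e_e
  e_d := A.e_d
  d_e := A.d_e
  d_d := A.d_d

/-- The identity, as a map `A ⟶ q^k A` of bidegree `(0, k)`. -/
def toShift (k : ℤ) (A : Cx) : A ⟶ shift k A := cls A.e (e_mem_cycles A)

/-- The identity, as a map `q^k A ⟶ A` of bidegree `(0, -k)`. -/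
def fromShift (k : ℤ) (A : Cx) : shift k A ⟶ A := cls A.e (e_mem_cycles A)

/-- The graded object underlying a cone: the source is shifted up by one. -/
abbrev coneG (A B : GObj) : GObj where
  X := matSum A.X B.X
  hdeg := Sum.elim (fun i => A.hdeg i + 1) B.hdeg
  qdeg := Sum.elim A.qdeg B.qdeg

theorem coneG_sgn (A B : GObj) : (coneG A B).sgn = matBlock (-A.sgn) 0 0 B.sgn := by
  ext i j
  change (Sum.elim (fun i => A.hdeg i + 1) B.hdeg i).negOnePow •
    (𝟙 (matSum A.X B.X) : _ ⟶ _) i j = _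
  have h : (𝟙 (matSum A.X B.X)) = matBlock (𝟙 A.X) 0 0 (𝟙 B.X) := by
    classical
    ext i j
    rcases i with i | i <;> rcases j with j | j
    · change _ = (𝟙 A.X : A.X ⟶ A.X) i j
      by_cases h : i = j
      · subst h; rw [Mat_.id_apply_self, Mat_.id_apply_self]; rfl
      · rw [Mat_.id_apply_of_ne _ _ _ h, Mat_.id_apply_of_ne _ _ _ (by simpa using h)]; rfl
    · rw [Mat_.id_apply_of_ne _ _ _ (by simp)]; rfl
    · rw [Mat_.id_apply_of_ne _ _ _ (by simp)]; rfl
    · change _ = (𝟙 B.X : B.X ⟶ B.X) i j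
      by_cases h : i = j
      · subst h; rw [Mat_.id_apply_self, Mat_.id_apply_self]; rfl
      · rw [Mat_.id_apply_of_ne _ _ _ h, Mat_.id_apply_of_ne _ _ _ (by simpa using h)]; rfl
  rw [h]
  rcases i with i | i <;> rcases j with j | j
  · change (A.hdeg i + 1).negOnePow • (𝟙 A.X : A.X ⟶ A.X) i j =
      -((A.hdeg i).negOnePow • (𝟙 A.X : A.X ⟶ A.X) i j)
    rw [Int.negOnePow_succ, Units.neg_smul]
  · exact smul_zero _
  · exact smul_zero _
  · rfl

/-- The cone of a chain map `f : A ⟶ B` of bidegree `(0, 0)`, with differential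
`(a, b) ↦ (-d a, f a + d b)`. -/
abbrev cone {A B : Cx} (f : A.X ⟶ B.X) (hf : f ∈ cycles A B)
    (hb : IsBihom (A := A.toGObj) (B := B.toGObj) 0 0 f) : Cx where
  toGObj := coneG A.toGObj B.toGObj
  e := matBlock A.e 0 0 B.e
  d := matBlock (-A.d) f 0 B.d
  e_bihom := by
    rintro (i | i) (j | j)
    · refine ⟨fun h => ?_, (A.e_bihom i j).2⟩
      have := (A.e_bihom i j).1 h
      change A.hdeg j + 1 = A.hdeg i + 1 + 0
      omega
    · exact ⟨fun h => (h rfl).elim, Submodule.zero_mem _⟩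
    · exact ⟨fun h => (h rfl).elim, Submodule.zero_mem _⟩
    · exact B.e_bihom i j
  d_bihom := by
    rintro (i | i) (j | j)
    · refine ⟨fun h => ?_, Submodule.neg_mem _ (A.d_bihom i j).2⟩
      have := (A.d_bihom i j).1 fun h0 => h (by
        change -(A.d i j) = 0
        rw [h0, neg_zero])
      change A.hdeg j + 1 = A.hdeg i + 1 + -1
      omega
    · refine ⟨fun h => ?_, (hb i j).2⟩
      have := (hb i j).1 h
      change B.hdeg j = A.hdeg i + 1 + -1
      omega
    · exact ⟨fun h => (h rfl).elim, Submodule.zero_mem _⟩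
    · exact B.d_bihom i j
  e_e := by rw [matBlock_comp]; simp
  e_d := by
    have := hf.1.1
    rw [matBlock_comp]; simp [this]
  d_e := by
    have := hf.1.2
    rw [matBlock_comp]; simp [this]
  d_d := by
    have h : f ≫ B.d = A.d ≫ f := by
      rw [cycles_comm hf, hb.sgn_comm]; simp
    rw [matBlock_comp]; simp [h, matBlock_zero]

variable {A B : Cx} (f : A.X ⟶ B.X) (hf : f ∈ cycles A B)
    (hb : IsBihom (A := A.toGObj) (B := B.toGObj) 0 0 f)

/-- The inclusion `B ⟶ Cone(f)`, of bidegree `(0, 0)`. -/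
def coneInr : B ⟶ cone f hf hb :=
  cls (matRow 0 B.e) (by
    refine mem_cycles_of_even ⟨?_, ?_⟩ ?_ ?_
    · rw [comp_matRow]; simp
    · change matRow 0 B.e ≫ matBlock A.e 0 0 B.e = _
      rw [matRow_comp_block]; simp
    · change _ ≫ (coneG A.toGObj B.toGObj).sgn = _
      rw [coneG_sgn, matRow_comp_block, comp_matRow]; simp
    · change matRow 0 B.e ≫ matBlock (-A.d) f 0 B.d = _
      rw [matRow_comp_block, comp_matRow]; simp)

/-- The projection `Cone(f) ⟶ A[1]`, regarded as a map to `A` of bidegree `(-1, 0)`. -/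
def coneFst : cone f hf hb ⟶ A :=
  cls (matCol A.e 0) (by
    refine mem_cycles_of_odd ⟨?_, ?_⟩ ?_ ?_
    · change matBlock A.e 0 0 B.e ≫ matCol A.e 0 = _
      rw [matBlock_comp_col]; simp
    · rw [matCol_comp]; simp
    · change _ = -((coneG A.toGObj B.toGObj).sgn ≫ _)
      rw [coneG_sgn, matBlock_comp_col, matCol_comp, ← matCol_neg]; simp
    · change _ = -(matBlock (-A.d) f 0 B.d ≫ matCol A.e 0)
      rw [matBlock_comp_col, matCol_comp, ← matCol_neg]; simp)

end Cx

open Cx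

section poly
variable {ι : Type} [Fintype ι] {n : ℕ}

/-- The direct sum of copies of `E^{⊗n}` indexed by `ι`. -/
abbrev constObj (ι : Type) [Fintype ι] (n : ℕ) : Mat_ PObj := ⟨ι, fun _ => ⟨n⟩⟩

/-- A matrix of polynomials, acting on a direct sum of copies of `E^{⊗n}`. -/
def polyMat (P : Matrix ι ι (MvPolynomial (Fin n) ℂ)) : constObj ι n ⟶ constObj ι n :=
  fun i j => DotPerm.single (Equiv.refl _) (P i j)

theorem polyMat_mul (P Q : Matrix ι ι (MvPolynomial (Fin n) ℂ)) :
    polyMat P ≫ polyMat Q = polyMat (P * Q) := by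
  ext i k
  change ∑ j, DotPerm.comp (DotPerm.single (Equiv.refl _) (P i j))
    (DotPerm.single (Equiv.refl _) (Q j k)) = DotPerm.single (Equiv.refl _) ((P * Q) i k)
  rw [Matrix.mul_apply, map_sum]
  refine Finset.sum_congr rfl fun j _ => ?_
  rw [DotPerm.comp_single]
  simp

theorem polyMat_add (P Q : Matrix ι ι (MvPolynomial (Fin n) ℂ)) :
    polyMat (P + Q) = polyMat P + polyMat Q := by
  ext i k
  exact (DotPerm.single (Equiv.refl _)).map_add _ _

theorem polyMat_zero : polyMat (0 : Matrix ι ι (MvPolynomial (Fin n) ℂ)) = 0 := by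
  ext i k
  exact (DotPerm.single (Equiv.refl _)).map_zero

theorem polyMat_neg (P : Matrix ι ι (MvPolynomial (Fin n) ℂ)) :
    polyMat (-P) = -polyMat P := by
  ext i k
  exact (DotPerm.single (Equiv.refl _)).map_neg _

/-- The matrix of the contraction `e_S ↦ ∑_{i ∈ S} ± c_i e_{S ∖ i}` on an exterior algebra with basis
`e_S = e_{i_1} ∧ … ∧ e_{i_k}`, for `S = {i_1 < … < i_k}`; the sign is `(-1)^{#{j ∈ S, j < i}}`. -/
def contraction {r : ℕ} {R : Type} [CommRing R] (c : Fin r → R) :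
    Matrix (Finset (Fin r)) (Finset (Fin r)) R :=
  fun S T => ∑ i, if i ∈ S ∧ T = S.erase i then (-1) ^ (S.filter (· < i)).card * c i else 0

theorem contraction_sign {r : ℕ} {S : Finset (Fin r)} {i j : Fin r} (hi : i ∈ S) (hij : i < j) :
    (-1 : ℤ) ^ (S.filter (· < i)).card * (-1) ^ ((S.erase i).filter (· < j)).card =
      - ((-1) ^ (S.filter (· < j)).card * (-1) ^ ((S.erase j).filter (· < i)).card) := by
  have h1 : (S.erase j).filter (· < i) = S.filter (· < i) := by
    ext k; simp only [Finset.mem_filter, Finset.mem_erase]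
    constructor
    · rintro ⟨⟨_, h⟩, h'⟩; exact ⟨h, h'⟩
    · rintro ⟨h, h'⟩; exact ⟨⟨(h'.trans hij).ne, h⟩, h'⟩
  have h2 : (S.erase i).filter (· < j) = (S.filter (· < j)).erase i := by
    ext k; simp only [Finset.mem_filter, Finset.mem_erase]; tauto
  have h3 : i ∈ S.filter (· < j) := by simp [hi, hij]
  rw [h1, h2, ← Finset.card_erase_add_one h3]
  ring

theorem contraction_mul_apply {r : ℕ} {R : Type} [CommRing R] (c c' : Fin r → R)
    (S T : Finset (Fin r)) : (contraction c * contraction c') S T =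
      ∑ i, ∑ j, if i ∈ S ∧ j ∈ S ∧ i ≠ j ∧ T = (S.erase i).erase j then
        (((-1) ^ (S.filter (· < i)).card * (-1) ^ ((S.erase i).filter (· < j)).card : ℤ) : R) *
          (c i * c' j) else 0 := by
  rw [Matrix.mul_apply]
  simp only [contraction, Finset.sum_mul]
  rw [Finset.sum_comm]
  refine Finset.sum_congr rfl fun i _ => ?_
  rw [Finset.sum_eq_single (S.erase i)]
  · rw [Finset.mul_sum]
    refine Finset.sum_congr rfl fun j _ => ?_
    by_cases h1 : i ∈ S
    · by_cases h2 : j ∈ S.erase i ∧ T = (S.erase i).erase j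
      · rw [if_pos ⟨h1, rfl⟩, if_pos h2, if_pos ⟨h1, (Finset.mem_erase.mp h2.1).2,
          (Finset.mem_erase.mp h2.1).1.symm, h2.2⟩]
        push_cast; ring
      · rw [if_neg h2, mul_zero, if_neg]
        rintro ⟨_, h3, h4, h5⟩
        exact h2 ⟨Finset.mem_erase.mpr ⟨h4.symm, h3⟩, h5⟩
    · rw [if_neg (fun h => h1 h.1), zero_mul, if_neg (fun h => h1 h.1)]
  · intro U _ hU
    rw [if_neg (fun h => hU h.2), zero_mul]
  · simp

theorem contraction_anticomm {r : ℕ} {R : Type} [CommRing R] (c c' : Fin r → R) :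
    contraction c * contraction c' = - (contraction c' * contraction c) := by
  ext S T
  rw [Matrix.neg_apply, contraction_mul_apply, contraction_mul_apply, Finset.sum_comm,
    ← Finset.sum_neg_distrib]
  refine Finset.sum_congr rfl fun j _ => ?_
  rw [← Finset.sum_neg_distrib]
  refine Finset.sum_congr rfl fun i _ => ?_
  by_cases h : i ∈ S ∧ j ∈ S ∧ i ≠ j ∧ T = (S.erase i).erase j
  · rw [if_pos h, if_pos ⟨h.2.1, h.1, h.2.2.1.symm, by rw [Finset.erase_right_comm]; exact h.2.2.2⟩]
    rw [← neg_mul, mul_comm (c i)]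
    congr 1
    rw [← Int.cast_neg]
    congr 1
    rcases lt_or_gt_of_ne h.2.2.1 with hij | hij
    · exact contraction_sign h.1 hij
    · rw [contraction_sign h.2.1 hij, neg_neg]
  · rw [if_neg h, if_neg, neg_zero]
    rintro ⟨h1, h2, h3, h4⟩
    exact h ⟨h2, h1, h3.symm, by rw [Finset.erase_right_comm]; exact h4⟩

theorem contraction_sq {r : ℕ} {R : Type} [CommRing R] (c : Fin r → R) :
    contraction c * contraction c = 0 := by
  ext S T
  rw [contraction_mul_apply, Matrix.zero_apply]
  rw [← Finset.sum_product' Finset.univ Finset.univ (fun i j => _)]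
  refine Finset.sum_involution (fun p _ => (p.2, p.1)) ?_ ?_ (by simp) (by simp)
  · rintro ⟨i, j⟩ _
    dsimp only
    by_cases h : i ∈ S ∧ j ∈ S ∧ i ≠ j ∧ T = (S.erase i).erase j
    · rw [if_pos h, if_pos ⟨h.2.1, h.1, h.2.2.1.symm, by
        rw [Finset.erase_right_comm]; exact h.2.2.2⟩, mul_comm (c j), ← add_mul, ← Int.cast_add]
      rcases lt_or_gt_of_ne h.2.2.1 with hij | hij
      · rw [contraction_sign h.1 hij]; simp
      · rw [contraction_sign h.2.1 hij]; simp
    · rw [if_neg h, if_neg, zero_add]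
      rintro ⟨h1, h2, h3, h4⟩
      exact h ⟨h2, h1, h3.symm, by rw [Finset.erase_right_comm]; exact h4⟩
  · rintro ⟨i, j⟩ _ hne heq
    have : i = j := congrArg Prod.fst heq.symm
    subst this
    simp at hne

end poly

/-- The index `i` of the difference `x_i - x_{i+1}`. -/
def leftIdx {n : ℕ} (i : Fin (n - 1)) : Fin n := ⟨i, by omega⟩
/-- The index `i + 1` of the difference `x_i - x_{i+1}`. -/
def rightIdx {n : ℕ} (i : Fin (n - 1)) : Fin n := ⟨i + 1, by omega⟩

/-- The graded object underlying the Koszul complex: a copy of `q^{2|S|+1-n} E^{⊗n}` in homological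
degree `|S|` for every `S ⊆ {1, …, n-1}`. -/
abbrev koszulG (n : ℕ) : GObj where
  X := constObj (Finset (Fin (n - 1))) n
  hdeg S := (S.card : ℤ)
  qdeg S := 2 * (S.card : ℤ) + 1 - n

theorem contraction_bihom {n : ℕ} (c : Fin (n - 1) → MvPolynomial (Fin n) ℂ) (k : ℤ)
    (hc : ∀ i, MvPolynomial.IsWeightedHomogeneous (fun _ => (2 : ℤ)) (c i) (k + 2)) :
    IsBihom (A := koszulG n) (B := koszulG n) (-1) k (polyMat (contraction c)) := by
  intro S T
  by_cases h : ∃ i ∈ S, T = S.erase i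
  · obtain ⟨i, hi, rfl⟩ := h
    have hcard := Finset.card_erase_add_one hi
    have hz : ((S.erase i).card : ℤ) + 1 = S.card := by exact_mod_cast hcard
    refine ⟨fun _ => ?_, ?_⟩
    · change ((S.erase i).card : ℤ) = S.card + -1
      omega
    · have e : k + (2 * (S.card : ℤ) + 1 - n) - (2 * ((S.erase i).card : ℤ) + 1 - n) = k + 2 := by
        omega
      change _ ∈ DotPerm.homog _ _ (k + (2 * (S.card : ℤ) + 1 - n) -
        (2 * ((S.erase i).card : ℤ) + 1 - n))
      rw [e]
      refine DotPerm.single_mem_homog _ (MvPolynomial.IsWeightedHomogeneous.sum _ _ _ fun j _ => ?_)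
      split_ifs
      · rcases neg_one_pow_eq_or (MvPolynomial (Fin n) ℂ) (S.filter (· < j)).card with h | h <;>
          rw [h]
        · simpa using hc j
        · have := (MvPolynomial.isWeightedHomogeneous_C (fun _ : Fin n => (2 : ℤ)) (-1 : ℂ)).mul
            (hc j)
          simpa using this
      · exact MvPolynomial.isWeightedHomogeneous_zero ℂ _ _
  · have h0 : polyMat (contraction c) S T = 0 := by
      have : contraction c S T = 0 := Finset.sum_eq_zero fun i _ =>
        if_neg fun h' => h ⟨i, h'.1, h'.2⟩
      change DotPerm.single _ (contraction c S T) = 0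
      rw [this, map_zero]
    rw [h0]
    exact ⟨fun h => (h rfl).elim, Submodule.zero_mem _⟩


/-- The differences `x_i - x_{i+1}`. -/
def koszulC (n : ℕ) (i : Fin (n - 1)) : MvPolynomial (Fin n) ℂ :=
  MvPolynomial.X (leftIdx i) - MvPolynomial.X (rightIdx i)

/-- `Cube_n`: the Koszul complex on `E^{⊗n}` of the commuting operators `x_i - x_{i+1}`,
`1 ≤ i ≤ n - 1`, with its last term `q^{1-n} E^{⊗n}` in homological degree `0`. -/
abbrev cube (n : ℕ+) : Cx where
  toGObj := koszulG n
  e := 𝟙 _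
  d := polyMat (contraction (koszulC n))
  e_bihom := id_bihom _
  d_bihom := contraction_bihom _ 0 fun i => by
    rw [zero_add, koszulC, sub_eq_add_neg, ← neg_one_mul, ← map_one MvPolynomial.C, ← map_neg]
    refine (MvPolynomial.isWeightedHomogeneous_X ℂ _ _).add ?_
    have h := (MvPolynomial.isWeightedHomogeneous_C (fun _ => (2 : ℤ)) (-1 : ℂ)).mul
      (MvPolynomial.isWeightedHomogeneous_X ℂ (fun _ => (2 : ℤ)) (rightIdx i))
    rwa [zero_add] at h
  e_e := Category.id_comp _
  e_d := Category.id_comp _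
  d_e := Category.comp_id _
  d_d := by rw [polyMat_mul, contraction_sq, polyMat_zero]

theorem mem_maps_cube {n m : ℕ+} (f : (cube n).X ⟶ (cube m).X) : f ∈ maps (cube n) (cube m) :=
  ⟨Category.id_comp _, Category.comp_id _⟩

/-- Multiplication by `x_i` on all of `Cube_n`. -/
def dotMat (n : ℕ+) (i : Fin n) : (cube n).X ⟶ (cube n).X :=
  polyMat (Matrix.diagonal fun _ => MvPolynomial.X i)

theorem dotMat_mem (n : ℕ+) (i : Fin n) : dotMat n i ∈ cycles (cube n) (cube n) := by
  refine mem_cycles_of_even (mem_maps_cube _) ?_ ?_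
  · ext S T
    refine (comp_sgn_apply (A := koszulG n) (dotMat n i) S T).trans
      (Eq.trans ?_ (sgn_comp_apply (A := koszulG n) (dotMat n i) S T).symm)
    by_cases h : S = T
    · rw [h]
    · have h0 : dotMat n i S T = 0 := by
        change DotPerm.single _ (Matrix.diagonal _ S T) = 0
        rw [Matrix.diagonal_apply_ne _ h, map_zero]
      rw [h0, smul_zero, smul_zero]
  · change polyMat _ ≫ polyMat _ = polyMat _ ≫ polyMat _
    rw [polyMat_mul, polyMat_mul]
    congr 1
    ext1 S T
    rw [Matrix.diagonal_mul, Matrix.mul_diagonal, mul_comm]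

/-- The endomorphism `x_i` of `Cube_n`, of bidegree `(0, 2)`. -/
def xAct (n : ℕ+) (i : Fin n) : End (cube n) := cls (dotMat n i) (dotMat_mem n i)

/-- Contraction with `u` on all of `Cube_n`. -/
def epsMat (n : ℕ+) (u : Fin n → ℂ) : (cube n).X ⟶ (cube n).X :=
  polyMat (contraction fun i => MvPolynomial.C (u (leftIdx i) - u (rightIdx i)))

theorem epsMat_mem (n : ℕ+) (u : Fin n → ℂ) : epsMat n u ∈ cycles (cube n) (cube n) := by
  refine mem_cycles_of_odd (mem_maps_cube _) ?_ ?_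
  · have := IsBihom.sgn_comm (A := (cube n).toGObj) (B := (cube n).toGObj) (contraction_bihom
      (fun i => MvPolynomial.C (u (leftIdx i) - u (rightIdx i))) (-2) fun i =>
        MvPolynomial.isWeightedHomogeneous_C _ _)
    rw [Int.negOnePow_neg, Int.negOnePow_one, Units.neg_smul, one_smul] at this
    exact this
  · change epsMat n u ≫ polyMat _ = -(polyMat _ ≫ epsMat n u)
    rw [epsMat, polyMat_mul, polyMat_mul, contraction_anticomm, polyMat_neg]

/-- The action of `u ∈ U_n` on `Cube_n`, of bidegree `(-1, -2)`: contraction with `u`, where the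
generator `e_i` of the Koszul complex pairs with `u` as the vector `x_i - x_{i+1}` does, that is, to
`u_i - u_{i+1}`. -/
def eps (n : ℕ+) (u : Fin n → ℂ) : End (cube n) := cls (epsMat n u) (epsMat_mem n u)

theorem dotMat_bihom (n : ℕ+) (i : Fin n) :
    IsBihom (A := koszulG n) (B := koszulG n) 0 2 (dotMat n i) := by
  intro S T
  by_cases h : S = T
  · subst h
    refine ⟨fun _ => (add_zero _).symm, ?_⟩
    rw [add_sub_cancel_right]
    refine DotPerm.single_mem_homog _ ?_
    rw [Matrix.diagonal_apply_eq]
    exact MvPolynomial.isWeightedHomogeneous_X ℂ _ _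
  · have h0 : dotMat n i S T = 0 := by
      change DotPerm.single _ (Matrix.diagonal _ S T) = 0
      rw [Matrix.diagonal_apply_ne _ h, map_zero]
    rw [h0]
    exact ⟨fun h => (h rfl).elim, Submodule.zero_mem _⟩

/-- The map `x_n - x_{n+1}` on `Cube_n ⊗ Cube_m`: the last dot of the first factor minus the first
dot of the second factor. -/
def junctionMat (n m : ℕ+) : (tens (cube n) (cube m)).X ⟶ (tens (cube n) (cube m)).X :=
  matTens (dotMat n ⟨n - 1, Nat.sub_lt n.pos one_pos⟩) (cube m).e -
    matTens (cube n).e (dotMat m ⟨0, m.pos⟩)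

theorem matTens_dot_cycles {A B : Cx} {f : A.X ⟶ A.X} {g : B.X ⟶ B.X} (hf : f ∈ cycles A A)
    (hg : g ∈ cycles B B) (hf' : f ≫ A.sgn = A.sgn ≫ f) (hg' : g ≫ B.sgn = B.sgn ≫ g) :
    matTens f g ∈ cycles (tens A B) (tens A B) := by
  have hfd : f ≫ A.d = A.d ≫ f := by rw [cycles_comm hf, hf', sgn_sgn_assoc]
  have hgd : g ≫ B.d = B.d ≫ g := by rw [cycles_comm hg, hg', sgn_sgn_assoc]
  refine mem_cycles_of_even ⟨?_, ?_⟩ ?_ ?_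
  · rw [matTens_comp, hf.1.1, hg.1.1]
  · rw [matTens_comp, hf.1.2, hg.1.2]
  · rw [tens_sgn, matTens_comp, matTens_comp, hf', hg']
  · rw [Preadditive.comp_add, Preadditive.add_comp]
    simp only [matTens_comp, Category.assoc, hf.1.1, hg.1.1, hg.1.2, hfd, hgd]
    rw [← Category.assoc f, hf', Category.assoc, hf.1.2]

theorem junctionMat_mem (n m : ℕ+) :
    junctionMat n m ∈ cycles (tens (cube n) (cube m)) (tens (cube n) (cube m)) := by
  have hs (n : ℕ+) (i : Fin n) : dotMat n i ≫ (cube n).sgn = (cube n).sgn ≫ dotMat n i := by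
    have := (dotMat_bihom n i).sgn_comm
    rw [Int.negOnePow_zero, one_smul] at this
    exact this
  exact Submodule.sub_mem _
    (matTens_dot_cycles (dotMat_mem n _) (e_mem_cycles _) (hs n _) (e_sgn _))
    (matTens_dot_cycles (e_mem_cycles _) (dotMat_mem m _) (e_sgn _) (hs m _))

theorem junctionMat_bihom (n m : ℕ+) :
    IsBihom (A := (shift 1 (tens (cube n) (cube m))).toGObj)
      (B := (shift (-1) (tens (cube n) (cube m))).toGObj) 0 0 (junctionMat n m) := by
  have h1 := (dotMat_bihom n ⟨n - 1, Nat.sub_lt n.pos one_pos⟩).tens (cube m).e_bihom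
  have h2 := ((cube n).e_bihom.tens (dotMat_bihom m ⟨0, m.pos⟩)).smul (-1)
  have h3 : IsBihom (A := gTens (koszulG n) (koszulG m)) (B := gTens (koszulG n) (koszulG m))
      0 2 (junctionMat n m) := by
    have h4 := IsBihom.add (h := 0) (k := 2) h1 h2
    rw [neg_one_smul, ← sub_eq_add_neg] at h4
    exact h4
  intro i j
  refine ⟨(h3 i j).1, ?_⟩
  have h5 : 0 + ((tens (cube n) (cube m)).qdeg i + 1) - ((tens (cube n) (cube m)).qdeg j + -1) =
    2 + (tens (cube n) (cube m)).qdeg i - (tens (cube n) (cube m)).qdeg j := by ring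
  rw [h5]
  exact (h3 i j).2

theorem cycles_shift {A B : Cx} {f : A.X ⟶ B.X} (hf : f ∈ cycles A B) (k l : ℤ) :
    (f : (shift k A).X ⟶ (shift l B).X) ∈ cycles (shift k A) (shift l B) := hf

/-- `Cone(q Cube_n ⊗ Cube_m ⟶ q⁻¹ Cube_n ⊗ Cube_m)` of the map `x_n - x_{n+1}`. -/
def cubeCone (n m : ℕ+) : Cx :=
  cone (A := shift 1 (tens (cube n) (cube m))) (B := shift (-1) (tens (cube n) (cube m)))
    (junctionMat n m) (cycles_shift (junctionMat_mem n m) 1 (-1)) (junctionMat_bihom n m)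

/-- The canonical map `Cube_n ⊗ Cube_m ⟶ Cone`, of bidegree `(0, -1)`. -/
def toCone (n m : ℕ+) : tens (cube n) (cube m) ⟶ cubeCone n m :=
  toShift (-1) _ ≫
    coneInr (A := shift 1 (tens (cube n) (cube m))) (B := shift (-1) (tens (cube n) (cube m)))
      (junctionMat n m) (cycles_shift (junctionMat_mem n m) 1 (-1)) (junctionMat_bihom n m)

/-- The canonical map `Cone ⟶ Cube_n ⊗ Cube_m`, of bidegree `(-1, -1)`. -/
def fromCone (n m : ℕ+) : cubeCone n m ⟶ tens (cube n) (cube m) :=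
  coneFst (A := shift 1 (tens (cube n) (cube m))) (B := shift (-1) (tens (cube n) (cube m)))
      (junctionMat n m) (cycles_shift (junctionMat_mem n m) 1 (-1)) (junctionMat_bihom n m) ≫
    fromShift 1 _

/-- The reflection representation `U_n` of `S_n`: vectors in `ℂⁿ` with coordinate sum zero. -/
def U (n : ℕ) : Submodule ℂ (Fin n → ℂ) where
  carrier := {u | ∑ i, u i = 0}
  add_mem' {u v} hu hv := by
    have hu' : ∑ i, u i = 0 := hu
    have hv' : ∑ i, v i = 0 := hv
    change ∑ i, (u i + v i) = 0
    rw [Finset.sum_add_distrib, hu', hv', add_zero]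
  zero_mem' := by simp
  smul_mem' c u hu := by
    have hu' : ∑ i, u i = 0 := hu
    change ∑ i, c * u i = 0
    rw [← Finset.mul_sum, hu', mul_zero]

/-- The action of a permutation on `U_n`. -/
def permU {n : ℕ} (σ : Equiv.Perm (Fin n)) : U n →ₗ[ℂ] U n where
  toFun u := ⟨fun i => u.1 (σ⁻¹ i), by
    have hu : ∑ i, u.1 i = 0 := u.2
    change ∑ i, u.1 (σ⁻¹ i) = 0
    rw [Equiv.sum_comp σ⁻¹ u.1, hu]⟩
  map_add' _ _ := rfl
  map_smul' _ _ := rfl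

/-- The graded algebra `⋀(U_n) ⊗ ℂ[x]`. -/
def CoeffAlg (n : ℕ) : Type := ExteriorAlgebra ℂ (U n) ⊗[ℂ] Polynomial ℂ

instance (n : ℕ) : Ring (CoeffAlg n) :=
  inferInstanceAs (Ring (ExteriorAlgebra ℂ (U n) ⊗[ℂ] Polynomial ℂ))

instance (n : ℕ) : Algebra ℂ (CoeffAlg n) :=
  inferInstanceAs (Algebra ℂ (ExteriorAlgebra ℂ (U n) ⊗[ℂ] Polynomial ℂ))

/-- The element `w ⊗ p` of `⋀(U_n) ⊗ ℂ[x]`. -/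
def coeffTmul {n : ℕ} (w : ExteriorAlgebra ℂ (U n)) (p : Polynomial ℂ) : CoeffAlg n := w ⊗ₜ[ℂ] p

/-- The action of a permutation on `⋀(U_n) ⊗ ℂ[x]`, trivial on `x`. -/
def permCoeff {n : ℕ} (σ : Equiv.Perm (Fin n)) : CoeffAlg n →ₐ[ℂ] CoeffAlg n :=
  Algebra.TensorProduct.map (ExteriorAlgebra.map (permU σ)) (AlgHom.id ℂ (Polynomial ℂ))

theorem permCoeff_one {n : ℕ} : permCoeff (1 : Equiv.Perm (Fin n)) = AlgHom.id ℂ (CoeffAlg n) := by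
  have h : permU (1 : Equiv.Perm (Fin n)) = LinearMap.id := rfl
  rw [permCoeff, h, ExteriorAlgebra.map_id]
  exact Algebra.TensorProduct.map_id

theorem permCoeff_mul {n : ℕ} (σ τ : Equiv.Perm (Fin n)) :
    permCoeff (σ * τ) = (permCoeff σ).comp (permCoeff τ) := by
  have h : permU (σ * τ) = (permU σ).comp (permU τ) := by
    ext u i
    change u.1 ((σ * τ)⁻¹ i) = u.1 (τ⁻¹ (σ⁻¹ i))
    rw [mul_inv_rev]; rfl
  rw [permCoeff, h, ← ExteriorAlgebra.map_comp_map]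
  exact Algebra.TensorProduct.map_comp _ _ (AlgHom.id ℂ _) (AlgHom.id ℂ _)

instance (n : ℕ) : MulSemiringAction (Equiv.Perm (Fin n)) (CoeffAlg n) where
  smul σ a := permCoeff σ a
  one_smul a := DFunLike.congr_fun permCoeff_one a
  mul_smul σ τ a := DFunLike.congr_fun (permCoeff_mul σ τ) a
  smul_zero σ := map_zero (permCoeff σ)
  smul_add σ := map_add (permCoeff σ)
  smul_one σ := map_one (permCoeff σ)
  smul_mul σ := map_mul (permCoeff σ)

instance (n : ℕ) : SMulCommClass (Equiv.Perm (Fin n)) ℂ (CoeffAlg n) where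
  smul_comm σ c a := map_smul (permCoeff σ) c a

/-- The crossed product `(⋀(U_n) ⊗ ℂ[x]) ⋊ ℂ[S_n]`. -/
abbrev CrossedAlg (n : ℕ) : Type := SkewMonoidAlgebra (CoeffAlg n) (Equiv.Perm (Fin n))

/-- The part of bidegree `(h, k)` of the crossed product, where `x` has bidegree `(0, 2)`, `U_n` has
bidegree `(-1, -2)` and `S_n` has bidegree `(0, 0)`. -/
def crossedPiece (n : ℕ) (h k : ℤ) : Submodule ℂ (CrossedAlg n) :=
  Submodule.span ℂ {z | ∃ (σ : Equiv.Perm (Fin n)) (a b : ℕ), h = -(a : ℤ) ∧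
    k = 2 * (b : ℤ) - 2 * (a : ℤ) ∧ ∃ w ∈ ⋀[ℂ]^a (U n),
      z = SkewMonoidAlgebra.single σ (coeffTmul w (Polynomial.X ^ b))}

/-- The morphisms of homological degree `h` and `q`-degree `k`. -/
def homPiece (A B : Cx) (h k : ℤ) : Submodule ℂ (A ⟶ B) :=
  Submodule.span ℂ {z | ∃ (f : A.X ⟶ B.X) (hf : f ∈ cycles A B),
    IsBihom (A := A.toGObj) (B := B.toGObj) h k f ∧ z = cls f hf}

/-- The induction map `U_n ⊕ U_m ⟶ U_{n+m}`. -/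
def indVec {n m : ℕ+} (v : U n) (w : U m) : U (n + m : ℕ+) :=
  ⟨Fin.append v.1 w.1, by
    have hv : ∑ i, v.1 i = 0 := v.2
    have hw : ∑ i, w.1 i = 0 := w.2
    change ∑ i : Fin ((n : ℕ) + m), Fin.append v.1 w.1 i = 0
    rw [Fin.sum_univ_add]
    simp [hv, hw]⟩

theorem sub_mean_mem {n : ℕ+} (u : Fin n → ℂ) : (fun i => u i - (∑ j, u j) / n) ∈ U n := by
  change ∑ i, (u i - (∑ j, u j) / n) = 0
  have : (n : ℂ) ≠ 0 := by exact_mod_cast n.ne_zero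
  rw [Finset.sum_sub_distrib, Finset.sum_const, Finset.card_univ, Fintype.card_fin, nsmul_eq_mul,
    mul_div_cancel₀ _ this, sub_self]

/-- First component of the restriction map `U_{n+m} ⟶ U_n ⊕ U_m`, the orthogonal projection. -/
def resL {n m : ℕ+} (u : U (n + m : ℕ+)) : U n :=
  ⟨_, sub_mean_mem fun i => u.1 (Fin.castAdd (m : ℕ) i)⟩

/-- Second component of the restriction map `U_{n+m} ⟶ U_n ⊕ U_m`. -/
def resR {n m : ℕ+} (u : U (n + m : ℕ+)) : U m :=
  ⟨_, sub_mean_mem fun i => u.1 (Fin.natAdd (n : ℕ) i)⟩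

/-- The action of `(v, w) ∈ U_n ⊕ U_m` on `Cube_n ⊗ Cube_m`. -/
def epsPair {n m : ℕ+} (v : U n) (w : U m) : End (tens (cube n) (cube m)) :=
  whiskerRight (eps n v) (cube m) + whiskerLeft (cube n) (eps m w)

/-- The merge map `Cube_n ⊗ Cube_m ⟶ Cube_{n+m}` obtained from an isomorphism with the cone. -/
def mergeOf {n m : ℕ+} (e : cube (n + m) ≅ cubeCone n m) :
    tens (cube n) (cube m) ⟶ cube (n + m) :=
  toCone n m ≫ e.inv

/-- The split map `Cube_{n+m} ⟶ Cube_n ⊗ Cube_m` obtained from an isomorphism with the cone. -/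
def splitOf {n m : ℕ+} (e : cube (n + m) ≅ cubeCone n m) :
    cube (n + m) ⟶ tens (cube n) (cube m) :=
  e.hom ≫ fromCone n m

/-- Parenthesized tensor products of `Cube_n`'s. -/
inductive CubeTree : Type
  | cube (n : ℕ+) : CubeTree
  | tensor (s t : CubeTree) : CubeTree

/-- The complex described by a parenthesized tensor product. -/
def CubeTree.obj : CubeTree → Cx
  | .cube n => AnnularCube.cube n
  | .tensor s t => Cx.tens s.obj t.obj

/-- The morphisms generated by given merge and split maps and by all endomorphisms of the `Cube_n`:
the smallest class of morphisms between tensor products of `Cube_n`'s containing these and the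
structural isomorphisms of the symmetric monoidal structure, and closed under linear combinations,
composition and tensor product. -/
inductive Generated (merge : ∀ n m : ℕ+, tens (cube n) (cube m) ⟶ cube (n + m))
    (split : ∀ n m : ℕ+, cube (n + m) ⟶ tens (cube n) (cube m)) :
    ∀ s t : CubeTree, (s.obj ⟶ t.obj) → Prop
  | zero (s t : CubeTree) : Generated merge split s t 0
  | add {s t : CubeTree} {f g : s.obj ⟶ t.obj} :
      Generated merge split s t f → Generated merge split s t g → Generated merge split s t (f + g)
  | smul {s t : CubeTree} (c : ℂ) {f : s.obj ⟶ t.obj} :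
      Generated merge split s t f → Generated merge split s t (c • f)
  | id (s : CubeTree) : Generated merge split s s (𝟙 s.obj)
  | comp {s t u : CubeTree} {f : s.obj ⟶ t.obj} {g : t.obj ⟶ u.obj} :
      Generated merge split s t f → Generated merge split t u g → Generated merge split s u (f ≫ g)
  | whiskerRight {s t : CubeTree} {f : s.obj ⟶ t.obj} (u : CubeTree) :
      Generated merge split s t f →
        Generated merge split (.tensor s u) (.tensor t u) (Cx.whiskerRight f u.obj)
  | whiskerLeft (u : CubeTree) {s t : CubeTree} {f : s.obj ⟶ t.obj} :
      Generated merge split s t f →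
        Generated merge split (.tensor u s) (.tensor u t) (Cx.whiskerLeft u.obj f)
  | assocHom (s t u : CubeTree) :
      Generated merge split (.tensor (.tensor s t) u) (.tensor s (.tensor t u))
        (Cx.assocHom s.obj t.obj u.obj)
  | assocInv (s t u : CubeTree) :
      Generated merge split (.tensor s (.tensor t u)) (.tensor (.tensor s t) u)
        (Cx.assocInv s.obj t.obj u.obj)
  | braiding (s t : CubeTree) :
      Generated merge split (.tensor s t) (.tensor t s) (Cx.braiding s.obj t.obj)
  | endo (n : ℕ+) (f : End (cube n)) : Generated merge split (.cube n) (.cube n) f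
  | merge (n m : ℕ+) : Generated merge split (.tensor (.cube n) (.cube m)) (.cube (n + m)) (merge n m)
  | split (n m : ℕ+) : Generated merge split (.cube (n + m)) (.tensor (.cube n) (.cube m)) (split n m)

end AnnularCube

end

open AnnularCube AnnularCube.Cx

/-!
All three assertions are proved with explicit matrices. An entry of a map between tensor products of
cubes is a combination of dotted permutations, and the differentials involve dots only. So the Hom
complex splits as a direct sum over the bijections of strands, and every morphism is a sum of
morphisms supported on single bijections (`CubeTree.exists_supported`).

**Endomorphisms.** The Koszul differential of `Cube_n` is the contraction with the sequence
`x_i - x_{i+1}`. Exterior multiplication by a generator is a homotopy from `x_i` to `x_{i+1}`, so all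
dots agree (`xAct_eq`). The endomorphisms supported on the identity permutation are matrices over
`ℂ[x_1, …, x_n]`, and the boundary of such a matrix is its graded commutator with the differential, the
combination `∑ (x_i - x_{i+1}) ∂_i` of the graded commutators `∂_i` with the single contractions. The
`∂_i` and the right multiplications by Koszul generators satisfy the relations of contractions and
exterior multiplications. The matrices killed by all `∂_i` are the combinations of products of
contractions, each determined by its first column (`eq_sum_monomialMat`), and the `x_i - x_{i+1}` form
a regular sequence on them. Hence every cycle is homotopic to such a combination
(`exists_sub_koszulSum`, `exists_sub_skewComm`), so `⋀(U_n) ⊗ ℂ[x]` acts by all of them. The action is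
faithful because the first column of a boundary vanishes once all dots are identified (`firstCol`).
A reflection lifts to a chain map by the formula `1 - α ∧ ι_α` on the exterior algebra of the Koszul
generators (`exists_isLift_swap`). As a lift is determined by its first column, the lifts form an
action of `S_n`, which moves the summand of a permutation to that of the identity. This gives the
crossed product (`crossedEquiv`), and comparing first columns gives the bidegrees
(`mem_crossedPiece_iff`).

**The cone.** Splitting the exterior algebra along the generator of `x_n - x_{n+1}` identifies the
underlying complexes of `Cube_{n+m}` and of the cone (`cubeConeIso`). A morphism from or to
`Cube_n ⊗ Cube_m` factors through the merge or the split map as soon as `x_n - x_{n+1}` annihilates it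
(`exists_mergeOf_comp`, `exists_comp_splitOf`). For morphisms to or from `Cube_{n+m}` this is automatic,
since dots slide along strands and all dots of `Cube_{n+m}` agree.

**Generation.** Consider a morphism between tensor products of cubes supported on a bijection `σ` of
strands, and argue by induction on the number of factors. If `σ` separates two strands of a factor of
the source, the morphism is annihilated by a difference of dots in two factors of the target, and it
factors through a split map, with a target of fewer factors. If `σ` joins strands of different factors,
it factors through a merge map in the same way. Otherwise `σ` matches the factors, and the Künneth
theorem over a field (`CubeTree.Supported.mem_span_tens`) writes the morphism as a sum of tensor
products of an endomorphism of a cube with a morphism between fewer factors (`CubeTree.gen`).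
-/

noncomputable section

namespace AnnularCube

/-! ### Homotopy classes and tensor products of maps -/

namespace Cx

theorem exists_cls {A B : Cx} (f : A ⟶ B) :
    ∃ (g : A.X ⟶ B.X) (hg : g ∈ cycles A B), f = cls g hg := by
  obtain ⟨g, rfl⟩ := toHHom_surjective A B f
  exact ⟨g.1, g.2, rfl⟩

theorem cls_eq_zero {A B : Cx} {f : A.X ⟶ B.X} (hf : f ∈ cycles A B) :
    cls f hf = 0 ↔ ∃ k ∈ maps A B, delta A B k = f :=
  toHHom_eq_zero ⟨f, hf⟩

theorem cls_sub {A B : Cx} {f g : A.X ⟶ B.X} (hf : f ∈ cycles A B) (hg : g ∈ cycles A B) :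
    cls f hf - cls g hg = cls (f - g) (Submodule.sub_mem _ hf hg) := rfl

theorem cls_add {A B : Cx} {f g : A.X ⟶ B.X} (hf : f ∈ cycles A B) (hg : g ∈ cycles A B) :
    cls f hf + cls g hg = cls (f + g) (Submodule.add_mem _ hf hg) := rfl

theorem cls_neg {A B : Cx} {f : A.X ⟶ B.X} (hf : f ∈ cycles A B) :
    -cls f hf = cls (-f) (Submodule.neg_mem _ hf) := rfl

theorem cls_smul {A B : Cx} {f : A.X ⟶ B.X} (c : ℂ) (hf : f ∈ cycles A B) :
    c • cls f hf = cls (c • f) (Submodule.smul_mem _ c hf) := rfl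

theorem cls_zero {A B : Cx} : cls (0 : A.X ⟶ B.X) (Submodule.zero_mem _) = (0 : A ⟶ B) := rfl

theorem cls_eq_cls {A B : Cx} {f g : A.X ⟶ B.X} (hf : f ∈ cycles A B) (hg : g ∈ cycles A B) :
    cls f hf = cls g hg ↔ ∃ k ∈ maps A B, delta A B k = f - g := by
  rw [← sub_eq_zero, cls_sub, cls_eq_zero]

theorem cls_comp {A B C : Cx} {f : A.X ⟶ B.X} {g : B.X ⟶ C.X} (hf : f ∈ cycles A B)
    (hg : g ∈ cycles B C) : cls f hf ≫ cls g hg = cls (f ≫ g) (comp_mem_cycles hf hg) := rfl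

theorem id_eq_cls (A : Cx) : 𝟙 A = cls A.e (e_mem_cycles A) := rfl

theorem cls_congr {A B : Cx} {f g : A.X ⟶ B.X} {hf : f ∈ cycles A B} {hg : g ∈ cycles A B}
    (h : f = g) : cls f hf = cls g hg := by subst h; rfl

theorem cls_sum {A B : Cx} {κ : Type*} (s : Finset κ) (f : κ → (A.X ⟶ B.X))
    (hf : ∀ i, f i ∈ cycles A B) :
    cls (∑ i ∈ s, f i) (Submodule.sum_mem _ fun i _ => hf i) = ∑ i ∈ s, cls (f i) (hf i) := by
  have h := map_sum (toHHom A B) (fun i => (⟨f i, hf i⟩ : cycles A B)) s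
  refine Eq.trans ?_ h
  have : (∑ i ∈ s, (⟨f i, hf i⟩ : cycles A B)) =
      ⟨∑ i ∈ s, f i, Submodule.sum_mem _ fun i _ => hf i⟩ := by
    ext1; simp
  rw [this]; rfl

/-- The Hom complexes form a differential graded category. -/
theorem delta_comp_eq {A B C : Cx} (f : A.X ⟶ B.X) (g : B.X ⟶ C.X) :
    delta A C (f ≫ g) = f ≫ delta B C g + delta A B f ≫ B.sgn ≫ g ≫ C.sgn := by
  simp only [delta_apply, Preadditive.comp_sub, Preadditive.sub_comp, Category.assoc,
    sgn_sgn_assoc]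
  abel

theorem delta_delta {A B : Cx} (f : A.X ⟶ B.X) : delta A B (delta A B f) = 0 := by
  simp only [delta_apply, Preadditive.comp_sub, Preadditive.sub_comp, Category.assoc,
    d_d, Limits.comp_zero, d_sgn, Preadditive.comp_neg, d_sgn_assoc]
  simp

theorem delta_mem_maps {A B : Cx} {f : A.X ⟶ B.X} (hf : f ∈ maps A B) :
    delta A B f ∈ maps A B := by
  refine Submodule.sub_mem _ ⟨?_, ?_⟩ ⟨?_, ?_⟩
  · rw [← Category.assoc, hf.1]
  · simp
  · simp
  · simp only [Category.assoc, ← e_sgn]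
    rw [← Category.assoc f, hf.2]

theorem rightMap_mem_cycles {A B : Cx} {f : A.X ⟶ B.X} (C : Cx) (hf : f ∈ cycles A B) :
    rightMap f C ∈ cycles (tens A C) (tens B C) := by
  refine ⟨rightMap_mem_maps C hf.1, ?_⟩
  have h : delta A B f = 0 := hf.2
  change delta _ _ _ = 0
  rw [rightMap_delta f C hf.1, h]
  exact matTens_zero_left _

theorem leftMap_zero (C : Cx) {A B : Cx} : leftMap C (0 : A.X ⟶ B.X) = 0 := by
  have := leftMap_smul C (0 : ℂ) (0 : A.X ⟶ B.X)
  simpa using this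

theorem leftMap_mem_cycles {A B : Cx} {f : A.X ⟶ B.X} (C : Cx) (hf : f ∈ cycles A B) :
    leftMap C f ∈ cycles (tens C A) (tens C B) := by
  refine ⟨leftMap_mem_maps C hf.1, ?_⟩
  have h : delta A B f = 0 := hf.2
  change delta _ _ _ = 0
  rw [leftMap_delta C f hf.1, h, leftMap_zero]

theorem whiskerRight_cls {A B : Cx} {f : A.X ⟶ B.X} (hf : f ∈ cycles A B) (C : Cx) :
    whiskerRight (cls f hf) C = cls (rightMap f C) (rightMap_mem_cycles C hf) := rfl

theorem whiskerLeft_cls {A B : Cx} {f : A.X ⟶ B.X} (hf : f ∈ cycles A B) (C : Cx) :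
    whiskerLeft C (cls f hf) = cls (leftMap C f) (leftMap_mem_cycles C hf) := rfl

theorem rightMap_comp {A B B' : Cx} (f : A.X ⟶ B.X) (g : B.X ⟶ B'.X) (C : Cx) :
    rightMap f C ≫ rightMap g C = rightMap (A := A) (B := B') (f ≫ g) C := by
  rw [rightMap, rightMap, matTens_comp, e_e]; rfl

theorem whiskerRight_comp {A B B' : Cx} (f : A ⟶ B) (g : B ⟶ B') (C : Cx) :
    whiskerRight (f ≫ g) C = whiskerRight f C ≫ whiskerRight g C := by
  obtain ⟨f, hf, rfl⟩ := exists_cls f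
  obtain ⟨g, hg, rfl⟩ := exists_cls g
  rw [cls_comp, whiskerRight_cls, whiskerRight_cls, whiskerRight_cls, cls_comp]
  exact cls_congr (rightMap_comp f g C).symm

theorem leftMap_of_even (C : Cx) {A B : Cx} {g : A.X ⟶ B.X} (h : g ≫ B.sgn = A.sgn ≫ g) :
    leftMap C g = matTens C.e g := by
  have h0 : even g = g := by
    rw [even, h, sgn_sgn_assoc, ← two_smul ℂ g, smul_smul]; norm_num
  have h1 : odd g = 0 := by
    rw [odd, h, sgn_sgn_assoc, sub_self, smul_zero]
  rw [leftMap, h0, h1, matTens_zero_right, add_zero]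

theorem leftMap_of_odd (C : Cx) {A B : Cx} {g : A.X ⟶ B.X} (h : g ≫ B.sgn = -(A.sgn ≫ g)) :
    leftMap C g = matTens (C.sgn ≫ C.e) g := by
  have h0 : even g = 0 := by
    rw [even, h, Preadditive.comp_neg, sgn_sgn_assoc, add_neg_cancel, smul_zero]
  have h1 : odd g = g := by
    rw [odd, h, Preadditive.comp_neg, sgn_sgn_assoc, sub_neg_eq_add, ← two_smul ℂ g, smul_smul]
    norm_num
  rw [leftMap, h0, h1, matTens_zero_right, zero_add]

theorem whiskerLeft_id (A C : Cx) : whiskerLeft C (𝟙 A) = 𝟙 (tens C A) :=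
  cls_congr (leftMap_of_even C (e_sgn A))

theorem even_comp {A B C : GObj} (f : A.X ⟶ B.X) (g : B.X ⟶ C.X) :
    even (A := A) (B := C) (f ≫ g) = even f ≫ even g + odd f ≫ odd g := by
  simp only [even, odd, Linear.smul_comp, Linear.comp_smul, Preadditive.add_comp,
    Preadditive.comp_add, Preadditive.sub_comp, Preadditive.comp_sub, Category.assoc,
    sgn_sgn_assoc]
  module

theorem odd_comp {A B C : GObj} (f : A.X ⟶ B.X) (g : B.X ⟶ C.X) :
    odd (A := A) (B := C) (f ≫ g) = even f ≫ odd g + odd f ≫ even g := by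
  simp only [even, odd, Linear.smul_comp, Linear.comp_smul, Preadditive.add_comp,
    Preadditive.comp_add, Preadditive.sub_comp, Preadditive.comp_sub, Category.assoc,
    sgn_sgn_assoc]
  module

theorem leftMap_comp {A B B' : Cx} (f : A.X ⟶ B.X) (g : B.X ⟶ B'.X) (C : Cx) :
    leftMap C f ≫ leftMap C g = leftMap (A := A) (B := B') C (f ≫ g) := by
  simp only [leftMap, even_comp, odd_comp, Preadditive.add_comp, Preadditive.comp_add,
    matTens_comp, matTens_add_right, Category.assoc, e_sgn_assoc, sgn_sgn_assoc, e_e]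
  abel

theorem whiskerLeft_comp {A B B' : Cx} (f : A ⟶ B) (g : B ⟶ B') (C : Cx) :
    whiskerLeft C (f ≫ g) = whiskerLeft C f ≫ whiskerLeft C g := by
  obtain ⟨f, hf, rfl⟩ := exists_cls f
  obtain ⟨g, hg, rfl⟩ := exists_cls g
  rw [cls_comp, whiskerLeft_cls, whiskerLeft_cls, whiskerLeft_cls, cls_comp]
  exact cls_congr (leftMap_comp f g C).symm

theorem whiskerRight_sub {A B : Cx} (f g : A ⟶ B) (C : Cx) :
    whiskerRight (f - g) C = whiskerRight f C - whiskerRight g C :=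
  map_sub (induced _ _ _) f g

section structural
variable {M M' M'' N N' N'' K K' K'' : Mat_ PObj}

theorem comp_finCongr_cancel {a m n c : ℕ} (e : m = n) (x : DotPerm a m) (y : DotPerm m c) :
    DotPerm.comp (DotPerm.comp x (DotPerm.single (finCongr e) 1))
      (DotPerm.comp (DotPerm.single (finCongr e.symm) 1) y) = DotPerm.comp x y := by
  subst e
  have h : DotPerm.comp (DotPerm.single (finCongr (rfl : m = m)) 1)
      (DotPerm.single (finCongr rfl) 1) = DotPerm.one m := by
    rw [DotPerm.comp_single, DotPerm.one]; simp
  rw [DotPerm.comp_assoc, ← DotPerm.comp_assoc (DotPerm.single _ 1), h, DotPerm.one_comp]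

theorem comp_finAddFlip_cancel {a m n c : ℕ} (x : DotPerm a (m + n)) (y : DotPerm (m + n) c) :
    DotPerm.comp (DotPerm.comp x (DotPerm.single finAddFlip 1))
      (DotPerm.comp (DotPerm.single finAddFlip 1) y) = DotPerm.comp x y := by
  have h : DotPerm.comp (DotPerm.single (finAddFlip (m := m) (n := n)) 1)
      (DotPerm.single (finAddFlip (m := n) (n := m)) 1) = DotPerm.one (m + n) := by
    rw [DotPerm.comp_single, DotPerm.one]
    have h : (finAddFlip (m := m) (n := n)).trans finAddFlip = Equiv.refl _ := by
      ext i; induction i using Fin.addCases <;> simp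
    rw [h]; simp
  rw [DotPerm.comp_assoc, ← DotPerm.comp_assoc (DotPerm.single _ 1), h, DotPerm.one_comp]

theorem matAssoc_matAssocInv (f : M ⟶ M') (g : N ⟶ N') (h : K ⟶ K')
    (f' : M' ⟶ M'') (g' : N' ⟶ N'') (h' : K' ⟶ K'') :
    matAssoc f g h ≫ matAssocInv f' g' h' = matTens (matTens (f ≫ f') (g ≫ g')) (h ≫ h') := by
  rw [← matTens_comp, ← matTens_comp]
  ext ⟨⟨i, j⟩, k⟩ ⟨⟨i', j'⟩, k'⟩
  refine (Fintype.sum_equiv (Equiv.prodAssoc _ _ _) _ _ fun p => ?_).symm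
  refine Eq.trans ?_ (congrArg (DotPerm.comp _) (DotPerm.tens_assoc_inv _ _ _).symm)
  exact (comp_finCongr_cancel _ _ _).symm

theorem matAssocInv_matAssoc (f : M ⟶ M') (g : N ⟶ N') (h : K ⟶ K')
    (f' : M' ⟶ M'') (g' : N' ⟶ N'') (h' : K' ⟶ K'') :
    matAssocInv f g h ≫ matAssoc f' g' h' = matTens (f ≫ f') (matTens (g ≫ g') (h ≫ h')) := by
  rw [← matTens_comp, ← matTens_comp]
  ext ⟨i, j, k⟩ ⟨i', j', k'⟩
  refine Fintype.sum_equiv (Equiv.prodAssoc _ _ _) _ _ fun p => ?_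
  refine (congrArg (DotPerm.comp _) (DotPerm.tens_assoc _ _ _)).trans ?_
  exact comp_finCongr_cancel _ _ _

theorem matSwap_matSwap (f : M ⟶ M') (g : N ⟶ N') (f' : M' ⟶ M'') (g' : N' ⟶ N'') :
    matSwap f g ≫ matSwap g' f' = matTens (f ≫ f') (g ≫ g') := by
  rw [← matTens_comp]
  ext ⟨i, j⟩ ⟨i', j'⟩
  refine Fintype.sum_equiv (Equiv.prodComm _ _) _ _ fun p => ?_
  refine (congrArg (DotPerm.comp _) (DotPerm.tens_swap _ _)).trans ?_
  exact comp_finAddFlip_cancel _ _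

end structural

/-- The associator is an isomorphism of complexes. -/
def assocIso (A B C : Cx) : tens (tens A B) C ≅ tens A (tens B C) where
  hom := assocHom A B C
  inv := assocInv A B C
  hom_inv_id := by
    refine (cls_comp _ _).trans (cls_congr ?_)
    rw [matAssoc_matAssocInv, e_e, e_e, e_e]
  inv_hom_id := by
    refine (cls_comp _ _).trans (cls_congr ?_)
    rw [matAssocInv_matAssoc, e_e, e_e, e_e]

/-- The symmetry is an isomorphism of complexes. -/
def braidIso (A B : Cx) : tens A B ≅ tens B A where
  hom := braiding A B
  inv := braiding B A
  hom_inv_id := by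
    refine (cls_comp _ _).trans (cls_congr ?_)
    rw [braidMat_eq, braidMat_eq]
    simp only [Linear.smul_comp, Linear.comp_smul, Preadditive.add_comp, Preadditive.comp_add,
      Preadditive.sub_comp, Preadditive.comp_sub, matSwap_matSwap, Category.assoc, e_sgn_assoc,
      sgn_sgn_assoc, e_e]
    module
  inv_hom_id := by
    refine (cls_comp _ _).trans (cls_congr ?_)
    rw [braidMat_eq, braidMat_eq]
    simp only [Linear.smul_comp, Linear.comp_smul, Preadditive.add_comp, Preadditive.comp_add,
      Preadditive.sub_comp, Preadditive.comp_sub, matSwap_matSwap, Category.assoc, e_sgn_assoc,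
      sgn_sgn_assoc, e_e]
    module

end Cx

/-! ### Decomposition of maps by permutations of the strands -/

namespace DotPerm

theorem single_coeff_comp_single {a b c : ℕ} (τ : Fin a ≃ Fin b) (r : MvPolynomial (Fin b) ℂ)
    (ρ : Fin b ≃ Fin c) (h : DotPerm b c) :
    single (τ.trans ρ) (coeff (τ.trans ρ) (comp (single τ r) h)) =
      comp (single τ r) (single ρ (coeff ρ h)) := by
  induction h using ind with
  | h0 => simp
  | hadd f g h1 h2 => simp [h1, h2]
  | hs ρ' s =>
    rw [comp_single]
    by_cases h : ρ = ρ'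
    · subst h; rw [coeff_single_self, coeff_single_self, comp_single]
    · have h' : τ.trans ρ ≠ τ.trans ρ' := fun h0 => h (by
        ext i; simpa using congrArg (fun e => ((e (τ.symm i) : Fin c) : ℕ)) h0)
      rw [coeff_single_ne h, coeff_single_ne h']; simp

theorem single_coeff_comp_single_right {a b c : ℕ} (τ : Fin b ≃ Fin c)
    (r : MvPolynomial (Fin c) ℂ) (ρ : Fin a ≃ Fin b) (h : DotPerm a b) :
    single (ρ.trans τ) (coeff (ρ.trans τ) (comp h (single τ r))) =
      comp (single ρ (coeff ρ h)) (single τ r) := by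
  induction h using ind with
  | h0 => simp
  | hadd f g h1 h2 => simp [h1, h2]
  | hs ρ' s =>
    rw [comp_single]
    by_cases h : ρ = ρ'
    · subst h; rw [coeff_single_self, coeff_single_self, comp_single]
    · have h' : ρ.trans τ ≠ ρ'.trans τ := fun h0 => h (by
        ext i; exact congrArg (fun e => (e i : ℕ)) (Equiv.ext fun j => by
          simpa using congrArg (fun e => e j) h0 : ρ = ρ'))
      rw [coeff_single_ne h, coeff_single_ne h']; simp

/-- The part of a morphism that consists of multiples of `σ`. -/
def permEntry {m n : ℕ} (σ : Fin m ≃ Fin n) : DotPerm m n →ₗ[ℂ] DotPerm m n :=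
  (single σ).comp (coeff σ)

theorem permEntry_apply {m n : ℕ} (σ : Fin m ≃ Fin n) (f : DotPerm m n) :
    permEntry σ f = single σ (coeff σ f) := rfl

theorem units_smul_single {m n : ℕ} (u : ℤˣ) (σ : Fin m ≃ Fin n) (p : MvPolynomial (Fin n) ℂ) :
    u • single σ p = single σ (u • p) := by
  rcases Int.units_eq_one_or u with rfl | rfl <;> simp

end DotPerm

/-- A labelling of the strands of all summands of `M` by a common set `T`. -/
abbrev Labels (M : Mat_ PObj) (T : Type) : Type := ∀ p : M.ι, T ≃ Fin (M.X p).strands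

section labels
variable {M M' M'' N N' : Mat_ PObj} {T T' T'' V V' : Type}

/-- The bijection of strands between two summands that realizes a bijection of labels. -/
abbrev strandEquiv (l : Labels M T) (l' : Labels M' T') (σ : T ≃ T') (p : M.ι) (q : M'.ι) :
    Fin (M.X p).strands ≃ Fin (M'.X q).strands := (l p).symm.trans (σ.trans (l' q))

/-- All entries of `f` are multiples of the bijection `σ`. -/
def Along (l : Labels M T) (l' : Labels M' T') (σ : T ≃ T') (f : M ⟶ M') : Prop :=
  ∀ p q, ∃ r, f p q = DotPerm.single (strandEquiv l l' σ p q) r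

/-- The part of a map that consists of multiples of the bijection `σ`. -/
def permPart (l : Labels M T) (l' : Labels M' T') (σ : T ≃ T') : (M ⟶ M') →ₗ[ℂ] (M ⟶ M') where
  toFun f p q := DotPerm.permEntry (strandEquiv l l' σ p q) (f p q)
  map_add' f g := by
    ext p q
    exact (DotPerm.permEntry _).map_add _ _
  map_smul' c f := by
    ext p q
    exact (DotPerm.permEntry _).map_smul _ _

theorem permPart_along (l : Labels M T) (l' : Labels M' T') (σ : T ≃ T') (f : M ⟶ M') :
    Along l l' σ (permPart l l' σ f) := fun _ _ => ⟨_, rfl⟩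

theorem strandEquiv_trans (l : Labels M T) (l' : Labels M' T') (l'' : Labels M'' T'') (σ : T ≃ T')
    (τ : T' ≃ T'') (p : M.ι) (q : M'.ι) (r : M''.ι) :
    (strandEquiv l l' σ p q).trans (strandEquiv l' l'' τ q r) =
      strandEquiv l l'' (σ.trans τ) p r := by
  ext i; simp [strandEquiv]

theorem Along.comp {l : Labels M T} {l' : Labels M' T'} {l'' : Labels M'' T''} {σ : T ≃ T'}
    {τ : T' ≃ T''} {f : M ⟶ M'} {g : M' ⟶ M''} (hf : Along l l' σ f) (hg : Along l' l'' τ g) :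
    Along l l'' (σ.trans τ) (f ≫ g) := by
  intro p r
  choose a ha using hf
  choose b hb using hg
  refine ⟨∑ q, MvPolynomial.rename (strandEquiv l' l'' τ q r) (a p q) * b q r, ?_⟩
  change ∑ q, DotPerm.comp (f p q) (g q r) = _
  rw [map_sum]
  refine Finset.sum_congr rfl fun q _ => ?_
  rw [ha, hb, DotPerm.comp_single, strandEquiv_trans]

theorem Along.add {l : Labels M T} {l' : Labels M' T'} {σ : T ≃ T'} {f g : M ⟶ M'}
    (hf : Along l l' σ f) (hg : Along l l' σ g) : Along l l' σ (f + g) := by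
  intro p q
  obtain ⟨a, ha⟩ := hf p q
  obtain ⟨b, hb⟩ := hg p q
  exact ⟨a + b, by rw [map_add, ← ha, ← hb]; rfl⟩

theorem Along.smul {l : Labels M T} {l' : Labels M' T'} {σ : T ≃ T'} {f : M ⟶ M'} (c : ℂ)
    (hf : Along l l' σ f) : Along l l' σ (c • f) := by
  intro p q
  obtain ⟨a, ha⟩ := hf p q
  exact ⟨c • a, by rw [map_smul, ← ha]; rfl⟩

theorem Along.neg {l : Labels M T} {l' : Labels M' T'} {σ : T ≃ T'} {f : M ⟶ M'}
    (hf : Along l l' σ f) : Along l l' σ (-f) := by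
  rw [← neg_one_smul ℂ]; exact hf.smul _

theorem Along.sub {l : Labels M T} {l' : Labels M' T'} {σ : T ≃ T'} {f g : M ⟶ M'}
    (hf : Along l l' σ f) (hg : Along l l' σ g) : Along l l' σ (f - g) := by
  rw [sub_eq_add_neg]; exact hf.add hg.neg

theorem along_id (l : Labels M T) : Along l l (Equiv.refl T) (𝟙 M) := by
  intro p q
  by_cases h : p = q
  · subst h
    refine ⟨1, ?_⟩
    rw [Mat_.id_apply_self]
    have : strandEquiv l l (Equiv.refl T) p p = Equiv.refl _ := by ext i; simp
    rw [this]; rfl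
  · exact ⟨0, by rw [Mat_.id_apply_of_ne _ _ _ h, map_zero]⟩

theorem along_sgn {A : GObj} (l : Labels A.X T) : Along l l (Equiv.refl T) A.sgn := by
  intro p q
  obtain ⟨r, hr⟩ := along_id l p q
  exact ⟨(A.hdeg p).negOnePow • r, by rw [← DotPerm.units_smul_single, ← hr]; rfl⟩

theorem comp_permPart {l : Labels M T} {l' : Labels M' T'} {l'' : Labels M'' T''} {σ : T ≃ T'}
    {g : M ⟶ M'} (hg : Along l l' σ g) (τ : T' ≃ T'') (f : M' ⟶ M'') :
    permPart l l'' (σ.trans τ) (g ≫ f) = g ≫ permPart l' l'' τ f := by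
  ext p r
  change DotPerm.permEntry _ (∑ q, DotPerm.comp (g p q) (f q r)) =
    ∑ q, DotPerm.comp (g p q) (DotPerm.permEntry _ (f q r))
  rw [map_sum]
  refine Finset.sum_congr rfl fun q _ => ?_
  obtain ⟨a, ha⟩ := hg p q
  rw [ha, DotPerm.permEntry_apply, DotPerm.permEntry_apply, ← DotPerm.single_coeff_comp_single,
    strandEquiv_trans]

theorem permPart_comp {l : Labels M T} {l' : Labels M' T'} {l'' : Labels M'' T''} {τ : T' ≃ T''}
    {g : M' ⟶ M''} (hg : Along l' l'' τ g) (σ : T ≃ T') (f : M ⟶ M') :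
    permPart l l'' (σ.trans τ) (f ≫ g) = permPart l l' σ f ≫ g := by
  ext p r
  change DotPerm.permEntry _ (∑ q, DotPerm.comp (f p q) (g q r)) =
    ∑ q, DotPerm.comp (DotPerm.permEntry _ (f p q)) (g q r)
  rw [map_sum]
  refine Finset.sum_congr rfl fun q _ => ?_
  obtain ⟨a, ha⟩ := hg q r
  rw [ha, DotPerm.permEntry_apply, DotPerm.permEntry_apply,
    ← DotPerm.single_coeff_comp_single_right, strandEquiv_trans]

theorem mat_sum_apply {κ : Type*} (s : Finset κ) (f : κ → (M ⟶ M')) (p : M.ι) (q : M'.ι) :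
    (∑ i ∈ s, f i) p q = ∑ i ∈ s, f i p q :=
  map_sum ({ toFun := fun f => f p q, map_zero' := rfl, map_add' := fun _ _ => rfl } :
    (M ⟶ M') →+ (M.X p ⟶ M'.X q)) f s

theorem sum_permPart [Fintype T] [Fintype T'] [DecidableEq T] [DecidableEq T'] (l : Labels M T)
    (l' : Labels M' T') (f : M ⟶ M') : ∑ σ, permPart l l' σ f = f := by
  ext p q
  let E : (T ≃ T') ≃ (Fin (M.X p).strands ≃ Fin (M'.X q).strands) :=
    Equiv.equivCongr (l p) (l' q)
  refine (mat_sum_apply _ _ p q).trans ?_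
  refine Eq.trans ?_ (DotPerm.eq_sum_single (f p q)).symm
  exact Fintype.sum_equiv E _ _ fun σ => rfl

/-- Multiplication by the dot on the strand with label `i`. -/
def labelDot (l : Labels M T) (i : T) : M ⟶ M :=
  fun p q => DotPerm.comp ((𝟙 M : M ⟶ M) p q)
    (DotPerm.single (Equiv.refl _) (MvPolynomial.X (l q i)))

theorem comp_labelDot_apply (l' : Labels M' T') (f : M ⟶ M') (i : T') (p : M.ι) (q : M'.ι) :
    (f ≫ labelDot l' i) p q =
      DotPerm.comp (f p q) (DotPerm.single (Equiv.refl _) (MvPolynomial.X (l' q i))) := by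
  have h : f p q = ∑ j, DotPerm.comp (f p j) ((𝟙 M' : M' ⟶ M') j q) :=
    congrFun (congrFun (Category.comp_id f).symm p) q
  rw [h, LinearMap.map_sum₂]
  exact Finset.sum_congr rfl fun j _ => (DotPerm.comp_assoc _ _ _).symm

theorem labelDot_comp_apply (l : Labels M T) (f : M ⟶ M') (i : T) (p : M.ι) (q : M'.ι) :
    (labelDot l i ≫ f) p q =
      DotPerm.comp (DotPerm.single (Equiv.refl _) (MvPolynomial.X (l p i))) (f p q) := by
  let f' : M ⟶ M' := fun j q =>
    DotPerm.comp (DotPerm.single (Equiv.refl _) (MvPolynomial.X (l j i))) (f j q)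
  have h : f' p q = ∑ j, DotPerm.comp ((𝟙 M : M ⟶ M) p j) (f' j q) :=
    congrFun (congrFun (Category.id_comp f').symm p) q
  refine Eq.trans ?_ h.symm
  exact Finset.sum_congr rfl fun j _ => DotPerm.comp_assoc _ _ _

/-- Dots slide along the strands. -/
theorem Along.labelDot_comp {l : Labels M T} {l' : Labels M' T'} {σ : T ≃ T'} {f : M ⟶ M'}
    (hf : Along l l' σ f) (i : T) : labelDot l i ≫ f = f ≫ labelDot l' (σ i) := by
  ext p q
  rw [comp_labelDot_apply, labelDot_comp_apply]
  obtain ⟨r, hr⟩ := hf p q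
  rw [hr, DotPerm.comp_single, DotPerm.comp_single, Equiv.refl_trans, Equiv.trans_refl,
    MvPolynomial.rename_X]
  simp [mul_comm]

/-- The labelling of a tensor product. -/
def tensLabels (l : Labels M T) (k : Labels N V) : Labels (matTensObj M N) (T ⊕ V) :=
  fun p => (Equiv.sumCongr (l p.1) (k p.2)).trans finSumFinEquiv

theorem strandEquiv_tens (l : Labels M T) (l' : Labels M' T') (k : Labels N V) (k' : Labels N' V')
    (σ : T ≃ T') (τ : V ≃ V') (p : M.ι × N.ι) (q : M'.ι × N'.ι) :
    strandEquiv (tensLabels l k) (tensLabels l' k') (Equiv.sumCongr σ τ) p q =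
      DotPerm.sumPerm (strandEquiv l l' σ p.1 q.1) (strandEquiv k k' τ p.2 q.2) := by
  refine Equiv.ext fun i => ?_
  obtain ⟨i, rfl⟩ := finSumFinEquiv.surjective i
  rcases i with i | i <;> simp [strandEquiv, tensLabels, DotPerm.sumPerm]

theorem Along.tens {l : Labels M T} {l' : Labels M' T'} {k : Labels N V} {k' : Labels N' V'}
    {σ : T ≃ T'} {τ : V ≃ V'} {f : M ⟶ M'} {g : N ⟶ N'} (hf : Along l l' σ f)
    (hg : Along k k' τ g) :
    Along (tensLabels l k) (tensLabels l' k') (Equiv.sumCongr σ τ) (matTens f g) := by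
  intro p q
  obtain ⟨a, ha⟩ := hf p.1 q.1
  obtain ⟨b, hb⟩ := hg p.2 q.2
  refine ⟨MvPolynomial.rename (Fin.castAdd _) a * MvPolynomial.rename (Fin.natAdd _) b, ?_⟩
  change DotPerm.tens (f p.1 q.1) (g p.2 q.2) = _
  rw [ha, hb, DotPerm.tens_single, strandEquiv_tens]

theorem matTens_labelDot_left (l : Labels M T) (k : Labels N V) (i : T) :
    matTens (labelDot l i) (𝟙 N) = labelDot (tensLabels l k) (Sum.inl i) := by
  ext p q
  change DotPerm.tens (DotPerm.comp ((𝟙 M : M ⟶ M) p.1 q.1) _) ((𝟙 N : N ⟶ N) p.2 q.2) =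
    DotPerm.comp ((𝟙 (matTensObj M N) : _ ⟶ _) p q) _
  rw [← matTens_id, ← DotPerm.comp_one ((𝟙 N : N ⟶ N) p.2 q.2), DotPerm.tens_comp]
  refine congrArg (DotPerm.comp _) ?_
  rw [DotPerm.one, DotPerm.tens_single]
  have h : DotPerm.sumPerm (Equiv.refl (Fin (M.X q.1).strands))
      (Equiv.refl (Fin (N.X q.2).strands)) = Equiv.refl _ := by
    ext i; simp [DotPerm.sumPerm]
  rw [h]
  simp [tensLabels]

theorem matTens_labelDot_right (l : Labels M T) (k : Labels N V) (i : V) :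
    matTens (𝟙 M) (labelDot k i) = labelDot (tensLabels l k) (Sum.inr i) := by
  ext p q
  change DotPerm.tens ((𝟙 M : M ⟶ M) p.1 q.1) (DotPerm.comp ((𝟙 N : N ⟶ N) p.2 q.2) _) =
    DotPerm.comp ((𝟙 (matTensObj M N) : _ ⟶ _) p q) _
  rw [← matTens_id, ← DotPerm.comp_one ((𝟙 M : M ⟶ M) p.1 q.1), DotPerm.tens_comp]
  refine congrArg (DotPerm.comp _) ?_
  rw [DotPerm.one, DotPerm.tens_single]
  have h : DotPerm.sumPerm (Equiv.refl (Fin (M.X q.1).strands))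
      (Equiv.refl (Fin (N.X q.2).strands)) = Equiv.refl _ := by
    ext i; simp [DotPerm.sumPerm]
  rw [h]
  simp [tensLabels]

end labels

/-! ### Contraction and exterior multiplication on an exterior algebra -/

section clifford
variable {r : ℕ} {R : Type} [CommRing R]

/-- The sign of `e_i` in the contraction of `e_S`. -/
def koszulSign (R : Type) [CommRing R] (i : Fin r) (S : Finset (Fin r)) : R :=
  (-1) ^ (S.filter (· < i)).card

theorem koszulSign_mul_self (i : Fin r) (S : Finset (Fin r)) :
    koszulSign R i S * koszulSign R i S = 1 := by
  rw [koszulSign, ← mul_pow]; simp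

theorem koszulSign_erase_of_lt {i j : Fin r} {S : Finset (Fin r)} (hi : i ∈ S) (h : i < j) :
    koszulSign R j (S.erase i) = -koszulSign R j S := by
  have h2 : (S.erase i).filter (· < j) = (S.filter (· < j)).erase i := by
    ext k; simp only [Finset.mem_filter, Finset.mem_erase]; tauto
  have h3 : i ∈ S.filter (· < j) := by simp [hi, h]
  rw [koszulSign, koszulSign, h2, ← Finset.card_erase_add_one h3]
  ring

theorem koszulSign_erase_of_le {i j : Fin r} (S : Finset (Fin r)) (h : j ≤ i) :
    koszulSign R j (S.erase i) = koszulSign R j S := by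
  have h2 : (S.erase i).filter (· < j) = S.filter (· < j) := by
    ext k; simp only [Finset.mem_filter, Finset.mem_erase]
    constructor
    · rintro ⟨⟨_, h⟩, h'⟩; exact ⟨h, h'⟩
    · rintro ⟨h1, h2⟩; exact ⟨⟨(h2.trans_le h).ne, h1⟩, h2⟩
  rw [koszulSign, koszulSign, h2]

theorem koszulSign_insert_of_lt {i j : Fin r} {S : Finset (Fin r)} (hi : i ∉ S) (h : i < j) :
    koszulSign R j (insert i S) = -koszulSign R j S := by
  have := koszulSign_erase_of_lt (R := R) (Finset.mem_insert_self i S) h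
  rw [Finset.erase_insert hi] at this
  rw [this, neg_neg]

theorem koszulSign_insert_of_le {i j : Fin r} (S : Finset (Fin r)) (h : j ≤ i) :
    koszulSign R j (insert i S) = koszulSign R j S := by
  rw [← koszulSign_erase_of_le (insert i S) h, Finset.erase_insert_eq_erase,
    koszulSign_erase_of_le S h]

theorem contraction_mulVec (c : Fin r → R) (v : Finset (Fin r) → R) (S : Finset (Fin r)) :
    (contraction c).mulVec v S =
      ∑ i, if i ∈ S then koszulSign R i S * c i * v (S.erase i) else 0 := by
  simp only [Matrix.mulVec, dotProduct, contraction, Finset.sum_mul]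
  rw [Finset.sum_comm]
  refine Finset.sum_congr rfl fun i _ => ?_
  rw [Finset.sum_eq_single (S.erase i)]
  · simp [koszulSign]
  · intro T _ hT
    rw [if_neg (fun h => hT h.2), zero_mul]
  · simp

/-- Exterior multiplication by `∑ b_i e_i`, the transpose of a contraction. -/
def creation (b : Fin r → R) : Matrix (Finset (Fin r)) (Finset (Fin r)) R :=
  (contraction b).transpose

theorem creation_mulVec (b : Fin r → R) (v : Finset (Fin r) → R) (S : Finset (Fin r)) :
    (creation b).mulVec v S =
      ∑ i, if i ∈ S then 0 else koszulSign R i S * b i * v (insert i S) := by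
  simp only [Matrix.mulVec, dotProduct, contraction, creation, Matrix.transpose_apply,
    Finset.sum_mul]
  rw [Finset.sum_comm]
  refine Finset.sum_congr rfl fun i _ => ?_
  rw [Finset.sum_eq_single (insert i S)]
  · by_cases h : i ∈ S
    · have : S ≠ S.erase i := fun h' => by
        rw [h'] at h; simp at h
      simp [h, this]
    · rw [if_pos ⟨Finset.mem_insert_self _ _, (Finset.erase_insert h).symm⟩, if_neg h,
        ← koszulSign, koszulSign_insert_of_le S le_rfl]
  · intro T _ hT
    rw [if_neg, zero_mul]
    rintro ⟨h1, h2⟩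
    exact hT (by rw [h2, Finset.insert_erase h1])
  · simp

theorem contraction_add (b c : Fin r → R) :
    contraction (b + c) = contraction b + contraction c := by
  ext S T
  simp only [contraction, Matrix.add_apply, ← Finset.sum_add_distrib]
  refine Finset.sum_congr rfl fun i _ => ?_
  split_ifs <;> simp [mul_add]

theorem contraction_smul (a : R) (c : Fin r → R) : contraction (a • c) = a • contraction c := by
  ext S T
  simp only [contraction, Matrix.smul_apply, smul_eq_mul, Finset.mul_sum]
  refine Finset.sum_congr rfl fun i _ => ?_
  split_ifs
  · simp only [Pi.smul_apply, smul_eq_mul]; ring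
  · simp

/-- Contraction as a linear map. -/
def contractionHom : (Fin r → R) →ₗ[R] Matrix (Finset (Fin r)) (Finset (Fin r)) R where
  toFun := contraction
  map_add' := contraction_add
  map_smul' := contraction_smul

theorem contraction_eq_sum (c : Fin r → R) :
    contraction c = ∑ i, c i • contraction (Pi.single i 1) := by
  have h : c = ∑ i, c i • (Pi.single i 1 : Fin r → R) := by
    ext j; simp [Finset.sum_apply, Pi.single_apply]
  conv_lhs => rw [h]
  exact (map_sum contractionHom _ _).trans
    (Finset.sum_congr rfl fun i _ => contractionHom.map_smul _ _)

theorem creation_eq_sum (c : Fin r → R) :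
    creation c = ∑ i, c i • creation (Pi.single i 1) := by
  rw [creation, contraction_eq_sum, Matrix.transpose_sum]
  rfl

theorem contraction_single_mulVec (i : Fin r) (v : Finset (Fin r) → R) (S : Finset (Fin r)) :
    (contraction (Pi.single i 1)).mulVec v S =
      if i ∈ S then koszulSign R i S * v (S.erase i) else 0 := by
  rw [contraction_mulVec, Finset.sum_eq_single i]
  · simp
  · intro j _ hj; simp [Pi.single_eq_of_ne hj]
  · simp

theorem creation_single_mulVec (i : Fin r) (v : Finset (Fin r) → R) (S : Finset (Fin r)) :
    (creation (Pi.single i 1)).mulVec v S =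
      if i ∈ S then 0 else koszulSign R i S * v (insert i S) := by
  rw [creation_mulVec, Finset.sum_eq_single i]
  · simp
  · intro j _ hj; simp [Pi.single_eq_of_ne hj]
  · simp

theorem matrix_ext_mulVec {κ : Type} [Fintype κ] {P Q : Matrix κ κ R}
    (h : ∀ v, P.mulVec v = Q.mulVec v) : P = Q := by
  classical
  ext i j
  have := congrFun (h (Pi.single j 1)) i
  simpa using this

theorem contraction_creation_single (i j : Fin r) :
    contraction (R := R) (Pi.single i 1) * creation (Pi.single j 1) +
      creation (Pi.single j 1) * contraction (Pi.single i 1) = if i = j then 1 else 0 := by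
  refine matrix_ext_mulVec fun v => funext fun S => ?_
  rw [Matrix.add_mulVec, ← Matrix.mulVec_mulVec, ← Matrix.mulVec_mulVec, Pi.add_apply,
    contraction_single_mulVec, creation_single_mulVec, creation_single_mulVec,
    contraction_single_mulVec]
  by_cases hij : i = j
  · subst hij
    by_cases hi : i ∈ S
    · simp [hi, koszulSign_erase_of_le S le_rfl, ← mul_assoc, koszulSign_mul_self]
    · simp [hi, koszulSign_insert_of_le S le_rfl, ← mul_assoc, koszulSign_mul_self]
  · have hji : j ≠ i := fun h => hij h.symm
    by_cases hi : i ∈ S <;> by_cases hj : j ∈ S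
    · simp [hi, hj, hij, hji]
    · have e : (insert j S).erase i = insert j (S.erase i) := Finset.erase_insert_of_ne hji
      simp only [hi, hj, hij, Finset.mem_erase, Finset.mem_insert, if_true, if_false, and_false,
        or_true, e, Matrix.zero_mulVec, Pi.zero_apply]
      rcases lt_or_gt_of_ne hij with h | h
      · rw [koszulSign_erase_of_lt hi h, koszulSign_insert_of_le S h.le]; ring
      · rw [koszulSign_erase_of_le S h.le, koszulSign_insert_of_lt hj h]; ring
    · simp [hi, hj, hij]
    · simp [hi, hj, hij]

/-- The canonical anticommutation relation. -/
theorem contraction_creation (b c : Fin r → R) :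
    contraction c * creation b + creation b * contraction c = (∑ i, b i * c i) • 1 := by
  rw [contraction_eq_sum c, creation_eq_sum b]
  simp only [Finset.sum_mul, Finset.mul_sum, smul_mul_smul_comm]
  rw [Finset.sum_comm, ← Finset.sum_add_distrib, Finset.sum_smul]
  refine Finset.sum_congr rfl fun j _ => ?_
  rw [← Finset.sum_add_distrib, Finset.sum_eq_single j]
  · rw [mul_comm (b j), ← smul_add, contraction_creation_single, if_pos rfl]
  · intro i _ hi
    rw [mul_comm (b i), ← smul_add, contraction_creation_single, if_neg hi.symm, smul_zero]
  · simp

end clifford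

/-! ### Matrices of polynomials as endomorphisms of the Koszul complex -/

section bar
variable {r : ℕ} {R : Type} [CommRing R]

/-- The parity operator on the exterior algebra. -/
def parity (r : ℕ) (R : Type) [CommRing R] : Matrix (Finset (Fin r)) (Finset (Fin r)) R :=
  Matrix.diagonal fun S => (-1) ^ S.card

/-- The conjugate by the parity operator: the sign change of the odd part. -/
def bar (P : Matrix (Finset (Fin r)) (Finset (Fin r)) R) :
    Matrix (Finset (Fin r)) (Finset (Fin r)) R := parity r R * P * parity r R

@[simp] theorem parity_mul_parity : parity r R * parity r R = 1 := by
  rw [parity, Matrix.diagonal_mul_diagonal, ← Matrix.diagonal_one]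
  congr 1; ext S; rw [← mul_pow]; simp

theorem bar_apply (P : Matrix (Finset (Fin r)) (Finset (Fin r)) R) (S T : Finset (Fin r)) :
    bar P S T = (-1) ^ S.card * P S T * (-1) ^ T.card := by
  rw [bar, parity, Matrix.mul_diagonal, Matrix.diagonal_mul]

theorem bar_mul (P Q : Matrix (Finset (Fin r)) (Finset (Fin r)) R) :
    bar (P * Q) = bar P * bar Q := by
  simp only [bar, Matrix.mul_assoc]
  rw [← Matrix.mul_assoc (parity r R) (parity r R), parity_mul_parity, Matrix.one_mul]

theorem bar_bar (P : Matrix (Finset (Fin r)) (Finset (Fin r)) R) : bar (bar P) = P := by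
  simp only [bar, Matrix.mul_assoc, parity_mul_parity, Matrix.mul_one]
  rw [← Matrix.mul_assoc, parity_mul_parity, Matrix.one_mul]

theorem bar_add (P Q : Matrix (Finset (Fin r)) (Finset (Fin r)) R) :
    bar (P + Q) = bar P + bar Q := by simp [bar, Matrix.mul_add, Matrix.add_mul]

theorem bar_sub (P Q : Matrix (Finset (Fin r)) (Finset (Fin r)) R) :
    bar (P - Q) = bar P - bar Q := by simp [bar, Matrix.mul_sub, Matrix.sub_mul]

theorem bar_smul (a : R) (P : Matrix (Finset (Fin r)) (Finset (Fin r)) R) :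
    bar (a • P) = a • bar P := by simp [bar]

theorem bar_one : bar (1 : Matrix (Finset (Fin r)) (Finset (Fin r)) R) = 1 := by simp [bar]

theorem contraction_eq_zero {c : Fin r → R} {S T : Finset (Fin r)}
    (h : S.card ≠ T.card + 1) : contraction c S T = 0 := by
  refine Finset.sum_eq_zero fun i _ => if_neg ?_
  rintro ⟨h1, rfl⟩
  exact h (Finset.card_erase_add_one h1).symm

theorem bar_contraction (c : Fin r → R) : bar (contraction c) = -contraction c := by
  ext S T
  rw [bar_apply, Matrix.neg_apply]
  by_cases h : S.card = T.card + 1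
  · rw [h, pow_succ]
    have : ((-1 : R) ^ T.card) * (-1) ^ T.card = 1 := by rw [← mul_pow]; simp
    linear_combination -contraction c S T * this
  · rw [contraction_eq_zero h]; simp

theorem bar_creation (c : Fin r → R) : bar (creation c) = -creation c := by
  ext S T
  have := congrFun (congrFun (bar_contraction c) T) S
  rw [bar_apply, Matrix.neg_apply] at this ⊢
  rw [creation, Matrix.transpose_apply, ← this]; ring

end bar

theorem cube_sgn (n : ℕ) : (koszulG n).sgn = polyMat (parity (n - 1) (MvPolynomial (Fin n) ℂ)) := by
  ext S T
  change (S.card : ℤ).negOnePow • (𝟙 (koszulG n).X : (koszulG n).X ⟶ (koszulG n).X) S T =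
    DotPerm.single _ (Matrix.diagonal _ S T)
  by_cases h : S = T
  · subst h
    rw [Mat_.id_apply_self, Matrix.diagonal_apply_eq]
    refine (DotPerm.units_smul_single _ _ _).trans (congrArg _ ?_)
    rcases Nat.even_or_odd S.card with h | h
    · rw [Int.negOnePow_even _ (by exact_mod_cast h), h.neg_one_pow, one_smul]
    · rw [Int.negOnePow_odd _ (by exact_mod_cast h), h.neg_one_pow, Units.neg_smul, one_smul]
  · rw [Mat_.id_apply_of_ne _ _ _ h, Matrix.diagonal_apply_ne _ h, map_zero, smul_zero]

theorem polyMat_sub {ι : Type} [Fintype ι] {n : ℕ} (P Q : Matrix ι ι (MvPolynomial (Fin n) ℂ)) :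
    polyMat (P - Q) = polyMat P - polyMat Q := by
  rw [sub_eq_add_neg, polyMat_add, polyMat_neg, ← sub_eq_add_neg]

theorem polyMat_injective {ι : Type} [Fintype ι] {n : ℕ} :
    Function.Injective (polyMat (ι := ι) (n := n)) := by
  intro P Q h
  ext1 i j
  have := congrArg (DotPerm.coeff (Equiv.refl (Fin n))) (congrFun (congrFun h i) j)
  rwa [polyMat, polyMat, DotPerm.coeff_single_self, DotPerm.coeff_single_self] at this

/-- The differential of `Cube_n` as a matrix. -/
abbrev koszulD (n : ℕ) :
    Matrix (Finset (Fin (n - 1))) (Finset (Fin (n - 1))) (MvPolynomial (Fin n) ℂ) :=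
  contraction (koszulC n)

theorem delta_polyMat (n : ℕ+)
    (P : Matrix (Finset (Fin (n - 1))) (Finset (Fin (n - 1))) (MvPolynomial (Fin n) ℂ)) :
    delta (cube n) (cube n) (polyMat P) = polyMat (P * koszulD n - koszulD n * bar P) := by
  have h : delta (cube n) (cube n) (polyMat P) = polyMat P ≫ polyMat (koszulD n) -
      polyMat (koszulD n) ≫ (koszulG n).sgn ≫ polyMat P ≫ (koszulG n).sgn := rfl
  rw [h, cube_sgn, polyMat_mul, polyMat_mul, polyMat_mul, polyMat_mul, polyMat_sub,
    ← Matrix.mul_assoc (parity _ _)]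
  rfl

theorem dotMat_eq (n : ℕ+) (i : Fin n) :
    dotMat n i = polyMat ((MvPolynomial.X i : MvPolynomial (Fin n) ℂ) • (1 : Matrix _ _ _)) := by
  rw [dotMat, Matrix.smul_one_eq_diagonal]

/-- Multiplication by a Koszul generator is a homotopy from `x_i` to `x_{i+1}`. -/
theorem xAct_leftIdx (n : ℕ+) (i : Fin (n - 1)) : xAct n (leftIdx i) = xAct n (rightIdx i) := by
  refine (cls_eq_cls _ _).mpr ⟨polyMat (creation (Pi.single i 1)), mem_maps_cube _, ?_⟩
  rw [delta_polyMat, bar_creation, Matrix.mul_neg, sub_neg_eq_add, add_comm, contraction_creation,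
    dotMat_eq, dotMat_eq, ← polyMat_sub, ← sub_smul]
  congr 2
  rw [Finset.sum_eq_single i]
  · simp [koszulC]
  · intro j _ hj; simp [Pi.single_eq_of_ne hj]
  · simp

theorem xAct_eq (n : ℕ+) (i j : Fin n) : xAct n i = xAct n j := by
  have h : ∀ k (hk : k < (n : ℕ)), xAct n ⟨k, hk⟩ = xAct n ⟨0, n.pos⟩ := by
    intro k
    induction k with
    | zero => intro _; rfl
    | succ k ih =>
      intro hk
      rw [← ih (by omega)]
      exact (xAct_leftIdx n ⟨k, by omega⟩).symm
  exact (h i i.2).trans (h j j.2).symm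

/-! ### Strands and blocks of a tensor product of cubes -/

namespace CubeTree

/-- The strands of a tensor product of cubes. -/
def Strand : CubeTree → Type
  | .cube n => Fin n
  | .tensor s t => Strand s ⊕ Strand t

instance : ∀ s : CubeTree, Fintype (Strand s)
  | .cube n => inferInstanceAs (Fintype (Fin n))
  | .tensor s t =>
    letI : Fintype (Strand s) := instFintypeStrand s
    letI : Fintype (Strand t) := instFintypeStrand t
    inferInstanceAs (Fintype (Strand s ⊕ Strand t))

/-- Two strands lie in the same block if they belong to the same factor `Cube_n`. -/
def SameBlock : (s : CubeTree) → Strand s → Strand s → Prop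
  | .cube _, _, _ => True
  | .tensor s _, .inl i, .inl j => SameBlock s i j
  | .tensor _ t, .inr i, .inr j => SameBlock t i j
  | .tensor _ _, .inl _, .inr _ => False
  | .tensor _ _, .inr _, .inl _ => False

/-- The number of factors `Cube_n`. -/
def blocks : CubeTree → ℕ
  | .cube _ => 1
  | .tensor s t => blocks s + blocks t

/-- The strands of every summand of the complex are labelled by the strands of the tree. -/
def labels : (s : CubeTree) → Labels s.obj.X (Strand s)
  | .cube n => fun _ => Equiv.refl (Fin n)
  | .tensor s t => tensLabels (labels s) (labels t)

instance : ∀ s : CubeTree, Nonempty (Strand s)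
  | .cube n => ⟨(⟨0, n.pos⟩ : Fin n)⟩
  | .tensor s _ => ⟨Sum.inl (instNonemptyStrand s).some⟩

/-- No summand of a tensor product of cubes is cut down by an idempotent. -/
theorem obj_e : ∀ s : CubeTree, s.obj.e = 𝟙 s.obj.X
  | .cube _ => rfl
  | .tensor s t => by
    change matTens s.obj.e t.obj.e = _
    rw [obj_e s, obj_e t]; exact matTens_id _ _

theorem polyMat_along {ι : Type} [Fintype ι] {n : ℕ} (P : Matrix ι ι (MvPolynomial (Fin n) ℂ)) :
    Along (M := constObj ι n) (M' := constObj ι n) (fun _ => Equiv.refl (Fin n))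
      (fun _ => Equiv.refl (Fin n)) (Equiv.refl (Fin n)) (polyMat P) :=
  fun p q => ⟨P p q, rfl⟩

theorem sumCongr_refl_refl (T V : Type) :
    Equiv.sumCongr (Equiv.refl T) (Equiv.refl V) = Equiv.refl (T ⊕ V) := by
  ext i; rcases i with i | i <;> rfl

theorem obj_d_along : ∀ s : CubeTree, Along (labels s) (labels s) (Equiv.refl _) s.obj.d
  | .cube n => polyMat_along _
  | .tensor s t => by
    have h1 := (obj_d_along s).tens (along_id (labels t))
    have h2 := ((along_sgn (labels s)).comp (along_id (labels s))).tens (obj_d_along t)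
    rw [← obj_e t, sumCongr_refl_refl] at h1
    rw [← obj_e s, Equiv.refl_trans, sumCongr_refl_refl] at h2
    exact h1.add h2

theorem mem_maps (s t : CubeTree) (f : s.obj.X ⟶ t.obj.X) : f ∈ maps s.obj t.obj :=
  ⟨by rw [obj_e, Category.id_comp], by rw [obj_e, Category.comp_id]⟩

/-- The Hom complex is the direct sum of its parts supported on single bijections, as the differentials
of the cubes involve only dots. -/
theorem delta_permPart (s t : CubeTree) (σ : Strand s ≃ Strand t) (f : s.obj.X ⟶ t.obj.X) :
    delta s.obj t.obj (permPart (labels s) (labels t) σ f) =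
      permPart (labels s) (labels t) σ (delta s.obj t.obj f) := by
  have h1 : ∀ g : s.obj.X ⟶ t.obj.X, permPart (labels s) (labels t) σ (g ≫ t.obj.d) =
      permPart (labels s) (labels t) σ g ≫ t.obj.d := fun g =>
    permPart_comp (obj_d_along t) σ g
  have h2 : ∀ g : s.obj.X ⟶ t.obj.X, permPart (labels s) (labels t) σ (g ≫ t.obj.sgn) =
      permPart (labels s) (labels t) σ g ≫ t.obj.sgn := fun g =>
    permPart_comp (along_sgn (labels t)) σ g
  have h3 : ∀ g : s.obj.X ⟶ t.obj.X, permPart (labels s) (labels t) σ (s.obj.d ≫ g) =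
      s.obj.d ≫ permPart (labels s) (labels t) σ g := fun g =>
    comp_permPart (obj_d_along s) σ g
  have h4 : ∀ g : s.obj.X ⟶ t.obj.X, permPart (labels s) (labels t) σ (s.obj.sgn ≫ g) =
      s.obj.sgn ≫ permPart (labels s) (labels t) σ g := fun g =>
    comp_permPart (along_sgn (labels s)) σ g
  rw [delta_apply, delta_apply, map_sub, h1, h3, h4, h2]

/-- A morphism is supported on the bijection `σ` of strands if it has such a representative. -/
def Supported {s t : CubeTree} (σ : Strand s ≃ Strand t) (f : s.obj ⟶ t.obj) : Prop :=
  ∃ (g : s.obj.X ⟶ t.obj.X) (hg : g ∈ cycles s.obj t.obj),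
    f = cls g hg ∧ Along (labels s) (labels t) σ g

open Classical in
/-- Every morphism is a sum of morphisms supported on single bijections of the strands. -/
theorem exists_supported {s t : CubeTree} (f : s.obj ⟶ t.obj) :
    ∃ F : (Strand s ≃ Strand t) → (s.obj ⟶ t.obj), f = ∑ σ, F σ ∧ ∀ σ, Supported σ (F σ) := by
  obtain ⟨g, hg, rfl⟩ := exists_cls f
  have h : ∀ σ, permPart (labels s) (labels t) σ g ∈ cycles s.obj t.obj := fun σ => by
    have h0 : delta s.obj t.obj g = 0 := hg.2
    refine ⟨mem_maps s t _, ?_⟩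
    change delta _ _ _ = 0
    rw [delta_permPart, h0, map_zero]
  refine ⟨fun σ => cls _ (h σ), ?_, fun σ => ⟨_, h σ, rfl, permPart_along _ _ _ _⟩⟩
  rw [← cls_sum]
  exact cls_congr (sum_permPart _ _ g).symm

theorem labelDot_mem (s : CubeTree) (i : Strand s) : labelDot (labels s) i ∈ cycles s.obj s.obj :=
  mem_cycles_of_even (mem_maps s s _) ((along_sgn (labels s)).labelDot_comp i)
    ((obj_d_along s).labelDot_comp i)

/-- The endomorphism given by the dot on the strand `i`. -/
def dot (s : CubeTree) (i : Strand s) : s.obj ⟶ s.obj := cls _ (labelDot_mem s i)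

theorem Supported.dot_comp {s t : CubeTree} {σ : Strand s ≃ Strand t} {f : s.obj ⟶ t.obj}
    (hf : Supported σ f) (i : Strand s) : dot s i ≫ f = f ≫ dot t (σ i) := by
  obtain ⟨g, hg, rfl, h⟩ := hf
  rw [dot, dot, cls_comp, cls_comp]
  exact cls_congr (h.labelDot_comp i)

theorem Supported.comp {s t u : CubeTree} {σ : Strand s ≃ Strand t} {τ : Strand t ≃ Strand u}
    {f : s.obj ⟶ t.obj} {g : t.obj ⟶ u.obj} (hf : Supported σ f) (hg : Supported τ g) :
    Supported (σ.trans τ) (f ≫ g) := by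
  obtain ⟨f, hf, rfl, h⟩ := hf
  obtain ⟨g, hg, rfl, h'⟩ := hg
  exact ⟨f ≫ g, comp_mem_cycles hf hg, rfl, h.comp h'⟩

theorem labelDot_cube (n : ℕ+) (i : Fin n) : labelDot (labels (.cube n)) i = dotMat n i := by
  ext (p : Finset (Fin (n - 1))) (q : Finset (Fin (n - 1)))
  change DotPerm.comp ((𝟙 (koszulG n).X : (koszulG n).X ⟶ (koszulG n).X) p q)
    (DotPerm.single (Equiv.refl (Fin n)) (MvPolynomial.X i)) =
    DotPerm.single (Equiv.refl _) (Matrix.diagonal _ p q)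
  by_cases h : p = q
  · subst h
    rw [Mat_.id_apply_self, Matrix.diagonal_apply_eq]
    exact DotPerm.one_comp _
  · rw [Mat_.id_apply_of_ne _ _ _ h, Matrix.diagonal_apply_ne _ h]
    exact (LinearMap.map_zero₂ DotPerm.comp _).trans (map_zero _).symm

theorem dot_cube (n : ℕ+) (i : Fin n) : dot (.cube n) i = xAct n i :=
  cls_congr (labelDot_cube n i)

theorem whiskerRight_dot (s t : CubeTree) (i : Strand s) :
    whiskerRight (dot s i) t.obj = dot (.tensor s t) (Sum.inl i) := by
  rw [dot, whiskerRight_cls]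
  refine cls_congr ?_
  rw [rightMap, obj_e]
  exact matTens_labelDot_left _ _ _

theorem whiskerLeft_dot (s t : CubeTree) (i : Strand t) :
    whiskerLeft s.obj (dot t i) = dot (.tensor s t) (Sum.inr i) := by
  rw [dot, whiskerLeft_cls]
  refine cls_congr ?_
  rw [leftMap_of_even _ ((along_sgn (labels t)).labelDot_comp i), obj_e]
  exact matTens_labelDot_right _ _ _

/-- Dots on strands of the same block are homotopic. -/
theorem dot_eq_of_sameBlock : ∀ (s : CubeTree) (i j : Strand s), SameBlock s i j → dot s i = dot s j
  | .cube n, i, j, _ => by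
    refine (dot_cube n i).trans ((xAct_eq n i j).trans (dot_cube n j).symm)
  | .tensor s t, .inl i, .inl j, h => by
    rw [← whiskerRight_dot, ← whiskerRight_dot, dot_eq_of_sameBlock s i j h]
  | .tensor s t, .inr i, .inr j, h => by
    rw [← whiskerLeft_dot, ← whiskerLeft_dot, dot_eq_of_sameBlock t i j h]

end CubeTree

/-! ### Exactness of the triangle of a cone -/

namespace Cx

/-- The data of a cone `C` of an even endomorphism `x` of `A`, as matrices: the inclusion `i` and the
projection `p`, which are closed, and the splittings `j` and `s`, whose boundaries are given by `x`.
In this form the data survive tensoring with another complex. -/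
structure ConeData {A C : Cx} (x : A.X ⟶ A.X) (i j : A.X ⟶ C.X) (p s : C.X ⟶ A.X) : Prop where
  x_sgn : x ≫ A.sgn = A.sgn ≫ x
  i_sgn : i ≫ C.sgn = A.sgn ≫ i
  j_mem : j ∈ maps A C
  s_mem : s ∈ maps C A
  i_cycles : i ∈ cycles A C
  p_cycles : p ∈ cycles C A
  i_s : i ≫ s = A.e
  j_p : j ≫ p = A.e
  i_p : i ≫ p = 0
  delta_j : delta A C j = x ≫ i
  delta_s : delta C A s = -(p ≫ x)

theorem delta_sgn_conj {A B : Cx} (k : A.X ⟶ B.X) :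
    delta A B (A.sgn ≫ k ≫ B.sgn) = -(A.sgn ≫ delta A B k ≫ B.sgn) := by
  rw [sgn_delta_sgn, delta_apply]
  simp

namespace ConeData

variable {A C : Cx} {x : A.X ⟶ A.X} {i j : A.X ⟶ C.X} {p s : C.X ⟶ A.X}

theorem rightMap (h : ConeData x i j p s) (R : Cx) :
    ConeData (A := tens A R) (C := tens C R) (rightMap x R) (rightMap i R) (rightMap j R)
      (rightMap p R) (rightMap s R) where
  x_sgn := by
    rw [tens_sgn]
    exact (matTens_comp _ _ _ _).trans (.trans (by rw [h.x_sgn, e_sgn]) (matTens_comp _ _ _ _).symm)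
  i_sgn := by
    rw [tens_sgn, tens_sgn]
    exact (matTens_comp _ _ _ _).trans (.trans (by rw [h.i_sgn, e_sgn]) (matTens_comp _ _ _ _).symm)
  j_mem := rightMap_mem_maps R h.j_mem
  s_mem := rightMap_mem_maps R h.s_mem
  i_cycles := rightMap_mem_cycles R h.i_cycles
  p_cycles := rightMap_mem_cycles R h.p_cycles
  i_s := by rw [rightMap_comp, h.i_s]; rfl
  j_p := by rw [rightMap_comp, h.j_p]; rfl
  i_p := by rw [rightMap_comp, h.i_p]; exact matTens_zero_left _
  delta_j := by rw [rightMap_delta _ _ h.j_mem, h.delta_j, ← rightMap_comp]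
  delta_s := by
    rw [rightMap_delta _ _ h.s_mem, h.delta_s, rightMap_comp]; exact matTens_neg_left _ _

/-- A morphism killed by `x` lifts along the projection of the cone. -/
theorem exists_comp_proj (h : ConeData x i j p s) {X : Cx} {f : X.X ⟶ A.X} (hf : f ∈ cycles X A)
    {k : X.X ⟶ A.X} (hk : k ∈ maps X A) (hfx : f ≫ x = delta X A k) :
    ∃ g, g ∈ cycles X C ∧ g ≫ p = f := by
  have hi : A.sgn ≫ i ≫ C.sgn = i := by rw [h.i_sgn, sgn_sgn_assoc]
  -- the boundary of `f ≫ j` is `f ≫ x ≫ i`, which is also the boundary of `k ≫ i`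
  refine ⟨f ≫ j - k ≫ i, ⟨?_, ?_⟩, ?_⟩
  · exact Submodule.sub_mem _ (comp_mem_maps hf.1 h.j_mem) (comp_mem_maps hk h.i_cycles.1)
  · change delta _ _ _ = 0
    have h1 := delta_comp k h.i_cycles
    rw [hi] at h1
    rw [map_sub, ← comp_delta hf, h.delta_j, ← h1, ← hfx, Category.assoc, sub_self]
  · rw [Preadditive.sub_comp, Category.assoc, Category.assoc, h.j_p, h.i_p, hf.1.2,
      Limits.comp_zero, sub_zero]

/-- A morphism killed by `x` extends along the inclusion into the cone. -/
theorem exists_incl_comp (h : ConeData x i j p s) {Y : Cx} {f : A.X ⟶ Y.X} (hf : f ∈ cycles A Y)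
    {k : A.X ⟶ Y.X} (hk : k ∈ maps A Y) (hfx : x ≫ f = delta A Y k) :
    ∃ g, g ∈ cycles C Y ∧ i ≫ g = f := by
  have h0 : delta A Y f = 0 := hf.2
  -- `s ≫ f` restricts to `f`; its boundary `-p ≫ x ≫ f` is cancelled by the second term, in which
  -- the signs compensate for the odd degree of `p`
  refine ⟨s ≫ f - p ≫ A.sgn ≫ k ≫ Y.sgn, ⟨?_, ?_⟩, ?_⟩
  · exact Submodule.sub_mem _ (comp_mem_maps h.s_mem hf.1)
      (comp_mem_maps h.p_cycles.1 (sgn_conj_mem_maps hk))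
  · change delta _ _ _ = 0
    have h1 : x ≫ A.sgn ≫ f ≫ Y.sgn = A.sgn ≫ delta A Y k ≫ Y.sgn := by
      rw [← hfx, ← Category.assoc, h.x_sgn]; simp only [Category.assoc]
    rw [map_sub, delta_comp_eq, h0, Limits.comp_zero, zero_add, h.delta_s,
      ← comp_delta h.p_cycles, delta_sgn_conj, Preadditive.neg_comp, Category.assoc, h1,
      Preadditive.comp_neg, sub_self]
  · rw [Preadditive.comp_sub, ← Category.assoc, ← Category.assoc, h.i_s, h.i_p, hf.1.1,
      Limits.zero_comp, sub_zero]

end ConeData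

section
variable {M M' N N' : Mat_ PObj}

theorem matRow_comp_col (c : N ⟶ M) (d : N ⟶ N') (a : M ⟶ M') (b : N' ⟶ M') :
    matRow c d ≫ matCol a b = c ≫ a + d ≫ b := by
  ext i j
  exact Fintype.sum_sum_type _

theorem matRow_sub (c c' : N ⟶ M) (d d' : N ⟶ N') :
    matRow c d - matRow c' d' = matRow (c - c') (d - d') := by
  ext i j
  rcases j with j | j <;> rfl

theorem matCol_sub (a a' : M ⟶ M') (c c' : N ⟶ M') :
    matCol a c - matCol a' c' = matCol (a - a') (c - c') := by
  ext i j
  rcases i with j | j <;> rfl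

end

/-- The shifts of the two ends of a cone affect only the `q`-degrees, not the matrices. -/
theorem coneData_cone (A : Cx) (k l : ℤ) (x : A.X ⟶ A.X)
    (hx : x ∈ cycles (shift k A) (shift l A))
    (hb : IsBihom (A := (shift k A).toGObj) (B := (shift l A).toGObj) 0 0 x) :
    ConeData (A := A) (C := cone (A := shift k A) (B := shift l A) x hx hb) x (matRow 0 A.e)
      (matRow A.e 0) (matCol A.e 0) (matCol 0 A.e) := by
  have hs : x ≫ A.sgn = A.sgn ≫ x := by
    have h := hb.sgn_comm
    rw [Int.negOnePow_zero, one_smul] at h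
    exact h
  have hC : (cone (A := shift k A) (B := shift l A) x hx hb).sgn =
    matBlock (-A.sgn) 0 0 A.sgn := coneG_sgn _ _
  have hd : (cone (A := shift k A) (B := shift l A) x hx hb).d = matBlock (-A.d) x 0 A.d := rfl
  have he : (cone (A := shift k A) (B := shift l A) x hx hb).e = matBlock A.e 0 0 A.e := rfl
  have h1 : A.e ≫ x = x := hx.1.1
  have h2 : x ≫ A.e = x := hx.1.2
  refine ⟨hs, ?_, ?_, ?_, ?_, ?_, ?_, ?_, ?_, ?_, ?_⟩
  · rw [hC, matRow_comp_block, comp_matRow]; simp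
  · refine ⟨?_, ?_⟩
    · rw [comp_matRow]; simp
    · rw [he, matRow_comp_block]; simp
  · refine ⟨?_, ?_⟩
    · rw [he, matBlock_comp_col]; simp
    · rw [matCol_comp]; simp
  · refine mem_cycles_of_even ⟨?_, ?_⟩ ?_ ?_
    · rw [comp_matRow]; simp
    · rw [he, matRow_comp_block]; simp
    · rw [hC, matRow_comp_block, comp_matRow]; simp
    · rw [hd, matRow_comp_block, comp_matRow]; simp
  · refine mem_cycles_of_odd ⟨?_, ?_⟩ ?_ ?_
    · rw [he, matBlock_comp_col]; simp
    · rw [matCol_comp]; simp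
    · rw [hC, matBlock_comp_col, matCol_comp, ← matCol_neg]; simp
    · rw [hd, matBlock_comp_col, matCol_comp, ← matCol_neg]; simp
  · rw [matRow_comp_col]; simp
  · rw [matRow_comp_col]; simp
  · rw [matRow_comp_col]; simp
  · rw [delta_apply, hC, hd, matRow_comp_block, matRow_comp_block, comp_matRow, comp_matRow,
      comp_matRow, matRow_sub]
    simp [h2, h1]
  · rw [delta_apply, hC, hd, matCol_comp, matCol_comp, matBlock_comp_col, matBlock_comp_col,
      matCol_sub, matCol_comp, ← matCol_neg]
    simp [h2, h1]

end Cx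

/-- The map `x_n - x_{n+1}` on `Cube_n ⊗ Cube_m` in the homotopy category. -/
def junction (n m : ℕ+) : tens (cube n) (cube m) ⟶ tens (cube n) (cube m) :=
  cls _ (junctionMat_mem n m)

theorem coneData_cubeCone (n m : ℕ+) :
    ConeData (A := tens (cube n) (cube m)) (C := cubeCone n m) (junctionMat n m)
      (matRow 0 (tens (cube n) (cube m)).e) (matRow (tens (cube n) (cube m)).e 0)
      (matCol (tens (cube n) (cube m)).e 0) (matCol 0 (tens (cube n) (cube m)).e) :=
  coneData_cone _ 1 (-1) _ (cycles_shift (junctionMat_mem n m) 1 (-1)) (junctionMat_bihom n m)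

theorem toCone_eq (n m : ℕ+) : toCone n m =
    cls (matRow 0 (tens (cube n) (cube m)).e) (coneData_cubeCone n m).i_cycles := by
  have h : ∀ A : Cx, A.e ≫ matRow (0 : A.X ⟶ A.X) A.e = matRow 0 A.e := fun A => by
    rw [comp_matRow]; simp
  exact (cls_comp _ _).trans (cls_congr (h (tens (cube n) (cube m))))

theorem fromCone_eq (n m : ℕ+) : fromCone n m =
    cls (matCol (tens (cube n) (cube m)).e 0) (coneData_cubeCone n m).p_cycles := by
  have h : ∀ A : Cx, matCol A.e (0 : A.X ⟶ A.X) ≫ A.e = matCol A.e 0 := fun A => by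
    rw [matCol_comp]; simp
  exact (cls_comp _ _).trans (cls_congr (h (tens (cube n) (cube m))))

namespace Cx.ConeData
variable {A C : Cx} {x : A.X ⟶ A.X} {i j : A.X ⟶ C.X} {p s : C.X ⟶ A.X}

theorem exists_comp_proj_cls (h : ConeData x i j p s) (hx : x ∈ cycles A A) {X : Cx} {f : X ⟶ A}
    (hf : f ≫ cls x hx = 0) : ∃ g, f = g ≫ cls p h.p_cycles := by
  obtain ⟨f, hf', rfl⟩ := exists_cls f
  rw [cls_comp] at hf
  obtain ⟨k, hk, hk'⟩ := (cls_eq_zero _).mp hf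
  obtain ⟨g, hg, hg'⟩ := h.exists_comp_proj hf' hk hk'.symm
  refine ⟨cls g hg, ?_⟩
  rw [cls_comp]
  exact cls_congr hg'.symm

theorem exists_incl_comp_cls (h : ConeData x i j p s) (hx : x ∈ cycles A A) {Y : Cx} {f : A ⟶ Y}
    (hf : cls x hx ≫ f = 0) : ∃ g, f = cls i h.i_cycles ≫ g := by
  obtain ⟨f, hf', rfl⟩ := exists_cls f
  rw [cls_comp] at hf
  obtain ⟨k, hk, hk'⟩ := (cls_eq_zero _).mp hf
  obtain ⟨g, hg, hg'⟩ := h.exists_incl_comp hf' hk hk'.symm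
  refine ⟨cls g hg, ?_⟩
  rw [cls_comp]
  exact cls_congr hg'.symm

end Cx.ConeData

section
variable {n m : ℕ+} (e : cube (n + m) ≅ cubeCone n m) (R : Cx)
include e

theorem exists_comp_splitOf {X : Cx} {f : X ⟶ tens (cube n) (cube m)}
    (hf : f ≫ junction n m = 0) : ∃ g, f = g ≫ splitOf e := by
  obtain ⟨g, hg⟩ := (coneData_cubeCone n m).exists_comp_proj_cls
    (junctionMat_mem n m) hf
  refine ⟨g ≫ e.inv, ?_⟩
  rw [splitOf, Category.assoc, Iso.inv_hom_id_assoc, fromCone_eq]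
  exact hg

theorem exists_mergeOf_comp {Y : Cx} {f : tens (cube n) (cube m) ⟶ Y}
    (hf : junction n m ≫ f = 0) : ∃ g, f = mergeOf e ≫ g := by
  obtain ⟨g, hg⟩ := (coneData_cubeCone n m).exists_incl_comp_cls
    (junctionMat_mem n m) hf
  refine ⟨e.hom ≫ g, ?_⟩
  rw [mergeOf, Category.assoc, Iso.inv_hom_id_assoc, toCone_eq]
  exact hg

theorem exists_comp_whiskerRight_splitOf {X : Cx} {f : X ⟶ tens (tens (cube n) (cube m)) R}
    (hf : f ≫ whiskerRight (junction n m) R = 0) : ∃ g, f = g ≫ whiskerRight (splitOf e) R := by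
  have hm := junctionMat_mem n m
  rw [junction, whiskerRight_cls] at hf
  obtain ⟨g, hg⟩ := ((coneData_cubeCone n m).rightMap R).exists_comp_proj_cls
    (rightMap_mem_cycles R hm) hf
  refine ⟨g ≫ whiskerRight e.inv R, ?_⟩
  rw [splitOf, Category.assoc, ← whiskerRight_comp, Iso.inv_hom_id_assoc, fromCone_eq]
  exact hg

theorem exists_whiskerRight_mergeOf_comp {Y : Cx} {f : tens (tens (cube n) (cube m)) R ⟶ Y}
    (hf : whiskerRight (junction n m) R ≫ f = 0) :
    ∃ g, f = whiskerRight (mergeOf e) R ≫ g := by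
  have hm := junctionMat_mem n m
  rw [junction, whiskerRight_cls] at hf
  obtain ⟨g, hg⟩ := ((coneData_cubeCone n m).rightMap R).exists_incl_comp_cls
    (rightMap_mem_cycles R hm) hf
  refine ⟨whiskerRight e.hom R ≫ g, ?_⟩
  rw [mergeOf, ← Category.assoc, ← whiskerRight_comp, Category.assoc, Iso.inv_hom_id,
    Category.comp_id, toCone_eq]
  exact hg

end

/-! ### Splitting an exterior algebra along one generator -/

section junction
variable {p q r : ℕ} (h : p + 1 + q = r)

/-- The generators before the distinguished one. -/
def inL (a : Fin p) : Fin r := ⟨a, by omega⟩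
/-- The distinguished generator. -/
def inMid : Fin r := ⟨p, by omega⟩
/-- The generators after the distinguished one. -/
def inR (b : Fin q) : Fin r := ⟨p + 1 + b, by omega⟩

theorem sum_inL_inMid_inR {M : Type*} [AddCommMonoid M] (f : Fin r → M) :
    ∑ i, f i = ∑ a, f (inL h a) + f (inMid h) + ∑ b, f (inR h b) := by
  subst h
  rw [Fin.sum_univ_add, Fin.sum_univ_castSucc]
  rfl

theorem forall_inL_inMid_inR {P : Fin r → Prop} (hL : ∀ a, P (inL h a)) (hM : P (inMid h))
    (hR : ∀ b, P (inR h b)) (i : Fin r) : P i := by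
  rcases lt_trichotomy i.1 p with hi | hi | hi
  · exact hL ⟨i, hi⟩
  · have : i = inMid h := Fin.ext hi
    rwa [this]
  · have : i = inR h ⟨i - (p + 1), by omega⟩ := Fin.ext (by simp [inR]; omega)
    rw [this]; exact hR _

@[simp] theorem inL_inj {a a' : Fin p} : inL h a = inL h a' ↔ a = a' := by
  simp [inL, Fin.ext_iff]
@[simp] theorem inR_inj {a a' : Fin q} : inR h a = inR h a' ↔ a = a' := by
  simp [inR, Fin.ext_iff]
@[simp] theorem inL_ne_inMid (a : Fin p) : inL h a ≠ inMid h := by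
  simp [inL, inMid, Fin.ext_iff]; omega
@[simp] theorem inR_ne_inMid (a : Fin q) : inR h a ≠ inMid h := by
  simp [inR, inMid, Fin.ext_iff]; omega
@[simp] theorem inL_ne_inR (a : Fin p) (b : Fin q) : inL h a ≠ inR h b := by
  simp [inL, inR, Fin.ext_iff]; omega

/-- The subset with given intersections with the two sides of the distinguished generator, which
belongs to it if and only if `ε = 1`. -/
def joinSet (ε : Fin 2) (S : Finset (Fin p)) (T : Finset (Fin q)) : Finset (Fin r) :=
  Finset.univ.filter fun i => (∃ a ∈ S, i = inL h a) ∨ (ε = 1 ∧ i = inMid h) ∨ ∃ b ∈ T, i = inR h b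

variable {ε : Fin 2} {S S' : Finset (Fin p)} {T T' : Finset (Fin q)}

@[simp] theorem inL_mem_joinSet {a : Fin p} : inL h a ∈ joinSet h ε S T ↔ a ∈ S := by
  simp [joinSet]
@[simp] theorem inMid_mem_joinSet : inMid h ∈ joinSet h ε S T ↔ ε = 1 := by
  simp [joinSet, (inL_ne_inMid h _).symm, (inR_ne_inMid h _).symm]
@[simp] theorem inR_mem_joinSet {b : Fin q} : inR h b ∈ joinSet h ε S T ↔ b ∈ T := by
  simp [joinSet, (inL_ne_inR h _ _).symm]

theorem joinSet_inj {ε' : Fin 2} :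
    joinSet h ε S T = joinSet h ε' S' T' ↔ ε = ε' ∧ S = S' ∧ T = T' := by
  refine ⟨fun e => ⟨?_, ?_, ?_⟩, by rintro ⟨rfl, rfl, rfl⟩; rfl⟩
  · have : inMid h ∈ joinSet h ε S T ↔ inMid h ∈ joinSet h ε' S' T' := by rw [e]
    simp only [inMid_mem_joinSet] at this
    omega
  · ext a; rw [← inL_mem_joinSet h (ε := ε) (T := T), e, inL_mem_joinSet]
  · ext a; rw [← inR_mem_joinSet h (ε := ε) (S := S), e, inR_mem_joinSet]

theorem exists_joinSet (U : Finset (Fin r)) : ∃ ε S T, U = joinSet h ε S T := by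
  refine ⟨if inMid h ∈ U then 1 else 0, Finset.univ.filter fun a => inL h a ∈ U,
    Finset.univ.filter fun b => inR h b ∈ U, ?_⟩
  ext i
  induction i using forall_inL_inMid_inR h with
  | hL a => simp
  | hM => simp
  | hR b => simp

theorem joinSet_erase_inL (a : Fin p) :
    (joinSet h ε S T).erase (inL h a) = joinSet h ε (S.erase a) T := by
  ext i
  induction i using forall_inL_inMid_inR h <;> simp [(inL_ne_inMid h _).symm, (inL_ne_inR h _ _).symm]

theorem joinSet_erase_inR (b : Fin q) :
    (joinSet h ε S T).erase (inR h b) = joinSet h ε S (T.erase b) := by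
  ext i
  induction i using forall_inL_inMid_inR h <;> simp [(inR_ne_inMid h _).symm]

theorem joinSet_erase_inMid : (joinSet h ε S T).erase (inMid h) = joinSet h 0 S T := by
  ext i
  induction i using forall_inL_inMid_inR h <;> simp

theorem card_eq_sum_ite (U : Finset (Fin r)) : U.card = ∑ i, if i ∈ U then 1 else 0 := by simp

theorem card_joinSet_filter_inL (a : Fin p) :
    ((joinSet h ε S T).filter (· < inL h a)).card = (S.filter (· < a)).card := by
  rw [card_eq_sum_ite, card_eq_sum_ite, sum_inL_inMid_inR h]
  have h1 : ∀ b, ¬ inR h b < inL h a := fun b => by simp only [inR, inL, Fin.mk_lt_mk]; omega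
  have h2 : ¬ inMid h < inL h a := by simp [inMid, inL]
  have h3 : ∀ b, inL h b < inL h a ↔ b < a := fun b => by simp [inL]
  simp [h1, h2, h3]

theorem card_joinSet_filter_inMid :
    ((joinSet h ε S T).filter (· < inMid h)).card = S.card := by
  rw [card_eq_sum_ite, card_eq_sum_ite, sum_inL_inMid_inR h]
  have h1 : ∀ b, ¬ inR h b < inMid h := fun b => by simp [inR, inMid]; omega
  have h3 : ∀ b, inL h b < inMid h := fun b => by simp [inL, inMid]
  simp [h1, h3]

theorem card_joinSet_filter_inR (b : Fin q) :
    ((joinSet h ε S T).filter (· < inR h b)).card = S.card + ε + (T.filter (· < b)).card := by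
  rw [card_eq_sum_ite, card_eq_sum_ite, card_eq_sum_ite, sum_inL_inMid_inR h]
  have h1 : ∀ b', inR h b' < inR h b ↔ b' < b := fun b => by simp [inR]
  have h2 : inMid h < inR h b := by simp [inMid, inR]; omega
  have h3 : ∀ a, inL h a < inR h b := fun b => by simp [inL, inR]; omega
  have h4 : (if ε = 1 then 1 else 0) = (ε : ℕ) := by fin_cases ε <;> rfl
  simp [h1, h2, h3, h4]

theorem card_joinSet : (joinSet h ε S T).card = S.card + ε + T.card := by
  rw [card_eq_sum_ite, card_eq_sum_ite, card_eq_sum_ite, sum_inL_inMid_inR h]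
  have h4 : (if ε = 1 then 1 else 0) = (ε : ℕ) := by fin_cases ε <;> rfl
  simp [h4]

variable {R : Type} [CommRing R]

/-- The contraction on the tensor product of two exterior algebras. -/
def tensContraction (a : Fin p → R) (b : Fin q → R) :
    Matrix (Finset (Fin p) × Finset (Fin q)) (Finset (Fin p) × Finset (Fin q)) R :=
  Matrix.kroneckerMap (· * ·) (contraction a) 1 +
    Matrix.kroneckerMap (· * ·) (parity p R) (contraction b)

theorem contraction_joinSet (c : Fin r → R) (ε ε' : Fin 2) (S S' T T') :
    contraction c (joinSet h ε S T) (joinSet h ε' S' T') =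
      (if ε = ε' ∧ T = T' then contraction (c ∘ inL h) S S' else 0) +
      (if ε = 1 ∧ ε' = 0 ∧ S = S' ∧ T = T' then (-1) ^ S.card * c (inMid h) else 0) +
      (if ε = ε' ∧ S = S' then (-1) ^ (S.card + ε) * contraction (c ∘ inR h) T T' else 0) := by
  rw [contraction, sum_inL_inMid_inR h]
  simp only [joinSet_erase_inL, joinSet_erase_inR, joinSet_erase_inMid, joinSet_inj,
    card_joinSet_filter_inL, card_joinSet_filter_inR, card_joinSet_filter_inMid,
    inL_mem_joinSet, inR_mem_joinSet, inMid_mem_joinSet]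
  congr 1
  · congr 1
    · by_cases h1 : ε = ε' ∧ T = T'
      · rw [if_pos h1, contraction]
        obtain ⟨rfl, rfl⟩ := h1
        simp
      · rw [if_neg h1]
        refine Finset.sum_eq_zero fun i _ => if_neg ?_
        rintro ⟨_, h3, _, h5⟩; exact h1 ⟨h3.symm, h5.symm⟩
    · refine if_congr ?_ rfl rfl
      constructor
      · rintro ⟨h1, h2, h3, h4⟩; exact ⟨h1, h2, h3.symm, h4.symm⟩
      · rintro ⟨h1, h2, h3, h4⟩; exact ⟨h1, h2, h3.symm, h4.symm⟩
  · by_cases h1 : ε = ε' ∧ S = S'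
    · rw [if_pos h1, contraction, Finset.mul_sum]
      obtain ⟨rfl, rfl⟩ := h1
      refine Finset.sum_congr rfl fun i _ => ?_
      simp only [true_and, mul_ite, mul_zero]
      refine if_congr Iff.rfl ?_ rfl
      rw [pow_add _ (S.card + _), mul_assoc]; rfl
    · rw [if_neg h1]
      refine Finset.sum_eq_zero fun i _ => if_neg ?_
      rintro ⟨_, h3, h4, _⟩; exact h1 ⟨h3.symm, h4.symm⟩

variable (R) in
/-- The inclusion of the summands without the distinguished generator. -/
def inclZero : Matrix (Finset (Fin r)) (Finset (Fin p) × Finset (Fin q)) R :=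
  fun U P => if U = joinSet h 0 P.1 P.2 then 1 else 0

variable (R) in
/-- The inclusion of the summands with the distinguished generator, which is moved to the front. -/
def inclOne : Matrix (Finset (Fin r)) (Finset (Fin p) × Finset (Fin q)) R :=
  fun U P => if U = joinSet h 1 P.1 P.2 then (-1) ^ P.1.card else 0

theorem inclZero_joinSet (ε S T P) : inclZero h R (joinSet h ε S T) P =
    if ε = 0 ∧ S = P.1 ∧ T = P.2 then 1 else 0 := if_congr (joinSet_inj h) rfl rfl

theorem inclOne_joinSet (ε S T P) : inclOne h R (joinSet h ε S T) P =
    if ε = 1 ∧ S = P.1 ∧ T = P.2 then (-1) ^ P.1.card else 0 := if_congr (joinSet_inj h) rfl rfl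

theorem mul_inclZero {κ : Type*} (M : Matrix κ (Finset (Fin r)) R) (k : κ) (P) :
    (M * inclZero h R) k P = M k (joinSet h 0 P.1 P.2) := by
  rw [Matrix.mul_apply, Finset.sum_eq_single (joinSet h 0 P.1 P.2)] <;>
    simp +contextual [inclZero]

theorem mul_inclOne {κ : Type*} (M : Matrix κ (Finset (Fin r)) R) (k : κ) (P) :
    (M * inclOne h R) k P = M k (joinSet h 1 P.1 P.2) * (-1) ^ P.1.card := by
  rw [Matrix.mul_apply, Finset.sum_eq_single (joinSet h 1 P.1 P.2)] <;>
    simp +contextual [inclOne]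

theorem inclZero_mul {κ : Type*} (M : Matrix (Finset (Fin p) × Finset (Fin q)) κ R) (ε S T k) :
    (inclZero h R * M) (joinSet h ε S T) k = if ε = 0 then M (S, T) k else 0 := by
  rw [Matrix.mul_apply, Finset.sum_eq_single (S, T)]
  · simp [inclZero, joinSet_inj]
  · rintro ⟨S', T'⟩ _ hne
    rw [inclZero, if_neg, zero_mul]
    rw [joinSet_inj]; rintro ⟨_, rfl, rfl⟩; exact hne rfl
  · simp

theorem inclOne_mul {κ : Type*} (M : Matrix (Finset (Fin p) × Finset (Fin q)) κ R) (ε S T k) :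
    (inclOne h R * M) (joinSet h ε S T) k = if ε = 1 then (-1) ^ S.card * M (S, T) k else 0 := by
  rw [Matrix.mul_apply, Finset.sum_eq_single (S, T)]
  · simp [inclOne, joinSet_inj]
  · rintro ⟨S', T'⟩ _ hne
    rw [inclOne, if_neg, zero_mul]
    rw [joinSet_inj]; rintro ⟨_, rfl, rfl⟩; exact hne rfl
  · simp

theorem inclZero_transpose_mul_self : (inclZero h R).transpose * inclZero h R = 1 := by
  ext P Q
  rw [mul_inclZero, Matrix.transpose_apply, inclZero_joinSet, Matrix.one_apply]
  refine if_congr ?_ rfl rfl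
  rw [Prod.ext_iff]; tauto

theorem inclOne_transpose_mul_self : (inclOne h R).transpose * inclOne h R = 1 := by
  ext P Q
  rw [mul_inclOne, Matrix.transpose_apply, inclOne_joinSet, Matrix.one_apply, ite_mul,
    zero_mul]
  by_cases hPQ : P = Q
  · subst hPQ
    rw [if_pos ⟨rfl, rfl, rfl⟩, if_pos rfl, ← mul_pow]; simp
  · rw [if_neg hPQ, if_neg]
    rintro ⟨_, h1, h2⟩; exact hPQ (Prod.ext h1.symm h2.symm)

theorem inclZero_transpose_mul_inclOne : (inclZero h R).transpose * inclOne h R = 0 := by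
  ext P Q
  rw [mul_inclOne, Matrix.transpose_apply, inclZero_joinSet]
  simp

theorem inclOne_transpose_mul_inclZero : (inclOne h R).transpose * inclZero h R = 0 := by
  ext P Q
  rw [mul_inclZero, Matrix.transpose_apply, inclOne_joinSet]
  simp

theorem incl_mul_transpose : inclOne h R * (inclOne h R).transpose +
    inclZero h R * (inclZero h R).transpose = 1 := by
  ext U V
  obtain ⟨ε, S, T, rfl⟩ := exists_joinSet h U
  obtain ⟨ε', S', T', rfl⟩ := exists_joinSet h V
  rw [Matrix.add_apply, inclOne_mul, inclZero_mul, Matrix.transpose_apply, Matrix.transpose_apply,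
    inclOne_joinSet, inclZero_joinSet, Matrix.one_apply]
  simp only [joinSet_inj]
  have h0 : ((-1 : R) ^ S.card) * (-1) ^ S.card = 1 := by rw [← mul_pow]; simp
  by_cases h1 : S = S' ∧ T = T'
  · obtain ⟨rfl, rfl⟩ := h1
    fin_cases ε <;> fin_cases ε' <;> simp [h0]
  · have : ∀ P : Prop, ¬ (P ∧ S = S' ∧ T = T') := fun P hP => h1 hP.2
    have h2 : ∀ P : Prop, ¬ (P ∧ S' = S ∧ T' = T) := fun P hP => h1 ⟨hP.2.1.symm, hP.2.2.symm⟩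
    simp [this, h2]

theorem contraction_mul_inclOne (c : Fin r → R) : contraction c * inclOne h R =
    -(inclOne h R * tensContraction (c ∘ inL h) (c ∘ inR h)) := by
  ext U ⟨S', T'⟩
  obtain ⟨ε, S, T, rfl⟩ := exists_joinSet h U
  rw [mul_inclOne, contraction_joinSet, Matrix.neg_apply, inclOne_mul]
  simp only [tensContraction, Matrix.add_apply, Matrix.kroneckerMap_apply, parity,
    Matrix.diagonal_apply, Matrix.one_apply]
  have hc : (if T = T' then contraction (c ∘ inL h) S S' else 0) * (-1) ^ S'.card =
      -((-1) ^ S.card * (if T = T' then contraction (c ∘ inL h) S S' else 0)) := by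
    by_cases hS : S.card = S'.card + 1
    · rw [hS, pow_succ]; ring
    · rw [contraction_eq_zero hS]; simp
  have hs : ∀ S : Finset (Fin p), ((-1 : R) ^ S.card) * (-1) ^ S.card = 1 := fun S => by
    rw [← mul_pow]; simp
  fin_cases ε
  · simp
  · simp only [Fin.mk_one, true_and, if_true, mul_ite, mul_one, mul_zero, one_ne_zero, false_and,
      and_false, if_false, add_zero, ite_mul, zero_mul] at hc ⊢
    rw [add_mul, mul_add, neg_add]
    simp only [ite_mul, zero_mul, mul_ite, mul_zero]
    rw [hc]
    congr 1
    by_cases hS : S = S'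
    · subst hS
      simp only [if_true]
      rw [← mul_assoc, hs]
      simp only [pow_succ]
      linear_combination (-contraction (c ∘ inR h) T T') * hs S
    · simp [hS]

theorem contraction_mul_inclZero (c : Fin r → R) : contraction c * inclZero h R =
    c (inMid h) • inclOne h R + inclZero h R * tensContraction (c ∘ inL h) (c ∘ inR h) := by
  ext U ⟨S', T'⟩
  obtain ⟨ε, S, T, rfl⟩ := exists_joinSet h U
  rw [mul_inclZero, contraction_joinSet, Matrix.add_apply, inclZero_mul, Matrix.smul_apply,
    inclOne_joinSet]
  simp only [tensContraction, Matrix.add_apply, Matrix.kroneckerMap_apply, parity,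
    Matrix.diagonal_apply, Matrix.one_apply]
  fin_cases ε
  · simp
  · by_cases hS : S = S'
    · subst hS; by_cases hT : T = T' <;> simp [hT, mul_comm]
    · simp [hS]

theorem inclZero_transpose_mul_contraction (c : Fin r → R) :
    (inclZero h R).transpose * contraction c =
      tensContraction (c ∘ inL h) (c ∘ inR h) * (inclZero h R).transpose := by
  rw [← Matrix.mul_one (contraction c), ← incl_mul_transpose h, Matrix.mul_add, Matrix.mul_add,
    ← Matrix.mul_assoc (contraction c), ← Matrix.mul_assoc (contraction c),
    contraction_mul_inclOne, contraction_mul_inclZero, Matrix.neg_mul, Matrix.mul_neg,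
    Matrix.add_mul, Matrix.mul_add]
  simp only [← Matrix.mul_assoc, inclZero_transpose_mul_inclOne, inclZero_transpose_mul_self,
    Matrix.zero_mul, Matrix.mul_smul, Matrix.smul_mul, Matrix.one_mul]
  simp

end junction

/-! ### The isomorphism of `Cube_{n+m}` with a cone -/

/-- Rectangular matrices of polynomials. -/
def rectMat {ι κ : Type} [Fintype ι] [Fintype κ] {n : ℕ}
    (P : Matrix ι κ (MvPolynomial (Fin n) ℂ)) : constObj ι n ⟶ constObj κ n :=
  fun i j => DotPerm.single (Equiv.refl _) (P i j)

section rect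
variable {ι κ μ : Type} [Fintype ι] [Fintype κ] [Fintype μ] {n : ℕ}

theorem polyMat_eq_rectMat (P : Matrix ι ι (MvPolynomial (Fin n) ℂ)) : polyMat P = rectMat P := rfl

theorem rectMat_comp (P : Matrix ι κ (MvPolynomial (Fin n) ℂ))
    (Q : Matrix κ μ (MvPolynomial (Fin n) ℂ)) : rectMat P ≫ rectMat Q = rectMat (P * Q) := by
  ext i k
  change ∑ j, DotPerm.comp (DotPerm.single (Equiv.refl _) (P i j))
    (DotPerm.single (Equiv.refl _) (Q j k)) = DotPerm.single (Equiv.refl _) ((P * Q) i k)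
  rw [Matrix.mul_apply, map_sum]
  refine Finset.sum_congr rfl fun j _ => ?_
  rw [DotPerm.comp_single]
  simp

theorem rectMat_add (P Q : Matrix ι κ (MvPolynomial (Fin n) ℂ)) :
    rectMat (P + Q) = rectMat P + rectMat Q := by
  ext i k; exact (DotPerm.single (Equiv.refl _)).map_add _ _

theorem rectMat_neg (P : Matrix ι κ (MvPolynomial (Fin n) ℂ)) :
    rectMat (-P) = -rectMat P := by
  ext i k; exact (DotPerm.single (Equiv.refl _)).map_neg _

theorem rectMat_zero : rectMat (0 : Matrix ι κ (MvPolynomial (Fin n) ℂ)) = 0 := by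
  ext i k; exact (DotPerm.single (Equiv.refl _)).map_zero

theorem rectMat_one [DecidableEq ι] : rectMat (1 : Matrix ι ι (MvPolynomial (Fin n) ℂ)) = 𝟙 _ := by
  ext i j
  by_cases h : i = j
  · subst h
    rw [Mat_.id_apply_self]
    change DotPerm.single _ ((1 : Matrix ι ι (MvPolynomial (Fin n) ℂ)) i i) = _
    rw [Matrix.one_apply_eq]; rfl
  · rw [Mat_.id_apply_of_ne _ _ _ h]
    change DotPerm.single _ ((1 : Matrix ι ι (MvPolynomial (Fin n) ℂ)) i j) = _
    rw [Matrix.one_apply_ne h, map_zero]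

theorem sumPerm_refl (a b : ℕ) : DotPerm.sumPerm (Equiv.refl (Fin a)) (Equiv.refl (Fin b)) =
    Equiv.refl (Fin (a + b)) := by
  ext i; simp [DotPerm.sumPerm]

/-- Polynomials in the first dots. -/
abbrev polyL (a b : ℕ) : MvPolynomial (Fin a) ℂ →ₐ[ℂ] MvPolynomial (Fin (a + b)) ℂ :=
  MvPolynomial.rename (Fin.castAdd b)

/-- Polynomials in the last dots. -/
abbrev polyR (a b : ℕ) : MvPolynomial (Fin b) ℂ →ₐ[ℂ] MvPolynomial (Fin (a + b)) ℂ :=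
  MvPolynomial.rename (Fin.natAdd a)

theorem matTens_rectMat {ι' κ' : Type} [Fintype ι'] [Fintype κ'] {m : ℕ}
    (P : Matrix ι κ (MvPolynomial (Fin n) ℂ)) (Q : Matrix ι' κ' (MvPolynomial (Fin m) ℂ)) :
    matTens (rectMat P) (rectMat Q) = rectMat (n := n + m) (Matrix.kroneckerMap (· * ·)
      (P.map (polyL n m)) (Q.map (polyR n m))) := by
  ext p q
  refine (DotPerm.tens_single _ _ _ _).trans ?_
  rw [sumPerm_refl]; rfl

end rect

theorem contraction_map {r : ℕ} {R R' F : Type} [CommRing R] [CommRing R'] [FunLike F R R']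
    [RingHomClass F R R'] (φ : F)
    (c : Fin r → R) : (contraction c).map φ = contraction (φ ∘ c) := by
  ext S T
  simp only [contraction, Matrix.map_apply, map_sum]
  refine Finset.sum_congr rfl fun i _ => ?_
  split_ifs <;> simp

theorem parity_map {r : ℕ} {R R' F : Type} [CommRing R] [CommRing R'] [FunLike F R R']
    [RingHomClass F R R'] (φ : F) :
    (parity r R).map φ = parity r R' := by
  rw [parity, Matrix.diagonal_map (map_zero _)]
  congr 1; ext S; simp

theorem matTens_contraction_add {n m : ℕ} (a : Fin (n - 1) → MvPolynomial (Fin n) ℂ)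
    (b : Fin (m - 1) → MvPolynomial (Fin m) ℂ) :
    matTens (polyMat (contraction a)) (𝟙 (koszulG m).X) +
      matTens (koszulG n).sgn (polyMat (contraction b)) =
    rectMat (n := n + m) (tensContraction (polyL n m ∘ a) (polyR n m ∘ b)) := by
  rw [cube_sgn, polyMat_eq_rectMat, polyMat_eq_rectMat, polyMat_eq_rectMat, ← rectMat_one,
    matTens_rectMat, matTens_rectMat]
  refine (rectMat_add _ _).symm.trans (congrArg _ ?_)
  rw [tensContraction, ← contraction_map (polyL n m), ← contraction_map (polyR n m),
    ← parity_map (polyL n m)]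
  congr 2
  exact Matrix.map_one _ (map_zero _) (map_one _)

theorem tens_cube_d (n m : ℕ+) : (tens (cube n) (cube m)).d =
    rectMat (n := n + m) (tensContraction (polyL n m ∘ koszulC n) (polyR n m ∘ koszulC m)) := by
  rw [← matTens_contraction_add]
  change matTens _ _ + matTens (_ ≫ 𝟙 _) _ = _
  rw [Category.comp_id]

theorem junctionMat_eq (n m : ℕ+) : junctionMat n m = rectMat (n := n + m)
    ((MvPolynomial.X (Fin.castAdd m ⟨n - 1, Nat.sub_lt n.pos one_pos⟩) -
      MvPolynomial.X (Fin.natAdd n ⟨0, m.pos⟩) : MvPolynomial (Fin (n + m)) ℂ) •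
      (1 : Matrix _ _ _)) := by
  have h1 : (𝟙 (koszulG n).X : (koszulG n).X ⟶ _) = rectMat 1 := rectMat_one.symm
  have h2 : (𝟙 (koszulG m).X : (koszulG m).X ⟶ _) = rectMat 1 := rectMat_one.symm
  change matTens _ (𝟙 (koszulG m).X) - matTens (𝟙 (koszulG n).X) _ = _
  rw [dotMat_eq, dotMat_eq, h1, h2, polyMat_eq_rectMat, polyMat_eq_rectMat, matTens_rectMat,
    matTens_rectMat, sub_eq_add_neg]
  refine (congrArg₂ (· + ·) rfl (rectMat_neg _).symm).trans ?_
  refine (rectMat_add _ _).symm.trans (congrArg _ ?_)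
  ext1 p q
  simp only [Matrix.add_apply, Matrix.neg_apply, Matrix.kroneckerMap_apply, Matrix.map_apply,
    Matrix.smul_apply, Matrix.one_apply, smul_eq_mul, Prod.ext_iff]
  by_cases h1 : p.1 = q.1 <;> by_cases h2 : p.2 = q.2 <;> simp [h1, h2, sub_eq_add_neg]

theorem junction_index (n m : ℕ+) : ((n : ℕ) - 1) + 1 + ((m : ℕ) - 1) = (n : ℕ) + m - 1 := by
  have := n.pos; have := m.pos; omega

theorem Cx.mem_cycles_of_inverse {A B : Cx} {f : A.X ⟶ B.X} {g : B.X ⟶ A.X} (hf : f ∈ cycles A B)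
    (hg : g ∈ maps B A) (h1 : f ≫ g = A.e) (h2 : g ≫ f = B.e) : g ∈ cycles B A := by
  refine ⟨hg, ?_⟩
  change delta _ _ _ = 0
  have h3 : delta A A A.e = 0 := (e_mem_cycles A).2
  rw [← (delta_mem_maps hg).1, ← h2, Category.assoc, comp_delta hf, h1, h3, Limits.comp_zero]

theorem koszulC_inL (n m : ℕ+) :
    koszulC (n + m : ℕ) ∘ inL (junction_index n m) = polyL n m ∘ koszulC n := by
  ext1 i
  simp only [Function.comp, koszulC, map_sub, MvPolynomial.rename_X]
  rfl

theorem koszulC_inR (n m : ℕ+) :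
    koszulC (n + m : ℕ) ∘ inR (junction_index n m) = polyR n m ∘ koszulC m := by
  ext1 i
  simp only [Function.comp, koszulC, map_sub, MvPolynomial.rename_X]
  have := n.pos
  congr 2
  all_goals
    ext
    simp only [leftIdx, rightIdx, inR, Fin.natAdd]
    omega

theorem koszulC_inMid (n m : ℕ+) : koszulC (n + m : ℕ) (inMid (junction_index n m)) =
    MvPolynomial.X (Fin.castAdd m ⟨n - 1, Nat.sub_lt n.pos one_pos⟩) -
      MvPolynomial.X (Fin.natAdd n ⟨0, m.pos⟩) := by
  rw [koszulC]
  have := n.pos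
  congr 2
  ext
  simp only [rightIdx, inMid, Fin.natAdd]
  omega

section
variable (n m : ℕ+)

/-- The polynomials in all dots of `Cube_{n+m}`, with the number of strands written as a sum of natural
numbers. -/
abbrev joinRing : Type := MvPolynomial (Fin ((n : ℕ) + m)) ℂ

/-- The split map as a matrix: the projection to the summands which contain the generator of the
junction. -/
def splitMat : (cube (n + m)).X ⟶ (tens (cube n) (cube m)).X :=
  rectMat (n := n + m) (inclOne (junction_index n m) (joinRing n m))

/-- The projection to the summands which do not contain the generator of the junction. -/
def restMat : (cube (n + m)).X ⟶ (tens (cube n) (cube m)).X :=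
  rectMat (n := n + m) (inclZero (junction_index n m) (joinRing n m))

/-- The merge map as a matrix: the inclusion of the summands which do not contain the generator of the
junction. -/
def mergeMat : (tens (cube n) (cube m)).X ⟶ (cube (n + m)).X :=
  rectMat (n := n + m) (inclZero (junction_index n m) (joinRing n m)).transpose

/-- The inclusion of the summands which contain the generator of the junction. -/
def corestMat : (tens (cube n) (cube m)).X ⟶ (cube (n + m)).X :=
  rectMat (n := n + m) (inclOne (junction_index n m) (joinRing n m)).transpose

theorem rect_comp_left {ι κ μ : Type} [Fintype ι] [Fintype κ] [Fintype μ] {N : ℕ}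
    {P : Matrix ι κ (MvPolynomial (Fin N) ℂ)} {Q : Matrix κ μ (MvPolynomial (Fin N) ℂ)}
    {W : Matrix ι μ (MvPolynomial (Fin N) ℂ)} (h : P * Q = W) :
    rectMat P ≫ rectMat Q = rectMat W := by rw [rectMat_comp, h]

theorem splitMat_corestMat :
    splitMat n m ≫ corestMat n m + restMat n m ≫ mergeMat n m = 𝟙 (cube (n + m)).X := by
  refine (congrArg₂ (· + ·) (rect_comp_left rfl) (rect_comp_left rfl)).trans ?_
  refine (rectMat_add _ _).symm.trans (.trans (congrArg _ ?_) rectMat_one)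
  exact incl_mul_transpose _

theorem tens_cube_e : (tens (cube n) (cube m)).e = 𝟙 (tens (cube n) (cube m)).X := matTens_id _ _

theorem corestMat_splitMat : corestMat n m ≫ splitMat n m = (tens (cube n) (cube m)).e :=
  (rect_comp_left (inclOne_transpose_mul_self _)).trans (rectMat_one.trans (tens_cube_e n m).symm)

theorem mergeMat_restMat : mergeMat n m ≫ restMat n m = (tens (cube n) (cube m)).e :=
  (rect_comp_left (inclZero_transpose_mul_self _)).trans (rectMat_one.trans (tens_cube_e n m).symm)

theorem corestMat_restMat : corestMat n m ≫ restMat n m = 0 :=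
  (rect_comp_left (inclOne_transpose_mul_inclZero _)).trans rectMat_zero

theorem mergeMat_splitMat : mergeMat n m ≫ splitMat n m = 0 :=
  (rect_comp_left (inclZero_transpose_mul_inclOne _)).trans rectMat_zero

theorem cube_d_splitMat : (cube (n + m)).d ≫ splitMat n m =
    -(splitMat n m ≫ (tens (cube n) (cube m)).d) := by
  rw [tens_cube_d, ← koszulC_inL, ← koszulC_inR]
  refine (rect_comp_left (contraction_mul_inclOne (junction_index n m) _)).trans ?_
  exact (rectMat_neg _).trans (congrArg _ (rectMat_comp _ _).symm)

theorem cube_d_restMat : (cube (n + m)).d ≫ restMat n m =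
    splitMat n m ≫ junctionMat n m + restMat n m ≫ (tens (cube n) (cube m)).d := by
  rw [tens_cube_d, ← koszulC_inL, ← koszulC_inR, junctionMat_eq, ← koszulC_inMid]
  refine (rect_comp_left (contraction_mul_inclZero (junction_index n m) _)).trans ?_
  refine (rectMat_add _ _).trans (congrArg₂ (· + ·) ?_ (rectMat_comp _ _).symm)
  have h : ∀ {ι κ : Type} [Fintype κ] [DecidableEq κ] (a : joinRing n m)
      (V : Matrix ι κ (joinRing n m)), a • V = V * a • (1 : Matrix κ κ (joinRing n m)) := by
    intro ι κ _ _ a V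
    rw [Matrix.mul_smul, Matrix.mul_one]
  exact .trans (congrArg _ (h _ _)) (rectMat_comp _ _).symm

/-- The isomorphism with the cone, as a matrix. -/
def toConeMat : (cube (n + m)).X ⟶ (cubeCone n m).X := matRow (splitMat n m) (restMat n m)

/-- The inverse isomorphism, as a matrix. -/
def ofConeMat : (cubeCone n m).X ⟶ (cube (n + m)).X := matCol (corestMat n m) (mergeMat n m)

theorem toConeMat_bihom : IsBihom (A := (cube (n + m)).toGObj) (B := (cubeCone n m).toGObj) 0 0
    (toConeMat n m) := by
  have hN : (((n + m : ℕ+) : ℕ) : ℤ) = n + m := by rw [PNat.add_coe]; push_cast; rfl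
  rintro (U : Finset (Fin ((n : ℕ) + m - 1))) (⟨(S : Finset (Fin (n - 1))), (T : Finset (Fin (m - 1)))⟩ |
    ⟨(S : Finset (Fin (n - 1))), (T : Finset (Fin (m - 1)))⟩)
  · by_cases h : U = joinSet (junction_index n m) 1 S T
    · have hc : (U.card : ℤ) = S.card + 1 + T.card := by rw [h, card_joinSet]; push_cast; rfl
      refine ⟨fun _ => ?_, ?_⟩
      · change (S.card : ℤ) + T.card + 1 = U.card + 0
        rw [hc]; ring
      · have hq : (0 : ℤ) + (cube (n + m)).qdeg U - (cubeCone n m).qdeg (Sum.inl (S, T)) = 0 := by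
          change 0 + (2 * (U.card : ℤ) + 1 - (n + m : ℕ+)) -
            ((2 * (S.card : ℤ) + 1 - n) + (2 * (T.card : ℤ) + 1 - m) + 1) = 0
          rw [hN, hc]; ring
        rw [hq]
        refine DotPerm.single_mem_homog _ ?_
        have h1 : inclOne (junction_index n m) (joinRing n m) U (S, T) = (-1) ^ S.card := if_pos h
        change MvPolynomial.IsWeightedHomogeneous _
          (inclOne (junction_index n m) (joinRing n m) U (S, T)) _
        rw [h1]
        rcases neg_one_pow_eq_or (joinRing n m) S.card with h1 | h1
        · rw [h1]; exact MvPolynomial.isWeightedHomogeneous_one ℂ _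
        · rw [h1, ← map_one MvPolynomial.C, ← map_neg]
          exact MvPolynomial.isWeightedHomogeneous_C _ _
    · have h0 : toConeMat n m U (Sum.inl (S, T)) = 0 := by
        change DotPerm.single _ (ite _ _ _) = 0
        rw [if_neg h, map_zero]
      rw [h0]
      exact ⟨fun h => (h rfl).elim, Submodule.zero_mem _⟩
  · by_cases h : U = joinSet (junction_index n m) 0 S T
    · have hc : (U.card : ℤ) = S.card + 0 + T.card := by rw [h, card_joinSet]; push_cast; rfl
      refine ⟨fun _ => ?_, ?_⟩
      · change (S.card : ℤ) + T.card = U.card + 0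
        rw [hc]; ring
      · have hq : (0 : ℤ) + (cube (n + m)).qdeg U - (cubeCone n m).qdeg (Sum.inr (S, T)) = 0 := by
          change 0 + (2 * (U.card : ℤ) + 1 - (n + m : ℕ+)) -
            ((2 * (S.card : ℤ) + 1 - n) + (2 * (T.card : ℤ) + 1 - m) + -1) = 0
          rw [hN, hc]; ring
        rw [hq]
        refine DotPerm.single_mem_homog _ ?_
        have h1 : inclZero (junction_index n m) (joinRing n m) U (S, T) = 1 := if_pos h
        change MvPolynomial.IsWeightedHomogeneous _
          (inclZero (junction_index n m) (joinRing n m) U (S, T)) _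
        rw [h1]
        exact MvPolynomial.isWeightedHomogeneous_one ℂ _
    · have h0 : toConeMat n m U (Sum.inr (S, T)) = 0 := by
        change DotPerm.single _ (ite _ _ _) = 0
        rw [if_neg h, map_zero]
      rw [h0]
      exact ⟨fun h => (h rfl).elim, Submodule.zero_mem _⟩

theorem toConeMat_mem : toConeMat n m ∈ cycles (cube (n + m)) (cubeCone n m) := by
  have hs := (toConeMat_bihom n m).sgn_comm
  rw [Int.negOnePow_zero, one_smul] at hs
  have he : splitMat n m ≫ (tens (cube n) (cube m)).e = splitMat n m := by
    rw [tens_cube_e, Category.comp_id]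
  have he' : restMat n m ≫ (tens (cube n) (cube m)).e = restMat n m := by
    rw [tens_cube_e, Category.comp_id]
  refine mem_cycles_of_even ⟨Category.id_comp _, ?_⟩ hs ?_
  · refine (matRow_comp_block _ _ _ _ _ _).trans ?_
    rw [he, he', Limits.comp_zero, Limits.comp_zero, add_zero, zero_add]; rfl
  · refine (matRow_comp_block _ _ _ _ _ _).trans ?_
    refine Eq.trans ?_ (comp_matRow _ _ _).symm
    rw [cube_d_splitMat, cube_d_restMat, Preadditive.comp_neg, Limits.comp_zero, add_zero]

theorem toConeMat_ofConeMat : toConeMat n m ≫ ofConeMat n m = (cube (n + m)).e :=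
  (matRow_comp_col _ _ _ _).trans (splitMat_corestMat n m)

theorem matCol_comp_row {M M' N N' K : Mat_ PObj} (a : M ⟶ K) (c : N ⟶ K) (b : K ⟶ M')
    (d : K ⟶ N') : matCol a c ≫ matRow b d = matBlock (a ≫ b) (a ≫ d) (c ≫ b) (c ≫ d) := by
  ext i j
  rcases i with i | i <;> rcases j with j | j <;> rfl

theorem ofConeMat_toConeMat : ofConeMat n m ≫ toConeMat n m = (cubeCone n m).e := by
  refine (matCol_comp_row _ _ _ _).trans ?_
  rw [corestMat_splitMat, corestMat_restMat, mergeMat_splitMat, mergeMat_restMat]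
  rfl

theorem ofConeMat_mem : ofConeMat n m ∈ cycles (cubeCone n m) (cube (n + m)) := by
  refine mem_cycles_of_inverse (toConeMat_mem n m) ⟨?_, Category.comp_id _⟩
    (toConeMat_ofConeMat n m) (ofConeMat_toConeMat n m)
  rw [← ofConeMat_toConeMat, Category.assoc, toConeMat_ofConeMat]
  exact Category.comp_id _

/-- `Cube_{n+m}` is the cone of the difference of the two dots at the junction. -/
def cubeConeIso : cube (n + m) ≅ cubeCone n m where
  hom := cls (toConeMat n m) (toConeMat_mem n m)
  inv := cls (ofConeMat n m) (ofConeMat_mem n m)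
  hom_inv_id := (cls_comp _ _).trans (cls_congr (toConeMat_ofConeMat n m))
  inv_hom_id := (cls_comp _ _).trans (cls_congr (ofConeMat_toConeMat n m))

theorem splitMat_mem : splitMat n m ∈ cycles (cube (n + m)) (tens (cube n) (cube m)) := by
  have h := comp_mem_cycles (toConeMat_mem n m) (coneData_cubeCone n m).p_cycles
  have h1 : toConeMat n m ≫ matCol (tens (cube n) (cube m)).e 0 = splitMat n m := by
    refine (matRow_comp_col _ _ _ _).trans ?_
    rw [tens_cube_e, Category.comp_id, Limits.comp_zero, add_zero]
  exact h1 ▸ h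

theorem mergeMat_mem : mergeMat n m ∈ cycles (tens (cube n) (cube m)) (cube (n + m)) := by
  have h := comp_mem_cycles (coneData_cubeCone n m).i_cycles (ofConeMat_mem n m)
  have h1 : matRow 0 (tens (cube n) (cube m)).e ≫ ofConeMat n m = mergeMat n m := by
    refine (matRow_comp_col _ _ _ _).trans ?_
    rw [tens_cube_e, Category.id_comp, Limits.zero_comp, zero_add]
  exact h1 ▸ h

theorem splitOf_eq : splitOf (cubeConeIso n m) = cls (splitMat n m) (splitMat_mem n m) := by
  rw [splitOf, fromCone_eq]
  refine (cls_comp _ _).trans (cls_congr ?_)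
  refine (matRow_comp_col _ _ _ _).trans ?_
  rw [tens_cube_e, Category.comp_id, Limits.comp_zero, add_zero]

theorem mergeOf_eq : mergeOf (cubeConeIso n m) = cls (mergeMat n m) (mergeMat_mem n m) := by
  rw [mergeOf, toCone_eq]
  refine (cls_comp _ _).trans (cls_congr ?_)
  refine (matRow_comp_col _ _ _ _).trans ?_
  rw [tens_cube_e, Category.id_comp, Limits.zero_comp, zero_add]

theorem toConeMat_empty : toConeMat n m ∅ (Sum.inr (∅, ∅)) =
    DotPerm.single (finCongr (PNat.add_coe n m)) 1 := by
  have h : inclZero (junction_index n m) (joinRing n m) ∅ (∅, ∅) = 1 := by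
    refine if_pos ?_
    ext i
    simp [joinSet]
  have h2 := congrArg (DotPerm.single (Equiv.refl (Fin ((n : ℕ) + m)))) h
  exact h2

/-- The differences of the coordinates of a vector, as constants. -/
def diffC {n : ℕ} (u : Fin n → ℂ) (i : Fin (n - 1)) : MvPolynomial (Fin n) ℂ :=
  MvPolynomial.C (u (leftIdx i) - u (rightIdx i))

/-- The matrix of `epsPair v w`. -/
def epsPairMat (v : Fin n → ℂ) (w : Fin m → ℂ) :
    (tens (cube n) (cube m)).X ⟶ (tens (cube n) (cube m)).X :=
  rectMat (n := n + m) (tensContraction (polyL n m ∘ diffC v) (polyR n m ∘ diffC w))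

theorem epsMat_sgn (u : Fin m → ℂ) : epsMat m u ≫ (cube m).sgn = -((cube m).sgn ≫ epsMat m u) := by
  have := IsBihom.sgn_comm (A := (cube m).toGObj) (B := (cube m).toGObj) (contraction_bihom
    (fun i => MvPolynomial.C (u (leftIdx i) - u (rightIdx i))) (-2) fun i =>
      MvPolynomial.isWeightedHomogeneous_C _ _)
  rw [Int.negOnePow_neg, Int.negOnePow_one, Units.neg_smul, one_smul] at this
  exact this

theorem epsPairMat_eq (v : Fin n → ℂ) (w : Fin m → ℂ) :
    rightMap (epsMat n v) (cube m) + leftMap (cube n) (epsMat m w) = epsPairMat n m v w := by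
  rw [leftMap_of_odd _ (epsMat_sgn m w), epsPairMat, ← matTens_contraction_add]
  change matTens _ _ + matTens (_ ≫ 𝟙 _) _ = _
  rw [Category.comp_id]; rfl

theorem epsPairMat_mem (v : Fin n → ℂ) (w : Fin m → ℂ) :
    epsPairMat n m v w ∈ cycles (tens (cube n) (cube m)) (tens (cube n) (cube m)) := by
  rw [← epsPairMat_eq]
  exact Submodule.add_mem _ (rightMap_mem_cycles _ (epsMat_mem n v))
    (leftMap_mem_cycles _ (epsMat_mem m w))

variable {n m}

theorem epsPair_eq (v : U n) (w : U m) :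
    epsPair v w = cls (epsPairMat n m v.1 w.1) (epsPairMat_mem n m _ _) := by
  rw [epsPair, eps, eps, whiskerRight_cls, whiskerLeft_cls, cls_add]
  exact cls_congr (epsPairMat_eq n m _ _)

section eps
variable {u : Fin (n + m : ℕ+) → ℂ} {v : Fin n → ℂ} {w : Fin m → ℂ}
  (hv : ∀ i : Fin (n - 1), u (Fin.castAdd (m : ℕ) (leftIdx i)) - u (Fin.castAdd (m : ℕ) (rightIdx i)) =
    v (leftIdx i) - v (rightIdx i))
  (hw : ∀ i : Fin (m - 1), u (Fin.natAdd (n : ℕ) (leftIdx i)) - u (Fin.natAdd (n : ℕ) (rightIdx i)) =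
    w (leftIdx i) - w (rightIdx i))
include hv hw

theorem diffC_inL_inR : diffC (n := n + m) u ∘ inL (junction_index n m) = polyL n m ∘ diffC v ∧
    diffC (n := n + m) u ∘ inR (junction_index n m) = polyR n m ∘ diffC w := by
  constructor
  · ext1 i
    simp only [Function.comp, diffC, MvPolynomial.rename_C, ← hv]
    rfl
  · ext1 i
    simp only [Function.comp, diffC, MvPolynomial.rename_C, ← hw]
    have h := n.pos
    have h1 : leftIdx (inR (junction_index n m) i) = Fin.natAdd (n : ℕ) (leftIdx i) := by
      ext; simp only [leftIdx, inR, Fin.natAdd]; omega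
    have h2 : rightIdx (inR (junction_index n m) i) = Fin.natAdd (n : ℕ) (rightIdx i) := by
      ext; simp only [rightIdx, inR, Fin.natAdd]; omega
    exact congrArg MvPolynomial.C (congrArg₂ (fun a b => u a - u b) h1 h2)

theorem epsMat_splitMat : epsMat (n + m) u ≫ splitMat n m =
    -(splitMat n m ≫ epsPairMat n m v w) := by
  obtain ⟨h1, h2⟩ := diffC_inL_inR hv hw
  rw [epsPairMat, ← h1, ← h2]
  refine (rect_comp_left (contraction_mul_inclOne (junction_index n m) _)).trans ?_
  exact (rectMat_neg _).trans (congrArg _ (rectMat_comp _ _).symm)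

theorem mergeMat_epsMat : mergeMat n m ≫ epsMat (n + m) u =
    epsPairMat n m v w ≫ mergeMat n m := by
  obtain ⟨h1, h2⟩ := diffC_inL_inR hv hw
  rw [epsPairMat, ← h1, ← h2]
  refine (rect_comp_left (inclZero_transpose_mul_contraction (junction_index n m) _)).trans ?_
  exact (rectMat_comp _ _).symm

end eps

/-- The exterior actions agree for all vectors with the same coordinate differences on both sides of the
junction. Restriction and induction both preserve these differences. -/
theorem epsPair_merge {u : U (n + m : ℕ+)} {v : U n} {w : U m}
    (hv : ∀ i : Fin (n - 1), u.1 (Fin.castAdd (m : ℕ) (leftIdx i)) -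
      u.1 (Fin.castAdd (m : ℕ) (rightIdx i)) = v.1 (leftIdx i) - v.1 (rightIdx i))
    (hw : ∀ i : Fin (m - 1), u.1 (Fin.natAdd (n : ℕ) (leftIdx i)) -
      u.1 (Fin.natAdd (n : ℕ) (rightIdx i)) = w.1 (leftIdx i) - w.1 (rightIdx i)) :
    epsPair v w ≫ mergeOf (cubeConeIso n m) = mergeOf (cubeConeIso n m) ≫ eps (n + m) u ∧
    splitOf (cubeConeIso n m) ≫ epsPair v w = -(eps (n + m) u ≫ splitOf (cubeConeIso n m)) := by
  rw [mergeOf_eq, splitOf_eq, epsPair_eq, eps, cls_comp, cls_comp, cls_comp, cls_comp, cls_neg]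
  exact ⟨cls_congr (mergeMat_epsMat hv hw).symm,
    cls_congr (neg_eq_iff_eq_neg.mpr (epsMat_splitMat hv hw)).symm⟩

end

/-! ### Morphisms between `Cube_n ⊗ Cube_m` and `Cube_{n+m}` -/

namespace CubeTree

/-- All dots act in the same way on morphisms to a tensor product with all strands in one block. -/
theorem dot_comp_eq_comp_dot {s t : CubeTree} (f : s.obj ⟶ t.obj) (i : Strand s) (k : Strand t)
    (ht : ∀ j, SameBlock t j k) : dot s i ≫ f = f ≫ dot t k := by
  classical
  obtain ⟨F, rfl, hF⟩ := exists_supported f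
  rw [Preadditive.comp_sum, Preadditive.sum_comp]
  refine Finset.sum_congr rfl fun σ _ => ?_
  rw [(hF σ).dot_comp i, dot_eq_of_sameBlock t _ _ (ht _)]

/-- All dots act in the same way on morphisms from a tensor product with all strands in one block. -/
theorem comp_dot_eq_dot_comp {s t : CubeTree} (f : s.obj ⟶ t.obj) (i : Strand s) (k : Strand t)
    (hs : ∀ j, SameBlock s i j) : f ≫ dot t k = dot s i ≫ f := by
  classical
  obtain ⟨F, rfl, hF⟩ := exists_supported f
  rw [Preadditive.comp_sum, Preadditive.sum_comp]
  refine Finset.sum_congr rfl fun σ _ => ?_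
  rw [← σ.apply_symm_apply k, ← (hF σ).dot_comp, dot_eq_of_sameBlock s _ _ (hs _)]

end CubeTree

open CubeTree

theorem whiskerRight_xAct (n m : ℕ+) (i : Fin n) : whiskerRight (xAct n i) (cube m) =
    dot (.tensor (.cube n) (.cube m)) (Sum.inl (i : Fin n)) :=
  (congrArg (fun f => whiskerRight f (cube m)) (dot_cube n i).symm).trans
    (whiskerRight_dot (.cube n) (.cube m) i)

theorem whiskerLeft_xAct (n m : ℕ+) (i : Fin m) : whiskerLeft (cube n) (xAct m i) =
    dot (.tensor (.cube n) (.cube m)) (Sum.inr (i : Fin m)) :=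
  (congrArg (fun f => whiskerLeft (cube n) f) (dot_cube m i).symm).trans
    (whiskerLeft_dot (.cube n) (.cube m) i)

/-- The map defining the cone is the difference of the two dots at the junction. -/
theorem junction_eq (n m : ℕ+) : junction n m =
    whiskerRight (xAct n ⟨n - 1, Nat.sub_lt n.pos one_pos⟩) (cube m) -
      whiskerLeft (cube n) (xAct m ⟨0, m.pos⟩) := by
  rw [xAct, xAct]
  refine Eq.trans (cls_congr ?_) (cls_sub (rightMap_mem_cycles _ (dotMat_mem _ _))
    (leftMap_mem_cycles _ (dotMat_mem _ _))).symm
  have hs : dotMat m ⟨0, m.pos⟩ ≫ (cube m).sgn = (cube m).sgn ≫ dotMat m ⟨0, m.pos⟩ := by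
    have := (dotMat_bihom m ⟨0, m.pos⟩).sgn_comm
    rw [Int.negOnePow_zero, one_smul] at this
    exact this
  rw [leftMap_of_even _ hs]
  rfl

section
variable {n m : ℕ+}

theorem xAct_merge (f : tens (cube n) (cube m) ⟶ cube (n + m)) (i : Fin n) (j : Fin m)
    (k : Fin (n + m : ℕ+)) :
    whiskerRight (xAct n i) (cube m) ≫ f = f ≫ xAct (n + m) k ∧
      whiskerLeft (cube n) (xAct m j) ≫ f = f ≫ xAct (n + m) k := by
  rw [whiskerRight_xAct, whiskerLeft_xAct, ← dot_cube]
  constructor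
  · exact dot_comp_eq_comp_dot (s := .tensor (.cube n) (.cube m)) (t := .cube (n + m)) f _ _
      fun _ => trivial
  · exact dot_comp_eq_comp_dot (s := .tensor (.cube n) (.cube m)) (t := .cube (n + m)) f _ _
      fun _ => trivial

theorem xAct_split (f : cube (n + m) ⟶ tens (cube n) (cube m)) (i : Fin n) (j : Fin m)
    (k : Fin (n + m : ℕ+)) :
    f ≫ whiskerRight (xAct n i) (cube m) = xAct (n + m) k ≫ f ∧
      f ≫ whiskerLeft (cube n) (xAct m j) = xAct (n + m) k ≫ f := by
  rw [whiskerRight_xAct, whiskerLeft_xAct, ← dot_cube]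
  constructor
  · exact comp_dot_eq_dot_comp (t := .tensor (.cube n) (.cube m)) (s := .cube (n + m)) f _ _
      fun _ => trivial
  · exact comp_dot_eq_dot_comp (t := .tensor (.cube n) (.cube m)) (s := .cube (n + m)) f _ _
      fun _ => trivial

theorem exists_eq_mergeOf_comp (e : cube (n + m) ≅ cubeCone n m)
    (f : tens (cube n) (cube m) ⟶ cube (n + m)) : ∃ φ : End (cube (n + m)), f = mergeOf e ≫ φ := by
  refine exists_mergeOf_comp e ?_
  have k : Fin (n + m : ℕ+) := ⟨0, (n + m).pos⟩
  rw [junction_eq, Preadditive.sub_comp, (xAct_merge f _ ⟨0, m.pos⟩ k).1,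
    (xAct_merge f ⟨0, n.pos⟩ _ k).2, sub_self]

theorem exists_eq_comp_splitOf (e : cube (n + m) ≅ cubeCone n m)
    (f : cube (n + m) ⟶ tens (cube n) (cube m)) : ∃ φ : End (cube (n + m)), f = φ ≫ splitOf e := by
  refine exists_comp_splitOf e ?_
  have k : Fin (n + m : ℕ+) := ⟨0, (n + m).pos⟩
  rw [junction_eq, Preadditive.comp_sub, (xAct_split f _ ⟨0, m.pos⟩ k).1,
    (xAct_split f ⟨0, n.pos⟩ _ k).2, sub_self]

theorem epsPair_ind (v : U n) (w : U m) :
    epsPair v w ≫ mergeOf (cubeConeIso n m) =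
      mergeOf (cubeConeIso n m) ≫ eps (n + m) (indVec v w) ∧
    splitOf (cubeConeIso n m) ≫ epsPair v w =
      -(eps (n + m) (indVec v w) ≫ splitOf (cubeConeIso n m)) :=
  epsPair_merge (u := indVec v w)
    (fun i => congrArg₂ (· - ·) (Fin.append_left v.1 w.1 (leftIdx i))
      (Fin.append_left v.1 w.1 (rightIdx i)))
    (fun i => congrArg₂ (· - ·) (Fin.append_right v.1 w.1 (leftIdx i))
      (Fin.append_right v.1 w.1 (rightIdx i)))

theorem epsPair_res (u : U (n + m : ℕ+)) :
    epsPair (resL u) (resR u) ≫ mergeOf (cubeConeIso n m) =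
      mergeOf (cubeConeIso n m) ≫ eps (n + m) u ∧
    splitOf (cubeConeIso n m) ≫ epsPair (resL u) (resR u) =
      -(eps (n + m) u ≫ splitOf (cubeConeIso n m)) :=
  epsPair_merge (fun _ => (sub_sub_sub_cancel_right _ _ _).symm)
    (fun _ => (sub_sub_sub_cancel_right _ _ _).symm)

end

/-! ### The Künneth theorem over a field -/

section kunneth
variable {V W : Type} [AddCommGroup V] [Module ℂ V] [AddCommGroup W] [Module ℂ W]

/-- Every endomorphism of a vector space has a generalized inverse. -/
theorem exists_contracting (d : V →ₗ[ℂ] V) : ∃ h : V →ₗ[ℂ] V, ∀ x, d (h (d x)) = d x := by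
  obtain ⟨g, hg⟩ := d.rangeRestrict.exists_rightInverse_of_surjective d.range_rangeRestrict
  obtain ⟨h, hh⟩ := LinearMap.exists_extend g
  refine ⟨h, fun x => ?_⟩
  have h1 : h (d x) = g ⟨d x, LinearMap.mem_range_self d x⟩ := by rw [← hh]; rfl
  have h2 := congrArg Subtype.val (LinearMap.congr_fun hg ⟨d x, LinearMap.mem_range_self d x⟩)
  rw [h1]
  exact h2

variable (dV : V →ₗ[ℂ] V) (dW s : W →ₗ[ℂ] W)

/-- The differential `1 ⊗ d + d ⊗ s` of the tensor product, for a parity operator `s`. -/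
def tensorDelta : V ⊗[ℂ] W →ₗ[ℂ] V ⊗[ℂ] W :=
  TensorProduct.map LinearMap.id dW + TensorProduct.map dV s

variable {dV dW s}

/-- Every closed element of a tensor product of complexes of vector spaces is, up to a boundary, a
sum of products of closed elements: splittings of the differentials contract everything else. -/
theorem exists_tensorDelta (hV : ∀ x, dV (dV x) = 0) (hW : ∀ x, dW (dW x) = 0)
    (hs : ∀ x, s (s x) = x) (hds : ∀ x, dW (s x) = -s (dW x)) {w : V ⊗[ℂ] W}
    (hw : tensorDelta dV dW s w = 0) :
    ∃ v, w - tensorDelta dV dW s v ∈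
      Submodule.span ℂ {z | ∃ a b, dV a = 0 ∧ dW b = 0 ∧ z = a ⊗ₜ[ℂ] b} := by
  obtain ⟨h, hh⟩ := exists_contracting dV
  obtain ⟨k, hk⟩ := exists_contracting dW
  -- the projections onto closed elements given by the splittings
  let p : V →ₗ[ℂ] V := LinearMap.id - dV ∘ₗ h - h ∘ₗ dV
  let q : W →ₗ[ℂ] W := LinearMap.id - dW ∘ₗ k - k ∘ₗ dW
  have hp : ∀ x, p x = x - dV (h x) - h (dV x) := fun x => rfl
  have hq : ∀ x, q x = x - dW (k x) - k (dW x) := fun x => rfl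
  have hdp : ∀ x, dV (p x) = 0 := fun x => by simp [hp, hV, hh]
  have hdq : ∀ x, dW (q x) = 0 := fun x => by simp [hq, hW, hk]
  have hpd : ∀ x, p (dV x) = 0 := fun x => by simp [hp, hV, hh]
  let D := tensorDelta dV dW s
  have hD : ∀ a b, D (a ⊗ₜ b) = a ⊗ₜ dW b + dV a ⊗ₜ s b := fun a b => rfl
  -- `D (h ⊗ s) + (h ⊗ s) D = 1 - p ⊗ 1`
  have e1 : ∀ z, D (TensorProduct.map h s z) + TensorProduct.map h s (D z) =
      z - TensorProduct.map p LinearMap.id z := by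
    intro z
    induction z with
    | zero => simp
    | add x y hx hy =>
      simp only [map_add]
      linear_combination (norm := module) hx + hy
    | tmul a b =>
      simp only [TensorProduct.map_tmul, hD, map_add, LinearMap.id_apply, hds, hs, hp,
        TensorProduct.sub_tmul, TensorProduct.tmul_neg]
      abel
  have e2 : ∀ z, TensorProduct.map p LinearMap.id (D z) =
      TensorProduct.map LinearMap.id dW (TensorProduct.map p LinearMap.id z) := by
    intro z
    induction z with
    | zero => simp
    | add x y hx hy => simp only [map_add, hx, hy]
    | tmul a b => simp [hD, hpd]
  -- on closed elements of the image of `p ⊗ 1` the last term vanishes, so `D (p ⊗ k) = p ⊗ 1 - p ⊗ q`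
  have e3 : ∀ z, D (TensorProduct.map p k z) =
      TensorProduct.map p LinearMap.id z - TensorProduct.map p q z -
        TensorProduct.map LinearMap.id k (TensorProduct.map LinearMap.id dW
          (TensorProduct.map p LinearMap.id z)) := by
    intro z
    induction z with
    | zero => simp
    | add x y hx hy =>
      simp only [map_add]
      linear_combination (norm := module) hx + hy
    | tmul a b =>
      simp only [TensorProduct.map_tmul, hD, LinearMap.id_apply, hdp, hq,
        TensorProduct.tmul_sub, TensorProduct.zero_tmul]
      abel
  have h1 := e1 w
  have h2 := e2 w
  have h3 := e3 w
  change D w = 0 at hw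
  rw [hw, map_zero] at h1 h2
  rw [← h2, map_zero, sub_zero] at h3
  refine ⟨TensorProduct.map h s w + TensorProduct.map p k w, ?_⟩
  have h4 : w - D (TensorProduct.map h s w + TensorProduct.map p k w) = TensorProduct.map p q w := by
    rw [map_add, h3]
    rw [add_zero] at h1
    rw [h1]; abel
  change w - D _ ∈ _
  rw [h4]
  generalize w = z
  induction z with
  | zero => simp
  | add x y hx hy => rw [map_add]; exact Submodule.add_mem _ hx hy
  | tmul a b => exact Submodule.subset_span ⟨p a, q b, hdp a, hdq b, rfl⟩

end kunneth

/-! ### Tensor products of spaces of morphisms -/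

namespace DotPerm
variable {a b c d : ℕ}

/-- Polynomials in two sets of variables as a tensor product. -/
def splitPoly (b d : ℕ) : MvPolynomial (Fin (b + d)) ℂ →ₐ[ℂ]
    MvPolynomial (Fin b) ℂ ⊗[ℂ] MvPolynomial (Fin d) ℂ :=
  MvPolynomial.aeval (Fin.addCases (fun i => MvPolynomial.X i ⊗ₜ 1) fun j => 1 ⊗ₜ MvPolynomial.X j)

theorem splitPoly_rename_mul (p : MvPolynomial (Fin b) ℂ) (r : MvPolynomial (Fin d) ℂ) :
    splitPoly b d (MvPolynomial.rename (Fin.castAdd d) p * MvPolynomial.rename (Fin.natAdd b) r) =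
      p ⊗ₜ r := by
  have h1 : (splitPoly b d).comp (MvPolynomial.rename (Fin.castAdd d)) =
      Algebra.TensorProduct.includeLeft := by
    ext i; simp [splitPoly]
  have h2 : (splitPoly b d).comp (MvPolynomial.rename (Fin.natAdd b)) =
      Algebra.TensorProduct.includeRight := by
    ext i; simp [splitPoly]
  have h1 := DFunLike.congr_fun h1 p
  have h2 := DFunLike.congr_fun h2 r
  simp only [AlgHom.comp_apply] at h1 h2
  rw [map_mul, h1, h2]
  simp

/-- Dotted permutations that respect a decomposition of the strands are sums of tensor products. -/
theorem single_mem_range_tens (σ : Fin a ≃ Fin b) (τ : Fin c ≃ Fin d)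
    (p : MvPolynomial (Fin (b + d)) ℂ) :
    single (sumPerm σ τ) p ∈ LinearMap.range (TensorProduct.lift (tens (a := a) (b := b) (c := c) (d := d))) := by
  let μ : MvPolynomial (Fin b) ℂ ⊗[ℂ] MvPolynomial (Fin d) ℂ →ₐ[ℂ] MvPolynomial (Fin (b + d)) ℂ :=
    Algebra.TensorProduct.productMap (MvPolynomial.rename (Fin.castAdd d))
      (MvPolynomial.rename (Fin.natAdd b))
  have h : μ.comp (splitPoly b d) = AlgHom.id ℂ _ := by
    ext i
    induction i using Fin.addCases <;> simp [splitPoly, μ]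
  have hp : p = μ (splitPoly b d p) := (DFunLike.congr_fun h p).symm
  rw [hp]
  generalize splitPoly b d p = z
  induction z with
  | zero => simp
  | add x y hx hy => rw [map_add, map_add]; exact Submodule.add_mem _ hx hy
  | tmul x y =>
    refine ⟨single σ x ⊗ₜ single τ y, ?_⟩
    rw [TensorProduct.lift.tmul, tens_single]
    simp [μ]

theorem sumPerm_injective {σ σ' : Fin a ≃ Fin b} {τ τ' : Fin c ≃ Fin d}
    (h : sumPerm σ τ = sumPerm σ' τ') : σ = σ' ∧ τ = τ' := by
  constructor
  · ext i
    have := congrArg (fun e => (e (Fin.castAdd c i) : ℕ)) h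
    simpa using this
  · ext i
    have := congrArg (fun e => (e (Fin.natAdd a i) : ℕ)) h
    simpa using this

/-- A left inverse of the tensor product of dotted permutations. -/
def untens : DotPerm (a + c) (b + d) →ₗ[ℂ] DotPerm a b ⊗[ℂ] DotPerm c d :=
  ∑ σ : Fin a ≃ Fin b, ∑ τ : Fin c ≃ Fin d,
    (TensorProduct.map (single σ) (single τ)).comp
      ((splitPoly b d).toLinearMap.comp (coeff (sumPerm σ τ)))

theorem untens_tens (f : DotPerm a b) (g : DotPerm c d) : untens (tens f g) = f ⊗ₜ g := by
  induction f using ind with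
  | h0 => simp
  | hadd f f' h1 h2 => rw [LinearMap.map_add₂, map_add, h1, h2, TensorProduct.add_tmul]
  | hs σ p =>
  induction g using ind with
  | h0 => simp
  | hadd f f' h1 h2 => rw [map_add, map_add, h1, h2, TensorProduct.tmul_add]
  | hs τ r =>
    rw [tens_single, untens, LinearMap.sum_apply, Finset.sum_eq_single σ, LinearMap.sum_apply,
      Finset.sum_eq_single τ]
    · simp only [LinearMap.comp_apply, coeff_single_self, AlgHom.toLinearMap_apply]
      rw [splitPoly_rename_mul, TensorProduct.map_tmul]
    · intro τ' _ h
      simp only [LinearMap.comp_apply]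
      rw [coeff_single_ne fun e => h (sumPerm_injective e).2, map_zero, map_zero]
    · simp
    · intro σ' _ h
      rw [LinearMap.sum_apply]
      refine Finset.sum_eq_zero fun τ' _ => ?_
      simp only [LinearMap.comp_apply]
      rw [coeff_single_ne fun e => h (sumPerm_injective e).1, map_zero, map_zero]
    · simp

end DotPerm

section matUnit
variable {M M' N N' : Mat_ PObj}

open Classical in
/-- The entries of a matrix with a single entry. They are given separately because the condition is
cast along equalities of indices. -/
def unitEntry (p : M.ι) (q : M'.ι) (x : DotPerm (M.X p).strands (M'.X q).strands) (i : M.ι)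
    (j : M'.ι) : DotPerm (M.X i).strands (M'.X j).strands :=
  if h : i = p ∧ j = q then h.1 ▸ h.2 ▸ x else 0

theorem unitEntry_self (p : M.ι) (q : M'.ι) (x) :
    unitEntry (M := M) (M' := M') p q x p q = x := dif_pos ⟨rfl, rfl⟩

theorem unitEntry_ne {p i : M.ι} {q j : M'.ι} (h : ¬ (i = p ∧ j = q)) (x) :
    unitEntry (M := M) (M' := M') p q x i j = 0 := dif_neg h

/-- The matrix with a single entry. -/
def matUnit (p : M.ι) (q : M'.ι) : DotPerm (M.X p).strands (M'.X q).strands →ₗ[ℂ] (M ⟶ M') where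
  toFun x := fun i j => unitEntry p q x i j
  map_add' x y := by
    ext i j
    change unitEntry p q (x + y) i j = unitEntry p q x i j + unitEntry p q y i j
    by_cases h : i = p ∧ j = q
    · obtain ⟨rfl, rfl⟩ := h; simp only [unitEntry_self]
    · simp only [unitEntry_ne h, add_zero]
  map_smul' c x := by
    ext i j
    change unitEntry p q (c • x) i j = c • unitEntry p q x i j
    by_cases h : i = p ∧ j = q
    · obtain ⟨rfl, rfl⟩ := h; simp only [unitEntry_self]
    · simp only [unitEntry_ne h, smul_zero]

theorem matUnit_apply_self (p : M.ι) (q : M'.ι) (x) : matUnit (M := M) (M' := M') p q x p q = x :=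
  unitEntry_self p q x

theorem matUnit_apply_ne {p i : M.ι} {q j : M'.ι} (h : ¬ (i = p ∧ j = q)) (x) :
    matUnit (M := M) (M' := M') p q x i j = 0 :=
  unitEntry_ne h x

theorem eq_sum_matUnit (f : M ⟶ M') : f = ∑ p, ∑ q, matUnit p q (f p q) := by
  ext i j
  rw [mat_sum_apply, Finset.sum_eq_single i, mat_sum_apply, Finset.sum_eq_single j]
  · exact (matUnit_apply_self i j _).symm
  · intro q _ h
    exact matUnit_apply_ne (fun e => h e.2.symm) _
  · simp
  · intro p _ h
    rw [mat_sum_apply]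
    exact Finset.sum_eq_zero fun q _ => matUnit_apply_ne (fun e => h e.1.symm) _
  · simp

theorem matTens_matUnit (p : M.ι) (q : M'.ι) (r : N.ι) (t : N'.ι) (x y) :
    matTens (matUnit p q x) (matUnit r t y) =
      matUnit (M := matTensObj M N) (M' := matTensObj M' N') (p, r) (q, t) (DotPerm.tens x y) := by
  ext ⟨i, k⟩ ⟨j, l⟩
  change DotPerm.tens (matUnit p q x i j) (matUnit r t y k l) = _
  by_cases h : (i, k) = (p, r) ∧ (j, l) = (q, t)
  · obtain ⟨h1, h2⟩ := h
    cases h1; cases h2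
    rw [matUnit_apply_self, matUnit_apply_self]
    exact (matUnit_apply_self (M := matTensObj M N) (M' := matTensObj M' N') (p, r) (q, t) _).symm
  · refine Eq.trans ?_ (matUnit_apply_ne (M := matTensObj M N) (M' := matTensObj M' N') h _).symm
    by_cases h1 : i = p ∧ j = q
    · rw [matUnit_apply_ne (p := r) (q := t) fun h2 => h (by
        rw [h1.1, h1.2, h2.1, h2.2]; exact ⟨rfl, rfl⟩)]
      exact (DotPerm.tens _).map_zero
    · rw [matUnit_apply_ne h1]
      exact LinearMap.map_zero₂ DotPerm.tens _

/-- The tensor product of matrices as a linear map. -/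
def matTensHom : (M ⟶ M') ⊗[ℂ] (N ⟶ N') →ₗ[ℂ] (matTensObj M N ⟶ matTensObj M' N') :=
  TensorProduct.lift (LinearMap.mk₂ ℂ matTens matTens_add_left matTens_smul_left matTens_add_right
    matTens_smul_right)

/-- The entry of a matrix as a linear map. -/
def matEntry (p : M.ι) (q : M'.ι) : (M ⟶ M') →ₗ[ℂ] DotPerm (M.X p).strands (M'.X q).strands where
  toFun f := f p q
  map_add' _ _ := rfl
  map_smul' _ _ := rfl

/-- A left inverse of the tensor product of matrices. -/
def matUntens : (matTensObj M N ⟶ matTensObj M' N') →ₗ[ℂ] (M ⟶ M') ⊗[ℂ] (N ⟶ N') :=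
  ∑ p : M.ι, ∑ q : M'.ι, ∑ r : N.ι, ∑ t : N'.ι,
    (TensorProduct.map (matUnit p q) (matUnit r t)).comp (DotPerm.untens.comp
      (matEntry (M := matTensObj M N) (M' := matTensObj M' N') (p, r) (q, t)))

theorem matUntens_matTens (f : M ⟶ M') (g : N ⟶ N') : matUntens (matTens f g) = f ⊗ₜ g := by
  have h : ∀ p q r t, (TensorProduct.map (matUnit p q) (matUnit r t)).comp (DotPerm.untens.comp
      (matEntry (M := matTensObj M N) (M' := matTensObj M' N') (p, r) (q, t))) (matTens f g) =
      matUnit p q (f p q) ⊗ₜ matUnit r t (g r t) := fun p q r t => by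
    change TensorProduct.map (matUnit p q) (matUnit r t)
      (DotPerm.untens (DotPerm.tens (f p q) (g r t))) = _
    rw [DotPerm.untens_tens, TensorProduct.map_tmul]
  simp only [matUntens, LinearMap.sum_apply, h, ← TensorProduct.tmul_sum, ← TensorProduct.sum_tmul,
    ← eq_sum_matUnit]

theorem matTensHom_injective :
    Function.Injective (matTensHom (M := M) (M' := M') (N := N) (N' := N')) := by
  refine Function.LeftInverse.injective (g := matUntens) fun z => ?_
  induction z with
  | zero => simp
  | add x y hx hy => rw [map_add, map_add, hx, hy]
  | tmul f g => exact matUntens_matTens f g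

theorem Along.mem_range_matTensHom {T T' V V' : Type} {l : Labels M T} {l' : Labels M' T'}
    {k : Labels N V} {k' : Labels N' V'} {σ : T ≃ T'} {τ : V ≃ V'}
    {f : matTensObj M N ⟶ matTensObj M' N'}
    (hf : Along (tensLabels l k) (tensLabels l' k') (Equiv.sumCongr σ τ) f) :
    f ∈ LinearMap.range (matTensHom (M := M) (M' := M') (N := N) (N' := N')) := by
  rw [eq_sum_matUnit f]
  refine Submodule.sum_mem _ fun p _ => Submodule.sum_mem _ fun q _ => ?_
  obtain ⟨r, hr⟩ := hf p q
  rw [strandEquiv_tens] at hr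
  obtain ⟨z, hz⟩ := DotPerm.single_mem_range_tens (strandEquiv l l' σ p.1 q.1)
    (strandEquiv k k' τ p.2 q.2) r
  rw [hr, ← hz]
  clear hz hr
  induction z with
  | zero => simp
  | add x y hx hy => rw [map_add, map_add]; exact Submodule.add_mem _ hx hy
  | tmul x y => exact ⟨matUnit p.1 q.1 x ⊗ₜ matUnit p.2 q.2 y, matTens_matUnit _ _ _ _ _ _⟩

end matUnit

/-! ### The Künneth formula for morphisms between tensor products -/

namespace Cx
variable {A A' B B' : Cx}

/-- Conjugation by the signs. -/
def sgnConj (A B : Cx) : (A.X ⟶ B.X) →ₗ[ℂ] (A.X ⟶ B.X) where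
  toFun f := A.sgn ≫ f ≫ B.sgn
  map_add' f g := by simp
  map_smul' c f := by simp

theorem sgnConj_apply (f : A.X ⟶ B.X) : sgnConj A B f = A.sgn ≫ f ≫ B.sgn := rfl

theorem sgnConj_sgnConj (f : A.X ⟶ B.X) : sgnConj A B (sgnConj A B f) = f := by
  simp [sgnConj_apply]

theorem even_sgnConj (f : A.X ⟶ B.X) : even (sgnConj A B f) = even f := by
  rw [even, even, ← sgnConj_apply, ← sgnConj_apply, sgnConj_sgnConj, add_comm]

theorem odd_sgnConj (f : A.X ⟶ B.X) : odd (sgnConj A B f) = -odd f := by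
  rw [odd, odd, ← sgnConj_apply, ← sgnConj_apply, sgnConj_sgnConj, ← smul_neg, neg_sub]

/-- The even part as a linear map. -/
def evenHom (A B : Cx) : (A.X ⟶ B.X) →ₗ[ℂ] (A.X ⟶ B.X) :=
  (1 / 2 : ℂ) • (LinearMap.id + sgnConj A B)

/-- The odd part as a linear map. -/
def oddHom (A B : Cx) : (A.X ⟶ B.X) →ₗ[ℂ] (A.X ⟶ B.X) :=
  (1 / 2 : ℂ) • (LinearMap.id - sgnConj A B)

theorem evenHom_evenHom (f : A.X ⟶ B.X) : evenHom A B (evenHom A B f) = evenHom A B f := by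
  simp only [evenHom, LinearMap.smul_apply, LinearMap.add_apply, LinearMap.id_apply, map_add,
    map_smul, sgnConj_sgnConj]
  module

theorem oddHom_oddHom (f : A.X ⟶ B.X) : oddHom A B (oddHom A B f) = oddHom A B f := by
  simp only [oddHom, LinearMap.smul_apply, LinearMap.sub_apply, LinearMap.id_apply, map_sub,
    map_smul, sgnConj_sgnConj]
  module

theorem evenHom_oddHom (f : A.X ⟶ B.X) : evenHom A B (oddHom A B f) = 0 := by
  simp only [evenHom, oddHom, LinearMap.smul_apply, LinearMap.sub_apply, LinearMap.add_apply,
    LinearMap.id_apply, map_sub, map_smul, sgnConj_sgnConj]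
  module

theorem oddHom_evenHom (f : A.X ⟶ B.X) : oddHom A B (evenHom A B f) = 0 := by
  simp only [evenHom, oddHom, LinearMap.smul_apply, LinearMap.sub_apply, LinearMap.add_apply,
    LinearMap.id_apply, map_add, map_smul, sgnConj_sgnConj]
  module

theorem evenHom_add_oddHom (f : A.X ⟶ B.X) : evenHom A B f + oddHom A B f = f := by
  simp only [evenHom, oddHom, LinearMap.smul_apply, LinearMap.sub_apply, LinearMap.add_apply,
    LinearMap.id_apply]
  module

/-- Composition with the sign. -/
def compSgn (A B : Cx) : (A.X ⟶ B.X) →ₗ[ℂ] (A.X ⟶ B.X) where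
  toFun f := f ≫ B.sgn
  map_add' f g := by simp
  map_smul' c f := by simp

theorem compSgn_apply (f : A.X ⟶ B.X) : compSgn A B f = f ≫ B.sgn := rfl

theorem compSgn_compSgn (f : A.X ⟶ B.X) : compSgn A B (compSgn A B f) = f := by
  simp [compSgn_apply]

/-- The sign rule for `(a ⊗ 1) ≫ (1 ⊗ b)`: an odd `b` is moved past the target of `a`. It is an
involution. -/
def koszulTwist (A A' B B' : Cx) :
    (A.X ⟶ A'.X) ⊗[ℂ] (B.X ⟶ B'.X) →ₗ[ℂ] (A.X ⟶ A'.X) ⊗[ℂ] (B.X ⟶ B'.X) :=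
  TensorProduct.map LinearMap.id (evenHom B B') + TensorProduct.map (compSgn A A') (oddHom B B')

theorem koszulTwist_koszulTwist (w : (A.X ⟶ A'.X) ⊗[ℂ] (B.X ⟶ B'.X)) :
    koszulTwist A A' B B' (koszulTwist A A' B B' w) = w := by
  induction w with
  | zero => simp
  | add x y hx hy => rw [map_add, map_add, hx, hy]
  | tmul a b =>
    simp only [koszulTwist, LinearMap.add_apply, TensorProduct.map_tmul, map_add,
      LinearMap.id_apply, evenHom_evenHom, oddHom_oddHom, evenHom_oddHom, oddHom_evenHom,
      compSgn_compSgn, TensorProduct.tmul_zero, add_zero, zero_add, ← TensorProduct.tmul_add,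
      evenHom_add_oddHom]

/-- The linear map with values `(a ⊗ 1) ≫ (1 ⊗ b)`. -/
def tensPair (A A' B B' : Cx) :
    (A.X ⟶ A'.X) ⊗[ℂ] (B.X ⟶ B'.X) →ₗ[ℂ] ((tens A B).X ⟶ (tens A' B').X) :=
  matTensHom ∘ₗ koszulTwist A A' B B'

theorem tensPair_injective : Function.Injective (tensPair A A' B B') :=
  matTensHom_injective.comp (Function.LeftInverse.injective koszulTwist_koszulTwist)

theorem range_tensPair : LinearMap.range (tensPair A A' B B') = LinearMap.range matTensHom :=
  LinearMap.range_comp_of_range_eq_top _ (LinearMap.range_eq_top.mpr fun w =>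
    ⟨_, koszulTwist_koszulTwist w⟩)

theorem tensPair_tmul {a : A.X ⟶ A'.X} {b : B.X ⟶ B'.X} (ha : a ∈ maps A A')
    (hb : b ∈ maps B B') :
    tensPair A A' B B' (a ⊗ₜ b) =
      ((rightMap a B : (tens A B).X ⟶ (tens A' B).X) ≫ leftMap A' b) := by
  have h1 : rightMap a B ≫ leftMap A' b = matTens (a ≫ A'.e) (B.e ≫ even b) +
      matTens (a ≫ A'.sgn ≫ A'.e) (B.e ≫ odd b) := by
    rw [rightMap, leftMap, Preadditive.comp_add, matTens_comp, matTens_comp]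
  rw [h1, ← e_sgn, ← Category.assoc a, ha.2, (even_mem_maps hb).1, (odd_mem_maps hb).1]
  rfl

theorem sgn_leftMap_sgn (C : Cx) (b : B.X ⟶ B'.X) :
    (tens C B).sgn ≫ leftMap C b ≫ (tens C B').sgn = leftMap C (sgnConj B B' b) := by
  rw [leftMap, leftMap, even_sgnConj, odd_sgnConj, tens_sgn, tens_sgn, Preadditive.add_comp,
    Preadditive.comp_add, matTens_comp, matTens_comp, matTens_comp, matTens_comp, even_sgn,
    odd_sgn]
  simp [matTens_neg_right]

/-- The Hom complex of two tensor products contains the tensor product of the Hom complexes of the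
factors. -/
theorem delta_tensPair (hA : ∀ a : A.X ⟶ A'.X, a ∈ maps A A') (hB : ∀ b : B.X ⟶ B'.X, b ∈ maps B B')
    (w : (A.X ⟶ A'.X) ⊗[ℂ] (B.X ⟶ B'.X)) :
    delta (tens A B) (tens A' B') (tensPair A A' B B' w) =
      tensPair A A' B B' (tensorDelta (delta A A') (delta B B') (sgnConj B B') w) := by
  induction w with
  | zero => simp only [map_zero]
  | add x y hx hy => simp only [map_add, hx, hy]
  | tmul a b =>
    have h : tensorDelta (delta A A') (delta B B') (sgnConj B B') (a ⊗ₜ b) =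
      a ⊗ₜ delta B B' b + delta A A' a ⊗ₜ sgnConj B B' b := rfl
    rw [h, map_add, tensPair_tmul (hA _) (hB _), tensPair_tmul (hA _) (hB _),
      tensPair_tmul (hA _) (hB _), delta_comp_eq, leftMap_delta _ _ (hB _),
      rightMap_delta _ _ (hA _), sgn_leftMap_sgn]

end Cx

namespace CubeTree

variable {s s' t t' : CubeTree}

/-- A morphism of a tensor product which respects the decomposition of the strands is a sum of
products of morphisms of the factors. -/
theorem Supported.mem_span_tens {σ : Strand s ≃ Strand s'} {τ : Strand t ≃ Strand t'}
    {f : (tensor s t).obj ⟶ (tensor s' t').obj}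
    (hf : Supported (s := .tensor s t) (t := .tensor s' t') (Equiv.sumCongr σ τ) f) :
    f ∈ Submodule.span ℂ {g : (tensor s t).obj ⟶ (tensor s' t').obj | ∃ (a : s.obj ⟶ s'.obj)
      (b : t.obj ⟶ t'.obj), g = whiskerRight a t.obj ≫ whiskerLeft s'.obj b} := by
  obtain ⟨g, hg, rfl, h⟩ := hf
  have h1 : g ∈ LinearMap.range (tensPair s.obj s'.obj t.obj t'.obj) := by
    rw [range_tensPair]; exact Along.mem_range_matTensHom h
  obtain ⟨w, rfl⟩ := h1
  have hw : tensorDelta (delta s.obj s'.obj) (delta t.obj t'.obj) (sgnConj t.obj t'.obj) w = 0 := by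
    refine tensPair_injective ?_
    rw [← delta_tensPair (mem_maps s s') (mem_maps t t'), map_zero]
    exact hg.2
  obtain ⟨v, hv⟩ := exists_tensorDelta (fun _ => delta_delta _) (fun _ => delta_delta _)
    sgnConj_sgnConj (fun x => by rw [sgnConj_apply, delta_sgn_conj]; rfl) hw
  -- a product of closed matrices represents a product of morphisms
  have key : ∀ z ∈ Submodule.span ℂ {z | ∃ a b, delta s.obj s'.obj a = 0 ∧
      delta t.obj t'.obj b = 0 ∧ z = a ⊗ₜ[ℂ] b},
      ∃ hz : tensPair s.obj s'.obj t.obj t'.obj z ∈ cycles (tensor s t).obj (tensor s' t').obj,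
        cls _ hz ∈ Submodule.span ℂ {g : (tensor s t).obj ⟶ (tensor s' t').obj |
          ∃ (a : s.obj ⟶ s'.obj) (b : t.obj ⟶ t'.obj),
            g = whiskerRight a t.obj ≫ whiskerLeft s'.obj b} := by
    intro z hz
    induction hz using Submodule.span_induction with
    | mem z hz =>
      obtain ⟨a, b, ha, hb, rfl⟩ := hz
      have ha' : a ∈ cycles s.obj s'.obj := ⟨mem_maps _ _ _, ha⟩
      have hb' : b ∈ cycles t.obj t'.obj := ⟨mem_maps _ _ _, hb⟩
      rw [tensPair_tmul ha'.1 hb'.1]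
      exact ⟨comp_mem_cycles (rightMap_mem_cycles _ ha') (leftMap_mem_cycles _ hb'),
        Submodule.subset_span ⟨cls a ha', cls b hb', rfl⟩⟩
    | zero => rw [map_zero]; exact ⟨Submodule.zero_mem _, Submodule.zero_mem _⟩
    | add x y _ _ hx hy =>
      obtain ⟨hx, hx'⟩ := hx
      obtain ⟨hy, hy'⟩ := hy
      rw [map_add]
      exact ⟨Submodule.add_mem _ hx hy, Submodule.add_mem _ hx' hy'⟩
    | smul c x _ hx =>
      obtain ⟨hx, hx'⟩ := hx
      rw [map_smul]
      exact ⟨Submodule.smul_mem _ c hx, Submodule.smul_mem _ c hx'⟩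
  obtain ⟨hz, hz'⟩ := key _ hv
  have heq : cls _ hg = cls _ hz := by
    refine (cls_eq_cls _ _).mpr ⟨tensPair s.obj s'.obj t.obj t'.obj v,
      mem_maps (.tensor s t) (.tensor s' t') _, ?_⟩
    refine (delta_tensPair (mem_maps s s') (mem_maps t t') v).trans ?_
    rw [map_sub]
    exact (sub_sub_cancel _ _).symm
  rw [heq]
  exact hz'

end CubeTree

/-! ### Strands and the structural isomorphisms -/

section labels
variable {M M' M'' N N' N'' : Mat_ PObj} {T T' T'' V V' V'' : Type}

theorem strandEquiv_assoc (l : Labels M T) (l' : Labels N T') (l'' : Labels M'' T'')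
    (p : (M.ι × N.ι) × M''.ι) (q : M.ι × N.ι × M''.ι) :
    strandEquiv (M := matTensObj (matTensObj M N) M'') (M' := matTensObj M (matTensObj N M''))
      (tensLabels (tensLabels l l') l'') (tensLabels l (tensLabels l' l''))
      (Equiv.sumAssoc T T' T'') p q =
    (DotPerm.sumPerm (DotPerm.sumPerm (strandEquiv l l (Equiv.refl T) p.1.1 q.1)
      (strandEquiv l' l' (Equiv.refl T') p.1.2 q.2.1))
      (strandEquiv l'' l'' (Equiv.refl T'') p.2 q.2.2)).trans
      (finCongr (Nat.add_assoc _ _ _)) := by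
  refine Equiv.ext fun i => ?_
  obtain ⟨i, rfl⟩ := finSumFinEquiv.surjective i
  rcases i with i | i
  · obtain ⟨i, rfl⟩ := finSumFinEquiv.surjective i
    rcases i with i | i <;>
      simp [strandEquiv, tensLabels, DotPerm.sumPerm, Fin.ext_iff]
  · simp [strandEquiv, tensLabels, DotPerm.sumPerm, Fin.ext_iff, Nat.add_assoc]

theorem strandEquiv_swap (l : Labels M T) (l' : Labels N T') (p : M.ι × N.ι) (q : N.ι × M.ι) :
    strandEquiv (M := matTensObj M N) (M' := matTensObj N M) (tensLabels l l') (tensLabels l' l)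
      (Equiv.sumComm T T') p q =
    (DotPerm.sumPerm (strandEquiv l l (Equiv.refl T) p.1 q.2)
      (strandEquiv l' l' (Equiv.refl T') p.2 q.1)).trans finAddFlip := by
  refine Equiv.ext fun i => ?_
  obtain ⟨i, rfl⟩ := finSumFinEquiv.surjective i
  rcases i with i | i <;> simp [strandEquiv, tensLabels, DotPerm.sumPerm]

theorem along_matAssoc (l : Labels M T) (l' : Labels N T') (l'' : Labels M'' T'') :
    Along (tensLabels (tensLabels l l') l'') (tensLabels l (tensLabels l' l''))
      (Equiv.sumAssoc T T' T'') (matAssoc (𝟙 M) (𝟙 N) (𝟙 M'')) := by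
  intro p q
  obtain ⟨a, ha⟩ := along_id l p.1.1 q.1
  obtain ⟨b, hb⟩ := along_id l' p.1.2 q.2.1
  obtain ⟨c, hc⟩ := along_id l'' p.2 q.2.2
  refine ⟨?_, ?_⟩
  rotate_left
  · change DotPerm.comp (DotPerm.tens (DotPerm.tens ((𝟙 M : M ⟶ M) p.1.1 q.1)
      ((𝟙 N : N ⟶ N) p.1.2 q.2.1)) ((𝟙 M'' : M'' ⟶ M'') p.2 q.2.2)) _ = _
    rw [ha, hb, hc, DotPerm.tens_single, DotPerm.tens_single, DotPerm.comp_single,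
      strandEquiv_assoc]

theorem along_matSwap (l : Labels M T) (l' : Labels N T') :
    Along (tensLabels l l') (tensLabels l' l) (Equiv.sumComm T T') (matSwap (𝟙 M) (𝟙 N)) := by
  intro p q
  obtain ⟨a, ha⟩ := along_id l p.1 q.2
  obtain ⟨b, hb⟩ := along_id l' p.2 q.1
  refine ⟨?_, ?_⟩
  rotate_left
  · change DotPerm.comp (DotPerm.tens ((𝟙 M : M ⟶ M) p.1 q.2) ((𝟙 N : N ⟶ N) p.2 q.1)) _ = _
    rw [ha, hb, DotPerm.tens_single, DotPerm.comp_single, strandEquiv_swap]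

theorem strandEquiv_assoc_inv (l : Labels M T) (l' : Labels N T') (l'' : Labels M'' T'')
    (p : M.ι × N.ι × M''.ι) (q : (M.ι × N.ι) × M''.ι) :
    strandEquiv (M := matTensObj M (matTensObj N M'')) (M' := matTensObj (matTensObj M N) M'')
      (tensLabels l (tensLabels l' l'')) (tensLabels (tensLabels l l') l'')
      (Equiv.sumAssoc T T' T'').symm p q =
    (DotPerm.sumPerm (strandEquiv l l (Equiv.refl T) p.1 q.1.1)
      (DotPerm.sumPerm (strandEquiv l' l' (Equiv.refl T') p.2.1 q.1.2)
      (strandEquiv l'' l'' (Equiv.refl T'') p.2.2 q.2))).trans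
      (finCongr (Nat.add_assoc _ _ _).symm) := by
  refine Equiv.ext fun i => ?_
  obtain ⟨i, rfl⟩ := finSumFinEquiv.surjective i
  rcases i with i | i
  · simp [strandEquiv, tensLabels, DotPerm.sumPerm, Fin.ext_iff]
  · obtain ⟨i, rfl⟩ := finSumFinEquiv.surjective i
    rcases i with i | i <;>
      simp [strandEquiv, tensLabels, DotPerm.sumPerm, Fin.ext_iff, Nat.add_assoc]

theorem along_matAssocInv (l : Labels M T) (l' : Labels N T') (l'' : Labels M'' T'') :
    Along (tensLabels l (tensLabels l' l'')) (tensLabels (tensLabels l l') l'')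
      (Equiv.sumAssoc T T' T'').symm (matAssocInv (𝟙 M) (𝟙 N) (𝟙 M'')) := by
  intro p q
  obtain ⟨a, ha⟩ := along_id l p.1 q.1.1
  obtain ⟨b, hb⟩ := along_id l' p.2.1 q.1.2
  obtain ⟨c, hc⟩ := along_id l'' p.2.2 q.2
  refine ⟨?_, ?_⟩
  rotate_left
  · change DotPerm.comp (DotPerm.tens ((𝟙 M : M ⟶ M) p.1 q.1.1)
      (DotPerm.tens ((𝟙 N : N ⟶ N) p.2.1 q.1.2) ((𝟙 M'' : M'' ⟶ M'') p.2.2 q.2))) _ = _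
    rw [ha, hb, hc, DotPerm.tens_single, DotPerm.tens_single, DotPerm.comp_single,
      strandEquiv_assoc_inv]

end labels

namespace CubeTree

theorem supported_id (s : CubeTree) : Supported (Equiv.refl _) (𝟙 s.obj) :=
  ⟨s.obj.e, e_mem_cycles _, id_eq_cls _, by rw [obj_e]; exact along_id _⟩

theorem Supported.whiskerRight {s t : CubeTree} {σ : Strand s ≃ Strand t} {f : s.obj ⟶ t.obj}
    (hf : Supported σ f) (u : CubeTree) :
    Supported (s := .tensor s u) (t := .tensor t u) (Equiv.sumCongr σ (Equiv.refl _))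
      (Cx.whiskerRight f u.obj) := by
  obtain ⟨g, hg, rfl, h⟩ := hf
  refine ⟨rightMap g u.obj, rightMap_mem_cycles _ hg, rfl, ?_⟩
  rw [rightMap, obj_e]
  exact h.tens (along_id _)

theorem Supported.whiskerLeft {s t : CubeTree} {σ : Strand s ≃ Strand t} {f : s.obj ⟶ t.obj}
    (hf : Supported σ f) (u : CubeTree) :
    Supported (s := .tensor u s) (t := .tensor u t) (Equiv.sumCongr (Equiv.refl _) σ)
      (Cx.whiskerLeft u.obj f) := by
  obtain ⟨g, hg, rfl, h⟩ := hf
  refine ⟨leftMap u.obj g, leftMap_mem_cycles _ hg, rfl, ?_⟩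
  have h1 : Along (labels s) (labels t) σ (s.obj.sgn ≫ g ≫ t.obj.sgn) :=
    (along_sgn (labels s)).comp (h.comp (along_sgn (labels t)))
  rw [leftMap, obj_e, Category.comp_id]
  exact ((along_id _).tens ((h.add h1).smul _)).add ((along_sgn _).tens ((h.sub h1).smul _))

theorem supported_assocHom (s t u : CubeTree) :
    Supported (s := .tensor (.tensor s t) u) (t := .tensor s (.tensor t u))
      (Equiv.sumAssoc _ _ _) (assocHom s.obj t.obj u.obj) := by
  refine ⟨matAssoc s.obj.e t.obj.e u.obj.e, _, rfl, ?_⟩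
  rw [obj_e, obj_e, obj_e]
  exact along_matAssoc (labels s) (labels t) (labels u)

theorem supported_assocInv (s t u : CubeTree) :
    Supported (s := .tensor s (.tensor t u)) (t := .tensor (.tensor s t) u)
      (Equiv.sumAssoc _ _ _).symm (assocInv s.obj t.obj u.obj) := by
  refine ⟨matAssocInv s.obj.e t.obj.e u.obj.e, _, rfl, ?_⟩
  rw [obj_e, obj_e, obj_e]
  exact along_matAssocInv (labels s) (labels t) (labels u)

theorem supported_braiding (s t : CubeTree) :
    Supported (s := .tensor s t) (t := .tensor t s) (Equiv.sumComm _ _)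
      (braiding s.obj t.obj) := by
  refine ⟨braidMat s.obj t.obj, _, rfl, ?_⟩
  intro p q
  obtain ⟨a, ha⟩ := along_matSwap (labels s) (labels t) p q
  refine ⟨(s.obj.hdeg p.1 * t.obj.hdeg p.2).negOnePow • a, ?_⟩
  refine Eq.trans ?_ (DotPerm.units_smul_single _ _ _)
  rw [← obj_e, ← obj_e] at ha
  exact congrArg (fun z => (s.obj.hdeg p.1 * t.obj.hdeg p.2).negOnePow • z) ha

/-! ### Bringing a factor to the front -/

variable (e : ∀ n m : ℕ+, AnnularCube.cube (n + m) ≅ cubeCone n m)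

/-- The morphisms generated by the merge and split maps of given isomorphisms with cones. -/
abbrev Gen (s t : CubeTree) (f : s.obj ⟶ t.obj) : Prop :=
  Generated (fun n m => mergeOf (e n m)) (fun n m => splitOf (e n m)) s t f

/-- An isomorphism of tensor products of cubes given by permuting factors and parentheses: it is
generated together with its inverse, and moves the strands along a bijection that preserves the
blocks. -/
structure Rearrangement (s t : CubeTree) where
  iso : s.obj ≅ t.obj
  strands : Strand s ≃ Strand t
  gen_hom : Gen e s t iso.hom
  gen_inv : Gen e t s iso.inv
  supported_hom : Supported strands iso.hom
  supported_inv : Supported strands.symm iso.inv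
  sameBlock : ∀ i j, SameBlock t (strands i) (strands j) ↔ SameBlock s i j
  blocks_eq : blocks s = blocks t

namespace Rearrangement
variable {e}

/-- The identity. -/
def refl (s : CubeTree) : Rearrangement e s s where
  iso := Iso.refl _
  strands := Equiv.refl _
  gen_hom := .id s
  gen_inv := .id s
  supported_hom := supported_id s
  supported_inv := supported_id s
  sameBlock _ _ := Iff.rfl
  blocks_eq := rfl

/-- Composition. -/
def trans {s t u : CubeTree} (a : Rearrangement e s t) (b : Rearrangement e t u) :
    Rearrangement e s u where
  iso := a.iso ≪≫ b.iso
  strands := a.strands.trans b.strands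
  gen_hom := .comp a.gen_hom b.gen_hom
  gen_inv := .comp b.gen_inv a.gen_inv
  supported_hom := a.supported_hom.comp b.supported_hom
  supported_inv := b.supported_inv.comp a.supported_inv
  sameBlock i j := (b.sameBlock _ _).trans (a.sameBlock i j)
  blocks_eq := a.blocks_eq.trans b.blocks_eq

/-- Tensor product with a further factor on the right. -/
def whiskerRight {s t : CubeTree} (a : Rearrangement e s t) (u : CubeTree) :
    Rearrangement e (.tensor s u) (.tensor t u) where
  iso :=
    { hom := Cx.whiskerRight a.iso.hom u.obj
      inv := Cx.whiskerRight a.iso.inv u.obj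
      hom_inv_id := (whiskerRight_comp _ _ _).symm.trans (by rw [a.iso.hom_inv_id]; rfl)
      inv_hom_id := (whiskerRight_comp _ _ _).symm.trans (by rw [a.iso.inv_hom_id]; rfl) }
  strands := Equiv.sumCongr a.strands (Equiv.refl _)
  gen_hom := .whiskerRight u a.gen_hom
  gen_inv := .whiskerRight u a.gen_inv
  supported_hom := a.supported_hom.whiskerRight u
  supported_inv := a.supported_inv.whiskerRight u
  sameBlock := by
    rintro (i | i) (j | j)
    exacts [a.sameBlock i j, Iff.rfl, Iff.rfl, Iff.rfl]
  blocks_eq := congrArg (· + blocks u) a.blocks_eq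

/-- Tensor product with a further factor on the left. -/
def whiskerLeft {s t : CubeTree} (u : CubeTree) (a : Rearrangement e s t) :
    Rearrangement e (.tensor u s) (.tensor u t) where
  iso :=
    { hom := Cx.whiskerLeft u.obj a.iso.hom
      inv := Cx.whiskerLeft u.obj a.iso.inv
      hom_inv_id := (whiskerLeft_comp _ _ _).symm.trans
        (by rw [a.iso.hom_inv_id]; exact whiskerLeft_id _ _)
      inv_hom_id := (whiskerLeft_comp _ _ _).symm.trans
        (by rw [a.iso.inv_hom_id]; exact whiskerLeft_id _ _) }
  strands := Equiv.sumCongr (Equiv.refl _) a.strands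
  gen_hom := .whiskerLeft u a.gen_hom
  gen_inv := .whiskerLeft u a.gen_inv
  supported_hom := a.supported_hom.whiskerLeft u
  supported_inv := a.supported_inv.whiskerLeft u
  sameBlock := by
    rintro (i | i) (j | j)
    exacts [Iff.rfl, Iff.rfl, Iff.rfl, a.sameBlock i j]
  blocks_eq := congrArg (blocks u + ·) a.blocks_eq

/-- Moving parentheses to the right. -/
def assoc (s t u : CubeTree) :
    Rearrangement e (.tensor (.tensor s t) u) (.tensor s (.tensor t u)) where
  iso := assocIso _ _ _
  strands := Equiv.sumAssoc _ _ _
  gen_hom := .assocHom s t u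
  gen_inv := .assocInv s t u
  supported_hom := supported_assocHom s t u
  supported_inv := supported_assocInv s t u
  sameBlock := by
    rintro ((i | i) | i) ((j | j) | j) <;> exact Iff.rfl
  blocks_eq := Nat.add_assoc _ _ _

/-- Moving parentheses to the left. -/
def assocSymm (s t u : CubeTree) :
    Rearrangement e (.tensor s (.tensor t u)) (.tensor (.tensor s t) u) where
  iso := (assocIso _ _ _).symm
  strands := (Equiv.sumAssoc _ _ _).symm
  gen_hom := .assocInv s t u
  gen_inv := .assocHom s t u
  supported_hom := supported_assocInv s t u
  supported_inv := supported_assocHom s t u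
  sameBlock := by
    rintro (i | i | i) (j | j | j) <;> exact Iff.rfl
  blocks_eq := (Nat.add_assoc _ _ _).symm

/-- Exchanging two factors. -/
def braid (s t : CubeTree) : Rearrangement e (.tensor s t) (.tensor t s) where
  iso := braidIso _ _
  strands := Equiv.sumComm _ _
  gen_hom := .braiding s t
  gen_inv := .braiding t s
  supported_hom := supported_braiding s t
  supported_inv := supported_braiding t s
  sameBlock := by
    rintro (i | i) (j | j) <;> exact Iff.rfl
  blocks_eq := Nat.add_comm _ _

end Rearrangement

/-- The factor containing a given strand can be brought to the front. -/
theorem exists_rearrangement : ∀ (s : CubeTree) (i : Strand s),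
    (∃ n, s = .cube n) ∨ ∃ (n : ℕ+) (r : CubeTree) (a : Rearrangement e s (.tensor (.cube n) r))
      (i' : Fin n), a.strands i = Sum.inl i'
  | .cube n, _ => .inl ⟨n, rfl⟩
  | .tensor s t, .inl i => by
    rcases exists_rearrangement s i with ⟨n, rfl⟩ | ⟨n, r, a, i', hi⟩
    · exact .inr ⟨n, t, .refl _, i, rfl⟩
    · refine .inr ⟨n, .tensor r t, (a.whiskerRight t).trans (.assoc _ _ _), i', ?_⟩
      change Equiv.sumAssoc _ _ _ (Sum.inl (a.strands i)) = _
      rw [hi]; rfl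
  | .tensor s t, .inr i => by
    rcases exists_rearrangement t i with ⟨n, rfl⟩ | ⟨n, r, a, i', hi⟩
    · exact .inr ⟨n, s, .braid _ _, i, rfl⟩
    · refine .inr ⟨n, .tensor r s, ((Rearrangement.braid s t).trans (a.whiskerRight s)).trans
        (.assoc _ _ _), i', ?_⟩
      change Equiv.sumAssoc _ _ _ (Sum.inl (a.strands i)) = _
      rw [hi]; rfl

/-- Two distinct factors can be brought to the front. -/
theorem exists_rearrangement₂ (s : CubeTree) (i j : Strand s) (h : ¬ SameBlock s i j) :
    (∃ (n m : ℕ+) (a : Rearrangement e s (.tensor (.cube n) (.cube m))) (i' : Fin n) (j' : Fin m),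
      a.strands i = Sum.inl i' ∧ a.strands j = Sum.inr j') ∨
    ∃ (n m : ℕ+) (r : CubeTree) (a : Rearrangement e s (.tensor (.tensor (.cube n) (.cube m)) r))
      (i' : Fin n) (j' : Fin m),
      a.strands i = Sum.inl (Sum.inl i') ∧ a.strands j = Sum.inl (Sum.inr j') := by
  rcases exists_rearrangement e s i with ⟨n, rfl⟩ | ⟨n, r, a, i', hi⟩
  · exact absurd trivial h
  rw [← a.sameBlock, hi] at h
  rcases hj : a.strands j with k | k
  · rw [hj] at h; exact absurd trivial h
  rcases exists_rearrangement e r k with ⟨m, rfl⟩ | ⟨m, r', b, j', hj'⟩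
  · exact .inl ⟨n, m, a, i', k, hi, hj⟩
  · refine .inr ⟨n, m, r', (a.trans (b.whiskerLeft (.cube n))).trans (.assocSymm _ _ _), i', j',
      ?_, ?_⟩
    · change (Equiv.sumAssoc _ _ _).symm (Equiv.sumCongr _ _ (a.strands i)) = _
      rw [hi]; rfl
    · change (Equiv.sumAssoc _ _ _).symm (Equiv.sumCongr _ _ (a.strands j)) = _
      rw [hj]
      change (Equiv.sumAssoc _ _ _).symm (Sum.inr (b.strands k)) = _
      rw [hj']; rfl

end CubeTree

/-! ### Generation of all morphisms -/

/-- A bijection of sums which maps left to left and right to right summands is a sum. -/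
theorem exists_sumCongr {A B C D : Type} (σ : A ⊕ B ≃ C ⊕ D)
    (h1 : ∀ a, ∃ c, σ (Sum.inl a) = Sum.inl c) (h2 : ∀ b, ∃ d, σ (Sum.inr b) = Sum.inr d) :
    ∃ (α : A ≃ C) (β : B ≃ D), σ = Equiv.sumCongr α β := by
  choose f hf using h1
  choose g hg using h2
  have hf' : Function.Bijective f := by
    refine ⟨fun a a' h => Sum.inl_injective (σ.injective (by rw [hf, hf, h])), fun c => ?_⟩
    obtain ⟨a | b, h⟩ := σ.surjective (Sum.inl c)
    · exact ⟨a, Sum.inl_injective ((hf a).symm.trans h)⟩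
    · exact (Sum.inr_ne_inl ((hg b).symm.trans h)).elim
  have hg' : Function.Bijective g := by
    refine ⟨fun a a' h => Sum.inr_injective (σ.injective (by rw [hg, hg, h])), fun c => ?_⟩
    obtain ⟨a | b, h⟩ := σ.surjective (Sum.inr c)
    · exact (Sum.inl_ne_inr ((hf a).symm.trans h)).elim
    · exact ⟨b, Sum.inr_injective ((hg b).symm.trans h)⟩
  refine ⟨Equiv.ofBijective f hf', Equiv.ofBijective g hg', ?_⟩
  ext (a | b)
  · exact hf a
  · exact hg b

namespace CubeTree

/-- In `Cube_n ⊗ Cube_m` the difference of the dots on strands of the two factors is the junction. -/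
theorem junction_eq_dot_sub (n m : ℕ+) (i : Fin n) (j : Fin m) :
    junction n m = dot (.tensor (.cube n) (.cube m)) (Sum.inl i) -
      dot (.tensor (.cube n) (.cube m)) (Sum.inr j) := by
  rw [junction_eq, xAct_eq n _ i, xAct_eq m _ j, whiskerRight_xAct, whiskerLeft_xAct]
  rfl

theorem whiskerRight_junction_eq (n m : ℕ+) (i : Fin n) (j : Fin m) (r : CubeTree) :
    Cx.whiskerRight (junction n m) r.obj =
      dot (.tensor (.tensor (.cube n) (.cube m)) r) (Sum.inl (Sum.inl i)) -
      dot (.tensor (.tensor (.cube n) (.cube m)) r) (Sum.inl (Sum.inr j)) := by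
  rw [junction_eq_dot_sub n m i j]
  refine (whiskerRight_sub _ _ _).trans ?_
  exact congrArg₂ (· - ·) (whiskerRight_dot (.tensor (.cube n) (.cube m)) r (Sum.inl i))
    (whiskerRight_dot (.tensor (.cube n) (.cube m)) r (Sum.inr j))

variable {e : ∀ n m : ℕ+, AnnularCube.cube (n + m) ≅ cubeCone n m}
variable {s t : CubeTree} {σ : Strand s ≃ Strand t} {f : s.obj ⟶ t.obj}

theorem comp_eq_zero_of_eq_sub {X Y Z : Cx} {d d' j : Y ⟶ Z} (hj : j = d - d') {g : X ⟶ Y}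
    (h : g ≫ d = g ≫ d') : g ≫ j = 0 := by
  rw [hj, Preadditive.comp_sub, h, sub_self]

theorem eq_sub_comp_eq_zero {X Y Z : Cx} {d d' j : X ⟶ Y} (hj : j = d - d') {g : Y ⟶ Z}
    (h : d ≫ g = d' ≫ g) : j ≫ g = 0 := by
  rw [hj, Preadditive.sub_comp, h, sub_self]

theorem Supported.comp_dot_eq (hf : Supported σ f) {i j : Strand s} (h : SameBlock s i j)
    {k l : Strand t} (hk : σ i = k) (hl : σ j = l) : f ≫ dot t k = f ≫ dot t l := by
  rw [← hk, ← hl, ← hf.dot_comp, ← hf.dot_comp, dot_eq_of_sameBlock s i j h]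

theorem Supported.dot_comp_eq (hf : Supported σ f) {i j : Strand t} (h : SameBlock t i j)
    {k l : Strand s} (hk : σ k = i) (hl : σ l = j) : dot s k ≫ f = dot s l ≫ f := by
  rw [hf.dot_comp, hf.dot_comp, hk, hl, dot_eq_of_sameBlock t i j h]

theorem Gen.congr {g : s.obj ⟶ t.obj} (h : f = g) (hg : Gen e s t g) : Gen e s t f := h ▸ hg

theorem Gen.of_span {S : Set (s.obj ⟶ t.obj)} (h : ∀ g ∈ S, Gen e s t g)
    (hf : f ∈ Submodule.span ℂ S) : Gen e s t f := by
  induction hf using Submodule.span_induction with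
  | mem g hg => exact h g hg
  | zero => exact .zero s t
  | add x y _ _ hx hy => exact .add hx hy
  | smul c x _ hx => exact .smul c hx

theorem Gen.sum {κ : Type} (S : Finset κ) {F : κ → (s.obj ⟶ t.obj)}
    (h : ∀ i, Gen e s t (F i)) : Gen e s t (∑ i ∈ S, F i) :=
  Gen.of_span (S := Set.range F) (by rintro _ ⟨i, rfl⟩; exact h i)
    (Submodule.sum_mem _ fun i _ => Submodule.subset_span ⟨i, rfl⟩)

theorem Rearrangement.gen_of_hom {t' : CubeTree} (a : Rearrangement e t t')
    (h : Gen e s t' (f ≫ a.iso.hom)) : Gen e s t f := by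
  have := Generated.comp h a.gen_inv
  rwa [Category.assoc, Iso.hom_inv_id, Category.comp_id] at this

theorem Rearrangement.gen_of_inv {s' : CubeTree} (a : Rearrangement e s s')
    (h : Gen e s' t (a.iso.inv ≫ f)) : Gen e s t f := by
  have := Generated.comp a.gen_hom h
  rwa [Iso.hom_inv_id_assoc] at this

theorem Gen.comp_splitOf {n m : ℕ+} {g : s.obj ⟶ (CubeTree.cube (n + m)).obj}
    (h : Gen e s (.cube (n + m)) g) :
    Gen e s (tensor (.cube n) (.cube m)) (g ≫ splitOf (e n m)) :=
  Generated.comp h (.split n m)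

theorem Gen.comp_whiskerRight_splitOf {n m : ℕ+} {r : CubeTree}
    {g : s.obj ⟶ (tensor (.cube (n + m)) r).obj} (h : Gen e s (.tensor (.cube (n + m)) r) g) :
    Gen e s (tensor (.tensor (.cube n) (.cube m)) r)
      (g ≫ Cx.whiskerRight (splitOf (e n m)) r.obj) :=
  Generated.comp h (.whiskerRight r (.split n m))

theorem gen_mergeOf (n m : ℕ+) : Gen e (tensor (.cube n) (.cube m)) (.cube (n + m))
    (mergeOf (e n m)) :=
  .merge n m

theorem gen_whiskerRight_mergeOf (n m : ℕ+) (r : CubeTree) :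
    Gen e (tensor (.tensor (.cube n) (.cube m)) r) (.tensor (.cube (n + m)) r)
      (Cx.whiskerRight (mergeOf (e n m)) r.obj) :=
  .whiskerRight r (gen_mergeOf n m)

theorem Gen.comp {u : CubeTree} {g : t.obj ⟶ u.obj} (hf : Gen e s t f) (hg : Gen e t u g) :
    Gen e s u (f ≫ g) :=
  Generated.comp hf hg

theorem Gen.mergeOf_comp {n m : ℕ+} {g : (CubeTree.cube (n + m)).obj ⟶ t.obj}
    (h : Gen e (.cube (n + m)) t g) :
    Gen e (tensor (.cube n) (.cube m)) t (mergeOf (e n m) ≫ g) :=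
  (gen_mergeOf n m).comp h

theorem Gen.whiskerRight_mergeOf_comp {n m : ℕ+} {r : CubeTree}
    {g : (tensor (.cube (n + m)) r).obj ⟶ t.obj} (h : Gen e (.tensor (.cube (n + m)) r) t g) :
    Gen e (tensor (.tensor (.cube n) (.cube m)) r) t
      (Cx.whiskerRight (mergeOf (e n m)) r.obj ≫ g) :=
  (gen_whiskerRight_mergeOf n m r).comp h

/-- A morphism to `Cube_n ⊗ Cube_m` on which dots of both factors agree factors through the split
map. -/
theorem gen_of_comp_dot_eq {n m : ℕ+} {f : s.obj ⟶ (tensor (.cube n) (.cube m)).obj} (i : Fin n)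
    (j : Fin m) (h : f ≫ dot (tensor (.cube n) (.cube m)) (Sum.inl i) =
      f ≫ dot (tensor (.cube n) (.cube m)) (Sum.inr j))
    (IH : ∀ g : s.obj ⟶ (CubeTree.cube (n + m)).obj, Gen e s (.cube (n + m)) g) :
    Gen e s (tensor (.cube n) (.cube m)) f := by
  have h1 := comp_eq_zero_of_eq_sub (X := s.obj) (Y := tens (AnnularCube.cube n) (AnnularCube.cube m))
    (Z := tens (AnnularCube.cube n) (AnnularCube.cube m)) (junction_eq_dot_sub n m i j) h
  obtain ⟨g, hg⟩ := exists_comp_splitOf (e n m) h1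
  exact Gen.congr hg (Gen.comp_splitOf (IH g))

theorem gen_of_comp_dot_eq_right {n m : ℕ+} {r : CubeTree}
    {f : s.obj ⟶ (tensor (.tensor (.cube n) (.cube m)) r).obj} (i : Fin n) (j : Fin m)
    (h : f ≫ dot (tensor (.tensor (.cube n) (.cube m)) r) (Sum.inl (Sum.inl i)) =
      f ≫ dot (tensor (.tensor (.cube n) (.cube m)) r) (Sum.inl (Sum.inr j)))
    (IH : ∀ g : s.obj ⟶ (tensor (.cube (n + m)) r).obj, Gen e s (.tensor (.cube (n + m)) r) g) :
    Gen e s (tensor (.tensor (.cube n) (.cube m)) r) f := by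
  have h1 := comp_eq_zero_of_eq_sub (X := s.obj)
    (Y := tens (tens (AnnularCube.cube n) (AnnularCube.cube m)) r.obj)
    (Z := tens (tens (AnnularCube.cube n) (AnnularCube.cube m)) r.obj)
    (whiskerRight_junction_eq n m i j r) h
  obtain ⟨g, hg⟩ := exists_comp_whiskerRight_splitOf (e n m) r.obj h1
  exact Gen.congr hg (Gen.comp_whiskerRight_splitOf (IH g))

/-- A morphism from `Cube_n ⊗ Cube_m` on which dots of both factors agree factors through the merge
map. -/
theorem gen_of_dot_comp_eq {n m : ℕ+} {f : (tensor (.cube n) (.cube m)).obj ⟶ t.obj} (i : Fin n)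
    (j : Fin m) (h : dot (tensor (.cube n) (.cube m)) (Sum.inl i) ≫ f =
      dot (tensor (.cube n) (.cube m)) (Sum.inr j) ≫ f)
    (IH : ∀ g : (CubeTree.cube (n + m)).obj ⟶ t.obj, Gen e (.cube (n + m)) t g) :
    Gen e (tensor (.cube n) (.cube m)) t f := by
  have h1 := eq_sub_comp_eq_zero (Z := t.obj) (Y := tens (AnnularCube.cube n) (AnnularCube.cube m))
    (X := tens (AnnularCube.cube n) (AnnularCube.cube m)) (junction_eq_dot_sub n m i j) h
  obtain ⟨g, hg⟩ := exists_mergeOf_comp (e n m) h1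
  exact Gen.congr hg (Gen.mergeOf_comp (IH g))

theorem gen_of_dot_comp_eq_right {n m : ℕ+} {r : CubeTree}
    {f : (tensor (.tensor (.cube n) (.cube m)) r).obj ⟶ t.obj} (i : Fin n) (j : Fin m)
    (h : dot (tensor (.tensor (.cube n) (.cube m)) r) (Sum.inl (Sum.inl i)) ≫ f =
      dot (tensor (.tensor (.cube n) (.cube m)) r) (Sum.inl (Sum.inr j)) ≫ f)
    (IH : ∀ g : (tensor (.cube (n + m)) r).obj ⟶ t.obj, Gen e (.tensor (.cube (n + m)) r) t g) :
    Gen e (tensor (.tensor (.cube n) (.cube m)) r) t f := by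
  have h1 := eq_sub_comp_eq_zero (Z := t.obj)
    (Y := tens (tens (AnnularCube.cube n) (AnnularCube.cube m)) r.obj)
    (X := tens (tens (AnnularCube.cube n) (AnnularCube.cube m)) r.obj)
    (whiskerRight_junction_eq n m i j r) h
  obtain ⟨g, hg⟩ := exists_whiskerRight_mergeOf_comp (e n m) r.obj h1
  exact Gen.congr hg (Gen.whiskerRight_mergeOf_comp (IH g))

/-- If a morphism separates two strands of a block, it factors through a split map, with a tensor
product of fewer factors. -/
theorem Supported.gen_of_split (hf : Supported σ f) {i j : Strand s} (h : SameBlock s i j)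
    (h' : ¬ SameBlock t (σ i) (σ j))
    (IH : ∀ (t' : CubeTree) (g : s.obj ⟶ t'.obj), blocks t' < blocks t → Gen e s t' g) :
    Gen e s t f := by
  rcases exists_rearrangement₂ e t _ _ h' with ⟨n, m, a, i', j', hi, hj⟩ |
    ⟨n, m, r, a, i', j', hi, hj⟩
  · refine a.gen_of_hom (gen_of_comp_dot_eq i' j'
      ((hf.comp a.supported_hom).comp_dot_eq h hi hj) fun g => IH _ g ?_)
    rw [a.blocks_eq]; exact Nat.one_lt_two
  · refine a.gen_of_hom (gen_of_comp_dot_eq_right i' j'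
      ((hf.comp a.supported_hom).comp_dot_eq h hi hj) fun g => IH _ g ?_)
    rw [a.blocks_eq]; exact Nat.add_lt_add_right Nat.one_lt_two _

/-- If a morphism joins two strands of different blocks, it factors through a merge map, with a
tensor product of fewer factors. -/
theorem Supported.gen_of_merge (hf : Supported σ f) {i j : Strand s} (h : ¬ SameBlock s i j)
    (h' : SameBlock t (σ i) (σ j))
    (IH : ∀ (s' : CubeTree) (g : s'.obj ⟶ t.obj), blocks s' < blocks s → Gen e s' t g) :
    Gen e s t f := by
  have hs : ∀ {s' : CubeTree} (a : Rearrangement e s s') {k : Strand s'} {l : Strand s},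
      a.strands l = k → (a.strands.symm.trans σ) k = σ l := by
    rintro s' a _ l rfl
    rw [Equiv.trans_apply, Equiv.symm_apply_apply]
  rcases exists_rearrangement₂ e s _ _ h with ⟨n, m, a, i', j', hi, hj⟩ |
    ⟨n, m, r, a, i', j', hi, hj⟩
  · refine a.gen_of_inv (gen_of_dot_comp_eq i' j'
      ((a.supported_inv.comp hf).dot_comp_eq h' (hs a hi) (hs a hj)) fun g => IH _ g ?_)
    rw [a.blocks_eq]; exact Nat.one_lt_two
  · refine a.gen_of_inv (gen_of_dot_comp_eq_right i' j'
      ((a.supported_inv.comp hf).dot_comp_eq h' (hs a hi) (hs a hj)) fun g => IH _ g ?_)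
    rw [a.blocks_eq]; exact Nat.add_lt_add_right Nat.one_lt_two _

/-- A morphism which maps blocks to blocks is a sum of tensor products of morphisms between cubes
and of morphisms with fewer factors. -/
theorem Supported.gen_of_sameBlock (hf : Supported σ f)
    (h : ∀ i j, SameBlock t (σ i) (σ j) ↔ SameBlock s i j)
    (IH : ∀ (s' t' : CubeTree) (g : s'.obj ⟶ t'.obj), blocks s' + blocks t' < blocks s + blocks t →
      Gen e s' t' g) : Gen e s t f := by
  obtain ⟨i⟩ := (inferInstance : Nonempty (Strand s))
  have hcube : ∀ (n m : ℕ+) (τ : Strand (.cube n) ≃ Strand (.cube m))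
      (g : (CubeTree.cube n).obj ⟶ (CubeTree.cube m).obj), Gen e (.cube n) (.cube m) g := by
    intro n m τ g
    obtain rfl : n = m := PNat.eq (Fin.equiv_iff_eq.mp ⟨τ⟩)
    exact .endo n g
  rcases exists_rearrangement e s i with ⟨n, rfl⟩ | ⟨n, r, a, i', hi⟩
  · rcases exists_rearrangement e t (σ i) with ⟨m, rfl⟩ | ⟨m, r, b, j', hj⟩
    · exact hcube n m σ f
    -- the target has a strand in a further block, but all strands of the source are in one block
    · obtain ⟨k⟩ := (inferInstance : Nonempty (Strand r))
      obtain ⟨x, hx⟩ : ∃ x : Strand (.tensor (.cube m) r), x = Sum.inr k := ⟨_, rfl⟩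
      have h1 := (h i (σ.symm (b.strands.symm x))).mpr trivial
      rw [Equiv.apply_symm_apply, ← b.sameBlock, Equiv.apply_symm_apply] at h1
      exact (Eq.mp (congrArg₂ (SameBlock (.tensor (.cube m) r)) hj hx) h1 : False).elim
  · rcases exists_rearrangement e t (σ i) with ⟨m, rfl⟩ | ⟨m, r', b, j', hj⟩
    -- the source has a strand in a further block, but all strands of the target are in one block
    · obtain ⟨k⟩ := (inferInstance : Nonempty (Strand r))
      obtain ⟨x, hx⟩ : ∃ x : Strand (.tensor (.cube n) r), x = Sum.inr k := ⟨_, rfl⟩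
      have h1 := (h i (a.strands.symm x)).mp trivial
      rw [← a.sameBlock, Equiv.apply_symm_apply] at h1
      exact (Eq.mp (congrArg₂ (SameBlock (.tensor (.cube n) r)) hi hx) h1 : False).elim
    -- with the matched factors in front, the bijection is a sum and the Künneth formula applies
    · have hσ := (a.supported_inv.comp hf).comp b.supported_hom
      set τ := (a.strands.symm.trans σ).trans b.strands with hτ
      have hτ' : ∀ k l, SameBlock _ (τ k) (τ l) ↔ SameBlock _ k l := fun k l => by
        rw [hτ]
        simp only [Equiv.trans_apply]
        rw [b.sameBlock, h, ← a.sameBlock, Equiv.apply_symm_apply, Equiv.apply_symm_apply]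
      have hτi : τ (Sum.inl i') = Sum.inl j' := by
        refine (congrArg τ hi).symm.trans ?_
        rw [hτ]
        simp only [Equiv.trans_apply, Equiv.symm_apply_apply]
        exact hj
      obtain ⟨α, β, hαβ⟩ := exists_sumCongr (A := Strand (.cube n)) (B := Strand r)
        (C := Strand (.cube m)) (D := Strand r') τ
        (fun k => by
          rcases hk : τ (Sum.inl k) with l | l
          · exact ⟨l, rfl⟩
          · exact (Eq.mp (congrArg₂ (SameBlock (.tensor (.cube m) r')) hτi hk)
              ((hτ' (Sum.inl i') (Sum.inl k)).mpr trivial) : False).elim)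
        (fun k => by
          rcases hk : τ (Sum.inr k) with l | l
          · exact ((hτ' (Sum.inl i') (Sum.inr k)).mp
              (Eq.mpr (congrArg₂ (SameBlock (.tensor (.cube m) r')) hτi hk) trivial) : False).elim
          · exact ⟨l, rfl⟩)
      refine b.gen_of_hom (a.gen_of_inv ?_)
      rw [hαβ] at hσ
      rw [← Category.assoc]
      refine Gen.of_span ?_ hσ.mem_span_tens
      rintro _ ⟨x, y, rfl⟩
      refine Generated.comp (t := .tensor (.cube m) r) (.whiskerRight r (hcube n m α x))
        (.whiskerLeft (.cube m) (IH r r' y ?_))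
      rw [a.blocks_eq, b.blocks_eq, blocks, blocks, blocks, blocks]
      omega

/-- Every morphism between tensor products of cubes is generated by endomorphisms of the cubes and
the merge and split maps. -/
theorem gen (e : ∀ n m : ℕ+, AnnularCube.cube (n + m) ≅ cubeCone n m) (s t : CubeTree)
    (f : s.obj ⟶ t.obj) : Gen e s t f := by
  classical
  induction hN : blocks s + blocks t using Nat.strong_induction_on generalizing s t with
  | h N IH =>
    subst hN
    obtain ⟨F, rfl, hF⟩ := exists_supported f
    refine Gen.sum _ fun σ => ?_
    by_cases h1 : ∃ i j, SameBlock s i j ∧ ¬ SameBlock t (σ i) (σ j)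
    · obtain ⟨i, j, h, h'⟩ := h1
      exact (hF σ).gen_of_split h h' fun t' g ht =>
        IH _ (Nat.add_lt_add_left ht _) s t' g rfl
    by_cases h2 : ∃ i j, ¬ SameBlock s i j ∧ SameBlock t (σ i) (σ j)
    · obtain ⟨i, j, h, h'⟩ := h2
      exact (hF σ).gen_of_merge h h' fun s' g hs =>
        IH _ (Nat.add_lt_add_right hs _) s' t g rfl
    push Not at h1 h2
    exact (hF σ).gen_of_sameBlock (fun i j => ⟨fun h => by_contra fun h' => h2 i j h' h, h1 i j⟩)
      fun s' t' g h => IH _ h s' t' g rfl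

end CubeTree

/-! ### Acyclicity of Koszul differentials -/

section koszul
variable {R M : Type} [CommRing R] [AddCommGroup M] [Module R M] {r : ℕ}

/-- The Koszul differential `∑ c_i ∂_i` of anticommuting operators `∂_i`. -/
def koszulSum (del : Fin r → M →ₗ[R] M) (c : Fin r → R) : M →ₗ[R] M := ∑ i, c i • del i

theorem koszulSum_apply (del : Fin r → M →ₗ[R] M) (c : Fin r → R) (x : M) :
    koszulSum del c x = ∑ i, c i • del i x := by simp [koszulSum]

variable {del mu : Fin r → M →ₗ[R] M} {c : Fin r → R}

theorem del_koszulSum (h1 : ∀ i j x, del i (del j x) = -del j (del i x)) (i : Fin r) (x : M) :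
    del i (koszulSum del c x) = -koszulSum del c (del i x) := by
  simp only [koszulSum_apply, map_sum, map_smul, h1 i, smul_neg, Finset.sum_neg_distrib]

theorem koszulSum_koszulSum (h1 : ∀ i j x, del i (del j x) = -del j (del i x))
    (h1' : ∀ i x, del i (del i x) = 0) (x : M) :
    koszulSum del c (koszulSum del c x) = 0 := by
  simp only [koszulSum_apply, map_sum, map_smul, Finset.smul_sum, smul_smul]
  rw [← Finset.sum_product']
  refine Finset.sum_involution (fun p _ => (p.2, p.1)) ?_ ?_ (by simp) (by simp)
  · rintro ⟨i, j⟩ _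
    simp only
    rw [h1 i j, smul_neg, mul_comm, add_neg_cancel]
  · rintro ⟨i, j⟩ _ h heq
    obtain rfl : j = i := congrArg Prod.fst heq
    exact h (by simp [h1'])

theorem koszulSum_mu
    (h2 : ∀ i j x, del i (mu j x) + mu j (del i x) = if i = j then x else 0) (j : Fin r) (x : M) :
    koszulSum del c (mu j x) = c j • x - mu j (koszulSum del c x) := by
  rw [eq_sub_iff_add_eq, koszulSum_apply, koszulSum_apply, map_sum, ← Finset.sum_add_distrib]
  simp only [map_smul, ← smul_add, h2]
  simp

/-- Let `∂_i` and `μ_j` satisfy the relations of contractions and multiplications on an exterior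
algebra, and let `c` be a regular sequence on the common kernel `N` of the `∂_i`. Then every cycle of
the differential `∑ c_i ∂_i` differs from an element of `N` by a boundary. The generators `μ_k` are
eliminated from a cycle one at a time, the last one first. -/
theorem exists_sub_koszulSum (h1 : ∀ i j x, del i (del j x) = -del j (del i x))
    (h1' : ∀ i x, del i (del i x) = 0)
    (h2 : ∀ i j x, del i (mu j x) + mu j (del i x) = if i = j then x else 0)
    (hreg : ∀ k b, (∀ i, del i b = 0) → (∃ a : Fin r → M, c k • b = ∑ j ∈ Finset.Iio k, c j • a j) →
      ∃ a : Fin r → M, (∀ i j, del i (a j) = 0) ∧ b = ∑ j ∈ Finset.Iio k, c j • a j)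
    {x : M} (hx : koszulSum del c x = 0) : ∃ y, ∀ i, del i (x - koszulSum del c y) = 0 := by
  have h2' : ∀ i x, del i (mu i x) = x - mu i (del i x) := fun i x => by
    have := h2 i i x
    rw [if_pos rfl] at this
    exact eq_sub_of_add_eq this
  have h2'' : ∀ i j x, i ≠ j → del i (mu j x) = -mu j (del i x) := fun i j x h => by
    have := h2 i j x
    rw [if_neg h] at this
    exact eq_neg_of_add_eq_zero_left this
  have hdd := koszulSum_koszulSum (c := c) h1 h1'
  have hcl : ∀ b, (∀ i, del i b = 0) → koszulSum del c b = 0 := fun b hb => by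
    rw [koszulSum_apply]; simp [hb]
  -- the assertion for cycles that do not involve the generators `μ_i` with `i ≥ k`
  have claim : ∀ k : ℕ, k ≤ r → ∀ x, koszulSum del c x = 0 → (∀ i : Fin r, k ≤ i → del i x = 0) →
      ∃ y, (∀ i : Fin r, k ≤ i → del i y = 0) ∧ ∀ i, del i (x - koszulSum del c y) = 0 := by
    intro k
    induction k with
    | zero =>
      intro _ x _ hx
      exact ⟨0, fun i _ => map_zero _, fun i => by rw [map_zero, sub_zero, hx i (Nat.zero_le _)]⟩
    | succ k ih =>
      intro hk x hDx hx
      have ih := ih (by omega)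
      obtain ⟨κ, hκ⟩ : ∃ κ : Fin r, (κ : ℕ) = k := ⟨⟨k, hk⟩, rfl⟩
      -- adding the boundary of `μ_κ z` subtracts `D z` from `∂_κ x`
      have modify : ∀ x z, koszulSum del c x = 0 → (∀ i : Fin r, k + 1 ≤ i → del i x = 0) →
          (∀ i : Fin r, k ≤ i → del i z = 0) →
          koszulSum del c (x + koszulSum del c (mu κ z)) = 0 ∧
          (∀ i : Fin r, k + 1 ≤ i → del i (x + koszulSum del c (mu κ z)) = 0) ∧
          del κ (x + koszulSum del c (mu κ z)) = del κ x - koszulSum del c z := by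
        intro x z hx hx' hz
        refine ⟨by rw [map_add, hx, hdd, add_zero], fun i hi => ?_, ?_⟩
        · have hne : i ≠ κ := by rintro rfl; omega
          rw [map_add, hx' i hi, del_koszulSum h1, h2'' i κ z hne, hz i (by omega)]
          simp
        · rw [map_add, del_koszulSum h1, h2', hz κ hκ.ge]
          simp [sub_eq_add_neg]
      -- make the coefficient `b` of `μ_κ` an element of the common kernel
      obtain ⟨y, hy, hyN⟩ := ih (del κ x) (by
          have := del_koszulSum (c := c) h1 κ x
          rw [hDx, map_zero] at this
          exact neg_eq_zero.mp this.symm)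
        (fun i hi => by
          rcases eq_or_ne i κ with rfl | hne
          · exact h1' _ _
          · rw [h1, hx i (by have := Fin.val_ne_of_ne hne; omega), map_zero, neg_zero])
      obtain ⟨m1, m2, m3⟩ := modify x y hDx hx hy
      set x1 := x + koszulSum del c (mu κ y) with hx1
      set b := del κ x - koszulSum del c y with hb
      have hA : ∀ i : Fin r, k ≤ i → del i (x1 - mu κ b) = 0 := by
        intro i hi
        rcases eq_or_ne i κ with rfl | hne
        · rw [map_sub, m3, h2', hyN]; simp
        · rw [map_sub, m2 i (by have := Fin.val_ne_of_ne hne; omega), h2'' _ _ _ hne, hyN]; simp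
      -- as `x1` is a cycle, `c_κ b` lies in the span of the previous `c_j`, and regularity makes `b` a
      -- boundary
      obtain ⟨a, ha, hab⟩ := hreg κ b hyN ⟨fun j => -del j (x1 - mu κ b), by
        have e1 : koszulSum del c (x1 - mu κ b) = -(c κ • b) := by
          rw [map_sub, m1, koszulSum_mu h2, hcl b hyN]; simp
        rw [← neg_eq_iff_eq_neg] at e1
        rw [← e1, koszulSum_apply, ← Finset.sum_neg_distrib]
        simp only [smul_neg]
        refine (Finset.sum_subset (Finset.subset_univ _) fun j _ hj => ?_).symm
        rw [hA j (by rw [Finset.mem_Iio, not_lt] at hj; rw [← hκ]; exact hj)]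
        simp⟩
      set z := ∑ j ∈ Finset.Iio κ, mu j (a j) with hz
      have hzD : koszulSum del c z = b := by
        rw [hz, map_sum, hab]
        refine Finset.sum_congr rfl fun j _ => ?_
        rw [koszulSum_mu h2, hcl _ fun i => ha i j, map_zero, sub_zero]
      have hz' : ∀ i : Fin r, k ≤ i → del i z = 0 := by
        intro i hi
        rw [hz, map_sum]
        refine Finset.sum_eq_zero fun j hj => ?_
        rw [Finset.mem_Iio] at hj
        rw [h2'' i j _ (by rintro rfl; exact absurd hj (not_lt.mpr (by rw [Fin.le_def]; omega))),
          ha]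
        simp
      obtain ⟨n1, n2, n3⟩ := modify x1 z m1 m2 hz'
      obtain ⟨w, hw, hwN⟩ := ih _ n1 fun i hi => by
        rcases eq_or_ne i κ with rfl | hne
        · rw [n3, m3, hzD, sub_self]
        · exact n2 i (by have := Fin.val_ne_of_ne hne; omega)
      refine ⟨w - mu κ z - mu κ y, fun i hi => ?_, fun i => ?_⟩
      · have hne : i ≠ κ := by rintro rfl; omega
        rw [map_sub, map_sub, hw i (by omega), h2'' _ _ _ hne, h2'' _ _ _ hne, hz' i (by omega),
          hy i (by omega)]
        simp
      · rw [← hwN i, hx1]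
        congr 1
        simp only [map_sub]
        abel
  obtain ⟨y, -, hy⟩ := claim r le_rfl x hx fun i hi => absurd i.2 (not_lt.mpr hi)
  exact ⟨y, hy⟩

end koszul

/-! ### Endomorphisms of an exterior algebra commuting with all contractions -/

section skew
variable {R : Type} [CommRing R] {r : ℕ}

/-- The graded commutator with an odd matrix `E`. -/
def skewComm (E : Matrix (Finset (Fin r)) (Finset (Fin r)) R) :
    Matrix (Finset (Fin r)) (Finset (Fin r)) R →ₗ[R] Matrix (Finset (Fin r)) (Finset (Fin r)) R where
  toFun P := P * E - E * bar P
  map_add' P Q := by rw [bar_add, Matrix.add_mul, Matrix.mul_add]; abel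
  map_smul' a P := by rw [bar_smul, Matrix.smul_mul, Matrix.mul_smul, smul_sub]; rfl

theorem skewComm_apply (E P : Matrix (Finset (Fin r)) (Finset (Fin r)) R) :
    skewComm E P = P * E - E * bar P := rfl

/-- The contraction with the `i`-th basis vector. -/
abbrev contr (R : Type) [CommRing R] {r : ℕ} (i : Fin r) :
    Matrix (Finset (Fin r)) (Finset (Fin r)) R :=
  contraction (Pi.single i 1)

theorem koszulSum_skewComm (c : Fin r → R) (P : Matrix (Finset (Fin r)) (Finset (Fin r)) R) :
    koszulSum (fun i => skewComm (contr R i)) c P = skewComm (contraction c) P := by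
  rw [koszulSum_apply, skewComm_apply, contraction_eq_sum c, Matrix.mul_sum, Matrix.sum_mul,
    ← Finset.sum_sub_distrib]
  refine Finset.sum_congr rfl fun i _ => ?_
  rw [skewComm_apply, Matrix.mul_smul, Matrix.smul_mul, smul_sub]

theorem skewComm_skewComm {c c' : Fin r → R} (P : Matrix (Finset (Fin r)) (Finset (Fin r)) R) :
    skewComm (contraction c) (skewComm (contraction c') P) =
      P * contraction c' * contraction c - contraction c' * bar P * contraction c
        + contraction c * bar P * contraction c' - contraction c * contraction c' * P := by
  simp only [skewComm_apply, bar_sub, bar_mul, bar_contraction, bar_bar, Matrix.sub_mul,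
    Matrix.mul_sub, Matrix.mul_neg, Matrix.neg_mul, Matrix.mul_assoc]
  abel

theorem skewComm_anticomm (c c' : Fin r → R) (P : Matrix (Finset (Fin r)) (Finset (Fin r)) R) :
    skewComm (contraction c) (skewComm (contraction c') P) =
      -skewComm (contraction c') (skewComm (contraction c) P) := by
  rw [skewComm_skewComm, skewComm_skewComm, contraction_anticomm c' c,
    Matrix.mul_assoc P, Matrix.mul_assoc P, contraction_anticomm c c']
  simp only [Matrix.mul_neg, Matrix.neg_mul]
  abel

theorem skewComm_sq (c : Fin r → R) (P : Matrix (Finset (Fin r)) (Finset (Fin r)) R) :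
    skewComm (contraction c) (skewComm (contraction c) P) = 0 := by
  rw [skewComm_skewComm, Matrix.mul_assoc P, contraction_sq]
  simp

/-- Right multiplication by a generator is a contracting homotopy for the graded commutator. -/
theorem skewComm_mul_creation (c b : Fin r → R)
    (P : Matrix (Finset (Fin r)) (Finset (Fin r)) R) :
    skewComm (contraction c) (P * creation b) + skewComm (contraction c) P * creation b =
      (∑ i, b i * c i) • P := by
  have h := congrArg (P * ·) (contraction_creation b c)
  simp only [Matrix.mul_add, Matrix.mul_smul, Matrix.mul_one] at h
  rw [← h]
  simp only [skewComm_apply, bar_mul, bar_creation, Matrix.sub_mul, Matrix.mul_neg,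
    Matrix.mul_assoc]
  abel

/-- A row vector killed by all contractions is supported on the empty set. -/
theorem eq_zero_of_vecMul_contr {v : Finset (Fin r) → R} (h : ∀ i, Matrix.vecMul v (contr R i) = 0)
    {S : Finset (Fin r)} (hS : S ≠ ∅) : v S = 0 := by
  obtain ⟨i, hi⟩ := Finset.nonempty_iff_ne_empty.mpr hS
  have h1 := congrFun (h i) (S.erase i)
  rw [← Matrix.mulVec_transpose] at h1
  have h2 : (creation (Pi.single i 1)).mulVec v (S.erase i) = 0 := h1
  rw [creation_single_mulVec, if_neg (Finset.notMem_erase i S), Finset.insert_erase hi] at h2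
  have h3 := congrArg (koszulSign R i (S.erase i) * ·) h2
  simpa [← mul_assoc, koszulSign_mul_self] using h3

/-- A matrix whose rows are determined by the previous rows after contraction vanishes if its first
column does. -/
theorem eq_zero_of_mul_contr {P : Matrix (Finset (Fin r)) (Finset (Fin r)) R}
    (h : ∀ (i : Fin r) (S : Finset (Fin r)),
      (∀ T : Finset (Fin r), T.card < S.card → P T = 0) → (P * contr R i) S = 0)
    (h0 : ∀ S, P S ∅ = 0) : P = 0 := by
  have key : ∀ N (S : Finset (Fin r)), S.card = N → P S = 0 := by
    intro N
    induction N using Nat.strong_induction_on with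
    | h N ih =>
      rintro S rfl
      ext U
      by_cases hU : U = ∅
      · rw [hU]; exact h0 S
      · exact eq_zero_of_vecMul_contr (fun i => h i S fun T hT => ih _ hT T rfl) hU
  ext S U
  exact congrFun (key _ S rfl) U

theorem contraction_mul_row_eq_zero {P : Matrix (Finset (Fin r)) (Finset (Fin r)) R} (c : Fin r → R)
    {S : Finset (Fin r)} (h : ∀ T : Finset (Fin r), T.card < S.card → P T = 0) :
    (contraction c * P) S = 0 := by
  ext U
  rw [Matrix.mul_apply]
  refine Finset.sum_eq_zero fun T _ => ?_
  by_cases hT : S.card = T.card + 1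
  · rw [h T (by omega)]; simp
  · rw [contraction_eq_zero hT, zero_mul]

/-- A matrix commuting with all contractions in the graded sense is determined by its first column. -/
theorem eq_of_skewComm_eq_zero {P Q : Matrix (Finset (Fin r)) (Finset (Fin r)) R}
    (hP : ∀ i, skewComm (contr R i) P = 0) (hQ : ∀ i, skewComm (contr R i) Q = 0)
    (h : ∀ S, P S ∅ = Q S ∅) : P = Q := by
  rw [← sub_eq_zero]
  refine eq_zero_of_mul_contr (fun i S hS => ?_) fun S => by rw [Matrix.sub_apply, h, sub_self]
  have h1 : skewComm (contr R i) (P - Q) = 0 := by rw [map_sub, hP, hQ, sub_self]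
  rw [skewComm_apply, sub_eq_zero] at h1
  rw [h1]
  refine contraction_mul_row_eq_zero _ fun T hT => ?_
  ext U
  rw [bar_apply, hS T hT]; simp

theorem skewComm_contraction_mul {c c' : Fin r → R}
    {P : Matrix (Finset (Fin r)) (Finset (Fin r)) R} (h : skewComm (contraction c) P = 0) :
    skewComm (contraction c) (contraction c' * P) = 0 := by
  rw [skewComm_apply, sub_eq_zero] at h ⊢
  rw [Matrix.mul_assoc, h, bar_mul, bar_contraction, ← Matrix.mul_assoc, ← Matrix.mul_assoc,
    contraction_anticomm c' c]
  simp

end skew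

/-! ### Permutations of the strands of the Koszul complex -/

section lifts
variable {n : ℕ}

/-- The differences of adjacent coordinates. -/
def diffs (n : ℕ) : (Fin n → ℂ) →ₗ[ℂ] (Fin (n - 1) → ℂ) where
  toFun u i := u (leftIdx i) - u (rightIdx i)
  map_add' u v := by ext i; simp only [Pi.add_apply]; ring
  map_smul' c u := by ext i; simp only [Pi.smul_apply, smul_eq_mul, RingHom.id_apply]; ring

/-- The contraction with a vector of `ℂⁿ`. -/
abbrev contrVec (u : Fin n → ℂ) : Matrix (Finset (Fin (n - 1))) (Finset (Fin (n - 1))) ℂ :=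
  contraction (diffs n u)

theorem contrVec_add (u v : Fin n → ℂ) : contrVec (u + v) = contrVec u + contrVec v := by
  rw [contrVec, map_add, contraction_add]

theorem contrVec_smul (a : ℂ) (u : Fin n → ℂ) : contrVec (a • u) = a • contrVec u := by
  rw [contrVec, map_smul, contraction_smul]

theorem exists_diffs_eq (c : Fin (n - 1) → ℂ) : ∃ u, diffs n u = c := by
  refine ⟨fun j => ∑ i : Fin (n - 1), if (j : ℕ) ≤ i then c i else 0, ?_⟩
  ext i
  change (∑ k : Fin (n - 1), if (i : ℕ) ≤ k then c k else 0) -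
    (∑ k : Fin (n - 1), if (i : ℕ) + 1 ≤ k then c k else 0) = c i
  rw [← Finset.sum_sub_distrib, Finset.sum_eq_single i]
  · simp
  · intro k _ hk
    have := Fin.val_ne_of_ne hk
    by_cases h : (i : ℕ) ≤ k
    · rw [if_pos h, if_pos (by omega), sub_self]
    · rw [if_neg h, if_neg (by omega), sub_self]
  · simp

/-- Every difference of coordinates is a combination of differences of adjacent coordinates. -/
theorem exists_sum_diffs (a b : Fin n) : ∃ β : Fin (n - 1) → ℂ, ∀ u : Fin n → ℂ,
    ∑ i, β i * diffs n u i = u a - u b := by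
  have h : ∀ k (hk : k < n), ∃ β : Fin (n - 1) → ℂ, ∀ u : Fin n → ℂ,
      ∑ i, β i * diffs n u i = u ⟨0, by omega⟩ - u ⟨k, hk⟩ := by
    intro k
    induction k with
    | zero => exact fun _ => ⟨0, fun u => by simp⟩
    | succ k ih =>
      intro hk
      obtain ⟨β, hβ⟩ := ih (by omega)
      refine ⟨β + Pi.single ⟨k, by omega⟩ 1, fun u => ?_⟩
      simp only [Pi.add_apply, add_mul, Finset.sum_add_distrib, hβ]
      rw [Finset.sum_eq_single (⟨k, by omega⟩ : Fin (n - 1))]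
      · rw [Pi.single_eq_same, one_mul]
        exact sub_add_sub_cancel _ _ _
      · intro j _ hj
        rw [Pi.single_eq_of_ne hj, zero_mul]
      · simp
  obtain ⟨β, hβ⟩ := h a a.2
  obtain ⟨γ, hγ⟩ := h b b.2
  refine ⟨γ - β, fun u => ?_⟩
  simp only [Pi.sub_apply, sub_mul, Finset.sum_sub_distrib, hβ, hγ]
  simp

/-- A matrix representing the action of the permutation `σ` on the exterior algebra of the Koszul
generators: it intertwines the contractions, preserves the degree and fixes the unit. -/
structure IsLift (σ : Equiv.Perm (Fin n))
    (L : Matrix (Finset (Fin (n - 1))) (Finset (Fin (n - 1))) ℂ) : Prop where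
  comm : ∀ u, contrVec u * L = L * contrVec (u ∘ σ.symm)
  card_eq : ∀ S T, L S T ≠ 0 → S.card = T.card
  bot : L ∅ ∅ = 1

theorem isLift_one : IsLift (n := n) 1 1 where
  comm u := by rw [Matrix.one_mul, Matrix.mul_one]; rfl
  card_eq S T h := by
    by_contra hne
    exact h (Matrix.one_apply_ne (by rintro rfl; exact hne rfl))
  bot := Matrix.one_apply_eq _

theorem IsLift.mul {σ τ : Equiv.Perm (Fin n)}
    {L L' : Matrix (Finset (Fin (n - 1))) (Finset (Fin (n - 1))) ℂ} (h : IsLift σ L)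
    (h' : IsLift τ L') : IsLift (τ * σ) (L * L') where
  comm u := by rw [← Matrix.mul_assoc, h.comm, Matrix.mul_assoc, h'.comm, ← Matrix.mul_assoc]; rfl
  card_eq S T hne := by
    rw [Matrix.mul_apply] at hne
    obtain ⟨U, _, hU⟩ := Finset.exists_ne_zero_of_sum_ne_zero hne
    rw [h.card_eq S U (left_ne_zero_of_mul hU), h'.card_eq U T (right_ne_zero_of_mul hU)]
  bot := by
    rw [Matrix.mul_apply, Finset.sum_eq_single ∅, h.bot, h'.bot, one_mul]
    · intro U _ hU
      have : L ∅ U = 0 := by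
        by_contra hne
        exact hU (Finset.card_eq_zero.mp (h.card_eq _ _ hne).symm)
      rw [this, zero_mul]
    · simp

/-- The rows of a lift are determined one degree after the other by the intertwining property. -/
theorem IsLift.unique {σ : Equiv.Perm (Fin n)}
    {L L' : Matrix (Finset (Fin (n - 1))) (Finset (Fin (n - 1))) ℂ} (h : IsLift σ L)
    (h' : IsLift σ L') : L = L' := by
  rw [← sub_eq_zero]
  refine eq_zero_of_mul_contr (fun i S hS => ?_) fun S => ?_
  · obtain ⟨u, hu⟩ := exists_diffs_eq (Pi.single i 1)
    have h1 : (L - L') * contr ℂ i = contrVec (u ∘ σ) * (L - L') := by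
      rw [Matrix.mul_sub, h.comm, h'.comm, ← Matrix.sub_mul, Function.comp_assoc,
        Equiv.self_comp_symm, Function.comp_id, contrVec, hu]
    rw [h1]
    exact contraction_mul_row_eq_zero _ hS
  · rw [Matrix.sub_apply]
    by_cases hS : S = ∅
    · rw [hS, h.bot, h'.bot, sub_self]
    · have h0 : ∀ {K}, IsLift σ K → K S ∅ = 0 := fun hK => by
        by_contra hne
        exact hS (Finset.card_eq_zero.mp (hK.card_eq _ _ hne))
      rw [h0 h, h0 h', sub_self]

/-- The reflection exchanging two coordinates acts on an exterior algebra by `1 - α ∧ ι_α`. -/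
theorem exists_isLift_swap (a b : Fin n) : ∃ L, IsLift (Equiv.swap a b) L := by
  obtain ⟨β, hβ⟩ := exists_sum_diffs a b
  set α : Fin n → ℂ := Pi.single a 1 - Pi.single b 1 with hα
  by_cases hab : a = b
  · subst hab
    rw [Equiv.swap_self]
    exact ⟨1, isLift_one⟩
  -- the canonical anticommutation relation for the coroot, which pairs with `u` to `u a - u b`
  have car : ∀ u : Fin n → ℂ, creation β * contrVec u =
      (u a - u b) • (1 : Matrix _ _ ℂ) - contrVec u * creation β := fun u => by
    rw [← hβ, ← contraction_creation]; abel
  have hαα : α a - α b = 2 := by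
    simp [hα, Pi.single_eq_of_ne hab, Pi.single_eq_of_ne (Ne.symm hab)]; norm_num
  have hu : ∀ u : Fin n → ℂ, u ∘ (Equiv.swap a b).symm = u + (-(u a - u b)) • α := fun u => by
    ext i
    simp only [Function.comp_apply, Equiv.symm_swap, Pi.add_apply, Pi.smul_apply, hα, Pi.sub_apply,
      smul_eq_mul]
    rcases eq_or_ne i a with rfl | hia
    · simp [Pi.single_eq_of_ne hab]
    rcases eq_or_ne i b with rfl | hib
    · simp [Pi.single_eq_of_ne hia]
    · rw [Equiv.swap_apply_of_ne_of_ne hia hib, Pi.single_eq_of_ne hia, Pi.single_eq_of_ne hib]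
      simp
  refine ⟨1 - contrVec α * creation β, ⟨fun u => ?_, fun S T h => ?_, ?_⟩⟩
  · have e1 : ∀ u, contrVec α * creation β * contrVec u =
        (u a - u b) • contrVec α + contrVec u * (contrVec α * creation β) := fun u => by
      rw [Matrix.mul_assoc, car, Matrix.mul_sub, Matrix.mul_smul, Matrix.mul_one,
        ← Matrix.mul_assoc, contraction_anticomm (diffs n α), ← Matrix.mul_assoc]
      simp
    have e2 : contrVec α * creation β * contrVec α = (2 : ℂ) • contrVec α := by
      rw [e1, hαα, ← Matrix.mul_assoc, contraction_sq]; simp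
    rw [hu, contrVec_add, contrVec_smul, Matrix.mul_add, Matrix.mul_sub, Matrix.mul_one,
      Matrix.sub_mul, Matrix.one_mul, Matrix.mul_smul, Matrix.sub_mul, Matrix.one_mul, e1, e2]
    module
  · by_contra hne
    refine h ?_
    rw [Matrix.sub_apply, Matrix.one_apply_ne (by rintro rfl; exact hne rfl), Matrix.mul_apply,
      Finset.sum_eq_zero, sub_zero]
    intro U _
    by_cases h1 : S.card = U.card + 1
    · have h2 : creation β U T = 0 := contraction_eq_zero (S := T) (T := U) (by omega)
      rw [h2, mul_zero]
    · exact mul_eq_zero_of_left (contraction_eq_zero h1) _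
  · rw [Matrix.sub_apply, Matrix.one_apply_eq, Matrix.mul_apply, Finset.sum_eq_zero, sub_zero]
    intro U _
    exact mul_eq_zero_of_left (contraction_eq_zero (by rw [Finset.card_empty]; omega)) _

theorem exists_isLift (σ : Equiv.Perm (Fin n)) : ∃ L, IsLift σ L := by
  induction σ using Equiv.Perm.swap_induction_on with
  | one => exact ⟨1, isLift_one⟩
  | swap_mul σ a b _ ih =>
    obtain ⟨L, hL⟩ := ih
    obtain ⟨L', hL'⟩ := exists_isLift_swap a b
    exact ⟨L * L', hL.mul hL'⟩

/-- The matrix of the action of a permutation on the exterior algebra of the Koszul generators. -/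
def permLift (σ : Equiv.Perm (Fin n)) : Matrix (Finset (Fin (n - 1))) (Finset (Fin (n - 1))) ℂ :=
  (exists_isLift σ).choose

theorem permLift_isLift (σ : Equiv.Perm (Fin n)) : IsLift σ (permLift σ) :=
  (exists_isLift σ).choose_spec

theorem permLift_one : permLift (1 : Equiv.Perm (Fin n)) = 1 :=
  (permLift_isLift 1).unique isLift_one

theorem permLift_mul (σ τ : Equiv.Perm (Fin n)) :
    permLift σ * permLift τ = permLift (τ * σ) :=
  ((permLift_isLift σ).mul (permLift_isLift τ)).unique (permLift_isLift _)

end lifts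

/-! ### Matrices of dotted permutations -/

section permMat
variable {ι : Type} [Fintype ι] {n : ℕ}

/-- The matrix with entries `P_{ij} · σ`. -/
def permMat (σ : Equiv.Perm (Fin n)) (P : Matrix ι ι (MvPolynomial (Fin n) ℂ)) :
    constObj ι n ⟶ constObj ι n :=
  fun i j => DotPerm.single σ (P i j)

theorem polyMat_eq_permMat (P : Matrix ι ι (MvPolynomial (Fin n) ℂ)) :
    polyMat P = permMat 1 P := rfl

theorem permMat_mul (σ τ : Equiv.Perm (Fin n)) (P Q : Matrix ι ι (MvPolynomial (Fin n) ℂ)) :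
    permMat σ P ≫ permMat τ Q = permMat (τ * σ) (P.map (MvPolynomial.rename τ) * Q) := by
  ext i k
  change ∑ j, DotPerm.comp (DotPerm.single σ (P i j)) (DotPerm.single τ (Q j k)) =
    DotPerm.single (τ * σ) ((P.map (MvPolynomial.rename τ) * Q) i k)
  rw [Matrix.mul_apply, map_sum]
  refine Finset.sum_congr rfl fun j _ => ?_
  rw [DotPerm.comp_single]; rfl

/-- The matrix of the coefficients of the permutation `σ`. -/
def coeffMat (σ : Equiv.Perm (Fin n)) :
    (constObj ι n ⟶ constObj ι n) →ₗ[ℂ] Matrix ι ι (MvPolynomial (Fin n) ℂ) where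
  toFun f i j := DotPerm.coeff σ (f i j)
  map_add' _ _ := by ext1 i j; exact (DotPerm.coeff σ).map_add _ _
  map_smul' _ _ := by ext1 i j; exact (DotPerm.coeff σ).map_smul _ _

theorem coeffMat_permMat (σ : Equiv.Perm (Fin n)) (P : Matrix ι ι (MvPolynomial (Fin n) ℂ)) :
    coeffMat σ (permMat σ P) = P := by
  ext1 i j; exact DotPerm.coeff_single_self _ _

theorem coeffMat_permMat_of_ne {σ τ : Equiv.Perm (Fin n)} (h : τ ≠ σ)
    (P : Matrix ι ι (MvPolynomial (Fin n) ℂ)) : coeffMat τ (permMat σ P) = 0 := by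
  ext1 i j; exact DotPerm.coeff_single_ne h _

theorem eq_sum_permMat (f : constObj ι n ⟶ constObj ι n) :
    f = ∑ σ, permMat σ (coeffMat σ f) := by
  ext i j
  refine (DotPerm.eq_sum_single (f i j)).trans ?_
  exact (mat_sum_apply _ (fun σ => permMat σ (coeffMat σ f)) i j).symm

theorem coeffMat_comp_polyMat (σ : Equiv.Perm (Fin n)) (f : constObj ι n ⟶ constObj ι n)
    (P : Matrix ι ι (MvPolynomial (Fin n) ℂ)) :
    coeffMat σ (f ≫ polyMat P) = coeffMat σ f * P := by
  conv_lhs => rw [eq_sum_permMat f]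
  rw [Preadditive.sum_comp, map_sum, Finset.sum_eq_single σ]
  · rw [polyMat_eq_permMat, permMat_mul, one_mul, coeffMat_permMat]
    congr 1
    ext1 i j
    exact MvPolynomial.rename_id_apply _
  · intro τ _ h
    rw [polyMat_eq_permMat, permMat_mul, one_mul, coeffMat_permMat_of_ne h.symm]
  · simp

theorem coeffMat_polyMat_comp (σ : Equiv.Perm (Fin n)) (f : constObj ι n ⟶ constObj ι n)
    (P : Matrix ι ι (MvPolynomial (Fin n) ℂ)) :
    coeffMat σ (polyMat P ≫ f) = P.map (MvPolynomial.rename σ) * coeffMat σ f := by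
  conv_lhs => rw [eq_sum_permMat f]
  rw [Preadditive.comp_sum, map_sum, Finset.sum_eq_single σ]
  · rw [polyMat_eq_permMat, permMat_mul, mul_one, coeffMat_permMat]
  · intro τ _ h
    rw [polyMat_eq_permMat, permMat_mul, mul_one, coeffMat_permMat_of_ne h.symm]
  · simp

end permMat

/-! ### The exterior action on the cube -/

section ext
variable {n : ℕ+}

/-- The ring of polynomials in the dots. -/
abbrev DotRing (n : ℕ) : Type := MvPolynomial (Fin n) ℂ

/-- Square matrices of polynomials on the Koszul generators. -/
abbrev KoszulMat (n : ℕ) : Type :=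
  Matrix (Finset (Fin (n - 1))) (Finset (Fin (n - 1))) (DotRing n)

theorem polyMat_mem_cycles {P : KoszulMat n} :
    polyMat P ∈ cycles (cube n) (cube n) ↔ skewComm (koszulD n) P = 0 := by
  constructor
  · intro h
    have h1 : delta (cube n) (cube n) (polyMat P) = 0 := h.2
    rw [delta_polyMat, ← polyMat_zero] at h1
    exact polyMat_injective h1
  · intro h
    refine ⟨mem_maps_cube _, ?_⟩
    change delta (cube n) (cube n) (polyMat P) = 0
    rw [delta_polyMat, ← skewComm_apply, h, polyMat_zero]

theorem skewComm_koszulD {P : KoszulMat n} (h : ∀ i, skewComm (contr (DotRing n) i) P = 0) :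
    skewComm (koszulD n) P = 0 := by
  rw [← koszulSum_skewComm, koszulSum_apply]
  simp [h]

theorem smul_polyMat (a : ℂ) (P : KoszulMat n) :
    a • polyMat P = polyMat ((MvPolynomial.C a : DotRing n) • P) := by
  ext S T
  refine ((DotPerm.single (Equiv.refl (Fin n))).map_smul a (P S T)).symm.trans ?_
  exact congrArg _ (MvPolynomial.smul_eq_C_mul _ _)

theorem epsMat_eq (u : Fin n → ℂ) :
    epsMat n u = polyMat (contraction (MvPolynomial.C ∘ diffs n u)) := rfl

/-- The action of `U_n` as a linear map. -/
def epsHom (n : ℕ+) : U n →ₗ[ℂ] End (cube n) where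
  toFun u := eps n u
  map_add' u v := by
    refine Eq.trans (cls_congr ?_) (cls_add (epsMat_mem n u) (epsMat_mem n v)).symm
    rw [epsMat_eq, epsMat_eq, epsMat_eq, ← polyMat_add, ← contraction_add, Submodule.coe_add,
      map_add]
    congr 2
    ext1 i
    exact MvPolynomial.C_add
  map_smul' a u := by
    refine Eq.trans (cls_congr ?_) (cls_smul a (epsMat_mem n u)).symm
    rw [epsMat_eq, epsMat_eq, smul_polyMat, ← contraction_smul, Submodule.coe_smul, map_smul]
    congr 2
    ext1 i
    exact MvPolynomial.C_mul

theorem eps_comp_eps (u : U n) : eps n u ≫ eps n u = 0 := by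
  refine (cls_comp _ _).trans ((cls_congr ?_).trans cls_zero)
  rw [epsMat_eq, polyMat_mul, contraction_sq, polyMat_zero]

/-- The action of the exterior algebra of `U_n` on `Cube_n`. -/
def extHom (n : ℕ+) : ExteriorAlgebra ℂ (U n) →ₐ[ℂ] End (cube n) :=
  ExteriorAlgebra.lift ℂ ⟨epsHom n, fun u => eps_comp_eps u⟩

theorem extHom_ι (u : U n) : extHom n (ExteriorAlgebra.ι ℂ u) = eps n u :=
  ExteriorAlgebra.lift_ι_apply ..

theorem exists_U_diffs_eq (c : Fin (n - 1 : ℕ) → ℂ) : ∃ u : U n, diffs n u = c := by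
  obtain ⟨u, hu⟩ := exists_diffs_eq c
  refine ⟨⟨_, sub_mean_mem u⟩, ?_⟩
  rw [← hu]
  ext i
  exact sub_sub_sub_cancel_right _ _ _

theorem contr_mul_first_col {R : Type} [CommRing R] {r : ℕ} (i : Fin r)
    (P : Matrix (Finset (Fin r)) (Finset (Fin r)) R) (T : Finset (Fin r)) :
    (contr R i * P) T ∅ = if i ∈ T then koszulSign R i T * P (T.erase i) ∅ else 0 :=
  contraction_single_mulVec i (fun S => P S ∅) T

/-- The products of contractions act by matrices whose first columns are the basis vectors. -/
theorem exists_monomial (S : Finset (Fin (n - 1 : ℕ))) : ∃ w ∈ ⋀[ℂ]^S.card (U n),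
    ∃ (A : KoszulMat n) (hA : polyMat A ∈ cycles (cube n) (cube n)), (∀ i, skewComm (contr (DotRing n) i) A = 0) ∧
    (∀ T, A T ∅ = if T = S then 1 else 0) ∧ extHom n w = cls (polyMat A) hA := by
  induction S using Finset.induction_on with
  | empty =>
    have h1 : ∀ i, skewComm (contr (DotRing n) i) (1 : KoszulMat n) = 0 := fun i => by
      rw [skewComm_apply, bar_one, Matrix.one_mul, Matrix.mul_one, sub_self]
    refine ⟨1, ?_, 1, polyMat_mem_cycles.mpr (skewComm_koszulD h1), h1,
      fun T => Matrix.one_apply, ?_⟩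
    · rw [Finset.card_empty, ExteriorAlgebra.exteriorPower, pow_zero]
      exact Submodule.one_le.mp le_rfl
    · rw [map_one]
      refine (id_eq_cls (cube n)).trans (cls_congr ?_)
      ext (S : Finset (Fin (n - 1))) (T : Finset (Fin (n - 1)))
      by_cases h : S = T
      · subst h
        refine (Mat_.id_apply_self _ _).trans ?_
        rw [polyMat, Matrix.one_apply_eq]; rfl
      · refine (Mat_.id_apply_of_ne _ _ _ h).trans ?_
        rw [polyMat, Matrix.one_apply_ne h, map_zero]
  | insert i S hi ih =>
    obtain ⟨w, hw, A, hA, hA1, hA2, hA3⟩ := ih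
    obtain ⟨u, hu⟩ := exists_U_diffs_eq (n := n) (Pi.single i 1)
    have hu' : epsMat n u = polyMat (contr (DotRing n) i) := by
      rw [epsMat_eq, hu]
      congr 2
      ext1 j
      rw [Function.comp_apply, Pi.single_apply, Pi.single_apply]
      split_ifs <;> simp
    -- the sign with which the contraction appears in the first column
    set s : ℂ := koszulSign ℂ i (insert i S) with hs
    have hs' : (MvPolynomial.C s : DotRing n) = koszulSign _ i (insert i S) := by
      rw [hs, koszulSign, koszulSign, map_pow, map_neg, map_one]
    have h1 : ∀ j, skewComm (contr (DotRing n) j)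
        ((MvPolynomial.C s : DotRing n) • (contr (DotRing n) i * A)) = 0 := fun j => by
      rw [map_smul, skewComm_contraction_mul (hA1 j), smul_zero]
    refine ⟨s • (w * ExteriorAlgebra.ι ℂ u), Submodule.smul_mem _ _ ?_, _,
      polyMat_mem_cycles.mpr (skewComm_koszulD h1), h1, fun T => ?_, ?_⟩
    · rw [Finset.card_insert_of_notMem hi, ExteriorAlgebra.exteriorPower, pow_succ]
      exact Submodule.mul_mem_mul hw ⟨u, rfl⟩
    · rw [Matrix.smul_apply, contr_mul_first_col, hA2, hs', smul_eq_mul]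
      by_cases hT : T = insert i S
      · subst hT
        rw [if_pos (Finset.mem_insert_self i S), if_pos (Finset.erase_insert hi), if_pos rfl,
          mul_one, koszulSign_mul_self]
      · rw [if_neg hT]
        by_cases hiT : i ∈ T
        · rw [if_pos hiT, if_neg (by rintro rfl; exact hT (Finset.insert_erase hiT).symm), mul_zero,
            mul_zero]
        · rw [if_neg hiT, mul_zero]
    · have h2 : extHom n (w * ExteriorAlgebra.ι ℂ u) = eps n u ≫ extHom n w := by
        rw [map_mul, extHom_ι]; rfl
      rw [map_smul, h2, hA3, eps, cls_comp]
      refine (cls_smul _ _).trans (cls_congr ?_)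
      rw [hu', polyMat_mul, smul_polyMat]

end ext

/-! ### Closed matrices of polynomials -/

section regular
variable {n : ℕ}

/-- The specialization identifying the first `k + 1` dots. -/
def collapse (k : Fin (n - 1)) : DotRing n →ₐ[ℂ] DotRing n :=
  MvPolynomial.aeval fun i => MvPolynomial.X (if (i : ℕ) ≤ k then leftIdx k else i)

theorem collapse_koszulC_of_lt {j k : Fin (n - 1)} (h : j < k) : collapse k (koszulC n j) = 0 := by
  rw [Fin.lt_def] at h
  have h1 : ((leftIdx j : Fin n) : ℕ) ≤ k := h.le
  have h2 : ((rightIdx j : Fin n) : ℕ) ≤ k := h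
  rw [koszulC, map_sub, collapse, MvPolynomial.aeval_X, MvPolynomial.aeval_X, if_pos h1, if_pos h2,
    sub_self]

theorem collapse_koszulC_self (k : Fin (n - 1)) : collapse k (koszulC n k) = koszulC n k := by
  have h1 : ((leftIdx k : Fin n) : ℕ) ≤ k := le_rfl
  have h2 : ¬ ((rightIdx k : Fin n) : ℕ) ≤ k := Nat.not_succ_le_self _
  rw [koszulC, map_sub, collapse, MvPolynomial.aeval_X, MvPolynomial.aeval_X, if_pos h1, if_neg h2]

theorem koszulC_ne_zero (k : Fin (n - 1)) : koszulC n k ≠ 0 := by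
  rw [koszulC, sub_ne_zero, Ne, MvPolynomial.X_inj]
  intro h
  have := congrArg Fin.val h
  exact absurd this (Nat.succ_ne_self _).symm

/-- The kernel of the specialization is generated by the differences of the identified dots. -/
theorem exists_eq_sum_of_collapse_eq_zero {k : Fin (n - 1)} {p : DotRing n}
    (hp : collapse k p = 0) : ∃ a : Fin (n - 1) → DotRing n,
      p = ∑ j ∈ Finset.Iio k, koszulC n j * a j := by
  set v : Fin (n - 1) → DotRing n := fun j => if j < k then koszulC n j else 0 with hv
  set I := Ideal.span (Set.range v) with hI
  have hmem : ∀ j < k, Ideal.Quotient.mk I (MvPolynomial.X (leftIdx j)) =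
      Ideal.Quotient.mk I (MvPolynomial.X (rightIdx j)) := fun j hj =>
    Ideal.Quotient.eq.mpr (Ideal.subset_span ⟨j, by rw [hv]; exact if_pos hj⟩)
  have hX : ∀ m (hm : m < n), m ≤ k → Ideal.Quotient.mk I (MvPolynomial.X ⟨m, hm⟩) =
      Ideal.Quotient.mk I (MvPolynomial.X ⟨0, by omega⟩) := by
    intro m
    induction m with
    | zero => intro _ _; rfl
    | succ m ih =>
      intro hm hmk
      rw [← ih (by omega) (by omega)]
      exact (hmem ⟨m, by omega⟩ hmk).symm
  have hq : (Ideal.Quotient.mkₐ ℂ I).comp (collapse k) = Ideal.Quotient.mkₐ ℂ I := by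
    refine MvPolynomial.algHom_ext fun i => ?_
    rw [AlgHom.comp_apply, collapse, MvPolynomial.aeval_X]
    split_ifs with h
    · exact (hX k (by omega) le_rfl).trans (hX i i.2 h).symm
    · rfl
  have hpI : p ∈ I := by
    rw [← Ideal.Quotient.eq_zero_iff_mem]
    have h := DFunLike.congr_fun hq p
    rw [AlgHom.comp_apply, hp, map_zero] at h
    exact h.symm
  obtain ⟨a, ha⟩ := Ideal.mem_span_range_iff_exists_fun.mp hpI
  refine ⟨a, ?_⟩
  rw [← ha, ← Finset.sum_subset (Finset.subset_univ (Finset.Iio k))]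
  · refine Finset.sum_congr rfl fun j hj => ?_
    rw [hv, mul_comm]
    exact congrArg (· * a j) (if_pos (Finset.mem_Iio.mp hj))
  · intro j _ hj
    have : v j = 0 := if_neg fun h => hj (Finset.mem_Iio.mpr h)
    rw [this, mul_zero]

end regular

section closed
variable {n : ℕ+}

/-- The matrix of the product of contractions whose first column is a basis vector. -/
def monomialMat (S : Finset (Fin (n - 1 : ℕ))) : KoszulMat n :=
  (exists_monomial S).choose_spec.2.choose

theorem skewComm_monomialMat (S : Finset (Fin (n - 1 : ℕ))) (i : Fin (n - 1 : ℕ)) :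
    skewComm (contr (DotRing n) i) (monomialMat S) = 0 :=
  (exists_monomial S).choose_spec.2.choose_spec.choose_spec.1 i

theorem monomialMat_first_col (S T : Finset (Fin (n - 1 : ℕ))) :
    monomialMat S T ∅ = if T = S then 1 else 0 :=
  (exists_monomial S).choose_spec.2.choose_spec.choose_spec.2.1 T

theorem monomialMat_mem_cycles (S : Finset (Fin (n - 1 : ℕ))) :
    polyMat (monomialMat S) ∈ cycles (cube n) (cube n) :=
  (exists_monomial S).choose_spec.2.choose_spec.choose

/-- The product of vectors of `U_n` belonging to `monomialMat`. -/
def monomialExt (S : Finset (Fin (n - 1 : ℕ))) : ExteriorAlgebra ℂ (U n) :=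
  (exists_monomial S).choose

theorem monomialExt_mem (S : Finset (Fin (n - 1 : ℕ))) : monomialExt S ∈ ⋀[ℂ]^S.card (U n) :=
  (exists_monomial S).choose_spec.1

theorem extHom_monomialExt (S : Finset (Fin (n - 1 : ℕ))) :
    extHom n (monomialExt S) = cls _ (monomialMat_mem_cycles S) :=
  (exists_monomial S).choose_spec.2.choose_spec.choose_spec.2.2

theorem skewComm_sum_monomialMat (g : Finset (Fin (n - 1 : ℕ)) → DotRing n)
    (i : Fin (n - 1 : ℕ)) :
    skewComm (contr (DotRing n) i) (∑ S, g S • monomialMat S) = 0 := by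
  rw [map_sum]
  refine Finset.sum_eq_zero fun S _ => ?_
  rw [map_smul, skewComm_monomialMat, smul_zero]

theorem sum_monomialMat_first_col (g : Finset (Fin (n - 1 : ℕ)) → DotRing n)
    (T : Finset (Fin (n - 1 : ℕ))) : (∑ S, g S • monomialMat S) T ∅ = g T := by
  rw [Matrix.sum_apply, Finset.sum_eq_single T]
  · rw [Matrix.smul_apply, monomialMat_first_col, if_pos rfl, smul_eq_mul, mul_one]
  · intro S _ hS
    rw [Matrix.smul_apply, monomialMat_first_col, if_neg hS.symm, smul_zero]
  · simp

/-- The matrices commuting with all contractions are the combinations of products of contractions. -/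
theorem eq_sum_monomialMat {P : KoszulMat n} (hP : ∀ i, skewComm (contr (DotRing n) i) P = 0) :
    P = ∑ S, P S ∅ • monomialMat S :=
  eq_of_skewComm_eq_zero hP (skewComm_sum_monomialMat _) fun T =>
    (sum_monomialMat_first_col (fun S => P S ∅) T).symm

/-- Every closed matrix of polynomials is homotopic to a combination of products of contractions. -/
theorem exists_sub_skewComm {P : KoszulMat n} (hP : skewComm (koszulD n) P = 0) :
    ∃ (g : Finset (Fin (n - 1 : ℕ)) → DotRing n) (Y : KoszulMat n),
      P - skewComm (koszulD n) Y = ∑ S, g S • monomialMat S := by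
  obtain ⟨Y, hY⟩ := exists_sub_koszulSum (R := DotRing n) (M := KoszulMat n)
    (del := fun i => skewComm (contr (DotRing n) i))
    (mu := fun j => LinearMap.mulRight (DotRing n) (creation (Pi.single j 1) : KoszulMat n))
    (c := koszulC n)
    (fun i j P => skewComm_anticomm _ _ P) (fun i P => skewComm_sq _ P)
    (fun i j P => by
      refine (skewComm_mul_creation _ _ P).trans ?_
      have h : ∑ k, (Pi.single j 1 : Fin (n - 1 : ℕ) → DotRing n) k *
          Pi.single (M := fun _ => DotRing n) i 1 k =
          if i = j then 1 else 0 := by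
        rw [Finset.sum_eq_single j]
        · rw [Pi.single_eq_same, one_mul, Pi.single_apply]
          exact if_congr eq_comm rfl rfl
        · intro k _ hk
          rw [Pi.single_eq_of_ne hk, zero_mul]
        · simp
      rw [h]
      split_ifs <;> simp)
    (fun k b hb ⟨a, ha⟩ => by
      -- regularity holds entry by entry in the first column: specializing the first dots kills the
      -- previous differences and not the next one
      have hb' : ∀ S, ∃ g : Fin (n - 1 : ℕ) → DotRing n,
          b S ∅ = ∑ j ∈ Finset.Iio k, koszulC n j * g j := fun S => by
        refine exists_eq_sum_of_collapse_eq_zero ?_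
        have h1 := congrArg (collapse k) (congrFun (congrFun ha S) ∅)
        rw [Matrix.smul_apply, Matrix.sum_apply, smul_eq_mul, map_mul, map_sum,
          collapse_koszulC_self, Finset.sum_eq_zero] at h1
        · exact (mul_eq_zero.mp h1).resolve_left (koszulC_ne_zero k)
        · intro j hj
          rw [Matrix.smul_apply, smul_eq_mul, map_mul,
            collapse_koszulC_of_lt (Finset.mem_Iio.mp hj), zero_mul]
      choose g hg using hb'
      refine ⟨fun j => ∑ S, g S j • monomialMat S,
        fun i j => skewComm_sum_monomialMat (fun S => g S j) i, ?_⟩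
      rw [eq_sum_monomialMat hb]
      simp only [Finset.smul_sum, smul_smul]
      rw [Finset.sum_comm]
      refine Finset.sum_congr rfl fun S _ => ?_
      rw [hg, Finset.sum_smul])
    (x := P) (by rw [koszulSum_skewComm]; exact hP)
  rw [koszulSum_skewComm] at hY
  exact ⟨_, Y, eq_sum_monomialMat hY⟩

end closed

/-! ### The action of the symmetric group on the cube -/

theorem DotPerm.comp_mem_homog {a b c : ℕ} {f : DotPerm a b} {g : DotPerm b c} {k l : ℤ}
    (hf : f ∈ homog a b k) (hg : g ∈ homog b c l) : comp f g ∈ homog a c (k + l) := by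
  rw [eq_sum_single f, eq_sum_single g, LinearMap.map_sum₂]
  refine Submodule.sum_mem _ fun σ _ => ?_
  rw [map_sum]
  refine Submodule.sum_mem _ fun τ _ => ?_
  rw [comp_single]
  exact single_mem_homog _ ((rename_homog _ (hf σ)).mul (hg τ))

theorem IsBihom.comp {A B C : GObj} {h k h' k' : ℤ} {f : A.X ⟶ B.X} {g : B.X ⟶ C.X}
    (hf : IsBihom h k f) (hg : IsBihom h' k' g) :
    IsBihom (A := A) (B := C) (h + h') (k + k') (f ≫ g) := by
  intro i j
  have he : (f ≫ g) i j = ∑ l, DotPerm.comp (f i l) (g l j) := rfl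
  refine ⟨fun hne => ?_, ?_⟩
  · rw [he] at hne
    obtain ⟨l, _, hl⟩ := Finset.exists_ne_zero_of_sum_ne_zero hne
    have h1 : f i l ≠ 0 := fun h0 => hl (by rw [h0]; exact LinearMap.map_zero₂ DotPerm.comp _)
    have h2 : g l j ≠ 0 := fun h0 => hl (by rw [h0]; exact map_zero _)
    rw [(hg l j).1 h2, (hf i l).1 h1, add_assoc]
  · rw [he]
    refine Submodule.sum_mem _ fun l _ => ?_
    have := DotPerm.comp_mem_homog (hf i l).2 (hg l j).2
    rwa [show k + A.qdeg i - B.qdeg l + (k' + B.qdeg l - C.qdeg j) =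
      k + k' + A.qdeg i - C.qdeg j by ring] at this

theorem homPiece_comp {A B C : Cx} {h k h' k' : ℤ} {f : A ⟶ B} {g : B ⟶ C}
    (hf : f ∈ homPiece A B h k) (hg : g ∈ homPiece B C h' k') :
    f ≫ g ∈ homPiece A C (h + h') (k + k') := by
  induction hf using Submodule.span_induction with
  | zero => rw [Limits.zero_comp]; exact Submodule.zero_mem _
  | add x y _ _ hx hy => rw [Preadditive.add_comp]; exact Submodule.add_mem _ hx hy
  | smul c x _ hx => rw [Linear.smul_comp]; exact Submodule.smul_mem _ _ hx
  | mem f hf =>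
  induction hg using Submodule.span_induction with
  | zero => rw [Limits.comp_zero]; exact Submodule.zero_mem _
  | add x y _ _ hx hy => rw [Preadditive.comp_add]; exact Submodule.add_mem _ hx hy
  | smul c x _ hx => rw [Linear.comp_smul]; exact Submodule.smul_mem _ _ hx
  | mem g hg =>
    obtain ⟨f, hf, hf', rfl⟩ := hf
    obtain ⟨g, hg, hg', rfl⟩ := hg
    exact Submodule.subset_span ⟨f ≫ g, comp_mem_cycles hf hg, hf'.comp hg', rfl⟩

section perm
variable {n : ℕ+}

/-- The chain map of a permutation of the strands of `Cube_n`. -/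
def permCube (n : ℕ+) (σ : Equiv.Perm (Fin n)) : (cube n).X ⟶ (cube n).X :=
  permMat σ ((permLift σ).map (MvPolynomial.C : ℂ →+* DotRing n))

theorem permCube_bihom (σ : Equiv.Perm (Fin n)) :
    IsBihom (A := (cube n).toGObj) (B := (cube n).toGObj) 0 0 (permCube n σ) := by
  intro (S : Finset (Fin (n - 1))) (T : Finset (Fin (n - 1)))
  by_cases h : permLift σ S T = 0
  · have h0 : permCube n σ S T = 0 := by
      change DotPerm.single σ (MvPolynomial.C (permLift σ S T)) = 0
      rw [h, map_zero, map_zero]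
    rw [h0]
    exact ⟨fun h => (h rfl).elim, Submodule.zero_mem _⟩
  · have hc : (S.card : ℤ) = T.card := by exact_mod_cast (permLift_isLift σ).card_eq S T h
    refine ⟨fun _ => ?_, DotPerm.single_mem_homog _ ?_⟩
    · change (T.card : ℤ) = S.card + 0
      rw [hc, add_zero]
    · have h1 : (0 : ℤ) + (2 * (S.card : ℤ) + 1 - (n : ℕ)) - (2 * (T.card : ℤ) + 1 - (n : ℕ)) = 0 := by
        rw [hc]; ring
      change MvPolynomial.IsWeightedHomogeneous _ (MvPolynomial.C (permLift σ S T))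
        ((0 : ℤ) + (2 * (S.card : ℤ) + 1 - (n : ℕ)) - (2 * (T.card : ℤ) + 1 - (n : ℕ)))
      rw [h1]
      exact MvPolynomial.isWeightedHomogeneous_C _ _

/-- The Koszul differential for any family of operators, as a combination of contractions with
vectors of `ℂⁿ`. -/
theorem contraction_sub_eq_sum {R : Type} [CommRing R] [Algebra ℂ R] {n : ℕ} (y : Fin n → R) :
    contraction (fun i : Fin (n - 1) => y (leftIdx i) - y (rightIdx i)) =
      ∑ a, y a • (contrVec (Pi.single a 1)).map (algebraMap ℂ R) := by
  have h : (fun i : Fin (n - 1) => y (leftIdx i) - y (rightIdx i)) =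
      ∑ a, y a • (algebraMap ℂ R ∘ diffs n (Pi.single a 1)) := by
    ext i
    rw [Finset.sum_apply]
    have h1 : ∀ j : Fin n, y j = ∑ a, y a * algebraMap ℂ R (Pi.single (M := fun _ => ℂ) a 1 j) :=
      fun j => by
        rw [Finset.sum_eq_single j]
        · rw [Pi.single_eq_same, map_one, mul_one]
        · intro a _ ha
          rw [Pi.single_eq_of_ne ha.symm, map_zero, mul_zero]
        · simp
    conv_lhs => rw [h1 (leftIdx i), h1 (rightIdx i)]
    rw [← Finset.sum_sub_distrib]
    refine Finset.sum_congr rfl fun a _ => ?_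
    rw [← mul_sub, ← map_sub]
    rfl
  rw [h]
  refine (map_sum contractionHom _ _).trans (Finset.sum_congr rfl fun a _ => ?_)
  rw [contraction_map]
  exact contraction_smul _ _

theorem permLift_koszulD {n : ℕ} (σ : Equiv.Perm (Fin n)) :
    (koszulD n).map (MvPolynomial.rename σ) *
      (permLift σ).map (MvPolynomial.C : ℂ →+* DotRing n) =
    (permLift σ).map (MvPolynomial.C : ℂ →+* DotRing n) * koszulD n := by
  have h1 : (koszulD n).map (MvPolynomial.rename σ : DotRing n →ₐ[ℂ] DotRing n) =
      contraction (fun i : Fin (n - 1) => (MvPolynomial.X (σ (leftIdx i)) : DotRing n) -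
        MvPolynomial.X (σ (rightIdx i))) := by
    rw [contraction_map]
    congr 1
    ext1 i
    rw [Function.comp_apply, koszulC, map_sub, MvPolynomial.rename_X, MvPolynomial.rename_X]
  have h2 : koszulD n = contraction (fun i : Fin (n - 1) => (MvPolynomial.X (leftIdx i) : DotRing n) -
        MvPolynomial.X (rightIdx i)) := rfl
  rw [h1, h2, contraction_sub_eq_sum (fun a => (MvPolynomial.X (σ a) : DotRing n)),
    contraction_sub_eq_sum (fun a => (MvPolynomial.X a : DotRing n)), Finset.sum_mul,
    Finset.mul_sum]
  refine Fintype.sum_equiv σ _ _ fun a => ?_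
  have h3 : (Pi.single a 1 : Fin n → ℂ) ∘ σ.symm = Pi.single (σ a) 1 := by
    ext i
    rw [Function.comp_apply, Pi.single_apply, Pi.single_apply]
    exact if_congr (Equiv.symm_apply_eq σ) rfl rfl
  have h4 := (permLift_isLift σ).comm (Pi.single a 1)
  rw [h3] at h4
  rw [Matrix.smul_mul, Matrix.mul_smul]
  congr 1
  have h5 := congrArg (fun M => M.map (MvPolynomial.C : ℂ →+* DotRing n)) h4
  simp only [Matrix.map_mul] at h5
  exact h5

theorem permCube_mem (σ : Equiv.Perm (Fin n)) : permCube n σ ∈ cycles (cube n) (cube n) := by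
  refine mem_cycles_of_even (mem_maps_cube _) ?_ ?_
  · have := (permCube_bihom σ).sgn_comm
    rwa [Int.negOnePow_zero, one_smul] at this
  · change permMat σ _ ≫ permMat 1 (koszulD n) = permMat 1 (koszulD n) ≫ permMat σ _
    rw [permMat_mul, permMat_mul, permLift_koszulD, one_mul, mul_one]
    congr 2
    ext1 i j
    exact MvPolynomial.rename_C _ _

theorem permCube_comp (σ τ : Equiv.Perm (Fin n)) :
    permCube n σ ≫ permCube n τ = permCube n (τ * σ) := by
  rw [permCube, permCube, permCube, permMat_mul, ← permLift_mul, Matrix.map_mul]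
  congr 2
  ext1 i j
  exact MvPolynomial.rename_C _ _

theorem polyMat_one {ι : Type} [Fintype ι] [DecidableEq ι] (n : ℕ) :
    polyMat (1 : Matrix ι ι (DotRing n)) = 𝟙 _ := by
  ext S T
  by_cases h : S = T
  · subst h
    refine Eq.trans ?_ (Mat_.id_apply_self _ _).symm
    rw [polyMat, Matrix.one_apply_eq]; rfl
  · refine Eq.trans ?_ (Mat_.id_apply_of_ne _ _ _ h).symm
    rw [polyMat, Matrix.one_apply_ne h, map_zero]

theorem permCube_one : permCube n 1 = 𝟙 _ := by
  rw [permCube, permLift_one, Matrix.map_one _ (map_zero _) (map_one _)]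
  exact polyMat_one _

/-- The action of the symmetric group on `Cube_n`. -/
def permHom (n : ℕ+) : Equiv.Perm (Fin n) →* End (cube n) where
  toFun σ := cls (permCube n σ) (permCube_mem σ)
  map_one' := cls_congr permCube_one
  map_mul' σ τ := cls_congr (permCube_comp τ σ).symm

theorem permHom_comp (σ τ : Equiv.Perm (Fin n)) :
    permHom n σ ≫ permHom n τ = permHom n (τ * σ) := ((permHom n).map_mul τ σ).symm

theorem eps_comp_permHom (σ : Equiv.Perm (Fin n)) (u : U n) :
    eps n u ≫ permHom n σ = permHom n σ ≫ eps n (permU σ u) := by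
  refine (cls_comp (epsMat_mem n u) (permCube_mem σ)).trans (Eq.trans (cls_congr ?_)
    (cls_comp (permCube_mem σ) (epsMat_mem n (permU σ u))).symm)
  have h : ∀ u : Fin n → ℂ, epsMat n u =
      permMat 1 ((contrVec u).map (MvPolynomial.C : ℂ →+* DotRing n)) := fun u => by
    rw [epsMat_eq, polyMat_eq_permMat, contraction_map]
  have h1 : ∀ (τ : Equiv.Perm (Fin n)) (A : Matrix (Finset (Fin (n - 1))) (Finset (Fin (n - 1))) ℂ),
      (A.map (MvPolynomial.C : ℂ →+* DotRing n)).map (MvPolynomial.rename τ : DotRing n →ₐ[ℂ] DotRing n) =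
        A.map (MvPolynomial.C : ℂ →+* DotRing n) := fun τ A => by
    ext1 i j
    exact MvPolynomial.rename_C _ _
  have h2 : (permU σ u).1 = u.1 ∘ σ.symm := rfl
  rw [h, h, permCube, permMat_mul, permMat_mul, h1, h1, ← Matrix.map_mul, ← Matrix.map_mul, h2,
    (permLift_isLift σ).comm]
  rfl

theorem xAct_comp_permHom (σ : Equiv.Perm (Fin n)) (i : Fin n) :
    xAct n i ≫ permHom n σ = permHom n σ ≫ xAct n (σ i) := by
  refine (cls_comp (dotMat_mem n i) (permCube_mem σ)).trans (Eq.trans (cls_congr ?_)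
    (cls_comp (permCube_mem σ) (dotMat_mem n (σ i))).symm)
  rw [dotMat_eq, dotMat_eq, permCube, polyMat_eq_permMat, polyMat_eq_permMat, permMat_mul,
    permMat_mul, one_mul, mul_one]
  congr 1
  have h1 : ((permLift σ).map (MvPolynomial.C : ℂ →+* DotRing n)).map
      (MvPolynomial.rename (1 : Equiv.Perm (Fin n)) : DotRing n →ₐ[ℂ] DotRing n) =
        (permLift σ).map (MvPolynomial.C : ℂ →+* DotRing n) := by
    ext1 i j
    exact MvPolynomial.rename_C _ _
  have h2 : ((MvPolynomial.X i : DotRing n) • (1 : KoszulMat n)).map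
      (MvPolynomial.rename σ : DotRing n →ₐ[ℂ] DotRing n) =
      (MvPolynomial.X (σ i) : DotRing n) • (1 : KoszulMat n) := by
    rw [Matrix.smul_one_eq_diagonal, Matrix.smul_one_eq_diagonal,
      Matrix.diagonal_map (map_zero _), MvPolynomial.rename_X]
  rw [h1, h2, Matrix.smul_mul, Matrix.one_mul, Matrix.mul_smul, Matrix.mul_one]

end perm

/-! ### The endomorphism algebra of the cube -/

section phi
variable {n : ℕ+}

/-- The action of polynomials in the dots. -/
def dotHom (n : ℕ+) : DotRing n →ₐ[ℂ] End (cube n) where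
  toFun p := cls (polyMat (p • (1 : KoszulMat n))) (polyMat_mem_cycles.mpr (by
    rw [map_smul, skewComm_apply, bar_one, Matrix.one_mul, Matrix.mul_one, sub_self, smul_zero]))
  map_one' := cls_congr (by rw [one_smul]; exact polyMat_one _)
  map_mul' p q := by
    refine Eq.trans (cls_congr ?_) (cls_comp _ _).symm
    rw [polyMat_mul, Matrix.smul_mul, Matrix.one_mul, smul_smul, mul_comm]
  map_zero' := by
    refine Eq.trans (cls_congr ?_) cls_zero
    rw [zero_smul, polyMat_zero]
  map_add' p q := by
    refine Eq.trans (cls_congr ?_) (cls_add _ _).symm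
    rw [add_smul, polyMat_add]
  commutes' a := by
    refine Eq.trans (cls_congr ?_) (cls_smul a (e_mem_cycles _)).symm
    refine Eq.trans (smul_polyMat a 1).symm ?_
    rw [polyMat_one]

theorem dotHom_X (i : Fin n) : dotHom n (MvPolynomial.X i) = xAct n i :=
  cls_congr (dotMat_eq n i).symm

/-- The first strand. -/
abbrev firstIdx (n : ℕ+) : Fin n := ⟨0, n.pos⟩

/-- The substitution of a single variable for all dots. -/
def collapseAll (n : ℕ) : DotRing n →ₐ[ℂ] Polynomial ℂ := MvPolynomial.aeval fun _ => Polynomial.X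

/-- All dots act in the same way, so a polynomial in the dots acts as a polynomial in one dot. -/
theorem dotHom_eq (p : DotRing n) :
    dotHom n p = Polynomial.aeval (xAct n (firstIdx n)) (collapseAll n p) := by
  have h : dotHom n = (Polynomial.aeval (xAct n (firstIdx n))).comp (collapseAll n) := by
    refine MvPolynomial.algHom_ext fun i => ?_
    rw [dotHom_X, AlgHom.comp_apply, collapseAll, MvPolynomial.aeval_X, Polynomial.aeval_X]
    exact xAct_eq n i _
  exact DFunLike.congr_fun h p

theorem commute_eps_xAct (u : U n) (i : Fin n) : Commute (eps n u : End (cube n)) (xAct n i) := by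
  refine (cls_comp (dotMat_mem n i) (epsMat_mem n u)).trans (Eq.trans (cls_congr ?_)
    (cls_comp (epsMat_mem n u) (dotMat_mem n i)).symm)
  rw [dotMat_eq, epsMat_eq, polyMat_mul, polyMat_mul, Matrix.smul_mul, Matrix.mul_smul,
    Matrix.one_mul, Matrix.mul_one]

theorem commute_extHom_aeval (w : ExteriorAlgebra ℂ (U n)) (p : Polynomial ℂ) :
    Commute (extHom n w) (Polynomial.aeval (xAct n (firstIdx n)) p) := by
  have h1 : ∀ w, Commute (extHom n w) (xAct n (firstIdx n)) := fun w => by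
    induction w using ExteriorAlgebra.induction with
    | algebraMap a => rw [AlgHom.commutes]; exact Algebra.commutes _ _
    | ι u => rw [extHom_ι]; exact commute_eps_xAct u _
    | mul a b ha hb => rw [map_mul]; exact ha.mul_left hb
    | add a b ha hb => rw [map_add]; exact ha.add_left hb
  induction p using Polynomial.induction_on' with
  | add p q hp hq => rw [map_add]; exact hp.add_right hq
  | monomial k a =>
    rw [Polynomial.aeval_monomial]
    exact (Algebra.commute_algebraMap_right a _).mul_right ((h1 w).pow_right k)

/-- The action of the exterior algebra of `U_n` and of the polynomials in `x`. -/
def coeffHom (n : ℕ+) : CoeffAlg n →ₐ[ℂ] End (cube n) :=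
  Algebra.TensorProduct.lift (extHom n) (Polynomial.aeval (xAct n (firstIdx n)))
    commute_extHom_aeval

theorem coeffHom_tmul (w : ExteriorAlgebra ℂ (U n)) (p : Polynomial ℂ) :
    coeffHom n (coeffTmul w p) = extHom n w * Polynomial.aeval (xAct n (firstIdx n)) p :=
  Algebra.TensorProduct.lift_tmul ..

theorem CoeffAlg.induction {n : ℕ} {P : CoeffAlg n → Prop} (a : CoeffAlg n)
    (h0 : P 0) (ht : ∀ w p, P (coeffTmul w p)) (ha : ∀ a b, P a → P b → P (a + b)) : P a :=
  TensorProduct.induction_on (motive := P) a h0 ht ha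

theorem smul_coeffTmul {n : ℕ} (σ : Equiv.Perm (Fin n)) (w : ExteriorAlgebra ℂ (U n))
    (p : Polynomial ℂ) :
    σ • coeffTmul w p = coeffTmul (ExteriorAlgebra.map (permU σ) w) p := rfl

/-- The permutations act on the coefficients as in the crossed product. -/
theorem coeffHom_smul (σ : Equiv.Perm (Fin n)) (a : CoeffAlg n) :
    coeffHom n (σ • a) * permHom n σ = permHom n σ * coeffHom n a := by
  have h1 : ∀ w, extHom n (ExteriorAlgebra.map (permU σ) w) * permHom n σ =
      permHom n σ * extHom n w := fun w => by
    induction w using ExteriorAlgebra.induction with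
    | algebraMap a =>
      rw [AlgHom.commutes, AlgHom.commutes]; exact Algebra.commutes _ _
    | ι u =>
      rw [ExteriorAlgebra.map_apply_ι, extHom_ι, extHom_ι]
      exact (eps_comp_permHom σ u).symm
    | mul a b ha hb => rw [map_mul, map_mul, map_mul, mul_assoc, hb, ← mul_assoc, ha, mul_assoc]
    | add a b ha hb => rw [map_add, map_add, map_add, add_mul, ha, hb, mul_add]
  have h2 : Commute (xAct n (firstIdx n)) (permHom n σ) := by
    have := xAct_comp_permHom σ (firstIdx n)
    rw [xAct_eq n (σ _) (firstIdx n)] at this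
    exact this.symm
  have h3 : ∀ p : Polynomial ℂ, Commute (Polynomial.aeval (xAct n (firstIdx n)) p)
      (permHom n σ) := fun p => by
    induction p using Polynomial.induction_on' with
    | add p q hp hq => rw [map_add]; exact hp.add_left hq
    | monomial k a =>
      rw [Polynomial.aeval_monomial]
      exact (Algebra.commute_algebraMap_left a _).mul_left (h2.pow_left k)
  induction a using CoeffAlg.induction with
  | h0 => rw [smul_zero, map_zero, zero_mul, mul_zero]
  | ha a b ha hb => rw [smul_add, map_add, map_add, add_mul, mul_add, ha, hb]
  | ht w p =>
    rw [smul_coeffTmul, coeffHom_tmul, coeffHom_tmul, mul_assoc, (h3 p).eq, ← mul_assoc, h1,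
      mul_assoc]

/-! ### The first column of an endomorphism -/

theorem coeffMat_delta (n : ℕ+) (k : (cube n).X ⟶ (cube n).X) :
    coeffMat (1 : Equiv.Perm (Fin n)) (delta (cube n) (cube n) k) =
      skewComm (koszulD n) (coeffMat 1 k) := by
  have h : delta (cube n) (cube n) k = k ≫ polyMat (koszulD n) -
      polyMat (koszulD n) ≫ (koszulG n).sgn ≫ k ≫ (koszulG n).sgn := rfl
  have h1 : ∀ P : KoszulMat n, P.map (MvPolynomial.rename (1 : Equiv.Perm (Fin n)) :
      DotRing n →ₐ[ℂ] DotRing n) = P := fun P => by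
    ext1 i j
    exact MvPolynomial.rename_id_apply _
  rw [h, cube_sgn, map_sub, coeffMat_comp_polyMat, coeffMat_polyMat_comp, coeffMat_polyMat_comp,
    coeffMat_comp_polyMat, h1, h1, skewComm_apply, bar, Matrix.mul_assoc (parity _ _)]

/-- The first column of the part of a matrix over the identity permutation, with all dots
identified. -/
def firstColMat (n : ℕ+) :
    ((cube n).X ⟶ (cube n).X) →ₗ[ℂ] (Finset (Fin (n - 1 : ℕ)) → Polynomial ℂ) where
  toFun f S := collapseAll n (coeffMat (1 : Equiv.Perm (Fin n)) f S ∅)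
  map_add' f g := by ext1 S; rw [map_add, Matrix.add_apply, map_add]; rfl
  map_smul' c f := by ext1 S; rw [map_smul, Matrix.smul_apply, map_smul]; rfl

theorem collapseAll_map_koszulD (n : ℕ) : (koszulD n).map (collapseAll n) = 0 := by
  rw [koszulD, contraction_map]
  have h : collapseAll n ∘ koszulC n = 0 := by
    ext1 i
    rw [Function.comp_apply, koszulC, map_sub, collapseAll, MvPolynomial.aeval_X,
      MvPolynomial.aeval_X, sub_self]; rfl
  rw [h]
  exact map_zero contractionHom

/-- The first column of an endomorphism of `Cube_n`: null-homotopic maps vanish when all dots are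
identified. -/
def firstCol (n : ℕ+) : End (cube n) →ₗ[ℂ] (Finset (Fin (n - 1 : ℕ)) → Polynomial ℂ) :=
  Submodule.liftQ ((boundaries (cube n) (cube n)).submoduleOf (cycles (cube n) (cube n)))
    ((firstColMat n).comp (cycles (cube n) (cube n)).subtype) (by
      rintro f ⟨k, -, hk⟩
      rw [LinearMap.mem_ker]
      ext1 S
      change collapseAll n (coeffMat (1 : Equiv.Perm (Fin n)) ((cycles _ _).subtype f) S ∅) = 0
      rw [← hk, coeffMat_delta, skewComm_apply]
      have h : ∀ P Q : KoszulMat n, (P * koszulD n - koszulD n * Q).map (collapseAll n) = 0 :=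
        fun P Q => by
          rw [Matrix.map_sub _ (map_sub _), Matrix.map_mul, Matrix.map_mul,
            collapseAll_map_koszulD]
          simp
      exact congrFun (congrFun (h _ _) S) ∅)

theorem firstCol_cls (f : (cube n).X ⟶ (cube n).X) (hf : f ∈ cycles (cube n) (cube n))
    (S : Finset (Fin (n - 1 : ℕ))) :
    firstCol n (cls f hf) S = collapseAll n (coeffMat (1 : Equiv.Perm (Fin n)) f S ∅) := rfl

theorem coeffHom_sum_eq_cls (g : Finset (Fin (n - 1 : ℕ)) → DotRing n) :
    coeffHom n (∑ S, coeffTmul (monomialExt S) (collapseAll n (g S))) =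
      cls (polyMat (∑ S, g S • monomialMat S))
        (polyMat_mem_cycles.mpr (skewComm_koszulD (skewComm_sum_monomialMat g))) := by
  have h1 : ∀ S, coeffHom n (coeffTmul (monomialExt S) (collapseAll n (g S))) =
      cls (polyMat (g S • monomialMat S)) (polyMat_mem_cycles.mpr
        (by rw [map_smul, polyMat_mem_cycles.mp (monomialMat_mem_cycles S), smul_zero])) := fun S => by
    rw [coeffHom_tmul, ← dotHom_eq, extHom_monomialExt]
    refine (cls_comp _ _).trans (cls_congr ?_)
    rw [polyMat_mul, Matrix.smul_mul, Matrix.one_mul]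
  rw [map_sum, Finset.sum_congr rfl fun S _ => h1 S, ← cls_sum]
  refine cls_congr ?_
  exact (map_sum (AddMonoidHom.mk' (fun P : KoszulMat n => polyMat P) polyMat_add) _ _).symm

theorem exists_collapseAll_eq (n : ℕ+) (p : Polynomial ℂ) : ∃ q, collapseAll n q = p :=
  ⟨Polynomial.aeval (MvPolynomial.X (firstIdx n)) p, by
    rw [← Polynomial.aeval_algHom_apply, collapseAll, MvPolynomial.aeval_X, Polynomial.aeval_X_left]
    rfl⟩

/-- Combinations of the products of vectors of `U_n`. -/
def combination (n : ℕ+) : (Finset (Fin (n - 1 : ℕ)) → Polynomial ℂ) →ₗ[ℂ] CoeffAlg n where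
  toFun g := ∑ S, coeffTmul (monomialExt S) (g S)
  map_add' g g' := by
    rw [← Finset.sum_add_distrib]
    exact Finset.sum_congr rfl fun S _ => TensorProduct.tmul_add _ _ _
  map_smul' c g := by
    rw [RingHom.id_apply, Finset.smul_sum]
    exact Finset.sum_congr rfl fun S _ => TensorProduct.tmul_smul c _ _

theorem exists_coeffHom_combination (g : Finset (Fin (n - 1 : ℕ)) → Polynomial ℂ) :
    ∃ (P : KoszulMat n) (hP : polyMat P ∈ cycles (cube n) (cube n)),
      coeffHom n (combination n g) = cls (polyMat P) hP ∧ ∀ S, collapseAll n (P S ∅) = g S := by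
  choose q hq using fun S => exists_collapseAll_eq n (g S)
  refine ⟨_, _, Eq.trans ?_ (coeffHom_sum_eq_cls q), fun S => ?_⟩
  · simp only [hq]; rfl
  · rw [sum_monomialMat_first_col, hq]

theorem firstCol_coeffHom_combination (g : Finset (Fin (n - 1 : ℕ)) → Polynomial ℂ) :
    firstCol n (coeffHom n (combination n g)) = g := by
  obtain ⟨P, hP, h, hg⟩ := exists_coeffHom_combination g
  ext1 S
  rw [h, firstCol_cls, polyMat_eq_permMat, coeffMat_permMat, hg]

theorem bijective_diffs (n : ℕ+) : Function.Bijective ((diffs n).comp (U n).subtype) := by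
  refine ⟨?_, fun c => exists_U_diffs_eq c⟩
  rw [← LinearMap.ker_eq_bot, LinearMap.ker_eq_bot']
  intro u hu
  have h1 : ∀ k (hk : k < (n : ℕ)), u.1 ⟨k, hk⟩ = u.1 (firstIdx n) := by
    intro k
    induction k with
    | zero => exact fun _ => rfl
    | succ k ih =>
      intro hk
      rw [← ih (by omega)]
      exact (sub_eq_zero.mp (congrFun hu ⟨k, by omega⟩)).symm
  have h2 : ∑ i, u.1 i = 0 := u.2
  rw [Finset.sum_congr rfl fun (i : Fin (n : ℕ)) _ => h1 i.1 i.2, Finset.sum_const,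
    Finset.card_univ, Fintype.card_fin, nsmul_eq_mul] at h2
  have h3 := (mul_eq_zero.mp h2).resolve_left (by exact_mod_cast n.ne_zero)
  ext i
  exact (h1 i.1 i.2).trans h3

/-- The basis of `U_n` dual to the Koszul generators. -/
def basisU (n : ℕ+) : Module.Basis (Fin (n - 1 : ℕ)) ℂ (U n) :=
  Module.Basis.ofEquivFun (LinearEquiv.ofBijective _ (bijective_diffs n))

theorem finrank_exteriorAlgebra (n : ℕ+) : Module.finrank ℂ (ExteriorAlgebra ℂ (U n)) =
    Fintype.card (Finset (Fin (n - 1 : ℕ))) :=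
  Module.finrank_eq_card_basis (basisU n).ExteriorAlgebra

/-- The products of vectors attached to subsets are linearly independent, because they have different
first columns, and so they form a basis of the exterior algebra, by its dimension. -/
theorem combination_surjective (n : ℕ+) : Function.Surjective (combination n) := by
  have hli : LinearIndependent ℂ (monomialExt : Finset (Fin (n - 1 : ℕ)) → ExteriorAlgebra ℂ (U n)) := by
    rw [Fintype.linearIndependent_iff]
    intro a ha S
    have h1 : combination n (fun S => Polynomial.C (a S)) = 0 := by
      have h2 : ∀ S, coeffTmul (monomialExt S) (Polynomial.C (a S)) =
          coeffTmul (a S • monomialExt S) (1 : Polynomial ℂ) := fun S => by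
        rw [coeffTmul, coeffTmul, TensorProduct.smul_tmul, Polynomial.smul_eq_C_mul, mul_one]
      change ∑ S, coeffTmul (monomialExt S) (Polynomial.C (a S)) = 0
      rw [Finset.sum_congr rfl fun S _ => h2 S]
      exact (TensorProduct.sum_tmul _ _ _).symm.trans (by rw [ha, TensorProduct.zero_tmul]; rfl)
    have h3 := firstCol_coeffHom_combination (n := n) fun S => Polynomial.C (a S)
    rw [h1, map_zero, map_zero] at h3
    exact Polynomial.C_eq_zero.mp (congrFun h3 S).symm
  have := Module.Finite.of_basis (basisU n).ExteriorAlgebra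
  have hspan := hli.span_eq_top_of_card_eq_finrank' (finrank_exteriorAlgebra n).symm
  intro a
  induction a using CoeffAlg.induction with
  | h0 => exact ⟨0, map_zero _⟩
  | ha a b ha hb =>
    obtain ⟨g, rfl⟩ := ha
    obtain ⟨g', rfl⟩ := hb
    exact ⟨g + g', map_add _ _ _⟩
  | ht w p =>
    have hw : w ∈ Submodule.span ℂ (Set.range
      (monomialExt : Finset (Fin (n - 1 : ℕ)) → ExteriorAlgebra ℂ (U n))) := hspan ▸ trivial
    obtain ⟨a, rfl⟩ := (Submodule.mem_span_range_iff_exists_fun ℂ).mp hw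
    refine ⟨fun S => a S • p, ?_⟩
    change ∑ S, coeffTmul (monomialExt S) (a S • p) = _
    refine Eq.trans ?_ (TensorProduct.sum_tmul _ _ _).symm
    exact Finset.sum_congr rfl fun S _ => (TensorProduct.smul_tmul (a S) _ _).symm

theorem combination_firstCol (a : CoeffAlg n) : combination n (firstCol n (coeffHom n a)) = a := by
  obtain ⟨g, rfl⟩ := combination_surjective n a
  rw [firstCol_coeffHom_combination]

/-- Every closed matrix of polynomials represents the action of an element of the coefficient
algebra. -/
theorem exists_coeffHom_eq {P : KoszulMat n} (hP : polyMat P ∈ cycles (cube n) (cube n)) :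
    ∃ a, coeffHom n a = cls (polyMat P) hP := by
  obtain ⟨g, Y, h⟩ := exists_sub_skewComm (polyMat_mem_cycles.mp hP)
  refine ⟨_, (coeffHom_sum_eq_cls g).trans ((cls_eq_cls _ _).mpr ⟨-polyMat Y, mem_maps_cube _, ?_⟩)⟩
  rw [map_neg, delta_polyMat, ← skewComm_apply, ← h, polyMat_sub]
  abel

end phi

/-! ### The crossed product acts by all endomorphisms of the cube -/

section crossed
variable {n : ℕ+}

/-- The action of the crossed product on `Cube_n`. -/
def crossedHom (n : ℕ+) : CrossedAlg n →ₐ[ℂ] End (cube n) :=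
  SkewMonoidAlgebra.liftNCAlgHom (coeffHom n) (permHom n) (coeffHom_smul _ _)

theorem crossedHom_single (σ : Equiv.Perm (Fin n)) (a : CoeffAlg n) :
    crossedHom n (SkewMonoidAlgebra.single σ a) = coeffHom n a * permHom n σ :=
  SkewMonoidAlgebra.liftNC_single _ _ _ _

theorem coeffMat_permMat_comp {ι : Type} [Fintype ι] {n : ℕ} (ρ σ : Equiv.Perm (Fin n))
    (A : Matrix ι ι (MvPolynomial (Fin n) ℂ)) (f : constObj ι n ⟶ constObj ι n) :
    coeffMat (σ * ρ) (permMat ρ A ≫ f) = A.map (MvPolynomial.rename σ) * coeffMat σ f := by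
  conv_lhs => rw [eq_sum_permMat f]
  rw [Preadditive.comp_sum, map_sum, Finset.sum_eq_single σ]
  · rw [permMat_mul, coeffMat_permMat]
  · intro τ _ hτ
    rw [permMat_mul, coeffMat_permMat_of_ne fun h => hτ (mul_right_cancel h).symm]
  · exact fun h => absurd (Finset.mem_univ _) h

theorem polyMat_coeffMat_mem {f : (cube n).X ⟶ (cube n).X} (hf : f ∈ cycles (cube n) (cube n)) :
    polyMat (coeffMat (1 : Equiv.Perm (Fin n)) f) ∈ cycles (cube n) (cube n) := by
  rw [polyMat_mem_cycles, ← coeffMat_delta, hf.2]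
  exact map_zero _

/-- An endomorphism is determined by its parts over the identity permutation, after composition with
the permutations. -/
theorem eq_sum_permCube_comp (f : (cube n).X ⟶ (cube n).X) :
    f = ∑ σ, permCube n σ ≫ polyMat (coeffMat (1 : Equiv.Perm (Fin n)) (permCube n σ⁻¹ ≫ f)) := by
  refine (eq_sum_permMat f).trans (Finset.sum_congr rfl fun σ _ => ?_)
  have h1 := coeffMat_permMat_comp σ⁻¹ σ
    ((permLift σ⁻¹).map (MvPolynomial.C : ℂ →+* DotRing n)) f
  rw [mul_inv_cancel] at h1
  have h2 : polyMat (coeffMat (1 : Equiv.Perm (Fin n)) (permCube n σ⁻¹ ≫ f)) =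
      permCube n σ⁻¹ ≫ permMat σ (coeffMat σ f) := by
    refine Eq.trans ?_ (permMat_mul _ _ _ _).symm
    rw [mul_inv_cancel, polyMat_eq_permMat]
    exact congrArg _ h1
  rw [h2, ← Category.assoc, permCube_comp, inv_mul_cancel, permCube_one]
  exact (Category.id_comp _).symm

theorem crossedHom_surjective (n : ℕ+) : Function.Surjective (crossedHom n) := by
  intro f
  obtain ⟨F, hF, rfl⟩ := exists_cls f
  have hc : ∀ σ, permCube n σ⁻¹ ≫ F ∈ cycles (cube n) (cube n) := fun σ =>
    comp_mem_cycles (permCube_mem _) hF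
  choose a ha using fun σ => exists_coeffHom_eq (polyMat_coeffMat_mem (hc σ))
  refine ⟨∑ σ, SkewMonoidAlgebra.single σ (a σ), ?_⟩
  have h1 : ∀ σ, crossedHom n (SkewMonoidAlgebra.single σ (a σ)) =
      cls _ (comp_mem_cycles (permCube_mem σ) (polyMat_coeffMat_mem (hc σ))) := fun σ => by
    rw [crossedHom_single, ha]
    exact cls_comp _ _
  rw [map_sum, Finset.sum_congr rfl fun σ _ => h1 σ, ← cls_sum]
  exact cls_congr (eq_sum_permCube_comp F).symm

theorem exists_coeffHom_eq_cls (a : CoeffAlg n) : ∃ (P : KoszulMat n)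
    (hP : polyMat P ∈ cycles (cube n) (cube n)), coeffHom n a = cls (polyMat P) hP := by
  obtain ⟨g, rfl⟩ := combination_surjective n a
  obtain ⟨P, hP, h, -⟩ := exists_coeffHom_combination g
  exact ⟨P, hP, h⟩

/-- The first column sees only the part of an endomorphism over the identity permutation. -/
theorem firstCol_perm_coeffHom {ρ : Equiv.Perm (Fin n)} (hρ : ρ ≠ 1) (a : CoeffAlg n) :
    firstCol n (permHom n ρ ≫ coeffHom n a) = 0 := by
  obtain ⟨P, hP, h⟩ := exists_coeffHom_eq_cls a
  have h1 : permHom n ρ ≫ coeffHom n a = cls (permCube n ρ ≫ polyMat P)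
      (comp_mem_cycles (permCube_mem ρ) hP) := by
    rw [h]; exact cls_comp _ _
  have h2 : coeffMat (1 : Equiv.Perm (Fin n)) (permCube n ρ ≫ polyMat P) = 0 := by
    rw [permCube, polyMat_eq_permMat, permMat_mul, one_mul, coeffMat_permMat_of_ne (Ne.symm hρ)]
  ext1 S
  rw [h1, firstCol_cls, h2]
  exact map_zero _

/-- The coefficients of an element of the crossed product can be read off from the endomorphism
by which it acts. -/
theorem coeff_eq_combination (z : CrossedAlg n) (σ : Equiv.Perm (Fin n)) :
    z.coeff σ = combination n (firstCol n (permHom n σ⁻¹ ≫ crossedHom n z)) := by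
  induction z using SkewMonoidAlgebra.induction_on with
  | zero =>
    rw [map_zero, Limits.comp_zero, map_zero, map_zero]; rfl
  | add z z' hz hz' =>
    rw [map_add, Preadditive.comp_add, map_add, map_add, ← hz, ← hz', SkewMonoidAlgebra.coeff_add,
      Finsupp.add_apply]
  | single τ a =>
    have h : permHom n σ⁻¹ ≫ crossedHom n (SkewMonoidAlgebra.single τ a) =
        permHom n (τ * σ⁻¹) ≫ coeffHom n a := by
      rw [crossedHom_single, ← permHom_comp, Category.assoc]; rfl
    rw [h, SkewMonoidAlgebra.coeff_single]
    by_cases hτ : τ = σ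
    · subst hτ
      rw [Finsupp.single_eq_same, mul_inv_cancel, map_one]
      exact (combination_firstCol a).symm.trans (congrArg _ (congrArg _ (Category.id_comp _).symm))
    · rw [Finsupp.single_eq_of_ne (Ne.symm hτ), firstCol_perm_coeffHom, map_zero]
      exact fun h => hτ (mul_inv_eq_one.mp h)

theorem crossedHom_injective (n : ℕ+) : Function.Injective (crossedHom n) := by
  rw [injective_iff_map_eq_zero]
  intro z hz
  ext1 σ
  rw [coeff_eq_combination, hz, Limits.comp_zero, map_zero, map_zero]; rfl

/-- The endomorphism algebra of `Cube_n` is the crossed product. -/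
def crossedEquiv (n : ℕ+) : CrossedAlg n ≃ₐ[ℂ] End (cube n) :=
  AlgEquiv.ofBijective (crossedHom n) ⟨crossedHom_injective n, crossedHom_surjective n⟩

theorem crossedEquiv_X (i : Fin n) :
    crossedEquiv n (SkewMonoidAlgebra.single 1 (coeffTmul 1 Polynomial.X)) = xAct n i := by
  refine (crossedHom_single 1 _).trans ?_
  rw [map_one, mul_one, coeffHom_tmul, map_one, one_mul, Polynomial.aeval_X]
  exact xAct_eq n _ i

theorem crossedEquiv_ι (u : U n) :
    crossedEquiv n (SkewMonoidAlgebra.single 1 (coeffTmul (ExteriorAlgebra.ι ℂ u) 1)) =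
      eps n u := by
  refine (crossedHom_single 1 _).trans ?_
  rw [map_one, mul_one, coeffHom_tmul, map_one, mul_one, extHom_ι]

theorem crossedEquiv_perm (σ : Equiv.Perm (Fin n)) :
    crossedEquiv n (SkewMonoidAlgebra.single σ 1) = cls (permCube n σ) (permCube_mem σ) := by
  refine (crossedHom_single σ _).trans ?_
  rw [map_one, one_mul]; rfl

theorem permCube_bot (σ : Equiv.Perm (Fin n)) : permCube n σ ∅ ∅ = DotPerm.single σ 1 := by
  change DotPerm.single σ (MvPolynomial.C (permLift σ ∅ ∅)) = _
  rw [(permLift_isLift σ).bot, map_one]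

/-! ### Bidegrees of endomorphisms -/

theorem cls_mem_homPiece {A B : Cx} {h k : ℤ} {f : A.X ⟶ B.X} (hf : f ∈ cycles A B)
    (hb : IsBihom (A := A.toGObj) (B := B.toGObj) h k f) : cls f hf ∈ homPiece A B h k :=
  Submodule.subset_span ⟨f, hf, hb, rfl⟩

theorem xAct_pow_mem (i : Fin n) (b : ℕ) :
    (xAct n i ^ b : End (cube n)) ∈ homPiece (cube n) (cube n) 0 (2 * b) := by
  induction b with
  | zero =>
    rw [pow_zero, Nat.cast_zero, mul_zero]
    exact cls_mem_homPiece (e_mem_cycles _) (cube n).e_bihom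
  | succ b ih =>
    rw [pow_succ]
    have h := homPiece_comp (cls_mem_homPiece (dotMat_mem n i) (dotMat_bihom n i)) ih
    rw [add_zero] at h
    rw [Nat.cast_succ, mul_add, mul_one, add_comm]
    exact h

theorem extHom_mem (a : ℕ) {w : ExteriorAlgebra ℂ (U n)} (hw : w ∈ ⋀[ℂ]^a (U n)) :
    extHom n w ∈ homPiece (cube n) (cube n) (-(a : ℤ)) (-(2 * a)) := by
  induction a generalizing w with
  | zero =>
    rw [ExteriorAlgebra.exteriorPower, pow_zero] at hw
    obtain ⟨c, rfl⟩ := Submodule.mem_one.mp hw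
    rw [AlgHom.commutes, Algebra.algebraMap_eq_smul_one]
    exact Submodule.smul_mem _ _ (cls_mem_homPiece (e_mem_cycles _) (cube n).e_bihom)
  | succ a ih =>
    rw [ExteriorAlgebra.exteriorPower, pow_succ] at hw
    induction hw using Submodule.mul_induction_on' with
    | add x _ y _ hx hy => rw [map_add]; exact Submodule.add_mem _ hx hy
    | mem_mul_mem x hx y hy =>
      obtain ⟨u, rfl⟩ := hy
      rw [map_mul, extHom_ι]
      have h1 : eps n u ∈ homPiece (cube n) (cube n) (-1) (-2) :=
        cls_mem_homPiece (epsMat_mem n u) (contraction_bihom _ (-2) fun i =>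
          MvPolynomial.isWeightedHomogeneous_C _ _)
      have h2 := homPiece_comp h1 (ih hx)
      have e1 : -((a + 1 : ℕ) : ℤ) = -1 + -(a : ℤ) := by push_cast; ring
      have e2 : -(2 * ((a + 1 : ℕ) : ℤ)) = -2 + -(2 * (a : ℤ)) := by push_cast; ring
      rw [e1, e2]
      exact h2

theorem permHom_mem (σ : Equiv.Perm (Fin n)) : permHom n σ ∈ homPiece (cube n) (cube n) 0 0 :=
  cls_mem_homPiece (permCube_mem σ) (permCube_bihom σ)

theorem crossedHom_mem {h k : ℤ} {z : CrossedAlg n} (hz : z ∈ crossedPiece n h k) :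
    crossedHom n z ∈ homPiece (cube n) (cube n) h k := by
  induction hz using Submodule.span_induction with
  | zero => rw [map_zero]; exact Submodule.zero_mem _
  | add x y _ _ hx hy => rw [map_add]; exact Submodule.add_mem _ hx hy
  | smul c x _ hx => rw [map_smul]; exact Submodule.smul_mem _ _ hx
  | mem x hx =>
    obtain ⟨σ, a, b, rfl, rfl, w, hw, rfl⟩ := hx
    rw [crossedHom_single, coeffHom_tmul, map_pow, Polynomial.aeval_X]
    have h1 := homPiece_comp (permHom_mem σ)
      (homPiece_comp (xAct_pow_mem (firstIdx n) b) (extHom_mem a hw))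
    rw [zero_add, zero_add, zero_add, ← sub_eq_add_neg] at h1
    exact h1

/-- A homogeneous polynomial becomes a multiple of a single power when all variables are identified. -/
theorem collapseAll_mem_span {n : ℕ} {d : ℤ} {p : DotRing n}
    (hp : MvPolynomial.IsWeightedHomogeneous (fun _ => (2 : ℤ)) p d) :
    collapseAll n p ∈ Submodule.span ℂ {x | ∃ b : ℕ, d = 2 * (b : ℤ) ∧ x = Polynomial.X ^ b} := by
  rw [p.as_sum, map_sum]
  refine Submodule.sum_mem _ fun m hm => ?_
  have hd := hp (MvPolynomial.mem_support_iff.mp hm)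
  rw [collapseAll, MvPolynomial.aeval_monomial, Finsupp.prod, Finset.prod_pow_eq_pow_sum,
    ← Algebra.smul_def]
  refine Submodule.smul_mem _ _ (Submodule.subset_span ⟨_, ?_, rfl⟩)
  rw [← hd, Finsupp.weight_apply, Finsupp.sum, Nat.cast_sum, Finset.mul_sum]
  refine Finset.sum_congr rfl fun i _ => ?_
  rw [nsmul_eq_mul, mul_comm]

theorem single_coeffTmul_mem {h k : ℤ} (σ : Equiv.Perm (Fin n)) {a : ℕ} (ha : h = -(a : ℤ))
    {w : ExteriorAlgebra ℂ (U n)} (hw : w ∈ ⋀[ℂ]^a (U n)) {p : Polynomial ℂ}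
    (hp : p ∈ Submodule.span ℂ {x : Polynomial ℂ | ∃ b : ℕ, k + 2 * a = 2 * (b : ℤ) ∧
      x = Polynomial.X ^ b}) :
    SkewMonoidAlgebra.single σ (coeffTmul w p) ∈ crossedPiece n h k := by
  induction hp using Submodule.span_induction with
  | zero =>
    have h0 : coeffTmul w (0 : Polynomial ℂ) = 0 := TensorProduct.tmul_zero _ _
    rw [h0, SkewMonoidAlgebra.single_zero]; exact Submodule.zero_mem _
  | add x y _ _ hx hy =>
    have h0 : coeffTmul w (x + y) = coeffTmul w x + coeffTmul w y := TensorProduct.tmul_add _ _ _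
    rw [h0, SkewMonoidAlgebra.single_add]; exact Submodule.add_mem _ hx hy
  | smul c x _ hx =>
    have h0 : coeffTmul w (c • x) = c • coeffTmul w x := TensorProduct.tmul_smul c _ _
    rw [h0, ← SkewMonoidAlgebra.smul_single]; exact Submodule.smul_mem _ _ hx
  | mem x hx =>
    obtain ⟨b, hb, rfl⟩ := hx
    exact Submodule.subset_span ⟨σ, a, b, ha, by omega, w, hw, rfl⟩

/-- The first column of a homogeneous endomorphism has homogeneous entries, in a single exterior
degree. -/
theorem single_combination_mem {h k : ℤ} (σ : Equiv.Perm (Fin n)) {f : End (cube n)}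
    (hf : f ∈ homPiece (cube n) (cube n) h k) :
    SkewMonoidAlgebra.single σ (combination n (firstCol n f)) ∈ crossedPiece n h k := by
  induction hf using Submodule.span_induction with
  | zero => rw [map_zero, map_zero, SkewMonoidAlgebra.single_zero]; exact Submodule.zero_mem _
  | add x y _ _ hx hy =>
    rw [map_add, map_add, SkewMonoidAlgebra.single_add]; exact Submodule.add_mem _ hx hy
  | smul c x _ hx =>
    rw [map_smul, map_smul, ← SkewMonoidAlgebra.smul_single]; exact Submodule.smul_mem _ _ hx
  | mem x hx =>
    obtain ⟨F, hF, hb, rfl⟩ := hx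
    have h1 : SkewMonoidAlgebra.single σ (combination n (firstCol n (cls F hF))) =
        ∑ S, SkewMonoidAlgebra.single σ (coeffTmul (monomialExt S)
          (collapseAll n (coeffMat (1 : Equiv.Perm (Fin n)) F S ∅))) :=
      map_sum (AddMonoidHom.mk' (SkewMonoidAlgebra.single σ)
        (SkewMonoidAlgebra.single_add (k := CoeffAlg n) σ)) (fun S => coeffTmul (monomialExt S)
          (collapseAll n (coeffMat (1 : Equiv.Perm (Fin n)) F S ∅))) Finset.univ
    rw [h1]
    refine Submodule.sum_mem _ fun S _ => ?_
    have hS := hb S (∅ : Finset (Fin (n - 1 : ℕ)))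
    by_cases h0 : F S (∅ : Finset (Fin (n - 1 : ℕ))) = 0
    · have h2 : coeffMat (1 : Equiv.Perm (Fin n)) F S ∅ = 0 := by
        change DotPerm.coeff _ (F S ∅) = 0
        rw [h0, map_zero]
      have h3 : coeffTmul (monomialExt S) (0 : Polynomial ℂ) = 0 := TensorProduct.tmul_zero _ _
      rw [h2, map_zero, h3, SkewMonoidAlgebra.single_zero]
      exact Submodule.zero_mem _
    · have h2 : ((∅ : Finset (Fin (n - 1 : ℕ))).card : ℤ) = S.card + h := hS.1 h0
      rw [Finset.card_empty] at h2
      refine single_coeffTmul_mem σ (by omega) (monomialExt_mem S) (collapseAll_mem_span ?_)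
      have h3 := hS.2 (1 : Equiv.Perm (Fin n))
      have h4 : k + (cube n).qdeg S - (cube n).qdeg (∅ : Finset (Fin (n - 1 : ℕ))) =
          k + 2 * S.card := by
        change k + (2 * (S.card : ℤ) + 1 - n) -
          (2 * ((∅ : Finset (Fin (n - 1 : ℕ))).card : ℤ) + 1 - n) = _
        rw [Finset.card_empty]; push_cast; ring
      rw [h4] at h3
      exact h3

theorem mem_crossedPiece_iff (h k : ℤ) (z : CrossedAlg n) :
    z ∈ crossedPiece n h k ↔ crossedEquiv n z ∈ homPiece (cube n) (cube n) h k := by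
  refine ⟨crossedHom_mem, fun hz => ?_⟩
  rw [← SkewMonoidAlgebra.sum_single z, SkewMonoidAlgebra.sum_def']
  refine Submodule.sum_mem _ fun σ _ => ?_
  rw [coeff_eq_combination]
  have h1 := homPiece_comp (permHom_mem σ⁻¹) hz
  rw [zero_add, zero_add] at h1
  exact single_combination_mem σ h1

end crossed

end AnnularCube

end

theorem mainTheorem7 :
    (∀ n : ℕ+, ∃ Φ : CrossedAlg n ≃ₐ[ℂ] End (cube n),
      (∀ i : Fin n, Φ (SkewMonoidAlgebra.single 1 (coeffTmul 1 Polynomial.X)) = xAct n i) ∧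
      (∀ u : U n, Φ (SkewMonoidAlgebra.single 1 (coeffTmul (ExteriorAlgebra.ι ℂ u) 1)) =
        eps n u) ∧
      (∀ σ : Equiv.Perm (Fin n), ∃ (f : (cube n).X ⟶ (cube n).X)
        (hf : f ∈ cycles (cube n) (cube n)),
        Φ (SkewMonoidAlgebra.single σ 1) = cls f hf ∧
        IsBihom (A := (cube n).toGObj) (B := (cube n).toGObj) 0 0 f ∧
        f ∅ ∅ = DotPerm.single σ 1) ∧
      (∀ (h k : ℤ) (a : CrossedAlg n),
        a ∈ crossedPiece n h k ↔ Φ a ∈ homPiece (cube n) (cube n) h k)) ∧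
    ∃ e : ∀ n m : ℕ+, cube (n + m) ≅ cubeCone n m,
      (∀ n m : ℕ+, ∃ (f : (cube (n + m)).X ⟶ (cubeCone n m).X)
        (hf : f ∈ cycles (cube (n + m)) (cubeCone n m)),
        (e n m).hom = cls f hf ∧
        IsBihom (A := (cube (n + m)).toGObj) (B := (cubeCone n m).toGObj) 0 0 f ∧
        f ∅ (.inr (∅, ∅)) = DotPerm.single (finCongr (PNat.add_coe n m)) 1) ∧
      (∀ n m : ℕ+,
        (∀ f : tens (cube n) (cube m) ⟶ cube (n + m), ∃ φ : End (cube (n + m)),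
          f = mergeOf (e n m) ≫ φ) ∧
        (∀ f : cube (n + m) ⟶ tens (cube n) (cube m), ∃ φ : End (cube (n + m)),
          f = φ ≫ splitOf (e n m)) ∧
        (∀ (f : tens (cube n) (cube m) ⟶ cube (n + m)) (i : Fin n) (j : Fin m)
          (k : Fin (n + m : ℕ+)),
          whiskerRight (xAct n i) (cube m) ≫ f = f ≫ xAct (n + m) k ∧
          whiskerLeft (cube n) (xAct m j) ≫ f = f ≫ xAct (n + m) k) ∧
        (∀ (f : cube (n + m) ⟶ tens (cube n) (cube m)) (i : Fin n) (j : Fin m)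
          (k : Fin (n + m : ℕ+)),
          f ≫ whiskerRight (xAct n i) (cube m) = xAct (n + m) k ≫ f ∧
          f ≫ whiskerLeft (cube n) (xAct m j) = xAct (n + m) k ≫ f) ∧
        (∀ (v : U n) (w : U m),
          epsPair v w ≫ mergeOf (e n m) =
            mergeOf (e n m) ≫ eps (n + m) (indVec v w) ∧
          splitOf (e n m) ≫ epsPair v w =
            -(eps (n + m) (indVec v w) ≫ splitOf (e n m))) ∧
        (∀ u : U (n + m : ℕ+),
          epsPair (resL u) (resR u) ≫ mergeOf (e n m) =
            mergeOf (e n m) ≫ eps (n + m) u ∧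
          splitOf (e n m) ≫ epsPair (resL u) (resR u) =
            -(eps (n + m) u ≫ splitOf (e n m)))) ∧
      (∀ (s t : CubeTree) (f : s.obj ⟶ t.obj),
        Generated (fun n m => mergeOf (e n m)) (fun n m => splitOf (e n m)) s t f) := by
  refine ⟨fun n => ⟨crossedEquiv n, crossedEquiv_X, crossedEquiv_ι, fun σ =>
    ⟨permCube n σ, permCube_mem σ, crossedEquiv_perm σ, permCube_bihom σ, permCube_bot σ⟩,
    mem_crossedPiece_iff⟩, fun n m => cubeConeIso n m, fun n m => ?_, fun n m => ?_,
    fun s t f => ?_⟩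
  · exact ⟨toConeMat n m, toConeMat_mem n m, rfl, toConeMat_bihom n m, toConeMat_empty n m⟩
  · exact ⟨exists_eq_mergeOf_comp _, exists_eq_comp_splitOf _, xAct_merge, xAct_split,
      epsPair_ind, epsPair_res⟩
  · exact CubeTree.gen _ s t f
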